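/- **Setting.** Let $n\in\mathbb N_0$ and let $(\mathsf M,g)$ be an $(n+1)$-dimensional conic manifold: $\mathsf M=\tilde{\mathsf M}\setminus\mathbb B$, where $\tilde{\mathsf M}$ is a compact smooth manifold with boundary $\mathbb B=\partial\tilde{\mathsf M}$, and $g$ is a smooth Riemannian metric on $\mathsf M$ which on a closed collar neighbourhood $[0,1]\times\mathbb B$ of the boundary satisfies $g=dx^2+x^2g_{\mathbb B}(y)$ for $(x,y)\in(0,1]\times\mathbb B$, with $g_{\mathbb B}$ a Riemannian metric on $\mathbb B$. Fix a cut-off function $\omega\in C^\infty([0,1),[0,1])$ with $\omega\equiv1$ near $0$ and $\omega\equiv0$ near $1$; regard $\omega=\omega(x)$ as a function on $\mathsf M$, zero outside the collar. For a Banach space $E$, $1<p<\infty$, $\sigma\ge0$ and $\gamma\in\mathbb R$, the Mellin Sobolev space $\mathcal H^{\sigma,\gamma}_p(\mathsf M,E)$ consists of all (classes of a.e. equal) functions $u:\mathsf M\to E$ with $$\|u\|_{\mathcal H^{\sigma,\gamma}_p}=\|S_\gamma(\omega u)\|_{H^\sigma_p([0,\infty)\times\mathbb B,E)}+\|(1-\omega)u\|_{H^\sigma_p(\mathsf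 M,E)}<\infty,\qquad (S_\gamma v)(t,y)=e^{(\gamma-\frac{n+1}2)t}\,v(e^{-t},y).$$ The norms $H^\sigma_p$ are defined, up to equivalence, by finitely many charts (of $\mathbb B$, and of $\mathsf M$ on the support of $1-\omega$) and a subordinate smooth partition of unity from $H^\sigma_p(\mathbb R^{n+1},E)$, which is the Sobolev space of functions with weak derivatives up to order $\sigma$ in $L_p$ if $\sigma\in\mathbb N_0$, and the Bessel potential space $(1-\Delta)^{-\sigma/2}L_p(\mathbb R^{n+1},E)$ otherwise. For $O\subset\mathbb R^L$ open, $BC^m(O,E)$ is the set of all $C^m$ maps $O\to E$ whose derivatives of order at most $m$ are bounded. For $X$ open in a normed space, $C^{k+1-}(X,F)$ is the set of all $k$ times continuously differentiable maps $X\to F$ whose $k$-th derivative is locally Lipschitz continuous. $[s]$ is the integer part of $s$. **Theorem.** Let $k,\nu\in\mathbb N_0$, $L\in\mathbb N$, $p>n+1$, $s>\frac{n+1}p$, $\gamma\ge\frac{n+1}2$ and $\nu\ge[s]$. Let $O\subset\mathbb R^L$ be open, $E$ a Banach space, and $\phi\in BC^{\nu+k+1}(O,E)$. Let $X$ be an open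 subset of $\mathcal H^{s,\gamma}_p(\mathsf M,\mathbb R^L)\oplus\mathbb R^L$, where $\mathbb R^L$ stands for the constant functions, such that the (continuous representatives of the) functions in $X$ take all their values in $O$. Then for every $\vartheta<\frac{n+1}2$ the substitution operator $\Phi(u)=\phi\circ u$ maps $X$ into $\mathcal H^{[s],\vartheta}_p(\mathsf M,E)$, and $$\Phi\in C^{k+1-}\bigl(X,\mathcal H^{[s],\vartheta}_p(\mathsf M,E)\bigr).$$ -/

import Mathlib

open MeasureTheory Set Bundle
open scoped Manifold ContDiff ENNReal Topology

noncomputable section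

/-! ### Sobolev and Bessel potential spaces on Euclidean space, with values in a Banach space -/

/-- Euclidean space `ℝ^d`. -/
abbrev Euc (d : ℕ) : Type := EuclideanSpace ℝ (Fin d)

section EuclideanSobolev

variable {d : ℕ} {E : Type*} [NormedAddCommGroup E] [NormedSpace ℝ E]

/-- The classical partial derivative `∂_{α 0} ⋯ ∂_{α (j-1)} ψ (x)`. -/
def partialDeriv {j : ℕ} (α : Fin j → Fin d) (ψ : Euc d → ℝ) (x : Euc d) : ℝ :=
  iteratedFDeriv ℝ j ψ x (fun i => EuclideanSpace.single (α i) (1 : ℝ))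

/-- `g` is the weak derivative `∂_{α 0} ⋯ ∂_{α (j-1)} f` on `ℝ^d`. -/
def HasWeakDeriv {j : ℕ} (α : Fin j → Fin d) (f g : Euc d → E) : Prop :=
  LocallyIntegrable f ∧ LocallyIntegrable g ∧
    ∀ ψ : Euc d → ℝ, ContDiff ℝ ∞ ψ → HasCompactSupport ψ →
      ∫ x, partialDeriv α ψ x • f x = (-1 : ℝ) ^ j • ∫ x, ψ x • g x

/-- A family `D` of functions, indexed by all `(α 0, …, α (j-1))` with `j ≤ m`, which are
the weak derivatives of `f` of order at most `m`. -/
def IsWeakJet (m : ℕ) (f : Euc d → E)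
    (D : (j : Fin (m + 1)) → (Fin j → Fin d) → Euc d → E) : Prop :=
  ∀ (j : Fin (m + 1)) (α : Fin j → Fin d), HasWeakDeriv α f (D j α)

/-- The norm of `W^m_p(ℝ^d, E)`: the sum of the `L_p`-norms of all weak derivatives of order at most
`m`; it is `∞` if `f ∉ W^m_p`. (Weak derivatives are unique a.e., so the infimum runs over at
most one value.) -/
def weakSobolevENorm (m : ℕ) (p : ℝ≥0∞) (f : Euc d → E) : ℝ≥0∞ :=
  ⨅ D : {D : (j : Fin (m + 1)) → (Fin j → Fin d) → Euc d → E // IsWeakJet m f D},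
    ∑ j, ∑ α, eLpNorm (D.1 j α) p volume

/-- The Bessel kernel `G_s` on `ℝ^d`, `s > 0`, i.e. the convolution kernel of
`(1 - Δ)^{-s/2} = Γ(s/2)⁻¹ ∫_0^∞ r^{s/2-1} e^{-r} e^{rΔ} dr`. -/
def besselKernel (d : ℕ) (s : ℝ) (x : Euc d) : ℝ :=
  (Real.Gamma (s / 2))⁻¹ * ∫ r in Ioi (0 : ℝ),
    r ^ (s / 2 - 1) * Real.exp (-r) *
      ((4 * Real.pi * r) ^ (-(d : ℝ) / 2) * Real.exp (-‖x‖ ^ 2 / (4 * r)))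

/-- `f = (1 - Δ)^{-s/2} g = G_s * g` almost everywhere. -/
def IsBesselPotential (s : ℝ) (f g : Euc d → E) : Prop :=
  AEStronglyMeasurable g ∧ ∀ᵐ x : Euc d,
    Integrable (fun y => besselKernel d s (x - y) • g y) ∧
      f x = ∫ y, besselKernel d s (x - y) • g y

/-- The norm of the Bessel potential space `(1 - Δ)^{-s/2} L_p(ℝ^d, E)`, that is
`‖(1 - Δ)^{s/2} f‖_{L_p}`; it is `∞` if `f` is not in the space. -/
def besselENorm (s : ℝ) (p : ℝ≥0∞) (f : Euc d → E) : ℝ≥0∞ :=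
  ⨅ g : {g : Euc d → E // IsBesselPotential s f g}, eLpNorm g.1 p volume

open Classical in
/-- The norm of `H^s_p(ℝ^d, E)`, `s ≥ 0`: for integers `s` this is the Sobolev space defined by weak
derivatives, for all other `s` the Bessel potential space. -/
def sobolevENorm (s : ℝ) (p : ℝ≥0∞) (f : Euc d → E) : ℝ≥0∞ :=
  if s = (⌊s⌋₊ : ℝ) then weakSobolevENorm ⌊s⌋₊ p f else besselENorm s p f

lemma partialDeriv_hasCompactSupport {j : ℕ} (α : Fin j → Fin d) {ψ : Euc d → ℝ}
    (hc : HasCompactSupport ψ) : HasCompactSupport (partialDeriv α ψ) := by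
  have h := hc.iteratedFDeriv (𝕜 := ℝ) j
  exact h.comp_left (g := fun T : ContinuousMultilinearMap ℝ (fun _ : Fin j => Euc d) ℝ =>
    T (fun i => EuclideanSpace.single (α i) (1 : ℝ))) rfl

lemma partialDeriv_continuous {j : ℕ} (α : Fin j → Fin d) {ψ : Euc d → ℝ}
    (hψ : ContDiff ℝ ∞ ψ) : Continuous (partialDeriv α ψ) := by
  have h : Continuous (iteratedFDeriv ℝ j ψ) :=
    hψ.continuous_iteratedFDeriv (by exact_mod_cast le_top)
  exact (ContinuousMultilinearMap.apply ℝ (fun _ : Fin j => Euc d) ℝ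
    (fun i => EuclideanSpace.single (α i) (1 : ℝ))).continuous.comp h

lemma HasWeakDeriv.add {j : ℕ} {α : Fin j → Fin d} {f₁ f₂ g₁ g₂ : Euc d → E}
    (h₁ : HasWeakDeriv α f₁ g₁) (h₂ : HasWeakDeriv α f₂ g₂) :
    HasWeakDeriv α (f₁ + f₂) (g₁ + g₂) := by
  refine ⟨h₁.1.add h₂.1, h₁.2.1.add h₂.2.1, fun ψ hψ hc => ?_⟩
  have I : ∀ {χ : Euc d → ℝ} {f : Euc d → E}, Continuous χ → HasCompactSupport χ →
      LocallyIntegrable f → Integrable (fun x => χ x • f x) := fun h1 h2 h3 =>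
    h3.integrable_smul_left_of_hasCompactSupport h1 h2
  have c1 := partialDeriv_continuous α hψ
  have c2 := partialDeriv_hasCompactSupport α hc
  simp only [Pi.add_apply, smul_add]
  rw [integral_add (I c1 c2 h₁.1) (I c1 c2 h₂.1),
    integral_add (I hψ.continuous hc h₁.2.1) (I hψ.continuous hc h₂.2.1),
    h₁.2.2 ψ hψ hc, h₂.2.2 ψ hψ hc, smul_add]

lemma HasWeakDeriv.smul {j : ℕ} {α : Fin j → Fin d} {f g : Euc d → E} (c : ℝ)
    (h : HasWeakDeriv α f g) : HasWeakDeriv α (c • f) (c • g) := by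
  refine ⟨h.1.smul c, h.2.1.smul c, fun ψ hψ hc => ?_⟩
  simp only [Pi.smul_apply]
  simp_rw [smul_comm _ c]
  rw [integral_smul, integral_smul, h.2.2 ψ hψ hc, smul_comm]

lemma IsBesselPotential.add {s : ℝ} {f₁ f₂ g₁ g₂ : Euc d → E}
    (h₁ : IsBesselPotential s f₁ g₁) (h₂ : IsBesselPotential s f₂ g₂) :
    IsBesselPotential s (f₁ + f₂) (g₁ + g₂) := by
  refine ⟨h₁.1.add h₂.1, ?_⟩
  filter_upwards [h₁.2, h₂.2] with x k1 k2
  simp only [Pi.add_apply, smul_add]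
  exact ⟨k1.1.add k2.1, by rw [integral_add k1.1 k2.1, k1.2, k2.2]⟩

lemma IsBesselPotential.smul {s : ℝ} {f g : Euc d → E} (c : ℝ)
    (h : IsBesselPotential s f g) : IsBesselPotential s (c • f) (c • g) := by
  refine ⟨h.1.const_smul c, ?_⟩
  filter_upwards [h.2] with x k
  simp only [Pi.smul_apply]
  simp_rw [smul_comm _ c]
  exact ⟨k.1.smul c, by rw [integral_smul, k.2]⟩

lemma weakSobolevENorm_add_le (m : ℕ) {p : ℝ≥0∞} (hp : 1 ≤ p) (f g : Euc d → E) :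
    weakSobolevENorm m p (f + g) ≤ weakSobolevENorm m p f + weakSobolevENorm m p g := by
  unfold weakSobolevENorm
  rw [ENNReal.iInf_add]
  refine le_iInf fun D₁ => ?_
  rw [ENNReal.add_iInf]
  refine le_iInf fun D₂ => ?_
  refine (iInf_le _ ⟨D₁.1 + D₂.1, fun j α => (D₁.2 j α).add (D₂.2 j α)⟩).trans ?_
  simp only [← Finset.sum_add_distrib]
  refine Finset.sum_le_sum fun j _ => Finset.sum_le_sum fun α _ => ?_
  exact eLpNorm_add_le (D₁.2 j α).2.1.aestronglyMeasurable
    (D₂.2 j α).2.1.aestronglyMeasurable hp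

lemma weakSobolevENorm_smul_le (m : ℕ) {p : ℝ≥0∞} (c : ℝ) (f : Euc d → E)
    (hf : weakSobolevENorm m p f ≠ ⊤) :
    weakSobolevENorm m p (c • f) ≤ ‖c‖ₑ * weakSobolevENorm m p f := by
  have hne : Nonempty
      {D : (j : Fin (m + 1)) → (Fin j → Fin d) → Euc d → E // IsWeakJet m f D} := by
    by_contra h
    rw [not_nonempty_iff] at h
    exact hf (by simp [weakSobolevENorm])
  unfold weakSobolevENorm
  rw [ENNReal.mul_iInf' (fun h => absurd h enorm_ne_top) (fun _ => hne)]
  refine le_iInf fun D => ?_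
  refine (iInf_le _ ⟨fun j α => c • D.1 j α, fun j α => (D.2 j α).smul c⟩).trans ?_
  simp only [Finset.mul_sum]
  refine Finset.sum_le_sum fun j _ => Finset.sum_le_sum fun α _ => ?_
  rw [eLpNorm_const_smul]

lemma besselENorm_add_le (s : ℝ) {p : ℝ≥0∞} (hp : 1 ≤ p) (f g : Euc d → E) :
    besselENorm s p (f + g) ≤ besselENorm s p f + besselENorm s p g := by
  unfold besselENorm
  rw [ENNReal.iInf_add]
  refine le_iInf fun D₁ => ?_
  rw [ENNReal.add_iInf]
  refine le_iInf fun D₂ => ?_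
  exact (iInf_le (fun h : {h : Euc d → E // IsBesselPotential s (f + g) h} =>
    eLpNorm h.1 p volume) ⟨D₁.1 + D₂.1, D₁.2.add D₂.2⟩).trans
    (eLpNorm_add_le D₁.2.1 D₂.2.1 hp)

lemma besselENorm_smul_le (s : ℝ) {p : ℝ≥0∞} (c : ℝ) (f : Euc d → E)
    (hf : besselENorm s p f ≠ ⊤) :
    besselENorm s p (c • f) ≤ ‖c‖ₑ * besselENorm s p f := by
  have hne : Nonempty {g : Euc d → E // IsBesselPotential s f g} := by
    by_contra h
    rw [not_nonempty_iff] at h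
    exact hf (by simp [besselENorm])
  unfold besselENorm
  rw [ENNReal.mul_iInf' (fun h => absurd h enorm_ne_top) (fun _ => hne)]
  refine le_iInf fun D => ?_
  exact (iInf_le (fun h : {h : Euc d → E // IsBesselPotential s (c • f) h} =>
    eLpNorm h.1 p volume) ⟨c • D.1, D.2.smul c⟩).trans
    (le_of_eq (eLpNorm_const_smul c D.1 p volume))

lemma sobolevENorm_add_le (s : ℝ) {p : ℝ≥0∞} (hp : 1 ≤ p) (f g : Euc d → E) :
    sobolevENorm s p (f + g) ≤ sobolevENorm s p f + sobolevENorm s p g := by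
  unfold sobolevENorm
  split_ifs
  · exact weakSobolevENorm_add_le _ hp f g
  · exact besselENorm_add_le _ hp f g

lemma sobolevENorm_smul_le (s : ℝ) {p : ℝ≥0∞} (c : ℝ) (f : Euc d → E)
    (hf : sobolevENorm s p f ≠ ⊤) :
    sobolevENorm s p (c • f) ≤ ‖c‖ₑ * sobolevENorm s p f := by
  unfold sobolevENorm at hf ⊢
  split_ifs with h
  · rw [if_pos h] at hf
    exact weakSobolevENorm_smul_le _ c f hf
  · rw [if_neg h] at hf
    exact besselENorm_smul_le _ c f hf

lemma sobolevENorm_zero (s : ℝ) (p : ℝ≥0∞) : sobolevENorm s p (0 : Euc d → E) = 0 := by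
  unfold sobolevENorm
  split_ifs
  · refine le_antisymm ?_ bot_le
    unfold weakSobolevENorm
    refine (iInf_le _ ⟨fun _ _ => 0, fun j α => ⟨locallyIntegrable_zero,
      locallyIntegrable_zero, fun ψ _ _ => by simp⟩⟩).trans ?_
    simp
  · refine le_antisymm ?_ bot_le
    unfold besselENorm
    have h0 : IsBesselPotential s (0 : Euc d → E) 0 :=
      ⟨aestronglyMeasurable_zero, Filter.Eventually.of_forall fun x => by simp⟩
    refine (iInf_le (fun h : {h : Euc d → E // IsBesselPotential s (0 : Euc d → E) h} =>
      eLpNorm h.1 p volume) ⟨0, h0⟩).trans ?_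
    simp

end EuclideanSobolev

/-! ### Conic manifolds -/

/-- The regular part `M = M̃ \ ∂M̃` of a manifold `M̃` with boundary. -/
abbrev RegularPart (n : ℕ) (Mt : Type*) [TopologicalSpace Mt]
    [ChartedSpace (EuclideanHalfSpace (n + 1)) Mt] : Type _ :=
  {z : Mt // z ∉ (𝓡∂ (n + 1)).boundary Mt}

/-- The structure of an `(n+1)`-dimensional conic manifold on a (compact, smooth) manifold `M̃` with
boundary `B = ∂M̃`: a closed collar `[0,1] × B ≅ collar.target` of the boundary, a Riemannian metric
`g_B` on `B`, and a Riemannian metric `g` on `M = M̃ \ B` with `g = dx² + x² g_B` on `(0,1) × B`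
(hence on `(0,1] × B`). Compactness makes `g` equivalent, outside the collar, to any smooth metric of
`M̃`. The values of `metric` at boundary points are irrelevant. -/
structure ConicManifold (n : ℕ) (Mt B : Type*)
    [TopologicalSpace Mt] [ChartedSpace (EuclideanHalfSpace (n + 1)) Mt]
    [IsManifold (𝓡∂ (n + 1)) ∞ Mt]
    [TopologicalSpace B] [ChartedSpace (Euc n) B] [IsManifold (𝓡 n) ∞ B] where
  /-- the collar, a diffeomorphism of `[0,1] × B` onto a neighbourhood of the boundary -/
  collar : PartialEquiv (ℝ × B) Mt
  source_eq : collar.source = Icc 0 1 ×ˢ univ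
  contMDiffOn_collar :
    ContMDiffOn (𝓘(ℝ, ℝ).prod (𝓡 n)) (𝓡∂ (n + 1)) ∞ collar collar.source
  contMDiffOn_collar_symm :
    ContMDiffOn (𝓡∂ (n + 1)) (𝓘(ℝ, ℝ).prod (𝓡 n)) ∞ collar.symm collar.target
  image_zero : collar '' ({0} ×ˢ univ) = (𝓡∂ (n + 1)).boundary Mt
  isOpen_image : IsOpen (collar '' (Ico 0 1 ×ˢ univ))
  /-- the Riemannian metric `g_B` of `B` -/
  crossMetric : ContMDiffRiemannianMetric (𝓡 n) ∞ (Euc n)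
    (fun y : B => TangentSpace (𝓡 n) y)
  /-- the conic Riemannian metric `g` of `M` -/
  metric : ∀ z : Mt,
    TangentSpace (𝓡∂ (n + 1)) z →L[ℝ] TangentSpace (𝓡∂ (n + 1)) z →L[ℝ] ℝ
  metric_symm : ∀ z ∉ (𝓡∂ (n + 1)).boundary Mt, ∀ v w, metric z v w = metric z w v
  metric_pos : ∀ z ∉ (𝓡∂ (n + 1)).boundary Mt, ∀ v, v ≠ 0 → 0 < metric z v v
  contMDiffOn_metric :
    ContMDiffOn (𝓡∂ (n + 1)) ((𝓡∂ (n + 1)).prod 𝓘(ℝ, Euc (n + 1) →L[ℝ] Euc (n + 1) →L[ℝ] ℝ)) ∞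
      (fun z => TotalSpace.mk' (Euc (n + 1) →L[ℝ] Euc (n + 1) →L[ℝ] ℝ)
        (E := fun z : Mt =>
          TangentSpace (𝓡∂ (n + 1)) z →L[ℝ] TangentSpace (𝓡∂ (n + 1)) z →L[ℝ] ℝ)
        z (metric z)) ((𝓡∂ (n + 1)).boundary Mt)ᶜ
  metric_collar : ∀ x ∈ Ioo (0 : ℝ) 1, ∀ y : B, ∀ a b : ℝ, ∀ v w : TangentSpace (𝓡 n) y,
    metric (collar (x, y))
      (mfderiv (𝓘(ℝ, ℝ).prod (𝓡 n)) (𝓡∂ (n + 1)) collar (x, y) (a, v))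
      (mfderiv (𝓘(ℝ, ℝ).prod (𝓡 n)) (𝓡∂ (n + 1)) collar (x, y) (b, w)) =
    a * b + x ^ 2 * crossMetric.inner y v w

/-- A cut-off function on `[0,1)`: smooth with values in `[0,1]`, equal to `1` near `0` and equal to
`0` near `1`. -/
structure IsCutoff (cut : ℝ → ℝ) : Prop where
  contDiffOn : ContDiffOn ℝ ∞ cut (Ico 0 1)
  mem_Icc : ∀ x ∈ Ico (0 : ℝ) 1, cut x ∈ Icc (0 : ℝ) 1
  eq_one : ∃ a ∈ Ioo (0 : ℝ) 1, ∀ x ∈ Icc 0 a, cut x = 1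
  eq_zero : ∃ b ∈ Ioo (0 : ℝ) 1, ∀ x ∈ Ico b 1, cut x = 0

lemma extend_add {α β E : Type*} [AddCommGroup E] {i : α → β} (hi : Function.Injective i)
    (u v : α → E) (z : β) :
    Function.extend i (u + v) 0 z = Function.extend i u 0 z + Function.extend i v 0 z := by
  by_cases h : ∃ a, i a = z
  · obtain ⟨a, rfl⟩ := h
    simp [hi.extend_apply]
  · simp [Function.extend_apply' _ _ _ h]

lemma extend_smul {α β E : Type*} [AddCommGroup E] [Module ℝ E] {i : α → β}
    (hi : Function.Injective i) (c : ℝ) (u : α → E) (z : β) :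
    Function.extend i (c • u) 0 z = c • Function.extend i u 0 z := by
  by_cases h : ∃ a, i a = z
  · obtain ⟨a, rfl⟩ := h
    simp [hi.extend_apply]
  · simp [Function.extend_apply' _ _ _ h]

section Mellin

variable {n : ℕ} {Mt B : Type*}
  [TopologicalSpace Mt] [ChartedSpace (EuclideanHalfSpace (n + 1)) Mt]
  [IsManifold (𝓡∂ (n + 1)) ∞ Mt]
  [TopologicalSpace B] [ChartedSpace (Euc n) B] [IsManifold (𝓡 n) ∞ B]

open Classical in
/-- The cut-off function `cut` as a function on `M̃`, extended by zero outside the collar. -/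
def ConicManifold.cutoff (C : ConicManifold n Mt B) (cut : ℝ → ℝ) (z : Mt) : ℝ :=
  if z ∈ C.collar '' (Ico 0 1 ×ˢ univ) then cut (C.collar.symm z).1 else 0

/-- Finitely many charts with subordinate smooth partitions of unity, on the cross section `B`, and,
with compact supports in `M = M̃ \ ∂M̃`, on the set where `1 - cut` does not vanish. They serve
to define Sobolev norms on `ℝ₊ × B` and for functions `(1 - cut) u` on `M`; different choices
give equivalent norms. -/
structure ConicAtlas (C : ConicManifold n Mt B) (cut : ℝ → ℝ) where
  /-- number of charts of `B` -/
  cardB : ℕ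
  /-- charts of `B` -/
  chartB : Fin cardB → OpenPartialHomeomorph B (Euc n)
  chartB_mem : ∀ i, chartB i ∈ IsManifold.maximalAtlas (𝓡 n) ∞ B
  /-- partition of unity on `B` -/
  partB : Fin cardB → B → ℝ
  partB_smooth : ∀ i, ContMDiff (𝓡 n) 𝓘(ℝ, ℝ) ∞ (partB i)
  partB_nonneg : ∀ i y, 0 ≤ partB i y
  partB_tsupport : ∀ i, tsupport (partB i) ⊆ (chartB i).source
  partB_sum : ∀ y, ∑ i, partB i y = 1
  /-- number of charts of `M` -/
  cardM : ℕ
  /-- charts of `M` -/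
  chartM : Fin cardM → OpenPartialHomeomorph Mt (EuclideanHalfSpace (n + 1))
  chartM_mem : ∀ i, chartM i ∈ IsManifold.maximalAtlas (𝓡∂ (n + 1)) ∞ Mt
  /-- partition of unity on the part of `M` where `cut ≠ 1` -/
  partM : Fin cardM → Mt → ℝ
  partM_smooth : ∀ i, ContMDiff (𝓡∂ (n + 1)) 𝓘(ℝ, ℝ) ∞ (partM i)
  partM_nonneg : ∀ i z, 0 ≤ partM i z
  partM_tsupport : ∀ i,
    tsupport (partM i) ⊆ (chartM i).source ∩ ((𝓡∂ (n + 1)).boundary Mt)ᶜ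
  partM_sum : ∀ z, C.cutoff cut z ≠ 1 → ∑ i, partM i z = 1

variable {C : ConicManifold n Mt B} {cut : ℝ → ℝ}
variable {E : Type*} [NormedAddCommGroup E] [NormedSpace ℝ E]

/-- The last `n` coordinates `y` of a point `(t, y) ∈ ℝ × ℝ^n = ℝ^{n+1}`; the first one is `t`. -/
def crossCoord (z : Euc (n + 1)) : Euc n := WithLp.toLp 2 (fun i => z i.succ)

open Classical in
/-- The function `χ_i S_γ(cut u)` on the half cylinder `ℝ₊ × B`, where
`S_γ(v)(t,y) = e^{(γ - (n+1)/2) t} v(e^{-t}, y)` and `χ_i` is a member of the partition of unity of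
`B`, in the coordinates given by the `i`-th chart of `B`, extended by zero to `ℝ × ℝ^n`.
(`cut(e^{-t})` vanishes for `t` near `0`.) -/
def ConicAtlas.cylinderPiece (loc : ConicAtlas C cut) (γ : ℝ) (i : Fin loc.cardB)
    (u : RegularPart n Mt → E) (z : Euc (n + 1)) : E :=
  if 0 < z 0 ∧ crossCoord z ∈ (loc.chartB i).target then
    (loc.partB i ((loc.chartB i).symm (crossCoord z)) *
      Real.exp ((γ - (n + 1) / 2) * z 0) * cut (Real.exp (-z 0))) •
      Function.extend Subtype.val u 0
        (C.collar (Real.exp (-z 0), (loc.chartB i).symm (crossCoord z)))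
  else 0

open Classical in
/-- The function `χ_i (1 - cut) u` on `M`, where `χ_i` is a member of the partition of unity of `M`,
in the coordinates given by the `i`-th chart of `M`, extended by zero to `ℝ^{n+1}`. -/
def ConicAtlas.corePiece (loc : ConicAtlas C cut) (i : Fin loc.cardM)
    (u : RegularPart n Mt → E) (z : Euc (n + 1)) : E :=
  if z ∈ ((loc.chartM i).extend (𝓡∂ (n + 1))).target then
    (loc.partM i (((loc.chartM i).extend (𝓡∂ (n + 1))).symm z) *
      (1 - C.cutoff cut (((loc.chartM i).extend (𝓡∂ (n + 1))).symm z))) •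
      Function.extend Subtype.val u 0 (((loc.chartM i).extend (𝓡∂ (n + 1))).symm z)
  else 0

/-- `‖S_γ(cut u)‖_{H^s_p(ℝ₊ × B)} + ‖(1 - cut) u‖_{H^s_p(M)}`, with value `∞` for functions `u`
outside the Mellin Sobolev space. -/
def ConicAtlas.mellinENorm (loc : ConicAtlas C cut) (p s γ : ℝ)
    (u : RegularPart n Mt → E) : ℝ≥0∞ :=
  ∑ i, sobolevENorm s (ENNReal.ofReal p) (loc.cylinderPiece γ i u) +
    ∑ i, sobolevENorm s (ENNReal.ofReal p) (loc.corePiece i u)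

lemma ConicAtlas.cylinderPiece_add (loc : ConicAtlas C cut) (γ : ℝ) (i : Fin loc.cardB)
    (u v : RegularPart n Mt → E) :
    loc.cylinderPiece γ i (u + v) = loc.cylinderPiece γ i u + loc.cylinderPiece γ i v := by
  ext z
  simp only [ConicAtlas.cylinderPiece, Pi.add_apply]
  split_ifs
  · rw [extend_add Subtype.val_injective, smul_add]
  · simp

lemma ConicAtlas.cylinderPiece_smul (loc : ConicAtlas C cut) (γ : ℝ) (i : Fin loc.cardB)
    (c : ℝ) (u : RegularPart n Mt → E) :
    loc.cylinderPiece γ i (c • u) = c • loc.cylinderPiece γ i u := by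
  ext z
  simp only [ConicAtlas.cylinderPiece, Pi.smul_apply]
  split_ifs
  · rw [extend_smul Subtype.val_injective, smul_comm]
  · simp

lemma ConicAtlas.corePiece_add (loc : ConicAtlas C cut) (i : Fin loc.cardM)
    (u v : RegularPart n Mt → E) :
    loc.corePiece i (u + v) = loc.corePiece i u + loc.corePiece i v := by
  ext z
  simp only [ConicAtlas.corePiece, Pi.add_apply]
  split_ifs
  · rw [extend_add Subtype.val_injective, smul_add]
  · simp

lemma ConicAtlas.corePiece_smul (loc : ConicAtlas C cut) (i : Fin loc.cardM)
    (c : ℝ) (u : RegularPart n Mt → E) :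
    loc.corePiece i (c • u) = c • loc.corePiece i u := by
  ext z
  simp only [ConicAtlas.corePiece, Pi.smul_apply]
  split_ifs
  · rw [extend_smul Subtype.val_injective, smul_comm]
  · simp

lemma ConicAtlas.mellinENorm_add_le (loc : ConicAtlas C cut) {p : ℝ} (hp : 1 < p) (s γ : ℝ)
    (u v : RegularPart n Mt → E) :
    loc.mellinENorm p s γ (u + v) ≤ loc.mellinENorm p s γ u + loc.mellinENorm p s γ v := by
  have hp' : 1 ≤ ENNReal.ofReal p := by
    rw [← ENNReal.ofReal_one]; exact ENNReal.ofReal_le_ofReal hp.le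
  unfold ConicAtlas.mellinENorm
  rw [add_add_add_comm, ← Finset.sum_add_distrib, ← Finset.sum_add_distrib]
  simp only [loc.cylinderPiece_add, loc.corePiece_add]
  exact add_le_add (Finset.sum_le_sum fun i _ => sobolevENorm_add_le s hp' _ _)
    (Finset.sum_le_sum fun i _ => sobolevENorm_add_le s hp' _ _)

lemma ConicAtlas.mellinENorm_smul_le (loc : ConicAtlas C cut) (p s γ : ℝ) (c : ℝ)
    (u : RegularPart n Mt → E) (hu : loc.mellinENorm p s γ u < ⊤) :
    loc.mellinENorm p s γ (c • u) ≤ ‖c‖ₑ * loc.mellinENorm p s γ u := by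
  unfold ConicAtlas.mellinENorm at hu ⊢
  rw [ENNReal.add_lt_top, ENNReal.sum_lt_top, ENNReal.sum_lt_top] at hu
  rw [mul_add, Finset.mul_sum, Finset.mul_sum]
  simp only [loc.cylinderPiece_smul, loc.corePiece_smul]
  exact add_le_add
    (Finset.sum_le_sum fun i hi => sobolevENorm_smul_le s c _ (hu.1 i hi).ne)
    (Finset.sum_le_sum fun i hi => sobolevENorm_smul_le s c _ (hu.2 i hi).ne)

lemma ConicAtlas.mellinENorm_zero (loc : ConicAtlas C cut) (p s γ : ℝ) :
    loc.mellinENorm p s γ (0 : RegularPart n Mt → E) = 0 := by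
  have h1 : ∀ i, loc.cylinderPiece γ i (0 : RegularPart n Mt → E) = 0 := fun i => by
    have := loc.cylinderPiece_smul γ i 0 (0 : RegularPart n Mt → E)
    simpa using this
  have h2 : ∀ i, loc.corePiece i (0 : RegularPart n Mt → E) = 0 := fun i => by
    have := loc.corePiece_smul i 0 (0 : RegularPart n Mt → E)
    simpa using this
  simp [ConicAtlas.mellinENorm, h1, h2, sobolevENorm_zero]

variable (E) in
/-- The functions `M → E` (everywhere defined) with finite Mellin Sobolev norm. -/
def ConicAtlas.mellinSubmodule (loc : ConicAtlas C cut) (p s γ : ℝ) [hp : Fact (1 < p)] :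
    Submodule ℝ (RegularPart n Mt → E) where
  carrier := {u | loc.mellinENorm p s γ u < ⊤}
  zero_mem' := by simp [loc.mellinENorm_zero]
  add_mem' {u v} hu hv := (loc.mellinENorm_add_le hp.out s γ u v).trans_lt
    (ENNReal.add_lt_top.2 ⟨hu, hv⟩)
  smul_mem' c u hu := (loc.mellinENorm_smul_le p s γ c u hu).trans_lt
    (ENNReal.mul_lt_top enorm_lt_top hu)

/-- The Mellin Sobolev norm as a seminorm on everywhere defined functions. -/
def ConicAtlas.mellinSeminorm (loc : ConicAtlas C cut) (p s γ : ℝ) [hp : Fact (1 < p)] :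
    Seminorm ℝ (loc.mellinSubmodule E p s γ) :=
  Seminorm.ofSMulLE (fun u => (loc.mellinENorm p s γ u.1).toReal)
    (by simp [loc.mellinENorm_zero])
    (fun u v => by
      have hu : loc.mellinENorm p s γ u.1 ≠ ⊤ := (show _ < ⊤ from u.2).ne
      have hv : loc.mellinENorm p s γ v.1 ≠ ⊤ := (show _ < ⊤ from v.2).ne
      rw [← ENNReal.toReal_add hu hv]
      exact ENNReal.toReal_mono (ENNReal.add_ne_top.2 ⟨hu, hv⟩)
        (loc.mellinENorm_add_le hp.out s γ u.1 v.1))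
    (fun c u => by
      have hu : loc.mellinENorm p s γ u.1 < ⊤ := u.2
      have h := ENNReal.toReal_mono (ENNReal.mul_lt_top enorm_lt_top hu).ne
        (loc.mellinENorm_smul_le p s γ c u.1 hu)
      rwa [ENNReal.toReal_mul, toReal_enorm] at h)

/-- Everywhere defined functions with finite Mellin Sobolev norm, as a seminormed space. -/
def MellinFun (loc : ConicAtlas C cut) (p s γ : ℝ) [Fact (1 < p)]
    (E : Type*) [NormedAddCommGroup E] [NormedSpace ℝ E] : Type _ :=
  loc.mellinSubmodule E p s γ

instance (loc : ConicAtlas C cut) (p s γ : ℝ) [Fact (1 < p)] :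
    AddCommGroup (MellinFun loc p s γ E) :=
  inferInstanceAs (AddCommGroup (loc.mellinSubmodule E p s γ))

instance (loc : ConicAtlas C cut) (p s γ : ℝ) [Fact (1 < p)] :
    Module ℝ (MellinFun loc p s γ E) :=
  inferInstanceAs (Module ℝ (loc.mellinSubmodule E p s γ))

instance (loc : ConicAtlas C cut) (p s γ : ℝ) [Fact (1 < p)] :
    SeminormedAddCommGroup (MellinFun loc p s γ E) :=
  AddGroupSeminorm.toSeminormedAddCommGroup
    (loc.mellinSeminorm (E := E) p s γ).toAddGroupSeminorm

instance (loc : ConicAtlas C cut) (p s γ : ℝ) [Fact (1 < p)] :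
    NormedSpace ℝ (MellinFun loc p s γ E) where
  norm_smul_le c u := (map_smul_eq_mul (loc.mellinSeminorm (E := E) p s γ) c u).le

/-- The Mellin Sobolev space `H^{s,γ}_p(M, E)`: functions with finite norm, two functions being
identified if their difference has norm zero, i.e. if they agree almost everywhere. -/
def MellinSobolev (loc : ConicAtlas C cut) (p s γ : ℝ) [Fact (1 < p)]
    (E : Type*) [NormedAddCommGroup E] [NormedSpace ℝ E] : Type _ :=
  SeparationQuotient (MellinFun loc p s γ E)

instance (loc : ConicAtlas C cut) (p s γ : ℝ) [Fact (1 < p)] :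
    NormedAddCommGroup (MellinSobolev loc p s γ E) :=
  inferInstanceAs (NormedAddCommGroup (SeparationQuotient (MellinFun loc p s γ E)))

instance (loc : ConicAtlas C cut) (p s γ : ℝ) [Fact (1 < p)] :
    NormedSpace ℝ (MellinSobolev loc p s γ E) :=
  inferInstanceAs (NormedSpace ℝ (SeparationQuotient (MellinFun loc p s γ E)))

/-- The function `u : M → E` belongs to the class `q ∈ H^{s,γ}_p(M, E)`. -/
def MellinSobolev.Represents {loc : ConicAtlas C cut} {p s γ : ℝ} [Fact (1 < p)]
    (q : MellinSobolev loc p s γ E) (u : RegularPart n Mt → E) : Prop :=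
  ∃ h : u ∈ loc.mellinSubmodule E p s γ,
    q = SeparationQuotient.mk (show MellinFun loc p s γ E from ⟨u, h⟩)

/-- `Rng(X)` for a set `X ⊆ H^{s,γ}_p(M, ℝ^L) ⊕ ℝ^L`: the union of the ranges of the functions
`w + c`, `(w, c) ∈ X`, where `w` stands for its continuous representative. -/
def mellinRng {loc : ConicAtlas C cut} {p s γ : ℝ} [Fact (1 < p)] {L : ℕ}
    (X : Set (MellinSobolev loc p s γ (Euc L) × Euc L)) : Set (Euc L) :=
  {ξ | ∃ U ∈ X, ∃ w : RegularPart n Mt → Euc L,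
    U.1.Represents w ∧ Continuous w ∧ ∃ z, ξ = w z + U.2}

end Mellin

/-! ### Classes of differentiable functions -/

/-- `φ ∈ BC^m(O, E)`: the function `φ` is of class `C^m` on the open set `O`, and all its derivatives
of order at most `m` are bounded on `O`. -/
def IsBC {L : ℕ} {E : Type*} [NormedAddCommGroup E] [NormedSpace ℝ E] (m : ℕ)
    (O : Set (Euc L)) (φ : Euc L → E) : Prop :=
  ContDiffOn ℝ m φ O ∧
    ∀ j ≤ m, ∃ K : ℝ, ∀ ξ ∈ O, ‖iteratedFDerivWithin ℝ j φ O ξ‖ ≤ K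

/-- `F ∈ C^{k+1-}(X, H)`: on the open set `X`, the map `F` is `k` times continuously differentiable
and its `k`-th derivative is locally Lipschitz continuous. -/
def IsCkLip {G H : Type*} [NormedAddCommGroup G] [NormedSpace ℝ G]
    [NormedAddCommGroup H] [NormedSpace ℝ H] (k : ℕ) (F : G → H) (X : Set G) : Prop :=
  ContDiffOn ℝ k F X ∧ LocallyLipschitzOn X (iteratedFDerivWithin ℝ k F X)

end

/-! Put d = n + 1. In the coordinate t = -log x the collar is a half cylinder, and the norm of
`MellinSobolev` is a finite sum of Sobolev norms on ℝ^d of localized pieces, which carry the weight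
e^{(γ - d/2)t} in the cylinder charts. Since γ ≥ d/2, this weight can be divided out: in every chart
a cut-off of w ∈ H^{s,γ}_p is controlled by unweighted pieces in H^s_p. As s > d/p, it is then
bounded and lies in W^{[s]}_p (`exists_embedding`, `exists_multiplierBound_trunc`).

A constant is not in L_p on the cylinder, but w + c is bounded with derivatives of orders 1, …, [s]
in L_p. This is the class `MultiplierBound`. Since p > d, Morrey's inequality shows that such
functions multiply W^m_p into itself (`exists_sobolevBound_bilin`). The chain rule and induction on
m show that composition with a C^m function preserves the class, is continuous, and for C^{m+1}
functions has a first order Taylor expansion (`exists_multiplierBound_comp`,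
`exists_multiplierBound_comp_sub`, `exists_multiplierBound_remainder`). Since ϑ < d/2, the target
weight decays exponentially along the cylinder, so the weighted partition of unity lies in every
W^m_p (`CutoffData.goodWeights`), and a piece of φ ∘ (w + c) is such a function times a multiplier.

For φ of class C^{[s]+1} on all of ℝ^L, the substitution operator Φ_φ is therefore differentiable,
with derivative H ↦ Φ_{φ'}(U) H. The product is a bounded bilinear map (`exists_mellinProdL`), so
the derivative is a continuous linear map applied to the substitution operator of φ'. Induction
gives Φ_φ ∈ C^k for φ ∈ C^{[s]+k} (`contDiff_substitution`). With k + 1 in place of k, the k-th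
derivative is C^1, hence locally Lipschitz.

It remains to pass from ℝ^L to O. The set X is open and the constants may be varied, so a whole
r-neighbourhood of the bounded range of w + c lies in O. Multiplying φ by a cut-off function that
equals one near the compact closure of this range does not change Φ near (w, c)
(`exists_substitution_eq`).

The embedding needs no Fourier multipliers and holds for every Banach space. For integer s it is
Morrey's inequality. For other s the Bessel kernel is a superposition of heat kernels; only
derivatives of order [s] < s are needed, these fall on the kernel and leave it integrable, and the
inequalities of Young and Hölder suffice. -/

noncomputable section
open Filter
open scoped NNReal Convolution

/-! ### Mollification and convergence in L_p. -/

section Mollification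

set_option linter.unusedSectionVars false

variable {d : ℕ} {F G H : Type*} [NormedAddCommGroup F] [NormedSpace ℝ F]
  [NormedAddCommGroup G] [NormedSpace ℝ G] [NormedAddCommGroup H] [NormedSpace ℝ H]

/-- The `i`-th standard basis vector of `ℝ^d`. -/
abbrev stdVec (i : Fin d) : Euc d := EuclideanSpace.single i (1 : ℝ)

/-- `g` is the first order weak derivative `∂_i f`. -/
def HasWeakPartial (i : Fin d) (f g : Euc d → F) : Prop :=
  LocallyIntegrable f ∧ LocallyIntegrable g ∧
    ∀ ψ : Euc d → ℝ, ContDiff ℝ ∞ ψ → HasCompactSupport ψ →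
      ∫ x, fderiv ℝ ψ x (stdVec i) • f x = -∫ x, ψ x • g x

/-- Convergence in `L_1` on compact sets. -/
def TendstoL1Loc (f : ℕ → Euc d → F) (g : Euc d → F) : Prop :=
  ∀ K : Set (Euc d), IsCompact K → Tendsto (fun n => ∫⁻ x in K, ‖f n x - g x‖ₑ) atTop (𝓝 0)

/-- A sequence of bump functions shrinking to the origin. -/
def mollBump (d n : ℕ) : ContDiffBump (0 : Euc d) where
  rIn := 1 / (2 * ((n : ℝ) + 1))
  rOut := 1 / ((n : ℝ) + 1)
  rIn_pos := by positivity
  rIn_lt_rOut := by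
    apply one_div_lt_one_div_of_lt <;> linarith [(Nat.cast_nonneg n : (0 : ℝ) ≤ n)]

/-- The standard mollifier kernel. -/
def mollKernel (d n : ℕ) : Euc d → ℝ := (mollBump d n).normed volume

/-- The mollification of a function. -/
def mollify (n : ℕ) (f : Euc d → F) : Euc d → F :=
  mollKernel d n ⋆[ContinuousLinearMap.lsmul ℝ ℝ, volume] f

lemma mollify_apply (n : ℕ) (f : Euc d → F) (x : Euc d) :
    mollify n f x = ∫ t, mollKernel d n t • f (x - t) := rfl

lemma mollKernel_contDiff (n : ℕ) : ContDiff ℝ ∞ (mollKernel d n) :=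
  (mollBump d n).contDiff_normed

lemma mollKernel_nonneg (n : ℕ) (x : Euc d) : 0 ≤ mollKernel d n x :=
  (mollBump d n).nonneg_normed x

lemma mollKernel_hasCompactSupport (n : ℕ) : HasCompactSupport (mollKernel d n) :=
  (mollBump d n).hasCompactSupport_normed

lemma mollKernel_continuous (n : ℕ) : Continuous (mollKernel d n) :=
  (mollKernel_contDiff n).continuous

lemma integral_mollKernel (n : ℕ) : ∫ x, mollKernel d n x = 1 :=
  (mollBump d n).integral_normed

lemma mollKernel_integrable (n : ℕ) : Integrable (mollKernel d n) :=
  (mollKernel_continuous n).integrable_of_hasCompactSupport (mollKernel_hasCompactSupport n)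

lemma lintegral_mollKernel (n : ℕ) : ∫⁻ x, ‖mollKernel d n x‖ₑ = 1 := by
  have h := ofReal_integral_eq_lintegral_ofReal (mollKernel_integrable (d := d) n)
    (Eventually.of_forall (mollKernel_nonneg n))
  rw [integral_mollKernel, ENNReal.ofReal_one] at h
  rw [h]
  refine lintegral_congr fun x => ?_
  rw [Real.enorm_eq_ofReal (mollKernel_nonneg n x)]

lemma mollKernel_eq_zero {n : ℕ} {x : Euc d} (hx : 1 / ((n : ℝ) + 1) ≤ ‖x‖) :
    mollKernel d n x = 0 := by
  have h := (mollBump d n).support_normed_eq (μ := (volume : Measure (Euc d)))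
  by_contra hne
  have : x ∈ Function.support ((mollBump d n).normed volume) := hne
  rw [h, mem_ball_zero_iff] at this
  exact absurd this (not_lt.2 hx)

lemma contDiff_mollify (n : ℕ) {f : Euc d → F} (hf : LocallyIntegrable f) :
    ContDiff ℝ ∞ (mollify n f) :=
  HasCompactSupport.contDiff_convolution_left (n := ⊤) _ (mollKernel_hasCompactSupport n)
    (mollKernel_contDiff n) hf

lemma tendsto_mollRadius : Tendsto (fun n : ℕ => 1 / ((n : ℝ) + 1)) atTop (𝓝 0) :=
  tendsto_one_div_add_atTop_nhds_zero_nat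

lemma ae_tendsto_mollify [CompleteSpace F] {f : Euc d → F} (hf : LocallyIntegrable f) :
    ∀ᵐ x, Tendsto (fun n => mollify n f x) atTop (𝓝 (f x)) := by
  refine ContDiffBump.ae_convolution_tendsto_right_of_locallyIntegrable (K := 2)
    (φ := fun n => mollBump d n) tendsto_mollRadius (Eventually.of_forall fun n => ?_) hf
  simp only [mollBump]
  have : (0 : ℝ) < n + 1 := by positivity
  field_simp
  exact le_rfl

lemma convolutionExistsAt_mollKernel (n : ℕ) {f : Euc d → F} (hf : LocallyIntegrable f)
    (x : Euc d) : Integrable (fun t => mollKernel d n t • f (x - t)) :=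
  (mollKernel_hasCompactSupport n).convolutionExists_left
    (ContinuousLinearMap.lsmul ℝ ℝ) (mollKernel_continuous n) hf x

lemma mollify_sub (n : ℕ) {f g : Euc d → F} (hf : LocallyIntegrable f)
    (hg : LocallyIntegrable g) : mollify n (f - g) = mollify n f - mollify n g := by
  ext x
  simp only [mollify_apply, Pi.sub_apply, smul_sub]
  exact integral_sub (convolutionExistsAt_mollKernel n hf x)
    (convolutionExistsAt_mollKernel n hg x)

lemma norm_mollify_le (n : ℕ) {f : Euc d → F} {c : ℝ} (hf : ∀ᵐ x, ‖f x‖ ≤ c) (x : Euc d) :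
    ‖mollify n f x‖ ≤ c := by
  rw [mollify_apply]
  have h1 : ∀ᵐ t, ‖f (x - t)‖ ≤ c :=
    (quasiMeasurePreserving_sub_left_of_right_invariant (volume : Measure (Euc d)) x).ae hf
  calc ‖∫ t, mollKernel d n t • f (x - t)‖ ≤ ∫ t, mollKernel d n t * c := by
        refine norm_integral_le_of_norm_le ((mollKernel_integrable n).mul_const c) ?_
        filter_upwards [h1] with t ht
        rw [norm_smul, Real.norm_of_nonneg (mollKernel_nonneg n t)]
        exact mul_le_mul_of_nonneg_left ht (mollKernel_nonneg n t)
    _ = c := by rw [integral_mul_const, integral_mollKernel, one_mul]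

/-- Hölder's inequality for the measure with density K gives (K * g)^p ≤ (∫ K)^{p-1} (K * g^p)
pointwise. Tonelli's theorem and translation invariance then integrate this in x. -/
lemma lintegral_young {p : ℝ} (hp : 1 ≤ p) {K g : Euc d → ℝ≥0∞} (hK : AEMeasurable K)
    (hg : AEMeasurable g) (hKfin : ∫⁻ x, K x ≠ ⊤) :
    ∫⁻ x, (∫⁻ t, K t * g (x - t)) ^ p ≤ (∫⁻ x, K x) ^ p * ∫⁻ x, g x ^ p := by
  have hp0 : 0 < p := by linarith
  wlog hKm : Measurable K generalizing K
  · have e := lintegral_congr_ae hK.ae_eq_mk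
    rw [e] at hKfin ⊢
    refine le_trans (le_of_eq ?_) (this hK.measurable_mk.aemeasurable hKfin hK.measurable_mk)
    refine lintegral_congr fun x => ?_
    congr 1
    refine lintegral_congr_ae ?_
    filter_upwards [hK.ae_eq_mk] with t ht
    rw [ht]
  wlog hgm : Measurable g generalizing g
  · have e : ∫⁻ x, g x ^ p = ∫⁻ x, hg.mk g x ^ p := by
      refine lintegral_congr_ae ?_
      filter_upwards [hg.ae_eq_mk] with t ht
      rw [ht]
    rw [e]
    refine le_trans (le_of_eq ?_) (this hg.measurable_mk.aemeasurable hg.measurable_mk)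
    refine lintegral_congr fun x => ?_
    congr 1
    refine lintegral_congr_ae ?_
    filter_upwards [(quasiMeasurePreserving_sub_left_of_right_invariant (volume : Measure (Euc d)) x).ae
      hg.ae_eq_mk] with t ht
    rw [ht]
  have key : ∀ x, (∫⁻ t, K t * g (x - t)) ^ p ≤
      (∫⁻ t, K t) ^ (p - 1) * ∫⁻ t, K t * g (x - t) ^ p := by
    intro x
    have hgx : Measurable (fun t => g (x - t)) := hgm.comp (measurable_const.sub measurable_id)
    have h := eLpNorm_le_eLpNorm_mul_rpow_measure_univ (μ := volume.withDensity K) (p := 1)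
      (q := ENNReal.ofReal p) (f := fun t => g (x - t))
      (by rw [← ENNReal.ofReal_one]; exact ENNReal.ofReal_le_ofReal hp)
      hgx.aestronglyMeasurable
    rw [eLpNorm_one_eq_lintegral_enorm, eLpNorm_eq_lintegral_rpow_enorm_toReal
      (by simpa using hp0) ENNReal.ofReal_ne_top, ENNReal.toReal_ofReal hp0.le] at h
    simp only [enorm_eq_self] at h
    rw [lintegral_withDensity_eq_lintegral_mul _ hKm hgx,
      lintegral_withDensity_eq_lintegral_mul _ hKm (hgx.pow_const p),
      withDensity_apply _ MeasurableSet.univ, setLIntegral_univ] at h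
    simp only [Pi.mul_apply] at h
    calc (∫⁻ t, K t * g (x - t)) ^ p ≤ _ := ENNReal.rpow_le_rpow h hp0.le
      _ = _ := by
        rw [ENNReal.mul_rpow_of_nonneg _ _ hp0.le, ← ENNReal.rpow_mul, ← ENNReal.rpow_mul,
          one_div_mul_cancel hp0.ne', ENNReal.rpow_one, mul_comm]
        congr 2
        simp
        field_simp
  calc ∫⁻ x, (∫⁻ t, K t * g (x - t)) ^ p
      ≤ ∫⁻ x, (∫⁻ t, K t) ^ (p - 1) * ∫⁻ t, K t * g (x - t) ^ p := lintegral_mono key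
    _ = (∫⁻ t, K t) ^ (p - 1) * ∫⁻ x, ∫⁻ t, K t * g (x - t) ^ p := by
        rw [lintegral_const_mul']
        exact ENNReal.rpow_ne_top_of_nonneg (by linarith) hKfin
    _ = (∫⁻ t, K t) ^ (p - 1) * ∫⁻ t, ∫⁻ x, K t * g (x - t) ^ p := by
        rw [lintegral_lintegral_swap]
        refine Measurable.aemeasurable ?_
        exact (hKm.comp measurable_snd).mul ((hgm.comp (measurable_fst.sub measurable_snd)).pow_const p)
    _ = (∫⁻ t, K t) ^ (p - 1) * ((∫⁻ t, K t) * ∫⁻ x, g x ^ p) := by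
        congr 1
        rw [← lintegral_mul_const _ hKm]
        refine lintegral_congr fun t => ?_
        rw [lintegral_const_mul _ (show Measurable fun x => g (x - t) ^ p from
          (hgm.comp (measurable_id.sub measurable_const)).pow_const p)]
        congr 1
        exact lintegral_sub_right_eq_self (fun x => g x ^ p) t
    _ = _ := by
        rw [← mul_assoc]
        congr 1
        conv_lhs => rw [← ENNReal.rpow_one (∫⁻ t, K t)]
        rw [← ENNReal.rpow_mul, ← ENNReal.rpow_add_of_nonneg _ _ (by linarith) (by linarith)]
        congr 1; ring

lemma eLpNorm_convolution_le {p : ℝ≥0∞} (hp : 1 ≤ p) (hpt : p ≠ ⊤) {K : Euc d → ℝ}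
    {g : Euc d → F} (hK : Integrable K) (hg : AEStronglyMeasurable g) :
    eLpNorm (fun x => ∫ t, K t • g (x - t)) p volume ≤
      (∫⁻ x, ‖K x‖ₑ) * eLpNorm g p volume := by
  have hp1 : 1 ≤ p.toReal := by
    rw [← ENNReal.toReal_one]; exact ENNReal.toReal_mono hpt hp
  have hp0 : 0 < p.toReal := by linarith
  have hpz : p ≠ 0 := (zero_lt_one.trans_le hp).ne'
  rw [eLpNorm_eq_lintegral_rpow_enorm_toReal hpz hpt,
    eLpNorm_eq_lintegral_rpow_enorm_toReal hpz hpt]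
  have h := lintegral_young hp1 hK.1.enorm hg.enorm hK.2.ne
  calc _ ≤ (∫⁻ x, (∫⁻ t, ‖K t‖ₑ * ‖g (x - t)‖ₑ) ^ p.toReal) ^ (1 / p.toReal) := by
        gcongr with x
        refine (enorm_integral_le_lintegral_enorm _).trans (le_of_eq ?_)
        simp_rw [enorm_smul]
    _ ≤ ((∫⁻ x, ‖K x‖ₑ) ^ p.toReal * ∫⁻ x, ‖g x‖ₑ ^ p.toReal) ^ (1 / p.toReal) := by gcongr
    _ = _ := by
        rw [ENNReal.mul_rpow_of_nonneg _ _ (by positivity), ← ENNReal.rpow_mul,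
          mul_one_div_cancel hp0.ne', ENNReal.rpow_one]

lemma eLpNorm_mollify_le {p : ℝ≥0∞} (hp : 1 ≤ p) (hpt : p ≠ ⊤) (n : ℕ) {f : Euc d → F}
    (hf : AEStronglyMeasurable f) : eLpNorm (mollify n f) p volume ≤ eLpNorm f p volume := by
  have h := eLpNorm_convolution_le hp hpt (mollKernel_integrable (d := d) n) hf
  rwa [lintegral_mollKernel, one_mul] at h

/-- The derivative falls on the kernel, and t ↦ K(x - t) is an admissible test function for the weak
derivative. The sign from the reflection cancels the sign from the integration by parts. -/
lemma fderiv_mollify {i : Fin d} {f g : Euc d → F} (h : HasWeakPartial i f g) (n : ℕ)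
    (x : Euc d) : fderiv ℝ (mollify n f) x (stdVec i) = mollify n g x := by
  have h1 := (mollKernel_hasCompactSupport n).hasFDerivAt_convolution_left
    (ContinuousLinearMap.lsmul ℝ ℝ) (μ := volume) (f := mollKernel d n) (g := f)
    ((mollKernel_contDiff n).of_le (by exact_mod_cast le_top)) h.1 x
  have h2 : fderiv ℝ (mollify n f) x = _ := h1.fderiv
  have hc : HasCompactSupport (fderiv ℝ (mollKernel d n)) :=
    (mollKernel_hasCompactSupport n).fderiv (𝕜 := ℝ)
  have hcont : Continuous (fderiv ℝ (mollKernel d n)) :=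
    (mollKernel_contDiff n).continuous_fderiv (by simp)
  have hint := hc.convolutionExists_left
    ((ContinuousLinearMap.lsmul ℝ ℝ (E := F)).precompL (Euc d)) hcont h.1 x
  rw [h2, convolution_def, ContinuousLinearMap.integral_apply hint]
  simp only [ContinuousLinearMap.precompL_apply, ContinuousLinearMap.lsmul_apply]
  set ψ : Euc d → ℝ := fun t => mollKernel d n (x - t) with hψ
  have hψd : ContDiff ℝ ∞ ψ := (mollKernel_contDiff n).comp (contDiff_const.sub contDiff_id)
  have hψc : HasCompactSupport ψ :=
    (mollKernel_hasCompactSupport n).comp_homeomorph (Homeomorph.subLeft x)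
  have hder : ∀ t, fderiv ℝ ψ t (stdVec i) = -fderiv ℝ (mollKernel d n) (x - t) (stdVec i) := by
    intro t
    have h3 : HasFDerivAt ψ ((fderiv ℝ (mollKernel d n) (x - t)).comp
        (-ContinuousLinearMap.id ℝ (Euc d))) t := by
      have h4 : DifferentiableAt ℝ (mollKernel d n) (x - t) :=
        (mollKernel_contDiff n).differentiable (by simp) _
      exact h4.hasFDerivAt.comp t ((hasFDerivAt_id t).const_sub x)
    rw [h3.fderiv]; simp
  have key := h.2.2 ψ hψd hψc
  simp only [hder, neg_smul, integral_neg, neg_inj] at key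
  rw [mollify_apply, ← integral_sub_left_eq_self _ volume x,
    ← integral_sub_left_eq_self (fun t => mollKernel d n t • g (x - t)) volume x]
  simpa [hψ] using key

/-- All mollification radii are at most one, so the difference vanishes off the closed
1-neighbourhood of the support, a set of finite measure. On this set uniform continuity makes it
small. -/
lemma tendsto_eLpNorm_mollify_sub_of_continuous [CompleteSpace F] {p : ℝ≥0∞} (hp : 1 ≤ p) (hpt : p ≠ ⊤)
    {g : Euc d → F} (hg : Continuous g) (hc : HasCompactSupport g) :
    Tendsto (fun n => eLpNorm (mollify n g - g) p volume) atTop (𝓝 0) := by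
  set K := Metric.cthickening 1 (tsupport g) with hK
  have hKc : IsCompact K := hc.isCompact.cthickening
  have hKv : volume K ≠ ⊤ := hKc.measure_lt_top.ne
  have hpz : p ≠ 0 := (zero_lt_one.trans_le hp).ne'
  have huc : UniformContinuous g := hc.uniformContinuous_of_continuous hg
  have bound : ∀ ε : ℝ, 0 < ε → ∀ᶠ n in atTop, eLpNorm (mollify n g - g) p volume ≤
      ENNReal.ofReal ε * volume K ^ (1 / p.toReal) := by
    intro ε hε
    obtain ⟨δ, hδ, hd⟩ := Metric.uniformContinuous_iff.1 huc ε hε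
    filter_upwards [tendsto_mollRadius.eventually (gt_mem_nhds hδ)] with n hn
    have hpt' : ∀ x, ‖(mollify n g - g) x‖ ≤ ‖K.indicator (fun _ => ε) x‖ := by
      intro x
      by_cases hx : x ∈ K
      · rw [indicator_of_mem hx, Pi.sub_apply, ← dist_eq_norm, Real.norm_of_nonneg hε.le]
        refine ContDiffBump.dist_normed_convolution_le hg.aestronglyMeasurable fun y hy => ?_
        exact (hd ((Metric.mem_ball.1 hy).trans hn)).le
      · have h0 : ∀ y, dist x y < 1 → g y = 0 := by
          intro y hy
          by_contra hne
          refine hx (Metric.mem_cthickening_of_dist_le x y 1 _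
            (subset_tsupport g hne) hy.le)
        have hm : mollify n g x = 0 := by
          rw [mollify_apply]
          refine integral_eq_zero_of_ae (Eventually.of_forall fun t => ?_)
          by_cases ht : 1 / ((n : ℝ) + 1) ≤ ‖t‖
          · simp [mollKernel_eq_zero ht]
          · have : g (x - t) = 0 := h0 _ (by
              simp only [dist_self_sub_right]
              refine (not_le.1 ht).trans_le ?_
              rw [div_le_one (by positivity)]
              linarith [(Nat.cast_nonneg n : (0 : ℝ) ≤ n)])
            simp [this]
        simp [Pi.sub_apply, hm, h0 x (by simp)]
    refine (eLpNorm_mono hpt').trans ?_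
    rw [eLpNorm_indicator_const hKc.measurableSet hpz hpt, Real.enorm_eq_ofReal hε.le]
  have hfin : volume K ^ (1 / p.toReal) ≠ ⊤ :=
    ENNReal.rpow_ne_top_of_nonneg (by positivity) hKv
  rw [ENNReal.tendsto_nhds_zero]
  intro ε hε
  have : Tendsto (fun r : ℝ => ENNReal.ofReal r * volume K ^ (1 / p.toReal)) (𝓝[>] 0)
      (𝓝 (ENNReal.ofReal 0 * volume K ^ (1 / p.toReal))) :=
    ENNReal.Tendsto.mul_const
      (((ENNReal.continuous_ofReal.tendsto 0)).mono_left nhdsWithin_le_nhds) (Or.inr hfin)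
  rw [ENNReal.ofReal_zero, zero_mul, ENNReal.tendsto_nhds_zero] at this
  obtain ⟨r, hr, hr0⟩ := ((this ε hε).and self_mem_nhdsWithin).exists
  filter_upwards [bound r hr0] with n hn using hn.trans hr

/-- Compactly supported continuous functions are dense in L_p, and mollification is a contraction of
L_p, so the general case costs three errors of size ε/3. -/
lemma tendsto_eLpNorm_mollify_sub [CompleteSpace F] {p : ℝ≥0∞} (hp : 1 ≤ p) (hpt : p ≠ ⊤) {f : Euc d → F}
    (hf : MemLp f p volume) :
    Tendsto (fun n => eLpNorm (mollify n f - f) p volume) atTop (𝓝 0) := by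
  rw [ENNReal.tendsto_nhds_zero]
  intro ε hε
  have hε3 : ε / 3 ≠ 0 := by simpa using hε.ne'
  obtain ⟨g, hgc, hfg, hg, hgm⟩ := hf.exists_hasCompactSupport_eLpNorm_sub_le hpt hε3
  have h1 := ENNReal.tendsto_nhds_zero.1
    (tendsto_eLpNorm_mollify_sub_of_continuous hp hpt hg hgc) (ε / 3) hε3.bot_lt
  filter_upwards [h1] with n hn
  have hfl := hf.locallyIntegrable hp
  have hgl := hgm.locallyIntegrable hp
  have e : mollify n f - f = mollify n (f - g) + ((mollify n g - g) - (f - g)) := by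
    rw [mollify_sub n hfl hgl]; abel
  have m1 : AEStronglyMeasurable (mollify n (f - g)) :=
    (contDiff_mollify n (hfl.sub hgl)).continuous.aestronglyMeasurable
  have m2 : AEStronglyMeasurable (mollify n g - g) :=
    ((contDiff_mollify n hgl).continuous.sub hg).aestronglyMeasurable
  rw [e]
  calc _ ≤ eLpNorm (mollify n (f - g)) p volume +
        (eLpNorm (mollify n g - g) p volume + eLpNorm (f - g) p volume) :=
        (eLpNorm_add_le m1 (m2.sub (hf.1.sub hgm.1)) hp).trans
          (add_le_add le_rfl (eLpNorm_sub_le m2 (hf.1.sub hgm.1) hp))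
    _ ≤ ε / 3 + (ε / 3 + ε / 3) := by
        refine add_le_add ?_ (add_le_add hn hfg)
        exact (eLpNorm_mollify_le hp hpt n (hf.1.sub hgm.1)).trans hfg
    _ = ε := by rw [← add_assoc, ENNReal.add_thirds]

/-- On K the mollifications see f only in the closed 1-neighbourhood of K, so f may be replaced by
an integrable function and the global L_1 statement applies. -/
lemma tendstoL1Loc_mollify [CompleteSpace F] {f : Euc d → F} (hf : LocallyIntegrable f) :
    TendstoL1Loc (fun n => mollify n f) f := by
  intro K hK
  set K1 := Metric.cthickening 1 K
  have hK1 : IsCompact K1 := hK.cthickening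
  have hi : Integrable (K1.indicator f) :=
    (integrable_indicator_iff hK1.measurableSet).2 (hf.integrableOn_isCompact hK1)
  have h1 := tendsto_eLpNorm_mollify_sub le_rfl ENNReal.one_ne_top (memLp_one_iff_integrable.2 hi)
  refine tendsto_of_tendsto_of_tendsto_of_le_of_le tendsto_const_nhds h1 (fun _ => bot_le)
    fun n => ?_
  rw [eLpNorm_one_eq_lintegral_enorm]
  refine le_trans (le_of_eq ?_) (setLIntegral_le_lintegral K _)
  refine setLIntegral_congr_fun hK.measurableSet fun x hx => ?_
  have hx1 : x ∈ K1 := Metric.self_subset_cthickening K hx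
  have : mollify n f x = mollify n (K1.indicator f) x := by
    rw [mollify_apply, mollify_apply]
    refine integral_congr_ae (Eventually.of_forall fun t => ?_)
    by_cases ht : 1 / ((n : ℝ) + 1) ≤ ‖t‖
    · simp [mollKernel_eq_zero ht]
    · have : x - t ∈ K1 := Metric.mem_cthickening_of_dist_le _ x 1 _ hx (by
        rw [dist_comm, dist_self_sub_right]
        refine (not_le.1 ht).le.trans ?_
        rw [div_le_one (by positivity)]
        linarith [(Nat.cast_nonneg n : (0 : ℝ) ≤ n)])
      simp [indicator_of_mem this]
  simp only [Pi.sub_apply, this, indicator_of_mem hx1]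

end Mollification

/-! ### Calculus of first order weak derivatives. -/

section WeakPartial

set_option linter.unusedSectionVars false

variable {d : ℕ} {F G H : Type*} [NormedAddCommGroup F] [NormedSpace ℝ F]
  [NormedAddCommGroup G] [NormedSpace ℝ G] [NormedAddCommGroup H] [NormedSpace ℝ H]

lemma TendstoL1Loc.tendsto_integral_smul {f : ℕ → Euc d → F} {g : Euc d → F}
    (h : TendstoL1Loc f g) (hf : ∀ n, LocallyIntegrable (f n)) (hg : LocallyIntegrable g)
    {χ : Euc d → ℝ} (hχ : Continuous χ) (hc : HasCompactSupport χ) :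
    Tendsto (fun n => ∫ x, χ x • f n x) atTop (𝓝 (∫ x, χ x • g x)) := by
  obtain ⟨C, hC⟩ := hχ.bounded_above_of_compact_support hc
  refine tendsto_integral_of_L1 _
    (hg.integrable_smul_left_of_hasCompactSupport hχ hc).aestronglyMeasurable
    (Eventually.of_forall fun n => (hf n).integrable_smul_left_of_hasCompactSupport hχ hc) ?_
  have h1 := ENNReal.Tendsto.const_mul (a := ENNReal.ofReal C) (h _ hc.isCompact)
    (Or.inr ENNReal.ofReal_ne_top)
  rw [mul_zero] at h1
  refine tendsto_of_tendsto_of_tendsto_of_le_of_le tendsto_const_nhds h1 (fun _ => bot_le)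
    fun n => ?_
  dsimp only
  rw [← lintegral_const_mul' _ _ ENNReal.ofReal_ne_top,
    ← lintegral_indicator hc.isCompact.measurableSet]
  refine lintegral_mono fun x => ?_
  by_cases hx : x ∈ tsupport χ
  · rw [indicator_of_mem hx, ← smul_sub, enorm_smul]
    gcongr
    rw [← ofReal_norm]
    exact ENNReal.ofReal_le_ofReal (hC x)
  · simp [image_eq_zero_of_notMem_tsupport hx]

lemma integral_fderiv_smul_eq {i : Fin d} {f : Euc d → F} (hf : ContDiff ℝ 1 f)
    {ψ : Euc d → ℝ} (hψ : ContDiff ℝ ∞ ψ) (hc : HasCompactSupport ψ) :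
    ∫ x, fderiv ℝ ψ x (stdVec i) • f x = -∫ x, ψ x • fderiv ℝ f x (stdVec i) := by
  have hψ' : Continuous fun x => fderiv ℝ ψ x (stdVec i) :=
    (hψ.continuous_fderiv (by simp)).clm_apply continuous_const
  have hf' : Continuous fun x => fderiv ℝ f x (stdVec i) :=
    (hf.continuous_fderiv (by simp)).clm_apply continuous_const
  have hc' : HasCompactSupport fun x => fderiv ℝ ψ x (stdVec i) := hc.fderiv_apply (𝕜 := ℝ) _
  rw [eq_comm, neg_eq_iff_eq_neg]
  refine integral_smul_fderiv_eq_neg_fderiv_smul_of_integrable ?_ ?_ ?_ ?_ ?_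
  · exact (hψ'.smul hf.continuous).integrable_of_hasCompactSupport hc'.smul_right
  · exact (hψ.continuous.smul hf').integrable_of_hasCompactSupport hc.smul_right
  · exact (hψ.continuous.smul hf.continuous).integrable_of_hasCompactSupport hc.smul_right
  · exact fun x _ => hψ.differentiable (by simp) x
  · exact fun x _ => hf.differentiable (by simp) x

/-- Integration by parts survives L_1 convergence on the support of the test function. The product
rule, the chain rule and the change of variables below all come from this closedness, with mollified
functions as approximations. -/
lemma HasWeakPartial.of_tendsto {i : Fin d} {f g : Euc d → F} {u : ℕ → Euc d → F}
    (hu : ∀ n, ContDiff ℝ 1 (u n)) (hf : LocallyIntegrable f) (hg : LocallyIntegrable g)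
    (h1 : TendstoL1Loc u f) (h2 : TendstoL1Loc (fun n x => fderiv ℝ (u n) x (stdVec i)) g) :
    HasWeakPartial i f g := by
  refine ⟨hf, hg, fun ψ hψ hc => ?_⟩
  have hψ' : Continuous fun x => fderiv ℝ ψ x (stdVec i) :=
    (hψ.continuous_fderiv (by simp)).clm_apply continuous_const
  have t1 := h1.tendsto_integral_smul (fun n => (hu n).continuous.locallyIntegrable) hf
    hψ' (hc.fderiv_apply (𝕜 := ℝ) _)
  have t2 := (h2.tendsto_integral_smul (fun n => Continuous.locallyIntegrable
    (((hu n).continuous_fderiv (by simp)).clm_apply continuous_const)) hg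
    hψ.continuous hc).neg
  exact tendsto_nhds_unique t1 (t2.congr fun n => (integral_fderiv_smul_eq (hu n) hψ hc).symm)

lemma HasWeakPartial.of_contDiff (i : Fin d) {f : Euc d → F} (hf : ContDiff ℝ 1 f) :
    HasWeakPartial i f (fun x => fderiv ℝ f x (stdVec i)) :=
  ⟨hf.continuous.locallyIntegrable, Continuous.locallyIntegrable
    ((hf.continuous_fderiv (by simp)).clm_apply continuous_const),
    fun _ hψ hc => integral_fderiv_smul_eq hf hψ hc⟩

lemma HasWeakPartial.const (i : Fin d) (c : F) :
    HasWeakPartial i (fun _ : Euc d => c) (fun _ => 0) := by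
  have := HasWeakPartial.of_contDiff i (contDiff_const (c := c) (𝕜 := ℝ) (E := Euc d) (n := 1))
  simpa using this

lemma HasWeakPartial.congr_ae {i : Fin d} {f g f' g' : Euc d → F} (h : HasWeakPartial i f g)
    (hf : f =ᵐ[volume] f') (hg : g =ᵐ[volume] g') : HasWeakPartial i f' g' := by
  refine ⟨h.1.congr hf, h.2.1.congr hg, fun ψ hψ hc => ?_⟩
  have h1 : ∫ x, fderiv ℝ ψ x (stdVec i) • f x = ∫ x, fderiv ℝ ψ x (stdVec i) • f' x :=
    integral_congr_ae (hf.mono fun x hx => by dsimp only; rw [hx])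
  have h2 : ∫ x, ψ x • g x = ∫ x, ψ x • g' x :=
    integral_congr_ae (hg.mono fun x hx => by dsimp only; rw [hx])
  rw [← h1, ← h2, h.2.2 ψ hψ hc]

lemma HasWeakPartial.add {i : Fin d} {f₁ g₁ f₂ g₂ : Euc d → F} (h₁ : HasWeakPartial i f₁ g₁)
    (h₂ : HasWeakPartial i f₂ g₂) : HasWeakPartial i (f₁ + f₂) (g₁ + g₂) := by
  refine ⟨h₁.1.add h₂.1, h₁.2.1.add h₂.2.1, fun ψ hψ hc => ?_⟩
  have hψ' : Continuous fun x => fderiv ℝ ψ x (stdVec i) :=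
    (hψ.continuous_fderiv (by simp)).clm_apply continuous_const
  have hc' : HasCompactSupport fun x => fderiv ℝ ψ x (stdVec i) := hc.fderiv_apply (𝕜 := ℝ) _
  simp only [Pi.add_apply, smul_add]
  rw [integral_add (h₁.1.integrable_smul_left_of_hasCompactSupport hψ' hc')
    (h₂.1.integrable_smul_left_of_hasCompactSupport hψ' hc'),
    integral_add (h₁.2.1.integrable_smul_left_of_hasCompactSupport hψ.continuous hc)
    (h₂.2.1.integrable_smul_left_of_hasCompactSupport hψ.continuous hc),
    h₁.2.2 ψ hψ hc, h₂.2.2 ψ hψ hc, neg_add]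

lemma HasWeakPartial.neg {i : Fin d} {f g : Euc d → F} (h : HasWeakPartial i f g) :
    HasWeakPartial i (-f) (-g) := by
  refine ⟨h.1.neg, h.2.1.neg, fun ψ hψ hc => ?_⟩
  simp only [Pi.neg_apply, smul_neg, integral_neg, h.2.2 ψ hψ hc]

lemma HasWeakPartial.sub {i : Fin d} {f₁ g₁ f₂ g₂ : Euc d → F} (h₁ : HasWeakPartial i f₁ g₁)
    (h₂ : HasWeakPartial i f₂ g₂) : HasWeakPartial i (f₁ - f₂) (g₁ - g₂) := by
  rw [sub_eq_add_neg, sub_eq_add_neg]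
  exact h₁.add h₂.neg

/-- A bounded sequence converging almost everywhere may be multiplied with a sequence converging
locally in `L_1`. -/
lemma TendstoL1Loc.bilin (B : F →L[ℝ] G →L[ℝ] H) {u : ℕ → Euc d → F} {v : ℕ → Euc d → G}
    {u₀ : Euc d → F} {v₀ : Euc d → G} (hu : TendstoL1Loc u u₀) (hu₀ : LocallyIntegrable u₀)
    (hum : ∀ n, AEStronglyMeasurable (u n)) (hvm : ∀ n, AEStronglyMeasurable (v n))
    (hv : ∀ᵐ x, Tendsto (fun n => v n x) atTop (𝓝 (v₀ x))) {c : ℝ≥0}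
    (hvc : ∀ n, ∀ᵐ x, ‖v n x‖₊ ≤ c) :
    TendstoL1Loc (fun n x => B (u n x) (v n x)) (fun x => B (u₀ x) (v₀ x)) := by
  have hv₀m : AEStronglyMeasurable v₀ := aestronglyMeasurable_of_tendsto_ae atTop hvm hv
  have hv₀ : ∀ᵐ x, ‖v₀ x‖₊ ≤ c := by
    filter_upwards [hv, ae_all_iff.2 hvc] with x h1 h2
    exact le_of_tendsto h1.nnnorm (Eventually.of_forall h2)
  intro K hK
  have hu₀K : IntegrableOn u₀ K := hu₀.integrableOn_isCompact hK
  obtain ⟨b, hbt, hb⟩ : ∃ b : ℝ≥0∞, b ≠ ⊤ ∧ ∀ x y, ‖B x y‖ₑ ≤ b * ‖x‖ₑ * ‖y‖ₑ := by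
    obtain ⟨C, hC0, hC⟩ := B.isBoundedBilinearMap.bound
    refine ⟨ENNReal.ofReal C, ENNReal.ofReal_ne_top, fun x y => ?_⟩
    simp only [← ofReal_norm]
    rw [← ENNReal.ofReal_mul hC0.le, ← ENNReal.ofReal_mul (by positivity)]
    exact ENNReal.ofReal_le_ofReal (hC x y)
  have t1 : Tendsto (fun n => b * c * ∫⁻ x in K, ‖u n x - u₀ x‖ₑ) atTop (𝓝 0) := by
    have := ENNReal.Tendsto.const_mul (a := b * c) (hu K hK)
      (Or.inr (ENNReal.mul_ne_top hbt ENNReal.coe_ne_top))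
    rwa [mul_zero] at this
  -- The factor that converges only almost everywhere is treated by dominated convergence, its
  -- oscillation being at most c + c.
  have t2 : Tendsto (fun n => ∫⁻ x in K, b * ‖u₀ x‖ₑ * ‖v n x - v₀ x‖ₑ) atTop (𝓝 0) := by
    rw [← lintegral_zero (α := Euc d) (μ := volume.restrict K)]
    refine tendsto_lintegral_of_dominated_convergence'
      (fun x => b * ‖u₀ x‖ₑ * (c + c)) (fun n => ?_) (fun n => ?_) ?_ ?_
    · exact ((hu₀K.1.enorm).const_mul _).mul ((hvm n).sub hv₀m).restrict.enorm
    · filter_upwards [ae_restrict_of_ae (hvc n), ae_restrict_of_ae hv₀] with x h1 h2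
      gcongr
      refine (enorm_sub_le).trans (add_le_add ?_ ?_) <;> exact ENNReal.coe_le_coe.2 ‹_›
    · rw [lintegral_mul_const'' _ (hu₀K.1.enorm.const_mul _),
        lintegral_const_mul'' _ hu₀K.1.enorm]
      exact ENNReal.mul_ne_top (ENNReal.mul_ne_top hbt hu₀K.2.ne) (by simp)
    · filter_upwards [ae_restrict_of_ae hv] with x hx
      have h0 : Tendsto (fun n => ‖v n x - v₀ x‖ₑ) atTop (𝓝 0) := by
        have := (hx.sub_const (v₀ x)).enorm
        simpa using this
      have := ENNReal.Tendsto.const_mul (a := b * ‖u₀ x‖ₑ) h0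
        (Or.inr (ENNReal.mul_ne_top hbt enorm_ne_top))
      rwa [mul_zero] at this
  have t := t1.add t2
  rw [add_zero] at t
  refine tendsto_of_tendsto_of_tendsto_of_le_of_le tendsto_const_nhds t (fun _ => bot_le)
    fun n => ?_
  dsimp only
  have hm : AEMeasurable (fun x => ‖u n x - u₀ x‖ₑ) (volume.restrict K) :=
    ((hum n).restrict.sub hu₀K.1).enorm
  rw [← lintegral_const_mul'' _ hm, ← lintegral_add_left' (hm.const_mul _)]
  refine lintegral_mono_ae ?_
  filter_upwards [ae_restrict_of_ae (hvc n)] with x hx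
  -- One factor is changed at a time: the first term uses the bound on `v n`, the second is `t2`.
  have e : B (u n x) (v n x) - B (u₀ x) (v₀ x) =
      B (u n x - u₀ x) (v n x) + B (u₀ x) (v n x - v₀ x) := by
    simp
  rw [e]
  refine (enorm_add_le _ _).trans (add_le_add ?_ (hb _ _))
  refine (hb _ _).trans ?_
  rw [mul_right_comm]
  gcongr
  exact ENNReal.coe_le_coe.2 hx

/-- This is the bilinear statement with scalar multiplication and the constant sequence 1 as first
factor. -/
lemma tendstoL1Loc_of_bounded {v : ℕ → Euc d → G} {v₀ : Euc d → G}
    (hvm : ∀ n, AEStronglyMeasurable (v n))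
    (hv : ∀ᵐ x, Tendsto (fun n => v n x) atTop (𝓝 (v₀ x))) {c : ℝ≥0}
    (hvc : ∀ n, ∀ᵐ x, ‖v n x‖₊ ≤ c) : TendstoL1Loc v v₀ := by
  have h : TendstoL1Loc (fun (_ : ℕ) (_ : Euc d) => (1 : ℝ)) (fun _ => 1) := fun K _ => by simp
  have := h.bilin (ContinuousLinearMap.lsmul ℝ ℝ (E := G)) continuous_const.locallyIntegrable
    (fun _ => aestronglyMeasurable_const) hvm hv hvc
  simpa using this

lemma locallyIntegrable_bilin (B : F →L[ℝ] G →L[ℝ] H) {u : Euc d → F} {v : Euc d → G}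
    (hu : LocallyIntegrable u) (hv : AEStronglyMeasurable v) {c : ℝ≥0}
    (hvc : ∀ᵐ x, ‖v x‖₊ ≤ c) : LocallyIntegrable (fun x => B (u x) (v x)) := by
  rw [locallyIntegrable_iff]
  intro K hK
  have h1 := hu.integrableOn_isCompact hK
  refine Integrable.mono' (g := fun x => ‖B‖ * c * ‖u x‖) (h1.norm.const_mul _)
    (B.aestronglyMeasurable_comp₂ h1.1 hv.restrict) ?_
  filter_upwards [ae_restrict_of_ae hvc] with x hx
  refine (B.le_opNorm₂ _ _).trans ?_
  rw [mul_right_comm]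
  have : ‖v x‖ ≤ c := hx
  gcongr

lemma TendstoL1Loc.add {u v : ℕ → Euc d → F} {u₀ v₀ : Euc d → F} (hu : TendstoL1Loc u u₀)
    (hv : TendstoL1Loc v v₀) (hum : ∀ n, AEStronglyMeasurable (u n))
    (hu₀ : AEStronglyMeasurable u₀) :
    TendstoL1Loc (fun n => u n + v n) (u₀ + v₀) := fun K hK => by
  have t := (hu K hK).add (hv K hK)
  rw [add_zero] at t
  refine tendsto_of_tendsto_of_tendsto_of_le_of_le tendsto_const_nhds t (fun _ => bot_le)
    fun n => ?_
  dsimp only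
  rw [← lintegral_add_left' (show AEMeasurable (fun x => ‖u n x - u₀ x‖ₑ) (volume.restrict K) from
    ((hum n).sub hu₀).restrict.enorm)]
  refine lintegral_mono fun x => ?_
  simp only [Pi.add_apply, add_sub_add_comm]
  exact enorm_add_le _ _

lemma aesm_mollify (n : ℕ) {u : Euc d → F} (hu : LocallyIntegrable u) :
    AEStronglyMeasurable (mollify n u) :=
  (contDiff_mollify n hu).continuous.aestronglyMeasurable

lemma ae_nnnorm_mollify_le (n : ℕ) {u : Euc d → F} {c : ℝ≥0} (hu : ∀ᵐ x, ‖u x‖₊ ≤ c) :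
    ∀ᵐ x, ‖mollify n u x‖₊ ≤ c :=
  Eventually.of_forall fun x => norm_mollify_le n hu x

variable [CompleteSpace F] [CompleteSpace G]

/-- The product rule for bounded functions. -/
lemma HasWeakPartial.bilin (B : F →L[ℝ] G →L[ℝ] H) {i : Fin d} {a a' : Euc d → F}
    {f f' : Euc d → G} (ha : HasWeakPartial i a a') (hf : HasWeakPartial i f f') {c c' : ℝ≥0}
    (hac : ∀ᵐ x, ‖a x‖₊ ≤ c) (hfc : ∀ᵐ x, ‖f x‖₊ ≤ c') :
    HasWeakPartial i (fun x => B (a x) (f x)) ((fun x => B (a' x) (f x)) + fun x => B (a x) (f' x)) := by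
  -- Mollification preserves the bounds on `a` and `f`. In each term of the differentiated product
  -- one factor is therefore bounded and converges almost everywhere, while the other converges in
  -- L_1 on compact sets.
  refine HasWeakPartial.of_tendsto (u := fun n x => B (mollify n a x) (mollify n f x))
    (fun n => ?_) (locallyIntegrable_bilin B ha.1 hf.1.aestronglyMeasurable hfc) ?_ ?_ ?_
  · exact B.isBoundedBilinearMap.contDiff.comp
      (((contDiff_mollify n ha.1).of_le (by exact_mod_cast le_top)).prodMk
        ((contDiff_mollify n hf.1).of_le (by exact_mod_cast le_top)))
  · exact (locallyIntegrable_bilin B ha.2.1 hf.1.aestronglyMeasurable hfc).add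
      (locallyIntegrable_bilin B.flip hf.2.1 ha.1.aestronglyMeasurable hac)
  · exact (tendstoL1Loc_mollify ha.1).bilin B ha.1 (fun n => aesm_mollify n ha.1) (fun n => aesm_mollify n hf.1)
      (ae_tendsto_mollify hf.1) (fun n => ae_nnnorm_mollify_le n hfc)
  · have e : (fun n x => fderiv ℝ (fun x => B (mollify n a x) (mollify n f x)) x (stdVec i)) =
        fun n => (fun x => B (mollify n a' x) (mollify n f x)) +
          fun x => B.flip (mollify n f' x) (mollify n a x) := by
      ext n x
      have d1 : DifferentiableAt ℝ (mollify n a) x :=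
        (contDiff_mollify n ha.1).differentiable (by simp) x
      have d2 : DifferentiableAt ℝ (mollify n f) x :=
        (contDiff_mollify n hf.1).differentiable (by simp) x
      rw [(B.hasFDerivAt_of_bilinear d1.hasFDerivAt d2.hasFDerivAt).fderiv]
      simp [fderiv_mollify ha, fderiv_mollify hf, add_comm]
    rw [e]
    refine TendstoL1Loc.add ?_ ?_ (fun n => ?_) ?_
    · exact (tendstoL1Loc_mollify ha.2.1).bilin B ha.2.1 (fun n => aesm_mollify n ha.2.1)
        (fun n => aesm_mollify n hf.1) (ae_tendsto_mollify hf.1) (fun n => ae_nnnorm_mollify_le n hfc)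
    · exact (tendstoL1Loc_mollify hf.2.1).bilin B.flip hf.2.1 (fun n => aesm_mollify n hf.2.1)
        (fun n => aesm_mollify n ha.1) (ae_tendsto_mollify ha.1) (fun n => ae_nnnorm_mollify_le n hac)
    · exact B.aestronglyMeasurable_comp₂ (aesm_mollify n ha.2.1) (aesm_mollify n hf.1)
    · exact B.aestronglyMeasurable_comp₂ ha.2.1.aestronglyMeasurable hf.1.aestronglyMeasurable

/-- The chain rule for bounded functions. -/
lemma HasWeakPartial.comp [ProperSpace F] {φ : F → G} (hφ : ContDiff ℝ 1 φ) {i : Fin d}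
    {u u' : Euc d → F} (hu : HasWeakPartial i u u') {c : ℝ≥0} (huc : ∀ᵐ x, ‖u x‖₊ ≤ c) :
    HasWeakPartial i (fun x => φ (u x)) (fun x => fderiv ℝ φ (u x) (u' x)) := by
  -- Mollification averages against a probability density and thus keeps the bound c. Everything
  -- takes place in one compact ball, where φ and its derivative are bounded.
  obtain ⟨C, hC⟩ : ∃ C : ℝ≥0, ∀ ξ ∈ Metric.closedBall (0 : F) c,
      ‖φ ξ‖₊ ≤ C ∧ ‖fderiv ℝ φ ξ‖₊ ≤ C := by
    obtain ⟨C1, h1⟩ := (isCompact_closedBall (0 : F) c).exists_bound_of_continuousOn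
      hφ.continuous.continuousOn
    obtain ⟨C2, h2⟩ := (isCompact_closedBall (0 : F) c).exists_bound_of_continuousOn
      (hφ.continuous_fderiv (by simp)).continuousOn
    refine ⟨C1.toNNReal ⊔ C2.toNNReal, fun ξ hξ => ⟨?_, ?_⟩⟩
    · exact le_sup_of_le_left (NNReal.le_toNNReal_of_coe_le (h1 ξ hξ))
    · exact le_sup_of_le_right (NNReal.le_toNNReal_of_coe_le (h2 ξ hξ))
  have hb : ∀ n x, mollify n u x ∈ Metric.closedBall (0 : F) c := fun n x => by
    rw [mem_closedBall_zero_iff]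
    exact norm_mollify_le n huc x
  have hub : ∀ᵐ x, u x ∈ Metric.closedBall (0 : F) c := huc.mono fun x hx => by
    rw [mem_closedBall_zero_iff]; exact hx
  have hφ' : Continuous (fderiv ℝ φ) := hφ.continuous_fderiv (by simp)
  have cm : ∀ n, ContDiff ℝ 1 (mollify n u) := fun n =>
    (contDiff_mollify n hu.1).of_le (by exact_mod_cast le_top)
  have m1 : AEStronglyMeasurable (fun x => φ (u x)) :=
    hφ.continuous.comp_aestronglyMeasurable hu.1.aestronglyMeasurable
  have m2 : AEStronglyMeasurable (fun x => fderiv ℝ φ (u x)) :=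
    hφ'.comp_aestronglyMeasurable hu.1.aestronglyMeasurable
  let ev : F →L[ℝ] (F →L[ℝ] G) →L[ℝ] G := (ContinuousLinearMap.id ℝ (F →L[ℝ] G)).flip
  refine HasWeakPartial.of_tendsto (u := fun n x => φ (mollify n u x)) (fun n => hφ.comp (cm n))
    ?_ ?_ ?_ ?_
  · have := locallyIntegrable_bilin (ContinuousLinearMap.lsmul ℝ ℝ (E := G))
      (continuous_const (y := (1 : ℝ))).locallyIntegrable m1
      (hub.mono fun x hx => (hC _ hx).1)
    simpa using this
  · exact locallyIntegrable_bilin ev hu.2.1 m2 (hub.mono fun x hx => (hC _ hx).2)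
  · refine tendstoL1Loc_of_bounded (c := C)
      (fun n => (hφ.continuous.comp (cm n).continuous).aestronglyMeasurable) ?_
      (fun n => Eventually.of_forall fun x => (hC _ (hb n x)).1)
    filter_upwards [ae_tendsto_mollify hu.1] with x hx
    exact (hφ.continuous.tendsto _).comp hx
  · have e : (fun n x => fderiv ℝ (fun x => φ (mollify n u x)) x (stdVec i)) =
        fun n x => ev (mollify n u' x) (fderiv ℝ φ (mollify n u x)) := by
      ext n x
      have d1 : DifferentiableAt ℝ φ (mollify n u x) := hφ.differentiable (by simp) _
      have d2 : DifferentiableAt ℝ (mollify n u) x := (cm n).differentiable (by simp) x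
      rw [show (fun x => φ (mollify n u x)) = φ ∘ mollify n u from rfl, fderiv_comp x d1 d2]
      simp [ev, fderiv_mollify hu]
    rw [e]
    refine (tendstoL1Loc_mollify hu.2.1).bilin ev hu.2.1
      (fun n => (contDiff_mollify n hu.2.1).continuous.aestronglyMeasurable)
      (fun n => (hφ'.comp (cm n).continuous).aestronglyMeasurable) ?_
      (fun n => Eventually.of_forall fun x => (hC _ (hb n x)).2)
    filter_upwards [ae_tendsto_mollify hu.1] with x hx
    exact (hφ'.tendsto _).comp hx

end WeakPartial

/-! ### Morrey's inequality for continuously differentiable functions. -/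

section Morrey

set_option linter.unusedSectionVars false

variable {d : ℕ} {F : Type*} [NormedAddCommGroup F] [NormedSpace ℝ F]

lemma lintegral_comp_sub_smul {h : Euc d → ℝ≥0∞} (hh : AEMeasurable h) (x : Euc d) {t : ℝ}
    (ht : 0 < t) :
    ∫⁻ z, h (x - t • z) = ENNReal.ofReal (t ^ (-(d : ℝ))) * ∫⁻ z, h z := by
  have h1 : ∫⁻ z, h (x - t • z) = ∫⁻ y, h (x - y) ∂(Measure.map (t • ·) volume) := by
    rw [lintegral_map' ?_ (by fun_prop)]
    rw [Measure.map_addHaar_smul volume ht.ne']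
    refine AEMeasurable.smul_measure ?_ _
    exact hh.comp_quasiMeasurePreserving (quasiMeasurePreserving_sub_left_of_right_invariant _ x)
  rw [h1, Measure.map_addHaar_smul volume ht.ne', lintegral_smul_measure,
    lintegral_sub_left_eq_self (fun y => h y) x, smul_eq_mul]
  congr 2
  rw [finrank_euclideanSpace_fin, Real.rpow_neg ht.le, Real.rpow_natCast, abs_of_pos (by positivity)]

/-- Hölder's inequality for a rescaled convolution. -/
lemma lintegral_mul_comp_sub_smul_le {p q : ℝ} (hpq : p.HolderConjugate q) {K h : Euc d → ℝ≥0∞}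
    (hK : AEMeasurable K) (hh : AEMeasurable h) (x : Euc d) {t : ℝ} (ht : 0 < t) :
    ∫⁻ z, K z * h (x - t • z) ≤ (∫⁻ z, K z ^ q) ^ (1 / q) *
      (ENNReal.ofReal (t ^ (-((d : ℝ) / p))) * (∫⁻ z, h z ^ p) ^ (1 / p)) := by
  have hq : AEMeasurable (fun z => h (x - t • z)) := by
    refine hh.comp_quasiMeasurePreserving ?_
    refine (quasiMeasurePreserving_sub_left_of_right_invariant (volume : Measure (Euc d)) x).comp
      (f := fun z => t • z) ⟨by fun_prop, ?_⟩
    rw [Measure.map_addHaar_smul volume ht.ne']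
    exact Measure.smul_absolutelyContinuous
  refine (ENNReal.lintegral_mul_le_Lp_mul_Lq volume hpq.symm hK hq).trans (le_of_eq ?_)
  congr 1
  rw [lintegral_comp_sub_smul (hh.pow_const p) x ht, ENNReal.mul_rpow_of_nonneg _ _
    (by have := hpq.pos; positivity), ENNReal.ofReal_rpow_of_nonneg (by positivity)
    (by have := hpq.pos; positivity), ← Real.rpow_mul ht.le]
  congr 3
  ring

/-- The fundamental theorem of calculus along the segment from x to x - z, where each coordinate of
z is at most one in absolute value. -/
lemma enorm_sub_le_lintegral_partial [CompleteSpace F] {f : Euc d → F} (hf : ContDiff ℝ 1 f)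
    (x z : Euc d) (hz : ‖z‖ ≤ 1) :
    ‖f x - f (x - z)‖ₑ ≤
      ∫⁻ t in Ioc (0 : ℝ) 1, ∑ i, ‖fderiv ℝ f (x - t • z) (stdVec i)‖ₑ := by
  have hder : ∀ t : ℝ, HasDerivAt (fun t : ℝ => f (x - t • z)) (-(fderiv ℝ f (x - t • z) z)) t := by
    intro t
    have h1 : HasDerivAt (fun t : ℝ => x - t • z) (-z) t := by
      simpa using ((hasDerivAt_id t).smul_const z).const_sub x
    have h2 := (hf.differentiable (by simp) (x - t • z)).hasFDerivAt.comp_hasDerivAt t h1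
    rwa [map_neg] at h2
  have hc : Continuous fun t : ℝ => -(fderiv ℝ f (x - t • z) z) :=
    (((hf.continuous_fderiv (by simp)).comp (by fun_prop)).clm_apply continuous_const).neg
  have h := intervalIntegral.integral_eq_sub_of_hasDerivAt (fun t _ => hder t)
    (hc.intervalIntegrable 0 1)
  simp only [one_smul, zero_smul, sub_zero] at h
  rw [← enorm_neg, neg_sub, ← h, intervalIntegral.integral_of_le zero_le_one]
  refine (enorm_integral_le_lintegral_enorm _).trans (lintegral_mono fun t => ?_)
  rw [enorm_neg]
  have hz' : z = ∑ i, z i • stdVec i := by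
    ext j
    simp [Finset.sum_apply, Pi.single_apply]
  have e : fderiv ℝ f (x - t • z) z = ∑ i, fderiv ℝ f (x - t • z) (z i • stdVec i) := by
    rw [← map_sum, ← hz']
  rw [e]
  refine (enorm_sum_le _ _).trans (Finset.sum_le_sum fun i _ => ?_)
  rw [map_smul, enorm_smul]
  have : ‖z i‖ₑ ≤ 1 := by
    rw [← ofReal_norm, ← ENNReal.ofReal_one]
    exact ENNReal.ofReal_le_ofReal ((PiLp.norm_apply_le z i).trans hz)
  exact mul_le_of_le_one_left' this

lemma lintegral_Ioc_rpow_ne_top {a : ℝ} (ha : -1 < a) :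
    ∫⁻ t in Ioc (0 : ℝ) 1, ENNReal.ofReal (t ^ a) ≠ ⊤ := by
  have h := (intervalIntegral.intervalIntegrable_rpow' (a := 0) (b := 1) ha)
  rw [intervalIntegrable_iff_integrableOn_Ioc_of_le zero_le_one] at h
  exact h.lintegral_lt_top.ne

/-- Morrey's inequality for smooth functions. -/
lemma exists_enorm_le_sobolev (d : ℕ) {p : ℝ} (hp1 : 1 < p) (hp : (d : ℝ) < p) :
    ∃ C : ℝ≥0, ∀ {F : Type*} [NormedAddCommGroup F] [NormedSpace ℝ F] [CompleteSpace F]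
      (f : Euc d → F), ContDiff ℝ 1 f → ∀ x, ‖f x‖ₑ ≤ C * (eLpNorm f (ENNReal.ofReal p) volume +
        ∑ i, eLpNorm (fun y => fderiv ℝ f y (stdVec i)) (ENNReal.ofReal p) volume) := by
  have hpq : p.HolderConjugate (p.conjExponent) := Real.HolderConjugate.conjExponent hp1
  set q := p.conjExponent
  set η : Euc d → ℝ≥0∞ := fun z => ‖mollKernel d 0 z‖ₑ with hη
  have ηm : AEMeasurable η := (mollKernel_continuous 0).aestronglyMeasurable.enorm
  set M : ℝ≥0∞ := (∫⁻ z, η z ^ q) ^ (1 / q) with hM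
  have hMt : M ≠ ⊤ := by
    have h1 : MemLp (mollKernel d 0) (ENNReal.ofReal q) volume :=
      (mollKernel_continuous 0).memLp_of_hasCompactSupport (mollKernel_hasCompactSupport 0)
    have h2 := h1.2.ne
    rwa [eLpNorm_eq_lintegral_rpow_enorm_toReal (by simpa using hpq.symm.pos)
      ENNReal.ofReal_ne_top, ENNReal.toReal_ofReal hpq.symm.nonneg] at h2
  set J : ℝ≥0∞ := ∫⁻ t in Ioc (0 : ℝ) 1, ENNReal.ofReal (t ^ (-((d : ℝ) / p))) with hJ
  -- The exponent -d/p is larger than -1 exactly because d < p.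
  have hJt : J ≠ ⊤ := lintegral_Ioc_rpow_ne_top (by
    rw [neg_lt_neg_iff, div_lt_one (by linarith)]; exact hp)
  have hC : M * (1 + J) ≠ ⊤ := ENNReal.mul_ne_top hMt (by simp [hJt])
  refine ⟨(M * (1 + J)).toNNReal, fun {F} _ _ _ f hf x => ?_⟩
  rw [ENNReal.coe_toNNReal hC]
  have hLp : ∀ {g : Euc d → F}, eLpNorm g (ENNReal.ofReal p) volume =
      (∫⁻ z, ‖g z‖ₑ ^ p) ^ (1 / p) := fun {g} => by
    rw [eLpNorm_eq_lintegral_rpow_enorm_toReal (by simpa using hpq.pos)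
      ENNReal.ofReal_ne_top, ENNReal.toReal_ofReal hpq.nonneg]
  have hfc : ∀ i, Continuous fun y => fderiv ℝ f y (stdVec i) := fun i =>
    (hf.continuous_fderiv (by simp)).clm_apply continuous_const
  -- The kernel has integral one and vanishes off the unit ball, so f(x) is a local average of f
  -- plus an average of the differences f(x) - f(x - z) with ‖z‖ < 1.
  have e1 : f x = mollify 0 f x + ∫ z, mollKernel d 0 z • (f x - f (x - z)) := by
    have i1 := convolutionExistsAt_mollKernel 0 hf.continuous.locallyIntegrable x
    have i2 : Integrable fun z => mollKernel d 0 z • f x := (mollKernel_integrable 0).smul_const _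
    simp only [smul_sub]
    rw [integral_sub i2 i1, integral_smul_const, integral_mollKernel, mollify_apply]
    simp
  have b1 : ‖mollify 0 f x‖ₑ ≤ M * eLpNorm f (ENNReal.ofReal p) volume := by
    rw [mollify_apply]
    refine (enorm_integral_le_lintegral_enorm _).trans ?_
    have := lintegral_mul_comp_sub_smul_le hpq ηm hf.continuous.aestronglyMeasurable.enorm x
      zero_lt_one
    rw [Real.one_rpow, ENNReal.ofReal_one, one_mul, ← hLp] at this
    simp only [one_smul] at this
    simpa only [enorm_smul] using this
  have b2 : ‖∫ z, mollKernel d 0 z • (f x - f (x - z))‖ₑ ≤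
      M * J * ∑ i, eLpNorm (fun y => fderiv ℝ f y (stdVec i)) (ENNReal.ofReal p) volume := by
    refine (enorm_integral_le_lintegral_enorm _).trans ?_
    calc ∫⁻ z, ‖mollKernel d 0 z • (f x - f (x - z))‖ₑ
        ≤ ∫⁻ z, ∫⁻ t in Ioc (0 : ℝ) 1,
            η z * ∑ i, ‖fderiv ℝ f (x - t • z) (stdVec i)‖ₑ := by
          refine lintegral_mono fun z => ?_
          rw [lintegral_const_mul' _ _ enorm_ne_top, enorm_smul]
          by_cases hz : 1 ≤ ‖z‖
          · simp [mollKernel_eq_zero (n := 0) (x := z) (by simpa using hz)]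
          · gcongr
            exact enorm_sub_le_lintegral_partial hf x z (not_le.1 hz).le
      _ = ∫⁻ t in Ioc (0 : ℝ) 1, ∫⁻ z, η z * ∑ i, ‖fderiv ℝ f (x - t • z) (stdVec i)‖ₑ := by
          rw [lintegral_lintegral_swap]
          refine Measurable.aemeasurable ?_
          refine Measurable.mul ?_ (Finset.measurable_sum _ fun i _ => ?_)
          · exact (mollKernel_continuous 0).measurable.enorm.comp measurable_fst
          · exact ((hfc i).enorm.comp (by fun_prop :
              Continuous fun a : Euc d × ℝ => x - a.2 • a.1)).measurable
      -- For fixed t, Hölder's inequality in z after rescaling by t costs the factor t^(-d/p), whose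
      -- integral over (0, 1] is J.
      _ ≤ ∫⁻ t in Ioc (0 : ℝ) 1, ENNReal.ofReal (t ^ (-((d : ℝ) / p))) * (M *
          ∑ i, eLpNorm (fun y => fderiv ℝ f y (stdVec i)) (ENNReal.ofReal p) volume) := by
          refine setLIntegral_mono' measurableSet_Ioc fun t ht => ?_
          simp_rw [Finset.mul_sum]
          rw [lintegral_finsetSum' _ fun i _ => ?_]
          · refine Finset.sum_le_sum fun i _ => ?_
            refine (lintegral_mul_comp_sub_smul_le hpq ηm (hfc i).aestronglyMeasurable.enorm x
              ht.1).trans (le_of_eq ?_)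
            rw [← hLp, ← hM]; ring
          · exact ηm.mul ((hfc i).comp (by fun_prop :
              Continuous fun z : Euc d => x - t • z)).aestronglyMeasurable.enorm
      _ = _ := by
          rw [lintegral_mul_const'' _ (by fun_prop), ← hJ]; ring
  rw [e1]
  refine (enorm_add_le _ _).trans ((add_le_add b1 b2).trans ?_)
  rw [mul_add]
  gcongr
  · exact le_mul_of_one_le_right' le_self_add
  · exact le_add_self

end Morrey

/-! ### Quantitative Sobolev and multiplier classes. -/

section SobolevBound

set_option linter.unusedSectionVars false

variable {d : ℕ} {F G : Type*} [NormedAddCommGroup F] [NormedSpace ℝ F]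
  [NormedAddCommGroup G] [NormedSpace ℝ G]

/-- All weak derivatives of `f` of order at most `m` have `L_p`-norm at most `c`. -/
def SobolevBound (p : ℝ) : ℕ → (Euc d → F) → ℝ≥0 → Prop
  | 0, f, c => AEStronglyMeasurable f ∧ eLpNorm f (ENNReal.ofReal p) volume ≤ c
  | m + 1, f, c => (AEStronglyMeasurable f ∧ eLpNorm f (ENNReal.ofReal p) volume ≤ c) ∧
      ∃ g : Fin d → Euc d → F, ∀ i, HasWeakPartial i f (g i) ∧ SobolevBound p m (g i) c

/-- `f` is bounded by `c`, and its weak derivatives of order `1, …, m` have `L_p`-norm at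
most `c`. -/
def MultiplierBound (p : ℝ) (m : ℕ) (f : Euc d → F) (c : ℝ≥0) : Prop :=
  (AEStronglyMeasurable f ∧ ∀ᵐ x, ‖f x‖₊ ≤ c) ∧
    ∀ k, m = k + 1 →
      ∃ g : Fin d → Euc d → F, ∀ i, HasWeakPartial i f (g i) ∧ SobolevBound p k (g i) c

variable {p : ℝ} {m : ℕ} {f f₁ f₂ : Euc d → F} {c c₁ c₂ : ℝ≥0}

lemma SobolevBound.base (h : SobolevBound p m f c) :
    AEStronglyMeasurable f ∧ eLpNorm f (ENNReal.ofReal p) volume ≤ c := by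
  cases m with
  | zero => exact h
  | succ m => exact h.1

lemma SobolevBound.memLp (h : SobolevBound p m f c) : MemLp f (ENNReal.ofReal p) volume :=
  ⟨h.base.1, h.base.2.trans_lt ENNReal.coe_lt_top⟩

lemma SobolevBound.mono (h : SobolevBound p m f c₁) (hc : c₁ ≤ c₂) : SobolevBound p m f c₂ := by
  have hc' : (c₁ : ℝ≥0∞) ≤ c₂ := by exact_mod_cast hc
  induction m generalizing f with
  | zero => exact ⟨h.1, h.2.trans hc'⟩
  | succ m ih =>
    obtain ⟨⟨h1, h2⟩, g, hg⟩ := h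
    exact ⟨⟨h1, h2.trans hc'⟩, g, fun i => ⟨(hg i).1, ih (hg i).2⟩⟩

lemma SobolevBound.pred (h : SobolevBound p (m + 1) f c) : SobolevBound p m f c := by
  induction m generalizing f with
  | zero => exact h.1
  | succ m ih =>
    obtain ⟨h0, g, hg⟩ := h
    exact ⟨h0, g, fun i => ⟨(hg i).1, ih (hg i).2⟩⟩

lemma SobolevBound.congr_ae (h : SobolevBound p m f₁ c) (e : f₁ =ᵐ[volume] f₂) :
    SobolevBound p m f₂ c := by
  cases m with
  | zero => exact ⟨h.1.congr e, (eLpNorm_congr_ae e).symm.trans_le h.2⟩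
  | succ m =>
    obtain ⟨⟨h1, h2⟩, g, hg⟩ := h
    exact ⟨⟨h1.congr e, (eLpNorm_congr_ae e).symm.trans_le h2⟩, g,
      fun i => ⟨(hg i).1.congr_ae e (ae_eq_refl _), (hg i).2⟩⟩

lemma SobolevBound.add [hp : Fact (1 < p)] (h₁ : SobolevBound p m f₁ c₁)
    (h₂ : SobolevBound p m f₂ c₂) : SobolevBound p m (f₁ + f₂) (c₁ + c₂) := by
  have hp' : 1 ≤ ENNReal.ofReal p := by
    rw [← ENNReal.ofReal_one]; exact ENNReal.ofReal_le_ofReal hp.out.le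
  induction m generalizing f₁ f₂ with
  | zero =>
    refine ⟨h₁.1.add h₂.1, (eLpNorm_add_le h₁.1 h₂.1 hp').trans ?_⟩
    push_cast
    exact add_le_add h₁.2 h₂.2
  | succ m ih =>
    obtain ⟨⟨h1, h2⟩, g, hg⟩ := h₁
    obtain ⟨⟨h1', h2'⟩, g', hg'⟩ := h₂
    refine ⟨⟨h1.add h1', (eLpNorm_add_le h1 h1' hp').trans ?_⟩, g + g',
      fun i => ⟨(hg i).1.add (hg' i).1, ih (hg i).2 (hg' i).2⟩⟩
    push_cast
    exact add_le_add h2 h2'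

lemma sobolevBound_zero : SobolevBound p m (0 : Euc d → F) 0 := by
  induction m with
  | zero => exact ⟨aestronglyMeasurable_zero, by simp⟩
  | succ m ih => exact ⟨⟨aestronglyMeasurable_zero, by simp⟩, 0,
      fun i => ⟨HasWeakPartial.const i 0, ih⟩⟩

lemma SobolevBound.sum [hp : Fact (1 < p)] {ι : Type*} (s : Finset ι) {f : ι → Euc d → F}
    {c : ι → ℝ≥0} (h : ∀ j ∈ s, SobolevBound p m (f j) (c j)) :
    SobolevBound p m (∑ j ∈ s, f j) (∑ j ∈ s, c j) := by
  classical
  induction s using Finset.induction_on with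
  | empty => exact sobolevBound_zero
  | insert a s ha ih =>
    rw [Finset.sum_insert ha, Finset.sum_insert ha]
    exact (h a (Finset.mem_insert_self a s)).add
      (ih fun j hj => h j (Finset.mem_insert_of_mem hj))

lemma MultiplierBound.mono (h : MultiplierBound p m f c₁) (hc : c₁ ≤ c₂) :
    MultiplierBound p m f c₂ := by
  refine ⟨⟨h.1.1, h.1.2.mono fun x hx => hx.trans hc⟩, fun k hk => ?_⟩
  obtain ⟨g, hg⟩ := h.2 k hk
  exact ⟨g, fun i => ⟨(hg i).1, (hg i).2.mono hc⟩⟩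

lemma MultiplierBound.pred (h : MultiplierBound p (m + 1) f c) : MultiplierBound p m f c := by
  refine ⟨h.1, fun k hk => ?_⟩
  obtain ⟨g, hg⟩ := h.2 m rfl
  subst hk
  exact ⟨g, fun i => ⟨(hg i).1, (hg i).2.pred⟩⟩

lemma MultiplierBound.add [hp : Fact (1 < p)] (h₁ : MultiplierBound p m f₁ c₁)
    (h₂ : MultiplierBound p m f₂ c₂) : MultiplierBound p m (f₁ + f₂) (c₁ + c₂) := by
  refine ⟨⟨h₁.1.1.add h₂.1.1, ?_⟩, fun k hk => ?_⟩
  · filter_upwards [h₁.1.2, h₂.1.2] with x k1 k2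
    exact (nnnorm_add_le _ _).trans (add_le_add k1 k2)
  · obtain ⟨g, hg⟩ := h₁.2 k hk
    obtain ⟨g', hg'⟩ := h₂.2 k hk
    exact ⟨g + g', fun i => ⟨(hg i).1.add (hg' i).1, (hg i).2.add (hg' i).2⟩⟩

lemma MultiplierBound.const (v : F) : MultiplierBound p m (fun _ : Euc d => v) ‖v‖₊ :=
  ⟨⟨aestronglyMeasurable_const, Eventually.of_forall fun _ => le_rfl⟩,
    fun _ _ => ⟨0, fun i => ⟨HasWeakPartial.const i v, sobolevBound_zero.mono zero_le⟩⟩⟩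

lemma SobolevBound.multiplierBound (h : SobolevBound p m f c₁) (hf : ∀ᵐ x, ‖f x‖₊ ≤ c₂)
    (h1 : c₁ ≤ c) (h2 : c₂ ≤ c) : MultiplierBound p m f c := by
  refine ⟨⟨h.base.1, hf.mono fun x hx => hx.trans h2⟩, fun k hk => ?_⟩
  subst hk
  obtain ⟨_, g, hg⟩ := h
  exact ⟨g, fun i => ⟨(hg i).1, (hg i).2.mono h1⟩⟩

/-- The set where the inequality holds is closed, and it is dense because its complement is a null
set. -/
lemma forall_le_of_ae_le {a b : Euc d → ℝ} (ha : Continuous a) (hb : Continuous b)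
    (h : ∀ᵐ x, a x ≤ b x) (x : Euc d) : a x ≤ b x := by
  have hd : Dense {x | a x ≤ b x} := Measure.dense_of_ae h
  have hc : IsClosed {x | a x ≤ b x} := isClosed_le ha hb
  have : x ∈ closure {x | a x ≤ b x} := hd x
  rwa [hc.closure_eq] at this

/-- Almost everywhere bounds between continuous functions hold everywhere, so continuous
approximants with essential error 1/(n+1) are uniformly Cauchy. Their uniform limit is continuous
and agrees with f almost everywhere. -/
lemma exists_continuous_ae_eq [CompleteSpace F] (h : ∀ ε : ℝ, 0 < ε →
    ∃ g : Euc d → F, Continuous g ∧ ∀ᵐ x, ‖f x - g x‖ ≤ ε) :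
    ∃ g : Euc d → F, Continuous g ∧ f =ᵐ[volume] g := by
  choose g hg hfg using fun n : ℕ => h (1 / ((n : ℝ) + 1)) (by positivity)
  have h1 : ∀ n k x, ‖g n x - g k x‖ ≤ 1 / ((n : ℝ) + 1) + 1 / ((k : ℝ) + 1) := by
    intro n k
    refine forall_le_of_ae_le ((hg n).sub (hg k)).norm continuous_const ?_
    filter_upwards [hfg n, hfg k] with x hn hk
    rw [← sub_add_sub_cancel (g n x) (f x) (g k x)]
    refine (norm_add_le _ _).trans (add_le_add ?_ hk)
    rwa [norm_sub_rev]
  have hu : UniformCauchySeqOn g atTop univ := by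
    rw [Metric.uniformCauchySeqOn_iff]
    intro ε hε
    obtain ⟨N, hN⟩ := (tendsto_mollRadius.eventually (gt_mem_nhds (half_pos hε))).exists_forall_of_atTop
    refine ⟨N, fun n hn k hk x _ => ?_⟩
    rw [dist_eq_norm]
    exact (h1 n k x).trans_lt (by linarith [hN n hn, hN k hk])
  have hl : ∀ x, ∃ y, Tendsto (fun n => g n x) atTop (𝓝 y) := fun x =>
    cauchySeq_tendsto_of_complete (hu.cauchySeq (mem_univ x))
  choose G hG using hl
  have ht := hu.tendstoUniformlyOn_of_tendsto fun x _ => hG x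
  refine ⟨G, ?_, ?_⟩
  · rw [← continuousOn_univ]
    exact ht.continuousOn (Frequently.of_forall fun n => (hg n).continuousOn)
  · filter_upwards [ae_all_iff.2 hfg] with x hx
    refine tendsto_nhds_unique ?_ (hG x)
    rw [tendsto_iff_norm_sub_tendsto_zero]
    refine squeeze_zero (fun _ => norm_nonneg _) (fun n => ?_) tendsto_mollRadius
    rw [norm_sub_rev]; exact hx n

/-- Morrey's inequality. -/
lemma exists_morrey_const (d : ℕ) {p : ℝ} [hp1 : Fact (1 < p)] (hp : (d : ℝ) < p) :
    ∃ C : ℝ≥0, 1 ≤ C ∧ ∀ {F : Type*} [NormedAddCommGroup F] [NormedSpace ℝ F] [CompleteSpace F]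
      (m : ℕ) (f : Euc d → F) (c : ℝ≥0), SobolevBound p (m + 1) f c → ∀ᵐ x, ‖f x‖₊ ≤ C * c := by
  obtain ⟨C, hC⟩ := exists_enorm_le_sobolev d hp1.out hp
  -- The function and each of its d first derivatives contribute c, which gives 1 + d; the
  -- additional 1 only makes the constant at least one.
  refine ⟨C * (1 + d) + 1, le_add_self, fun {F} _ _ _ m f c h => ?_⟩
  have hp' : 1 ≤ ENNReal.ofReal p := by
    rw [← ENNReal.ofReal_one]; exact ENNReal.ofReal_le_ofReal hp1.out.le
  have hfl : LocallyIntegrable f := h.memLp.locallyIntegrable hp'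
  obtain ⟨h0, g, hg⟩ := h
  have hb : ∀ n x, ‖mollify n f x‖ₑ ≤ C * (1 + d) * c := by
    intro n x
    refine (hC _ ((contDiff_mollify n hfl).of_le (by exact_mod_cast le_top)) x).trans ?_
    rw [mul_assoc]
    gcongr
    rw [add_mul, one_mul]
    refine add_le_add ((eLpNorm_mollify_le hp' ENNReal.ofReal_ne_top n h0.1).trans h0.2) ?_
    calc _ ≤ ∑ i : Fin d, (c : ℝ≥0∞) := Finset.sum_le_sum fun i _ => by
          simp only [fderiv_mollify (hg i).1]
          exact (eLpNorm_mollify_le hp' ENNReal.ofReal_ne_top n (hg i).2.base.1).trans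
            (hg i).2.base.2
      _ = _ := by simp
  filter_upwards [ae_tendsto_mollify hfl] with x hx
  have h1 : ‖f x‖ₑ ≤ C * (1 + d) * c := le_of_tendsto hx.enorm (Eventually.of_forall fun n => hb n x)
  have h2 : ‖f x‖₊ ≤ C * (1 + d) * c := by exact_mod_cast h1
  refine h2.trans ?_
  gcongr
  exact le_self_add

/-- The mollifications converge to f in W^1_p. Morrey's inequality for the difference turns this
into essentially uniform convergence of smooth functions. -/
lemma SobolevBound.exists_continuous [hp1 : Fact (1 < p)] (hp : (d : ℝ) < p) [CompleteSpace F]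
    (h : SobolevBound p (m + 1) f c) : ∃ g : Euc d → F, Continuous g ∧ f =ᵐ[volume] g := by
  obtain ⟨C, hC1, hC⟩ := exists_morrey_const d hp
  have hp' : 1 ≤ ENNReal.ofReal p := by
    rw [← ENNReal.ofReal_one]; exact ENNReal.ofReal_le_ofReal hp1.out.le
  have hfm := h.memLp
  have hfl : LocallyIntegrable f := hfm.locallyIntegrable hp'
  obtain ⟨h0, g, hg⟩ := h
  refine exists_continuous_ae_eq fun ε hε => ?_
  lift ε to ℝ≥0 using hε.le
  set δ : ℝ≥0 := ε / C with hδ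
  have hC0 : 0 < C := zero_lt_one.trans_le hC1
  have hδ0 : (0 : ℝ≥0∞) < δ := by
    rw [ENNReal.coe_pos]; exact div_pos (by exact_mod_cast hε) hC0
  have ev1 := ENNReal.tendsto_nhds_zero.1
    (tendsto_eLpNorm_mollify_sub hp' ENNReal.ofReal_ne_top hfm) δ hδ0
  have ev2 := fun i => ENNReal.tendsto_nhds_zero.1
    (tendsto_eLpNorm_mollify_sub hp' ENNReal.ofReal_ne_top (hg i).2.memLp) δ hδ0
  obtain ⟨n, hn1, hn2⟩ := (ev1.and (eventually_all.2 ev2)).exists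
  refine ⟨mollify n f, (contDiff_mollify n hfl).continuous, ?_⟩
  have key : SobolevBound p 1 (mollify n f - f) δ := by
    refine ⟨⟨(aesm_mollify n hfl).sub h0.1, hn1⟩, fun i => mollify n (g i) - g i, fun i => ⟨?_,
      (aesm_mollify n (hg i).1.2.1).sub (hg i).2.base.1, hn2 i⟩⟩
    refine HasWeakPartial.sub ?_ (hg i).1
    have := HasWeakPartial.of_contDiff i
      ((contDiff_mollify n hfl).of_le (m := 1) (by exact_mod_cast le_top))
    simpa only [fderiv_mollify (hg i).1] using this
  filter_upwards [hC 0 _ _ key] with x hx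
  rw [hδ, mul_div_cancel₀ _ hC0.ne'] at hx
  rw [norm_sub_rev]
  exact hx

end SobolevBound

/-! ### Products of multipliers and Sobolev functions. -/

section Nemytskii

set_option linter.unusedSectionVars false

variable {d : ℕ} {F G H : Type*} [NormedAddCommGroup F] [NormedSpace ℝ F]
  [NormedAddCommGroup G] [NormedSpace ℝ G] [NormedAddCommGroup H] [NormedSpace ℝ H]

lemma exists_nnnorm_bilin_le (B : F →L[ℝ] G →L[ℝ] H) :
    ∃ b : ℝ≥0, ∀ x y, ‖B x y‖₊ ≤ b * ‖x‖₊ * ‖y‖₊ := by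
  obtain ⟨C, hC0, hC⟩ := B.isBoundedBilinearMap.bound
  exact ⟨⟨C, hC0.le⟩, fun x y => hC x y⟩

lemma eLpNorm_bilin_le_of_left {p : ℝ≥0∞} (B : F →L[ℝ] G →L[ℝ] H) {b : ℝ≥0}
    (hb : ∀ x y, ‖B x y‖₊ ≤ b * ‖x‖₊ * ‖y‖₊) {u : Euc d → F} {v : Euc d → G} {c c' : ℝ≥0}
    (hu : ∀ᵐ x, ‖u x‖₊ ≤ c) (hv : eLpNorm v p volume ≤ c') :
    eLpNorm (fun x => B (u x) (v x)) p volume ≤ (b * c * c' : ℝ≥0) := by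
  refine (eLpNorm_le_nnreal_smul_eLpNorm_of_ae_le_mul (c := b * c) (g := v) ?_ p).trans ?_
  · filter_upwards [hu] with x hx
    refine (hb _ _).trans ?_
    gcongr
  · rw [ENNReal.smul_def, smul_eq_mul]
    push_cast
    gcongr

lemma eLpNorm_bilin_le_of_right {p : ℝ≥0∞} (B : F →L[ℝ] G →L[ℝ] H) {b : ℝ≥0}
    (hb : ∀ x y, ‖B x y‖₊ ≤ b * ‖x‖₊ * ‖y‖₊) {u : Euc d → F} {v : Euc d → G} {c c' : ℝ≥0}
    (hu : eLpNorm u p volume ≤ c) (hv : ∀ᵐ x, ‖v x‖₊ ≤ c') :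
    eLpNorm (fun x => B (u x) (v x)) p volume ≤ (b * c * c' : ℝ≥0) := by
  have := eLpNorm_bilin_le_of_left B.flip (b := b) (fun x y => by
    rw [mul_right_comm]; exact hb y x) hv hu
  rw [mul_right_comm] at this
  exact this

variable [CompleteSpace F] [CompleteSpace G]

/-- Induction on m with ∂B(u, v) = B(∂u, v) + B(u, ∂v). If u is the multiplier, the second term is
again a multiplier of lower order times a Sobolev function. In the first term ∂u is only a Sobolev
function, and v must serve as the multiplier; it can, because v ∈ W^{m+1}_p is bounded by Morrey's
inequality. Both orders of the factors are carried through the induction for this reason. -/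
lemma exists_sobolevBound_bilin {p : ℝ} [hp1 : Fact (1 < p)] (hp : (d : ℝ) < p)
    (B : F →L[ℝ] G →L[ℝ] H) (m : ℕ) :
    ∃ C : ℝ≥0, ∀ (u : Euc d → F) (v : Euc d → G) (c c' : ℝ≥0),
      (MultiplierBound p m u c ∧ SobolevBound p m v c') ∨
        (SobolevBound p m u c ∧ MultiplierBound p m v c') →
      SobolevBound p m (fun x => B (u x) (v x)) (C * c * c') := by
  obtain ⟨b, hb⟩ := exists_nnnorm_bilin_le B
  -- Morrey's constant is taken twice, for values in G and for values in F, whose universes may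
  -- differ.
  obtain ⟨K, hK1, hK⟩ := exists_morrey_const.{_} d hp
  obtain ⟨K', hK1', hK'⟩ := exists_morrey_const.{_} d hp
  have base : ∀ (u : Euc d → F) (v : Euc d → G) (c c' : ℝ≥0),
      (MultiplierBound p m u c ∧ SobolevBound p m v c') ∨
        (SobolevBound p m u c ∧ MultiplierBound p m v c') →
      AEStronglyMeasurable (fun x => B (u x) (v x)) ∧
        eLpNorm (fun x => B (u x) (v x)) (ENNReal.ofReal p) volume ≤ (b * c * c' : ℝ≥0) := by
    rintro u v c c' (⟨h1, h2⟩ | ⟨h1, h2⟩)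
    · exact ⟨B.aestronglyMeasurable_comp₂ h1.1.1 h2.base.1,
        eLpNorm_bilin_le_of_left B hb h1.1.2 h2.base.2⟩
    · exact ⟨B.aestronglyMeasurable_comp₂ h1.base.1 h2.1.1,
        eLpNorm_bilin_le_of_right B hb h1.base.2 h2.1.2⟩
  induction m with
  | zero => exact ⟨b, fun u v c c' h => base u v c c' h⟩
  | succ m ih =>
    obtain ⟨C, hC⟩ := ih (by
      rintro u v c c' (⟨h1, h2⟩ | ⟨h1, h2⟩)
      · exact ⟨B.aestronglyMeasurable_comp₂ h1.1.1 h2.base.1,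
          eLpNorm_bilin_le_of_left B hb h1.1.2 h2.base.2⟩
      · exact ⟨B.aestronglyMeasurable_comp₂ h1.base.1 h2.1.1,
          eLpNorm_bilin_le_of_right B hb h1.base.2 h2.1.2⟩)
    refine ⟨b + C * (K + K'), fun u v c c' h => ⟨⟨(base u v c c' h).1, (base u v c c' h).2.trans ?_⟩,
      ?_⟩⟩
    · rw [ENNReal.coe_le_coe]
      gcongr
      exact le_self_add
    rcases h with ⟨h1, h2⟩ | ⟨h1, h2⟩
    · have hvb := hK _ _ _ h2
      have h2m : MultiplierBound p (m + 1) v (K * c') :=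
        h2.multiplierBound hvb (le_mul_of_one_le_left' hK1) le_rfl
      obtain ⟨g, hg⟩ := h1.2 m rfl
      obtain ⟨_, g', hg'⟩ := id h2
      refine ⟨fun i => (fun x => B (g i x) (v x)) + fun x => B (u x) (g' i x), fun i => ⟨
        (hg i).1.bilin B (hg' i).1 h1.1.2 hvb, ?_⟩⟩
      refine ((hC (g i) v c (K * c') (Or.inr ⟨(hg i).2, h2m.pred⟩)).add
        (hC u (g' i) c c' (Or.inl ⟨h1.pred, (hg' i).2⟩))).mono ?_
      -- Since 1 ≤ K', the second term may be enlarged so that both cases end with the same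
      -- constant.
      calc C * c * (K * c') + C * c * c' ≤ C * c * (K * c') + C * c * (K' * c') := by
            gcongr; exact le_mul_of_one_le_left' hK1'
        _ = C * (K + K') * c * c' := by ring
        _ ≤ _ := by gcongr; exact le_add_self
    · have hub := hK' _ _ _ h1
      have h1m : MultiplierBound p (m + 1) u (K' * c) :=
        h1.multiplierBound hub (le_mul_of_one_le_left' hK1') le_rfl
      obtain ⟨g', hg'⟩ := h2.2 m rfl
      obtain ⟨_, g, hg⟩ := id h1
      refine ⟨fun i => (fun x => B (g i x) (v x)) + fun x => B (u x) (g' i x), fun i => ⟨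
        (hg i).1.bilin B (hg' i).1 hub h2.1.2, ?_⟩⟩
      refine ((hC (g i) v c c' (Or.inr ⟨(hg i).2, h2.pred⟩)).add
        (hC u (g' i) (K' * c) c' (Or.inl ⟨h1m.pred, (hg' i).2⟩))).mono ?_
      calc C * c * c' + C * (K' * c) * c' ≤ C * (K * c) * c' + C * (K' * c) * c' := by
            gcongr; exact le_mul_of_one_le_left' hK1
        _ = C * (K + K') * c * c' := by ring
        _ ≤ _ := by gcongr; exact le_add_self

end Nemytskii

/-! ### Substitution in multiplier classes: boundedness, continuity, Taylor remainder. -/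

section Composition

set_option linter.unusedSectionVars false

variable {d : ℕ} {V : Type} [NormedAddCommGroup V] [NormedSpace ℝ V] [ProperSpace V]
  [CompleteSpace V]

/-- Evaluation of operators as a bilinear map. -/
def evalBilin (V G : Type*) [NormedAddCommGroup V] [NormedSpace ℝ V] [NormedAddCommGroup G]
    [NormedSpace ℝ G] : (V →L[ℝ] G) →L[ℝ] V →L[ℝ] G :=
  ContinuousLinearMap.id ℝ (V →L[ℝ] G)

lemma exists_bound_on_ball {W : Type*} [NormedAddCommGroup W] {φ : V → W} (hφ : Continuous φ)
    (c : ℝ≥0) : ∃ C : ℝ≥0, ∀ ξ, ‖ξ‖₊ ≤ c → ‖φ ξ‖₊ ≤ C := by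
  obtain ⟨C1, h1⟩ := (isCompact_closedBall (0 : V) c).exists_bound_of_continuousOn
    hφ.continuousOn
  exact ⟨C1.toNNReal, fun ξ hξ => NNReal.le_toNNReal_of_coe_le
    (h1 ξ (by rw [mem_closedBall_zero_iff]; exact hξ))⟩

lemma exists_modulus_on_ball {W : Type*} [NormedAddCommGroup W] {φ : V → W} (hφ : Continuous φ)
    (c : ℝ≥0) {ε : ℝ≥0} (hε : 0 < ε) :
    ∃ δ : ℝ≥0, 0 < δ ∧ ∀ ξ η, ‖ξ‖₊ ≤ c → ‖η‖₊ ≤ δ → ‖φ (ξ + η) - φ ξ‖₊ ≤ ε := by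
  have hu := (isCompact_closedBall (0 : V) (c + 1)).uniformContinuousOn_of_continuous
    hφ.continuousOn
  obtain ⟨δ, hδ, h⟩ := Metric.uniformContinuousOn_iff.1 hu ε (by exact_mod_cast hε)
  lift δ to ℝ≥0 using hδ.le
  have hδ' : 0 < δ := by exact_mod_cast hδ
  -- The bound 1 keeps ξ + η in the ball of radius c + 1, and halving δ makes the inequality strict.
  refine ⟨(δ / 2) ⊓ 1, lt_inf_iff.2 ⟨half_pos hδ', one_pos⟩, fun ξ η hξ hη => ?_⟩
  have h1 : ‖ξ‖ ≤ c := hξ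
  have h2 : ‖η‖ ≤ 1 := hη.trans inf_le_right
  have h3 : ‖η‖₊ < δ := (hη.trans inf_le_left).trans_lt (half_lt_self hδ')
  have := h (ξ + η) (by
    rw [mem_closedBall_zero_iff]
    exact (norm_add_le _ _).trans (add_le_add h1 h2)) ξ (by
    rw [mem_closedBall_zero_iff]; linarith) (by
    rw [dist_eq_norm, add_sub_cancel_left]; exact h3)
  rw [dist_eq_norm] at this
  exact this.le

variable {p : ℝ} [hp1 : Fact (1 < p)]

/-- By the chain rule ∂φ(u) = φ'(u) ∂u, where φ'(u) is a multiplier of order m by induction and ∂u ∈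
W^m_p. The induction runs over all target spaces, since φ' takes values in V →L[ℝ] G. -/
lemma exists_multiplierBound_comp (hp : (d : ℝ) < p) (m : ℕ) {G : Type*} [NormedAddCommGroup G]
    [NormedSpace ℝ G] [CompleteSpace G] {φ : V → G} (hφ : ContDiff ℝ m φ) {u : Euc d → V}
    {c : ℝ≥0} (hu : MultiplierBound p m u c) :
    ∃ C, MultiplierBound p m (fun x => φ (u x)) C := by
  induction m generalizing G with
  | zero =>
    obtain ⟨C, hC⟩ := exists_bound_on_ball hφ.continuous c
    exact ⟨C, ⟨hφ.continuous.comp_aestronglyMeasurable hu.1.1, hu.1.2.mono fun x hx => hC _ hx⟩,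
      fun k hk => absurd hk (by omega)⟩
  | succ m ih =>
    obtain ⟨C, hC⟩ := exists_bound_on_ball hφ.continuous c
    have hφ' : ContDiff ℝ m (fderiv ℝ φ) := hφ.fderiv_right (by norm_cast)
    have hφ1 : ContDiff ℝ 1 φ := hφ.of_le (by norm_cast; omega)
    obtain ⟨C', hC'⟩ := ih hφ' hu.pred
    obtain ⟨b, hb⟩ := exists_sobolevBound_bilin (d := d) hp (evalBilin V G) m
    refine ⟨C + b * C' * c, ⟨hφ.continuous.comp_aestronglyMeasurable hu.1.1,
      hu.1.2.mono fun x hx => (hC _ hx).trans le_self_add⟩, fun k hk => ?_⟩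
    obtain rfl : m = k := by omega
    obtain ⟨g, hg⟩ := hu.2 m rfl
    exact ⟨fun i x => fderiv ℝ φ (u x) (g i x), fun i => ⟨(hg i).1.comp hφ1 hu.1.2,
      (hb _ _ _ _ (Or.inl ⟨hC', (hg i).2⟩)).mono le_add_self⟩⟩

/-- The derivative of φ(u + h) - φ(u) is (φ'(u + h) - φ'(u)) ∂(u + h) + φ'(u) ∂h. The first factor
is small by induction applied to φ', and ∂h is small by assumption. -/
lemma exists_multiplierBound_comp_sub (hp : (d : ℝ) < p) (m : ℕ) {G : Type*}
    [NormedAddCommGroup G] [NormedSpace ℝ G] [CompleteSpace G] {φ : V → G}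
    (hφ : ContDiff ℝ m φ) {u : Euc d → V} {c : ℝ≥0} (hu : MultiplierBound p m u c) {ε : ℝ≥0}
    (hε : 0 < ε) : ∃ δ : ℝ≥0, 0 < δ ∧ ∀ h : Euc d → V, MultiplierBound p m h δ →
      MultiplierBound p m (fun x => φ (u x + h x) - φ (u x)) ε := by
  induction m generalizing G ε with
  | zero =>
    obtain ⟨δ, hδ, h⟩ := exists_modulus_on_ball hφ.continuous c hε
    refine ⟨δ, hδ, fun k hk => ⟨⟨?_, ?_⟩, fun k hk => absurd hk (by omega)⟩⟩
    · exact (hφ.continuous.comp_aestronglyMeasurable (hu.1.1.add hk.1.1)).sub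
        (hφ.continuous.comp_aestronglyMeasurable hu.1.1)
    · filter_upwards [hu.1.2, hk.1.2] with x h1 h2 using h _ _ h1 h2
  | succ m ih =>
    have hφ' : ContDiff ℝ m (fderiv ℝ φ) := hφ.fderiv_right (by norm_cast)
    have hφ1 : ContDiff ℝ 1 φ := hφ.of_le (by norm_cast; omega)
    obtain ⟨b, hb⟩ := exists_sobolevBound_bilin (d := d) hp (evalBilin V G) m
    obtain ⟨C', hC'⟩ := exists_multiplierBound_comp hp m hφ' hu.pred
    -- Each of the two terms receives ε/2. The derivative of u + h has bound c + 1, because h will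
    -- also be kept below 1.
    set ε1 : ℝ≥0 := ε / 2 / (b * (c + 1) + 1) with hε1
    have hε2 : 0 < ε / 2 := half_pos hε
    have hε1' : 0 < ε1 := div_pos hε2 (by positivity)
    obtain ⟨δ0, hδ0, h0⟩ := exists_modulus_on_ball hφ.continuous c hε
    obtain ⟨δ1, hδ1, h1⟩ := ih hφ' hu.pred hε1'
    set δ2 : ℝ≥0 := ε / 2 / (b * C' + 1) with hδ2
    have hδ2' : 0 < δ2 := div_pos hε2 (by positivity)
    refine ⟨δ0 ⊓ δ1 ⊓ δ2 ⊓ 1, by simp [hδ0, hδ1, hδ2'], fun h hh => ?_⟩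
    have hh0 : MultiplierBound p (m + 1) h δ0 :=
      hh.mono (inf_le_left.trans (inf_le_left.trans inf_le_left))
    have hh1 : MultiplierBound p (m + 1) h δ1 :=
      hh.mono (inf_le_left.trans (inf_le_left.trans inf_le_right))
    have hh2 : MultiplierBound p (m + 1) h (δ2 ⊓ 1) := hh.mono (by
      refine le_inf (inf_le_left.trans inf_le_right) inf_le_right)
    refine ⟨⟨?_, ?_⟩, fun k hk => ?_⟩
    · exact (hφ.continuous.comp_aestronglyMeasurable (hu.1.1.add hh.1.1)).sub
        (hφ.continuous.comp_aestronglyMeasurable hu.1.1)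
    · filter_upwards [hu.1.2, hh0.1.2] with x k1 k2 using h0 _ _ k1 k2
    obtain rfl : m = k := by omega
    obtain ⟨g, hg⟩ := hu.2 m rfl
    obtain ⟨g', hg'⟩ := hh2.2 m rfl
    refine ⟨fun i => (fun x => fderiv ℝ φ (u x + h x) ((g i + g' i) x)) -
      fun x => fderiv ℝ φ (u x) (g i x), fun i => ⟨?_, ?_⟩⟩
    · exact (((hg i).1.add (hg' i).1).comp hφ1 (hu.add hh).1.2).sub ((hg i).1.comp hφ1 hu.1.2)
    · have e : ((fun x => fderiv ℝ φ (u x + h x) ((g i + g' i) x)) -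
          fun x => fderiv ℝ φ (u x) (g i x)) =
          (fun x => evalBilin V G (fderiv ℝ φ (u x + h x) - fderiv ℝ φ (u x))
            ((g i + g' i) x)) + fun x => evalBilin V G (fderiv ℝ φ (u x)) (g' i x) := by
        ext x
        simp [evalBilin]
        abel
      dsimp only
      rw [e]
      refine ((hb _ _ _ _ (Or.inl ⟨h1 h hh1.pred, ((hg i).2.add (hg' i).2).mono
        (add_le_add le_rfl inf_le_right)⟩)).add (hb _ _ _ _ (Or.inl ⟨hC', (hg' i).2.mono
          inf_le_left⟩))).mono ?_
      calc b * ε1 * (c + 1) + b * C' * δ2 ≤ ε / 2 + ε / 2 := by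
            refine add_le_add ?_ ?_
            · rw [hε1, mul_right_comm, ← mul_div_assoc]
              refine div_le_of_le_mul₀ zero_le zero_le ?_
              rw [mul_comm]; gcongr; exact le_self_add
            · rw [hδ2, ← mul_div_assoc]
              refine div_le_of_le_mul₀ zero_le zero_le ?_
              rw [mul_comm]; gcongr; exact le_self_add
        _ = ε := add_halves ε

/-- The mean value inequality for φ - φ'(ξ) on a ball around ξ, where φ' differs from φ'(ξ) by at
most ε, uniformly for ‖ξ‖ ≤ c. -/
lemma exists_remainder_on_ball {W : Type*} [NormedAddCommGroup W] [NormedSpace ℝ W] {φ : V → W}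
    (hφ : ContDiff ℝ 1 φ) (c : ℝ≥0) {ε : ℝ≥0} (hε : 0 < ε) :
    ∃ δ : ℝ≥0, 0 < δ ∧ ∀ ξ η, ‖ξ‖₊ ≤ c → ‖η‖₊ ≤ δ →
      ‖φ (ξ + η) - φ ξ - fderiv ℝ φ ξ η‖₊ ≤ ε * ‖η‖₊ := by
  obtain ⟨δ, hδ, h⟩ := exists_modulus_on_ball (hφ.continuous_fderiv (by simp)) c hε
  refine ⟨δ, hδ, fun ξ η hξ hη => ?_⟩
  have := (convex_closedBall ξ (δ : ℝ)).norm_image_sub_le_of_norm_hasFDerivWithin_le'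
    (f := φ) (f' := fderiv ℝ φ) (φ := fderiv ℝ φ ξ) (C := ε) (x := ξ) (y := ξ + η)
    (fun x _ => (hφ.differentiable (by simp) x).hasFDerivAt.hasFDerivWithinAt)
    (fun x hx => by
      have h1 : ‖x - ξ‖₊ ≤ δ := by
        rw [Metric.mem_closedBall, dist_eq_norm] at hx; exact hx
      have := h ξ (x - ξ) hξ h1
      rw [add_sub_cancel] at this
      exact this)
    (Metric.mem_closedBall_self δ.2)
    (by rw [Metric.mem_closedBall, dist_eq_norm, add_sub_cancel_left]; exact hη)
  rw [add_sub_cancel_left] at this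
  exact this

/-- Differentiating the Taylor remainder and regrouping gives (φ'(u + h) - φ'(u) - φ''(u) h) ∂u +
(φ'(u + h) - φ'(u)) ∂h. The first bracket is the remainder for φ', covered by induction; the second
term is a small factor times one of size δ. The bound ε δ for every size δ ≤ δ₀ of h is the o(‖h‖)
required for Fréchet differentiability. -/
lemma exists_multiplierBound_remainder (hp : (d : ℝ) < p) (m : ℕ) {G : Type*}
    [NormedAddCommGroup G] [NormedSpace ℝ G] [CompleteSpace G] {φ : V → G}
    (hφ : ContDiff ℝ (m + 1) φ) {u : Euc d → V} {c : ℝ≥0} (hu : MultiplierBound p m u c)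
    {ε : ℝ≥0} (hε : 0 < ε) : ∃ δ₀ : ℝ≥0, 0 < δ₀ ∧ ∀ δ ≤ δ₀, ∀ h : Euc d → V,
      MultiplierBound p m h δ →
      MultiplierBound p m (fun x => φ (u x + h x) - φ (u x) - fderiv ℝ φ (u x) (h x))
        (ε * δ) := by
  have hφ1 : ContDiff ℝ 1 φ := hφ.of_le (by norm_cast; omega)
  have hφc : Continuous (fderiv ℝ φ) := hφ1.continuous_fderiv (by simp)
  have hmeas : ∀ h : Euc d → V, AEStronglyMeasurable h →
      AEStronglyMeasurable (fun x => φ (u x + h x) - φ (u x) - fderiv ℝ φ (u x) (h x)) :=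
    fun h hh => ((hφ.continuous.comp_aestronglyMeasurable (hu.1.1.add hh)).sub
      (hφ.continuous.comp_aestronglyMeasurable hu.1.1)).sub
      ((evalBilin V G).aestronglyMeasurable_comp₂
        (hφc.comp_aestronglyMeasurable hu.1.1) hh)
  induction m generalizing G ε with
  | zero =>
    obtain ⟨δ, hδ, h⟩ := exists_remainder_on_ball hφ1 c hε
    refine ⟨δ, hδ, fun δ' hδ' h' hh => ⟨⟨hmeas h' hh.1.1, ?_⟩,
      fun k hk => absurd hk (by omega)⟩⟩
    filter_upwards [hu.1.2, hh.1.2] with x h1 h2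
    exact (h _ _ h1 (h2.trans hδ')).trans (by gcongr)
  | succ m ih =>
    have hφ' : ContDiff ℝ (m + 1) (fderiv ℝ φ) := hφ.fderiv_right (by norm_cast)
    have hφ'm : ContDiff ℝ m (fderiv ℝ φ) := hφ'.of_le (by norm_cast; omega)
    have hφ'1 : ContDiff ℝ 1 (fderiv ℝ φ) := hφ'.of_le (by norm_cast; omega)
    obtain ⟨b, hb⟩ := exists_sobolevBound_bilin (d := d) hp (evalBilin V G) m
    -- The final sum is b ε1 (c + 1) δ: the part c comes from ∂u, the part 1 from ∂h.
    set ε1 : ℝ≥0 := ε / (b * (c + 1) + 1) with hε1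
    have hε1' : 0 < ε1 := div_pos hε (by positivity)
    obtain ⟨δ0, hδ0, h0⟩ := exists_remainder_on_ball hφ1 c hε
    obtain ⟨δ1, hδ1, h1⟩ := ih hφ' hu.pred hε1' hφ'1 (hφ'1.continuous_fderiv (by simp))
      (fun h hh => ((hφ'.continuous.comp_aestronglyMeasurable (hu.1.1.add hh)).sub
      (hφ'.continuous.comp_aestronglyMeasurable hu.1.1)).sub
      ((evalBilin V (V →L[ℝ] G)).aestronglyMeasurable_comp₂
        ((hφ'1.continuous_fderiv (by simp)).comp_aestronglyMeasurable hu.1.1) hh))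
    obtain ⟨δ2, hδ2, h2⟩ := exists_multiplierBound_comp_sub hp m hφ'm hu.pred hε1'
    refine ⟨δ0 ⊓ δ1 ⊓ δ2, by simp [hδ0, hδ1, hδ2], fun δ hδ h hh => ⟨⟨hmeas h hh.1.1, ?_⟩,
      fun k hk => ?_⟩⟩
    · filter_upwards [hu.1.2, hh.1.2] with x k1 k2
      exact (h0 _ _ k1 (k2.trans (hδ.trans (inf_le_left.trans inf_le_left)))).trans (by gcongr)
    obtain rfl : m = k := by omega
    obtain ⟨g, hg⟩ := hu.2 m rfl
    obtain ⟨g', hg'⟩ := hh.2 m rfl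
    obtain ⟨C1, hC1⟩ := exists_bound_on_ball hφc c
    have hw1 : ∀ i, HasWeakPartial i (fun x => fderiv ℝ φ (u x))
        (fun x => fderiv ℝ (fderiv ℝ φ) (u x) (g i x)) := fun i => (hg i).1.comp hφ'1 hu.1.2
    have hw2 : ∀ i, HasWeakPartial i (fun x => evalBilin V G (fderiv ℝ φ (u x)) (h x))
        ((fun x => evalBilin V G (fderiv ℝ (fderiv ℝ φ) (u x) (g i x)) (h x)) +
          fun x => evalBilin V G (fderiv ℝ φ (u x)) (g' i x)) := fun i =>
      (hw1 i).bilin (evalBilin V G) (hg' i).1 (hu.1.2.mono fun x hx => hC1 _ hx) hh.1.2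
    refine ⟨fun i => (fun x => fderiv ℝ φ (u x + h x) ((g i + g' i) x)) -
      (fun x => fderiv ℝ φ (u x) (g i x)) -
      ((fun x => evalBilin V G (fderiv ℝ (fderiv ℝ φ) (u x) (g i x)) (h x)) +
          fun x => evalBilin V G (fderiv ℝ φ (u x)) (g' i x)), fun i => ⟨?_, ?_⟩⟩
    · exact ((((hg i).1.add (hg' i).1).comp hφ1 (hu.add hh).1.2).sub
        ((hg i).1.comp hφ1 hu.1.2)).sub (hw2 i)
    · have e : (fun x => fderiv ℝ φ (u x + h x) ((g i + g' i) x)) -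
          (fun x => fderiv ℝ φ (u x) (g i x)) -
          ((fun x => evalBilin V G (fderiv ℝ (fderiv ℝ φ) (u x) (g i x)) (h x)) +
          fun x => evalBilin V G (fderiv ℝ φ (u x)) (g' i x)) =
          (fun x => evalBilin V G (fderiv ℝ φ (u x + h x) - fderiv ℝ φ (u x) -
            fderiv ℝ (fderiv ℝ φ) (u x) (h x)) (g i x)) +
          fun x => evalBilin V G (fderiv ℝ φ (u x + h x) - fderiv ℝ φ (u x)) (g' i x) := by
        ext x
        -- The chain rule produces φ''(u)(∂u, h), the remainder for φ' contains φ''(u)(h, ∂u); they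
        -- agree by symmetry of the second derivative.
        have hs : IsSymmSndFDerivAt ℝ φ (u x) :=
          (hφ.contDiffAt (x := u x)).isSymmSndFDerivAt (by
            simp only [minSmoothness_of_isRCLikeNormedField]; norm_cast; omega)
        have := hs.eq (g i x) (h x)
        simp [evalBilin, this]
        abel
      dsimp only
      rw [e]
      refine ((hb _ _ _ _ (Or.inl ⟨h1 δ (hδ.trans (inf_le_left.trans inf_le_right)) h hh.pred,
        (hg i).2⟩)).add (hb _ _ _ _ (Or.inl ⟨h2 h (hh.mono (hδ.trans inf_le_right)).pred,
          (hg' i).2⟩))).mono ?_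
      calc b * (ε1 * δ) * c + b * ε1 * δ = (b * (c + 1) * ε1) * δ := by ring
        _ ≤ ε * δ := by
            gcongr
            rw [hε1, ← mul_div_assoc]
            refine div_le_of_le_mul₀ zero_le zero_le ?_
            rw [mul_comm]; gcongr; exact le_self_add

end Composition

/-! ### Smooth functions with bounded derivatives. -/

section BoundedSmooth

variable {V W : Type*} [NormedAddCommGroup V] [NormedSpace ℝ V]
  [NormedAddCommGroup W] [NormedSpace ℝ W]

/-- Smooth functions all of whose derivatives are bounded. -/
def BoundedSmooth (ζ : V → ℝ) : Prop :=
  ContDiff ℝ ∞ ζ ∧ ∀ j : ℕ, ∃ C : ℝ, ∀ x, ‖iteratedFDeriv ℝ j ζ x‖ ≤ C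

lemma BoundedSmooth.exists_nnnorm_le {ζ : V → ℝ} (h : BoundedSmooth ζ) :
    ∃ C : ℝ≥0, ∀ x, ‖ζ x‖₊ ≤ C := by
  obtain ⟨C, hC⟩ := h.2 0
  refine ⟨C.toNNReal, fun x => NNReal.le_toNNReal_of_coe_le ?_⟩
  have := hC x
  rwa [norm_iteratedFDeriv_zero] at this

lemma BoundedSmooth.mul {ζ ξ : V → ℝ} (h : BoundedSmooth ζ) (h' : BoundedSmooth ξ) :
    BoundedSmooth fun x => ζ x * ξ x := by
  refine ⟨h.1.mul h'.1, fun j => ?_⟩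
  choose C hC using h.2
  choose C' hC' using h'.2
  refine ⟨∑ i ∈ Finset.range (j + 1), (j.choose i : ℝ) * C i * C' (j - i), fun x => ?_⟩
  refine (norm_iteratedFDeriv_mul_le h.1 h'.1 x (n := j) (by exact_mod_cast le_top)).trans ?_
  refine Finset.sum_le_sum fun i _ => ?_
  have := (norm_nonneg _).trans (hC i x)
  exact mul_le_mul (mul_le_mul_of_nonneg_left (hC i x) (by positivity)) (hC' _ x)
    (norm_nonneg _) (by positivity)

lemma BoundedSmooth.add {ζ ξ : V → ℝ} (h : BoundedSmooth ζ) (h' : BoundedSmooth ξ) :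
    BoundedSmooth fun x => ζ x + ξ x := by
  refine ⟨h.1.add h'.1, fun j => ?_⟩
  obtain ⟨C, hC⟩ := h.2 j
  obtain ⟨C', hC'⟩ := h'.2 j
  refine ⟨C + C', fun x => ?_⟩
  rw [show (fun x => ζ x + ξ x) = ζ + ξ from rfl, iteratedFDeriv_add_apply
    (h.1.contDiffAt.of_le (by exact_mod_cast le_top))
    (h'.1.contDiffAt.of_le (by exact_mod_cast le_top))]
  exact (norm_add_le _ _).trans (add_le_add (hC x) (hC' x))

lemma BoundedSmooth.fderiv_apply {ζ : V → ℝ} (h : BoundedSmooth ζ) (v : V) :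
    BoundedSmooth fun x => fderiv ℝ ζ x v := by
  have h1 : ContDiff ℝ ∞ (fderiv ℝ ζ) := h.1.fderiv_right (by simp)
  refine ⟨h1.clm_apply contDiff_const, fun j => ?_⟩
  obtain ⟨C, hC⟩ := h.2 (j + 1)
  refine ⟨‖v‖ * C, fun x => ?_⟩
  refine (norm_iteratedFDeriv_clm_apply_const h1.contDiffAt (n := j)
    (by exact_mod_cast le_top)).trans ?_
  rw [norm_iteratedFDeriv_fderiv]
  gcongr
  exact hC x

lemma BoundedSmooth.const (c : ℝ) : BoundedSmooth fun _ : V => c := by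
  refine ⟨contDiff_const, fun j => ⟨|c|, fun x => ?_⟩⟩
  rcases Nat.eq_zero_or_pos j with rfl | hj
  · simp
  · rw [iteratedFDeriv_const_of_ne hj.ne']
    simp

lemma BoundedSmooth.of_hasCompactSupport {ζ : V → ℝ} (h : ContDiff ℝ ∞ ζ)
    (hc : HasCompactSupport ζ) : BoundedSmooth ζ :=
  ⟨h, fun j => (h.continuous_iteratedFDeriv (m := j)
    (by exact_mod_cast le_top)).bounded_above_of_compact_support (hc.iteratedFDeriv j)⟩

lemma BoundedSmooth.comp_clm {ζ : W → ℝ} (h : BoundedSmooth ζ) (T : V →L[ℝ] W) :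
    BoundedSmooth fun x => ζ (T x) := by
  refine ⟨h.1.comp T.contDiff, fun j => ?_⟩
  obtain ⟨C, hC⟩ := h.2 j
  refine ⟨C * ∏ _i : Fin j, ‖T‖, fun x => ?_⟩
  rw [show (fun x => ζ (T x)) = ζ ∘ T from rfl,
    T.iteratedFDeriv_comp_right h.1 x (i := j) (by exact_mod_cast le_top)]
  refine (ContinuousMultilinearMap.norm_compContinuousLinearMap_le _ _).trans ?_
  gcongr
  exact hC _

end BoundedSmooth

/-! ### Changes of coordinates in Sobolev spaces. -/

section Transition

set_option linter.unusedSectionVars false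

variable {d : ℕ} {F : Type*} [NormedAddCommGroup F] [NormedSpace ℝ F]

/-- `κ` is a diffeomorphism of `V` whose derivatives are bounded on the closed set `S ⊆ V`, the
Jacobian matrix being given there by `J`, with determinant bounded away from zero. -/
structure IsTransition (κ : Euc d → Euc d) (V S : Set (Euc d))
    (J : Fin d → Fin d → Euc d → ℝ) (c₀ : ℝ≥0) : Prop where
  isOpen : IsOpen V
  isClosed : IsClosed S
  subset : S ⊆ V
  contDiffOn : ContDiffOn ℝ ∞ κ V
  injOn : InjOn κ V
  jacobian_bdd : ∀ i l, BoundedSmooth (J i l)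
  jacobian_eq : ∀ z ∈ S, ∀ i l, (fderiv ℝ κ z (stdVec i)) l = J i l z
  pos : 0 < c₀
  det_le : ∀ z ∈ S, (c₀ : ℝ) ≤ |(fderiv ℝ κ z).det|

namespace IsTransition

variable {κ : Euc d → Euc d} {V S : Set (Euc d)} {J : Fin d → Fin d → Euc d → ℝ} {c₀ : ℝ≥0}

lemma hasFDerivAt (h : IsTransition κ V S J c₀) {z : Euc d} (hz : z ∈ V) :
    HasFDerivAt κ (fderiv ℝ κ z) z :=
  ((h.contDiffOn.contDiffAt (h.isOpen.mem_nhds hz)).differentiableAt (by simp)).hasFDerivAt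

/-- The change of variables formula, with the Jacobian determinant replaced by its lower bound c₀ on
S. -/
lemma lintegral_comp_le (h : IsTransition κ V S J c₀) {T : Set (Euc d)} (hT : MeasurableSet T)
    (hTS : T ⊆ S) (g : Euc d → ℝ≥0∞) :
    c₀ * ∫⁻ z in T, g (κ z) ≤ ∫⁻ y in κ '' T, g y := by
  rw [lintegral_image_eq_lintegral_abs_det_fderiv_mul volume hT
    (fun z hz => (h.hasFDerivAt (h.subset (hTS hz))).hasFDerivWithinAt)
    (h.injOn.mono (hTS.trans h.subset)), ← lintegral_const_mul' _ _ ENNReal.coe_ne_top]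
  refine setLIntegral_mono' hT fun z hz => ?_
  gcongr
  rw [← ENNReal.ofReal_coe_nnreal]
  exact ENNReal.ofReal_le_ofReal (h.det_le z (hTS hz))

/-- The preimage of a null set is null: the exceptional set is enclosed in a measurable null set,
and the change of variables for the constant function 1 gives c₀ |T| ≤ |κ(T)| = 0. -/
lemma ae_comp (h : IsTransition κ V S J c₀) {P : Euc d → Prop} (hP : ∀ᵐ y, P y) :
    ∀ᵐ z ∂volume.restrict S, P (κ z) := by
  classical
  set N := toMeasurable volume {y | ¬ P y} with hN
  have hN0 : volume N = 0 := by rw [measure_toMeasurable]; exact hP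
  have hNm : MeasurableSet N := measurableSet_toMeasurable _ _
  have hκ : Measurable (S.piecewise κ 0) :=
    (h.contDiffOn.continuousOn.mono h.subset).measurable_piecewise continuousOn_const
      h.isClosed.measurableSet
  set T := S ∩ S.piecewise κ 0 ⁻¹' N with hT
  have hTm : MeasurableSet T := h.isClosed.measurableSet.inter (hκ hNm)
  have hTS : T ⊆ S := inter_subset_left
  have h1 := h.lintegral_comp_le hTm hTS (fun _ => 1)
  have h2 : κ '' T ⊆ N := by
    rintro _ ⟨z, ⟨hz, hz'⟩, rfl⟩
    rwa [mem_preimage, piecewise_eq_of_mem _ _ _ hz] at hz'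
  rw [setLIntegral_one, setLIntegral_one, measure_mono_null h2 hN0, nonpos_iff_eq_zero,
    mul_eq_zero] at h1
  have hT0 : volume T = 0 := h1.resolve_left (by simpa using h.pos.ne')
  rw [ae_restrict_iff' h.isClosed.measurableSet]
  filter_upwards [compl_mem_ae_iff.2 hT0] with z hz hzS
  by_contra hp
  refine hz ⟨hzS, ?_⟩
  rw [mem_preimage, piecewise_eq_of_mem _ _ _ hzS]
  exact subset_toMeasurable _ _ hp

lemma aestronglyMeasurable_comp (h : IsTransition κ V S J c₀) {f : Euc d → F}
    (hf : AEStronglyMeasurable f) :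
    AEStronglyMeasurable (fun z => f (κ z)) (volume.restrict S) := by
  have h1 : AEMeasurable κ (volume.restrict S) :=
    (h.contDiffOn.continuousOn.mono h.subset).aemeasurable h.isClosed.measurableSet
  refine (hf.stronglyMeasurable_mk.aestronglyMeasurable.comp_aemeasurable h1).congr ?_
  filter_upwards [h.ae_comp hf.ae_eq_mk] with z hz
  exact hz.symm

lemma aestronglyMeasurable_smul_comp (h : IsTransition κ V S J c₀) {f : Euc d → F}
    (hf : AEStronglyMeasurable f) {ζ : Euc d → ℝ} (hζ : Continuous ζ)
    (hS : Function.support ζ ⊆ S) : AEStronglyMeasurable (fun z => ζ z • f (κ z)) := by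
  have h1 : AEStronglyMeasurable (fun z => ζ z • f (κ z)) (volume.restrict S) :=
    hζ.aestronglyMeasurable.smul (h.aestronglyMeasurable_comp hf)
  rw [← aestronglyMeasurable_indicator_iff h.isClosed.measurableSet] at h1
  refine h1.congr (Eventually.of_forall fun z => ?_)
  by_cases hz : z ∈ S
  · rw [indicator_of_mem hz]
  · have : ζ z = 0 := by_contra fun hne => hz (hS hne)
    simp [indicator_of_notMem hz, this]

lemma eLpNorm_smul_comp_le (h : IsTransition κ V S J c₀) {p : ℝ} (hp : 1 < p) {f : Euc d → F}
    {c : ℝ≥0} (hf : eLpNorm f (ENNReal.ofReal p) volume ≤ c) {ζ : Euc d → ℝ} {Z : ℝ≥0}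
    (hZ : ∀ x, ‖ζ x‖₊ ≤ Z) (hS : Function.support ζ ⊆ S) :
    eLpNorm (fun z => ζ z • f (κ z)) (ENNReal.ofReal p) volume ≤
      (Z * c₀⁻¹ ^ (1 / p) * c : ℝ≥0) := by
  have hp0 : 0 < p := by linarith
  have hpz : ENNReal.ofReal p ≠ 0 := by simpa using hp0
  have hS' : (fun z => ζ z • f (κ z)) = S.indicator fun z => ζ z • f (κ z) := by
    ext z
    by_cases hz : z ∈ S
    · rw [indicator_of_mem hz]
    · have : ζ z = 0 := by_contra fun hne => hz (hS hne)
      simp [indicator_of_notMem hz, this]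
  have hc0 : (c₀ : ℝ≥0∞) ≠ 0 := by simpa using h.pos.ne'
  have h1 := h.lintegral_comp_le h.isClosed.measurableSet subset_rfl (fun y => ‖f y‖ₑ ^ p)
  have h2 : ∫⁻ z in S, ‖f (κ z)‖ₑ ^ p ≤ (c₀ : ℝ≥0∞)⁻¹ * ∫⁻ y, ‖f y‖ₑ ^ p := by
    rw [← ENNReal.mul_le_iff_le_inv hc0 ENNReal.coe_ne_top]
    exact h1.trans (setLIntegral_le_lintegral _ _)
  rw [hS', eLpNorm_indicator_eq_eLpNorm_restrict h.isClosed.measurableSet]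
  rw [eLpNorm_eq_lintegral_rpow_enorm_toReal hpz ENNReal.ofReal_ne_top,
    ENNReal.toReal_ofReal hp0.le] at hf
  refine (eLpNorm_le_nnreal_smul_eLpNorm_of_ae_le_mul (c := Z) (g := fun z => f (κ z))
    (Eventually.of_forall fun z => ?_) _).trans ?_
  · rw [nnnorm_smul]
    gcongr
    exact hZ z
  rw [ENNReal.smul_def, smul_eq_mul,
    eLpNorm_eq_lintegral_rpow_enorm_toReal hpz ENNReal.ofReal_ne_top,
    ENNReal.toReal_ofReal hp0.le]
  push_cast
  rw [mul_assoc]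
  gcongr
  refine (ENNReal.rpow_le_rpow h2 (by positivity)).trans ?_
  rw [ENNReal.mul_rpow_of_nonneg _ _ (by positivity), ENNReal.coe_rpow_of_nonneg _ (by positivity),
    ENNReal.coe_inv h.pos.ne']
  gcongr

/-- A compact K matters only through K ∩ S, whose image under κ is compact, so convergence there can
be pulled back. -/
lemma tendstoL1Loc_smul_comp (h : IsTransition κ V S J c₀) {f : ℕ → Euc d → F} {g : Euc d → F}
    (hf : TendstoL1Loc f g) {ζ : Euc d → ℝ} {Z : ℝ≥0} (hZ : ∀ x, ‖ζ x‖₊ ≤ Z)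
    (hS : Function.support ζ ⊆ S) :
    TendstoL1Loc (fun n z => ζ z • f n (κ z)) (fun z => ζ z • g (κ z)) := by
  intro K hK
  have hKS : IsCompact (K ∩ S) := hK.inter_right h.isClosed
  have hc0 : (c₀ : ℝ≥0∞) ≠ 0 := by simpa using h.pos.ne'
  have h1 := ENNReal.Tendsto.const_mul (a := Z * (c₀ : ℝ≥0∞)⁻¹) (hf (κ '' (K ∩ S))
    (hKS.image_of_continuousOn (h.contDiffOn.continuousOn.mono (inter_subset_right.trans h.subset))))
    (Or.inr (ENNReal.mul_ne_top ENNReal.coe_ne_top (ENNReal.inv_ne_top.2 hc0)))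
  rw [mul_zero] at h1
  refine tendsto_of_tendsto_of_tendsto_of_le_of_le tendsto_const_nhds h1 (fun _ => bot_le)
    fun n => ?_
  have h2 := h.lintegral_comp_le hKS.measurableSet inter_subset_right
    (fun y => ‖f n y - g y‖ₑ)
  dsimp only
  calc ∫⁻ z in K, ‖ζ z • f n (κ z) - ζ z • g (κ z)‖ₑ
      ≤ ∫⁻ z in K, S.indicator (fun z => Z * ‖f n (κ z) - g (κ z)‖ₑ) z := by
        refine lintegral_mono fun z => ?_
        by_cases hz : z ∈ S
        · rw [indicator_of_mem hz, ← smul_sub, enorm_smul]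
          gcongr
          exact ENNReal.coe_le_coe.2 (hZ z)
        · have : ζ z = 0 := by_contra fun hne => hz (hS hne)
          simp [this]
    _ = Z * ∫⁻ z in K ∩ S, ‖f n (κ z) - g (κ z)‖ₑ := by
        rw [lintegral_indicator h.isClosed.measurableSet,
          Measure.restrict_restrict h.isClosed.measurableSet, inter_comm,
          lintegral_const_mul' _ _ ENNReal.coe_ne_top]
    _ ≤ _ := by
        rw [mul_assoc]
        gcongr
        rwa [← ENNReal.mul_le_iff_le_inv hc0 ENNReal.coe_ne_top]

/-- The closure of the support of ζ lies in the closed set S ⊆ V, so the product vanishes near every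
point outside V. -/
lemma contDiff_smul_comp (h : IsTransition κ V S J c₀) {f : Euc d → F} (hf : ContDiff ℝ ∞ f)
    {ζ : Euc d → ℝ} (hζ : ContDiff ℝ ∞ ζ) (hS : Function.support ζ ⊆ S) :
    ContDiff ℝ ∞ fun z => ζ z • f (κ z) := by
  have ht : tsupport ζ ⊆ S := closure_minimal hS h.isClosed
  rw [contDiff_iff_contDiffAt]
  intro z
  by_cases hz : z ∈ V
  · exact hζ.contDiffAt.smul
      (hf.contDiffAt.comp z (h.contDiffOn.contDiffAt (h.isOpen.mem_nhds hz)))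
  · have : ∀ᶠ y in 𝓝 z, ζ y • f (κ y) = 0 := by
      filter_upwards [(isClosed_tsupport ζ).isOpen_compl.mem_nhds
        (fun hz' => hz (h.subset (ht hz')))] with y hy
      rw [image_eq_zero_of_notMem_tsupport hy, zero_smul]
    exact contDiffAt_const.congr_of_eventuallyEq this

lemma fderiv_smul_comp (h : IsTransition κ V S J c₀) {f : Euc d → F} (hf : ContDiff ℝ ∞ f)
    {ζ : Euc d → ℝ} (hζ : ContDiff ℝ ∞ ζ) (hS : Function.support ζ ⊆ S) (i : Fin d) (z : Euc d) :
    fderiv ℝ (fun z => ζ z • f (κ z)) z (stdVec i) = fderiv ℝ ζ z (stdVec i) • f (κ z) +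
      ∑ l, (ζ z * J i l z) • fderiv ℝ f (κ z) (stdVec l) := by
  have ht : tsupport ζ ⊆ S := closure_minimal hS h.isClosed
  by_cases hz : z ∈ V
  · have h1 := h.hasFDerivAt hz
    have h2 := (hf.differentiable (by simp) (κ z)).hasFDerivAt.comp z h1
    have h3 := (hζ.differentiable (by simp) z).hasFDerivAt.smul h2
    rw [show (fun z => ζ z • f (κ z)) = ζ • f ∘ κ from rfl, h3.fderiv]
    simp only [add_apply, smul_apply,
      ContinuousLinearMap.comp_apply, ContinuousLinearMap.smulRight_apply, Function.comp_apply]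
    rw [add_comm]
    congr 1
    -- `J` is the Jacobian matrix only on S; elsewhere ζ vanishes.
    by_cases hzS : z ∈ S
    · have e : fderiv ℝ κ z (stdVec i) = ∑ l, J i l z • stdVec l := by
        ext l
        rw [h.jacobian_eq z hzS i l]
        simp [Finset.sum_apply, Pi.single_apply]
      rw [e, map_sum, Finset.smul_sum]
      refine Finset.sum_congr rfl fun l _ => ?_
      rw [map_smul, smul_smul]
    · have : ζ z = 0 := by_contra fun hne => hzS (hS hne)
      simp [this]
  · have hz' : z ∉ tsupport ζ := fun hz' => hz (h.subset (ht hz'))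
    have h0 : ζ =ᶠ[𝓝 z] 0 := notMem_tsupport_iff_eventuallyEq.1 hz'
    have h1 : (fun z => ζ z • f (κ z)) =ᶠ[𝓝 z] fun _ => 0 := by
      filter_upwards [h0] with y hy
      rw [hy, Pi.zero_apply, zero_smul]
    rw [h1.fderiv_eq, h0.fderiv_eq, h0.eq_of_nhds]
    simp

variable [CompleteSpace F]

/-- The formula holds for the mollifications of f, and both sides converge in L_1 on compact sets.
-/
lemma hasWeakPartial_smul_comp (h : IsTransition κ V S J c₀) {p : ℝ} (hp : 1 < p)
    {f : Euc d → F} {g : Fin d → Euc d → F} (hfg : ∀ l, HasWeakPartial l f (g l))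
    (hf : MemLp f (ENNReal.ofReal p) volume) (hg : ∀ l, MemLp (g l) (ENNReal.ofReal p) volume)
    {ζ : Euc d → ℝ} (hζ : BoundedSmooth ζ) (hS : Function.support ζ ⊆ S) (i : Fin d) :
    HasWeakPartial i (fun z => ζ z • f (κ z))
      ((fun z => fderiv ℝ ζ z (stdVec i) • f (κ z)) +
        ∑ l, fun z => (ζ z * J i l z) • g l (κ z)) := by
  have ht : tsupport ζ ⊆ S := closure_minimal hS h.isClosed
  have hp' : 1 ≤ ENNReal.ofReal p := by
    rw [← ENNReal.ofReal_one]; exact ENNReal.ofReal_le_ofReal hp.le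
  have hS1 : Function.support (fun z => fderiv ℝ ζ z (stdVec i)) ⊆ S := fun z hz => by
    refine ht (support_fderiv_subset ℝ (f := ζ) fun h0 => hz ?_)
    simp [h0]
  have hS2 : ∀ l, Function.support (fun z => ζ z * J i l z) ⊆ S := fun l z hz =>
    hS (left_ne_zero_of_mul hz)
  have loc : ∀ {u : Euc d → F} {ξ : Euc d → ℝ}, MemLp u (ENNReal.ofReal p) volume →
      BoundedSmooth ξ → Function.support ξ ⊆ S → LocallyIntegrable fun z => ξ z • u (κ z) := by
    intro u ξ hu hξ hξS
    obtain ⟨Z, hZ⟩ := hξ.exists_nnnorm_le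
    have hu2 : eLpNorm u (ENNReal.ofReal p) volume ≤
        ((eLpNorm u (ENNReal.ofReal p) volume).toNNReal : ℝ≥0∞) := by
      rw [ENNReal.coe_toNNReal hu.2.ne]
    exact MemLp.locallyIntegrable ⟨h.aestronglyMeasurable_smul_comp hu.1 hξ.1.continuous hξS,
      (h.eLpNorm_smul_comp_le hp hu2 hZ hξS).trans_lt ENNReal.coe_lt_top⟩ hp'
  have conv : ∀ {u : Euc d → F} {ξ : Euc d → ℝ}, LocallyIntegrable u →
      BoundedSmooth ξ → Function.support ξ ⊆ S →
      TendstoL1Loc (fun n z => ξ z • mollify n u (κ z)) fun z => ξ z • u (κ z) := by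
    intro u ξ hu hξ hξS
    obtain ⟨Z, hZ⟩ := hξ.exists_nnnorm_le
    exact h.tendstoL1Loc_smul_comp (tendstoL1Loc_mollify hu) hZ hξS
  have b1 : BoundedSmooth fun z => fderiv ℝ ζ z (stdVec i) := hζ.fderiv_apply _
  have b2 : ∀ l, BoundedSmooth fun z => ζ z * J i l z := fun l => hζ.mul (h.jacobian_bdd i l)
  refine HasWeakPartial.of_tendsto (u := fun n z => ζ z • mollify n f (κ z)) (fun n =>
    (h.contDiff_smul_comp (contDiff_mollify n (hfg i).1) hζ.1 hS).of_le
      (by exact_mod_cast le_top)) (loc hf hζ hS) ?_ (conv (hfg i).1 hζ hS) ?_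
  · exact (loc hf b1 hS1).add (locallyIntegrable_finsetSum' _ fun l _ => loc (hg l) (b2 l) (hS2 l))
  · have e : (fun n z => fderiv ℝ (fun z => ζ z • mollify n f (κ z)) z (stdVec i)) =
        fun n => (fun z => fderiv ℝ ζ z (stdVec i) • mollify n f (κ z)) +
          ∑ l, fun z => (ζ z * J i l z) • mollify n (g l) (κ z) := by
      ext n z
      rw [h.fderiv_smul_comp (contDiff_mollify n (hfg i).1) hζ.1 hS]
      simp [fderiv_mollify (hfg _)]
    rw [e]
    have m1 : ∀ (n : ℕ) {u : Euc d → F} {ξ : Euc d → ℝ}, LocallyIntegrable u →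
        BoundedSmooth ξ → Function.support ξ ⊆ S →
        AEStronglyMeasurable fun z => ξ z • mollify n u (κ z) := fun n u ξ hu hξ hξS =>
      h.aestronglyMeasurable_smul_comp (aesm_mollify n hu) hξ.1.continuous hξS
    refine (conv (hfg i).1 b1 hS1).add ?_ (fun n => m1 n (hfg i).1 b1 hS1)
      (loc hf b1 hS1).aestronglyMeasurable
    have : ∀ s : Finset (Fin d), TendstoL1Loc
        (fun n => ∑ l ∈ s, fun z => (ζ z * J i l z) • mollify n (g l) (κ z))
        (∑ l ∈ s, fun z => (ζ z * J i l z) • g l (κ z)) := by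
      intro s
      induction s using Finset.induction_on with
      | empty => intro K _; simp
      | insert a s ha ih =>
        simp only [Finset.sum_insert ha]
        exact (conv (hfg a).2.1 (b2 a) (hS2 a)).add ih
          (fun n => m1 n (hfg a).2.1 (b2 a) (hS2 a)) (loc (hg a) (b2 a) (hS2 a)).aestronglyMeasurable
    exact this Finset.univ

/-- Differentiation replaces the factor ζ by ∂ζ and by the products ζ J, which are again bounded
smooth functions supported in S. Hence the induction is over all such ζ. -/
lemma exists_sobolevBound_smul_comp (h : IsTransition κ V S J c₀) {p : ℝ} [hp : Fact (1 < p)]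
    (m : ℕ) {ζ : Euc d → ℝ} (hζ : BoundedSmooth ζ) (hS : Function.support ζ ⊆ S) :
    ∃ C : ℝ≥0, ∀ (f : Euc d → F) (c : ℝ≥0), SobolevBound p m f c →
      SobolevBound p m (fun z => ζ z • f (κ z)) (C * c) := by
  have ht : tsupport ζ ⊆ S := closure_minimal hS h.isClosed
  induction m generalizing ζ with
  | zero =>
    obtain ⟨Z, hZ⟩ := hζ.exists_nnnorm_le
    exact ⟨Z * c₀⁻¹ ^ (1 / p), fun f c hf =>
      ⟨h.aestronglyMeasurable_smul_comp hf.1 hζ.1.continuous hS,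
        h.eLpNorm_smul_comp_le hp.out hf.2 hZ hS⟩⟩
  | succ m ih =>
    have hS1 : ∀ i, Function.support (fun z => fderiv ℝ ζ z (stdVec i)) ⊆ S := fun i z hz => by
      refine ht (support_fderiv_subset ℝ (f := ζ) fun h0 => hz ?_)
      simp [h0]
    have hS2 : ∀ i l, Function.support (fun z => ζ z * J i l z) ⊆ S := fun i l z hz =>
      hS (left_ne_zero_of_mul hz)
    obtain ⟨Z, hZ⟩ := hζ.exists_nnnorm_le
    choose C1 hC1 using fun i => ih (hζ.fderiv_apply (stdVec i)) (hS1 i)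
      (closure_minimal (hS1 i) h.isClosed)
    choose C2 hC2 using fun i l => ih (hζ.mul (h.jacobian_bdd i l)) (hS2 i l)
      (closure_minimal (hS2 i l) h.isClosed)
    refine ⟨Z * c₀⁻¹ ^ (1 / p) + ∑ i, (C1 i + ∑ l, C2 i l), fun f c hf => ?_⟩
    obtain ⟨hf0, g, hg⟩ := id hf
    refine ⟨⟨h.aestronglyMeasurable_smul_comp hf0.1 hζ.1.continuous hS,
      (h.eLpNorm_smul_comp_le hp.out hf0.2 hZ hS).trans ?_⟩,
      fun i => (fun z => fderiv ℝ ζ z (stdVec i) • f (κ z)) +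
        ∑ l, fun z => (ζ z * J i l z) • g l (κ z), fun i => ⟨?_, ?_⟩⟩
    · rw [ENNReal.coe_le_coe]; gcongr; exact le_self_add
    · exact h.hasWeakPartial_smul_comp hp.out (fun l => (hg l).1) hf.memLp
        (fun l => (hg l).2.memLp) hζ hS i
    · refine ((hC1 i f c hf.pred).add (SobolevBound.sum Finset.univ fun l _ =>
        hC2 i l (g l) c (hg l).2)).mono ?_
      rw [← Finset.sum_mul, ← add_mul]
      refine mul_le_mul_left ?_ _
      exact (Finset.single_le_sum (f := fun i => C1 i + ∑ l, C2 i l)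
        (fun _ _ => zero_le) (Finset.mem_univ i)).trans le_add_self

end IsTransition

end Transition

/-! ### Weak jets and iterated first order weak derivatives. -/

section WeakJet
set_option linter.unusedSectionVars false

variable {d : ℕ} {F : Type*} [NormedAddCommGroup F] [NormedSpace ℝ F]

lemma partialDeriv_contDiff {j : ℕ} (α : Fin j → Fin d) {ψ : Euc d → ℝ}
    (hψ : ContDiff ℝ ∞ ψ) : ContDiff ℝ ∞ (partialDeriv α ψ) := by
  have h : ContDiff ℝ ∞ (iteratedFDeriv ℝ j ψ) := hψ.iteratedFDeriv_right (by exact_mod_cast le_top)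
  exact (ContinuousMultilinearMap.apply ℝ (fun _ : Fin j => Euc d) ℝ
    (fun i => EuclideanSpace.single (α i) (1 : ℝ))).contDiff.comp h

lemma partialDeriv_zero (α : Fin 0 → Fin d) (ψ : Euc d → ℝ) : partialDeriv α ψ = ψ := by
  ext x
  simp [partialDeriv]

lemma partialDeriv_succ {j : ℕ} (α : Fin (j + 1) → Fin d) {ψ : Euc d → ℝ}
    (hψ : ContDiff ℝ ∞ ψ) (x : Euc d) :
    partialDeriv α ψ x = fderiv ℝ (partialDeriv (Fin.tail α) ψ) x (stdVec (α 0)) := by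
  have h : DifferentiableAt ℝ (iteratedFDeriv ℝ j ψ) x :=
    (hψ.iteratedFDeriv_right (m := 1) (i := j) (by exact_mod_cast le_top)).differentiable
      (by simp) x
  have h1 := ((ContinuousMultilinearMap.apply ℝ (fun _ : Fin j => Euc d) ℝ
    (fun i => stdVec (Fin.tail α i))).hasFDerivAt.comp x h.hasFDerivAt).fderiv
  have e : partialDeriv (Fin.tail α) ψ = (ContinuousMultilinearMap.apply ℝ
    (fun _ : Fin j => Euc d) ℝ (fun i => stdVec (Fin.tail α i))) ∘ iteratedFDeriv ℝ j ψ := rfl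
  rw [e, h1]
  simp only [partialDeriv, iteratedFDeriv_succ_apply_left]
  rfl

/-- A derivative of the test function is itself a test function, so the first index can be
integrated by parts separately; this gives one factor -1. The converse `HasWeakDeriv.tail` uses the
same identity. -/
lemma HasWeakDeriv.of_tail {j : ℕ} {α : Fin (j + 1) → Fin d} {f g h : Euc d → F}
    (hf : HasWeakPartial (α 0) f g) (hg : HasWeakDeriv (Fin.tail α) g h) :
    HasWeakDeriv α f h := by
  refine ⟨hf.1, hg.2.1, fun ψ hψ hc => ?_⟩
  simp only [partialDeriv_succ α hψ]
  rw [hf.2.2 _ (partialDeriv_contDiff _ hψ) (partialDeriv_hasCompactSupport _ hc),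
    hg.2.2 ψ hψ hc, pow_succ, mul_neg_one, neg_smul]

lemma HasWeakDeriv.tail {j : ℕ} {α : Fin (j + 1) → Fin d} {f g h : Euc d → F}
    (hf : HasWeakPartial (α 0) f g) (hh : HasWeakDeriv α f h) :
    HasWeakDeriv (Fin.tail α) g h := by
  refine ⟨hf.2.1, hh.2.1, fun ψ hψ hc => ?_⟩
  have h1 := hh.2.2 ψ hψ hc
  simp only [partialDeriv_succ α hψ] at h1
  rw [hf.2.2 _ (partialDeriv_contDiff _ hψ) (partialDeriv_hasCompactSupport _ hc), pow_succ,
    mul_neg_one, neg_smul] at h1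
  exact neg_injective h1

lemma hasWeakDeriv_zero (α : Fin 0 → Fin d) {f : Euc d → F} (hf : LocallyIntegrable f) :
    HasWeakDeriv α f f :=
  ⟨hf, hf, fun ψ _ _ => by simp [partialDeriv_zero]⟩

lemma HasWeakDeriv.hasWeakPartial {α : Fin 1 → Fin d} {f g : Euc d → F}
    (h : HasWeakDeriv α f g) : HasWeakPartial (α 0) f g := by
  refine ⟨h.1, h.2.1, fun ψ hψ hc => ?_⟩
  have h1 := h.2.2 ψ hψ hc
  simpa only [partialDeriv_succ α hψ, partialDeriv_zero, pow_one, neg_smul, one_smul] using h1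

/-- The fundamental lemma of the calculus of variations, after cancelling the sign (-1)^j. -/
lemma HasWeakDeriv.unique [CompleteSpace F] {j : ℕ} {α : Fin j → Fin d} {f g g' : Euc d → F}
    (h : HasWeakDeriv α f g) (h' : HasWeakDeriv α f g') : g =ᵐ[volume] g' := by
  refine ae_eq_of_integral_contDiff_smul_eq h.2.1 h'.2.1 fun ψ hψ hc => ?_
  have := (h.2.2 ψ hψ hc).symm.trans (h'.2.2 ψ hψ hc)
  exact smul_right_injective F (pow_ne_zero j (by norm_num : (-1 : ℝ) ≠ 0)) this

variable {p : ℝ} [hp : Fact (1 < p)]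

lemma SobolevBound.exists_hasWeakDeriv {j m : ℕ} {f : Euc d → F} {c : ℝ≥0}
    (h : SobolevBound p m f c) (hj : j ≤ m) (α : Fin j → Fin d) :
    ∃ g, HasWeakDeriv α f g ∧ eLpNorm g (ENNReal.ofReal p) volume ≤ c := by
  have hp' : 1 ≤ ENNReal.ofReal p := by
    rw [← ENNReal.ofReal_one]; exact ENNReal.ofReal_le_ofReal hp.out.le
  induction j generalizing m f with
  | zero => exact ⟨f, hasWeakDeriv_zero α (h.memLp.locallyIntegrable hp'), h.base.2⟩
  | succ j ih =>
    obtain ⟨m, rfl⟩ : ∃ k, m = k + 1 := ⟨m - 1, by omega⟩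
    obtain ⟨_, g, hg⟩ := h
    obtain ⟨g', hg', hg2⟩ := ih (hg (α 0)).2 (by omega) (Fin.tail α)
    exact ⟨g', HasWeakDeriv.of_tail (hg (α 0)).1 hg', hg2⟩

/-- The number of partial derivatives of order at most `m`. -/
def jetCard (d m : ℕ) : ℝ≥0 := ∑ j : Fin (m + 1), ∑ _α : Fin j → Fin d, 1

lemma SobolevBound.weakSobolevENorm_le {m : ℕ} {f : Euc d → F} {c : ℝ≥0}
    (h : SobolevBound p m f c) :
    weakSobolevENorm m (ENNReal.ofReal p) f ≤ (jetCard d m * c : ℝ≥0) := by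
  choose D hD hDc using fun (j : Fin (m + 1)) (α : Fin j → Fin d) =>
    h.exists_hasWeakDeriv (Nat.lt_succ_iff.1 j.2) α
  refine (iInf_le _ ⟨D, hD⟩).trans ?_
  rw [jetCard, Finset.sum_mul]
  push_cast
  refine Finset.sum_le_sum fun j _ => ?_
  rw [Finset.sum_mul]
  refine Finset.sum_le_sum fun α _ => ?_
  rw [one_mul]
  exact hDc j α

/-- The family is indexed by all natural numbers so that it can be shifted: the jet of ∂_i f at α is
the jet of f at the multi-index with i put in front. -/
lemma SobolevBound.of_hasWeakDeriv [CompleteSpace F] {m : ℕ} {f : Euc d → F} {c : ℝ≥0}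
    (D : (j : ℕ) → (Fin j → Fin d) → Euc d → F)
    (hD : ∀ j ≤ m, ∀ α : Fin j → Fin d, HasWeakDeriv α f (D j α) ∧
      eLpNorm (D j α) (ENNReal.ofReal p) volume ≤ c) : SobolevBound p m f c := by
  have h0 : AEStronglyMeasurable f ∧ eLpNorm f (ENNReal.ofReal p) volume ≤ c := by
    have h := hD 0 (Nat.zero_le _) Fin.elim0
    refine ⟨h.1.1.aestronglyMeasurable, ?_⟩
    rw [(hasWeakDeriv_zero Fin.elim0 h.1.1).unique h.1 |> eLpNorm_congr_ae]
    exact h.2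
  induction m generalizing f D with
  | zero => exact h0
  | succ m ih =>
    have h1 : ∀ i, HasWeakPartial i f (D 1 fun _ => i) := fun i =>
      (hD 1 (by omega) fun _ => i).1.hasWeakPartial
    refine ⟨h0, fun i => D 1 fun _ => i, fun i => ⟨h1 i, ?_⟩⟩
    refine ih (fun j α => D (j + 1) (Fin.cons i α)) (fun j hj α => ?_) ?_
    · have h2 := hD (j + 1) (by omega) (Fin.cons i α)
      refine ⟨?_, h2.2⟩
      have := HasWeakDeriv.tail (α := (Fin.cons i α : Fin (j + 1) → Fin d))
        (by simpa using h1 i) h2.1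
      simpa using this
    · have h2 := hD 1 (by omega) fun _ => i
      exact ⟨h2.1.2.1.aestronglyMeasurable, h2.2⟩

/-- A finite infimum means that a jet exists. By uniqueness almost everywhere every jet gives the
same sum, so the infimum is attained and bounds each summand. -/
lemma sobolevBound_of_weakSobolevENorm_le [CompleteSpace F] {m : ℕ} {f : Euc d → F} {c : ℝ≥0}
    (h : weakSobolevENorm m (ENNReal.ofReal p) f ≤ c) : SobolevBound p m f c := by
  have hne : Nonempty
      {D : (j : Fin (m + 1)) → (Fin j → Fin d) → Euc d → F // IsWeakJet m f D} := by
    by_contra hc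
    rw [not_nonempty_iff] at hc
    rw [weakSobolevENorm, iInf_of_empty, top_le_iff] at h
    exact ENNReal.coe_ne_top h
  obtain ⟨⟨D, hD⟩⟩ := hne
  have hsum : ∑ j, ∑ α, eLpNorm (D j α) (ENNReal.ofReal p) volume ≤ c := by
    refine le_trans (le_iInf fun D' => le_of_eq ?_) h
    refine Finset.sum_congr rfl fun j _ => Finset.sum_congr rfl fun α _ => ?_
    exact eLpNorm_congr_ae ((hD j α).unique (D'.2 j α))
  have hle : ∀ j α, eLpNorm (D j α) (ENNReal.ofReal p) volume ≤ c := fun j α => by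
    refine le_trans ?_ hsum
    refine le_trans ?_ (Finset.single_le_sum (f := fun j => ∑ α, eLpNorm (D j α)
      (ENNReal.ofReal p) volume) (fun _ _ => zero_le) (Finset.mem_univ j))
    exact Finset.single_le_sum (f := fun α => eLpNorm (D j α) (ENNReal.ofReal p) volume)
      (fun _ _ => zero_le) (Finset.mem_univ α)
  refine SobolevBound.of_hasWeakDeriv
    -- The value 0 beyond order m is never used.
    (fun j α => if hj : j < m + 1 then D ⟨j, hj⟩ α else 0) fun j hj α => ?_
  rw [dif_pos (Nat.lt_succ_iff.2 hj)]
  exact ⟨hD ⟨j, _⟩ α, hle ⟨j, _⟩ α⟩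

lemma sobolevENorm_natCast (m : ℕ) (q : ℝ≥0∞) (f : Euc d → F) :
    sobolevENorm (m : ℝ) q f = weakSobolevENorm m q f := by
  simp [sobolevENorm]

end WeakJet

/-! ### Polynomial multiples of the Gaussian. -/

section GaussPoly
set_option linter.unusedSectionVars false

variable {d : ℕ}

/-- Polynomial multiples of the Gaussian `exp (-|x|²/4)`. -/
inductive IsGaussPoly : (Euc d → ℝ) → Prop
  | gauss : IsGaussPoly (fun x => Real.exp (-‖x‖ ^ 2 / 4))
  | coord_mul (i : Fin d) {G : Euc d → ℝ} (h : IsGaussPoly G) : IsGaussPoly (fun x => x i * G x)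
  | add {G H : Euc d → ℝ} (hG : IsGaussPoly G) (hH : IsGaussPoly H) : IsGaussPoly (fun x => G x + H x)
  | const_mul (c : ℝ) {G : Euc d → ℝ} (h : IsGaussPoly G) : IsGaussPoly (fun x => c * G x)

lemma coord_contDiff (i : Fin d) : ContDiff ℝ ∞ (fun x : Euc d => x i) :=
  (EuclideanSpace.proj i : Euc d →L[ℝ] ℝ).contDiff

lemma IsGaussPoly.contDiff {G : Euc d → ℝ} (h : IsGaussPoly G) : ContDiff ℝ ∞ G := by
  induction h with
  | gauss =>
    exact Real.contDiff_exp.comp (((contDiff_norm_sq ℝ).neg).div_const 4)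
  | coord_mul i _ ih => exact (coord_contDiff i).mul ih
  | add _ _ h1 h2 => exact h1.add h2
  | const_mul c _ ih => exact contDiff_const.mul ih

lemma fderiv_coord (i j : Fin d) (x : Euc d) :
    fderiv ℝ (fun x : Euc d => x i) x (stdVec j) = if i = j then 1 else 0 := by
  have : fderiv ℝ (fun x : Euc d => x i) x =
      (EuclideanSpace.proj i : Euc d →L[ℝ] ℝ) :=
    (EuclideanSpace.proj i : Euc d →L[ℝ] ℝ).fderiv
  rw [this]
  simp [stdVec]

/-- Differentiating the Gaussian gives -x_j/2 times the Gaussian, so the class is closed under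
derivatives. Thus all derivatives of heat kernels can be treated by the same estimates. -/
lemma IsGaussPoly.fderiv_apply {G : Euc d → ℝ} (h : IsGaussPoly G) (j : Fin d) :
    IsGaussPoly (fun x => fderiv ℝ G x (stdVec j)) := by
  induction h with
  | gauss =>
    have e : (fun x : Euc d => fderiv ℝ (fun x => Real.exp (-‖x‖ ^ 2 / 4)) x (stdVec j)) =
        fun x => (-1 / 2 : ℝ) * (x j * Real.exp (-‖x‖ ^ 2 / 4)) := by
      ext x
      have h1 : HasFDerivAt (fun x : Euc d => -‖x‖ ^ 2 / 4)
          ((-1 / 4 : ℝ) • (2 • innerSL ℝ x)) x := by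
        have := (hasStrictFDerivAt_norm_sq x).hasFDerivAt.const_mul (-1 / 4 : ℝ)
        refine this.congr_of_eventuallyEq (Eventually.of_forall fun y => ?_)
        simp only; ring
      rw [h1.exp.fderiv]
      simp [stdVec, EuclideanSpace.inner_single_right]
      ring
    rw [e]
    exact (IsGaussPoly.gauss.coord_mul j).const_mul _
  | @coord_mul i G hG ih =>
    have e : (fun x : Euc d => fderiv ℝ (fun x => x i * G x) x (stdVec j)) =
        fun x => x i * fderiv ℝ G x (stdVec j) + (if i = j then 1 else 0) * G x := by
      ext x
      rw [fderiv_fun_mul ((coord_contDiff i).differentiable (by simp) x)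
        (hG.contDiff.differentiable (by simp) x)]
      simp only [_root_.add_apply, _root_.smul_apply, smul_eq_mul, fderiv_coord]
      ring
    rw [e]
    exact (ih.coord_mul i).add (hG.const_mul _)
  | add h1 h2 ih1 ih2 =>
    have e := fun x => fderiv_fun_add (h1.contDiff.differentiable (by simp) x)
      (h2.contDiff.differentiable (by simp) x)
    simp only [e]
    exact ih1.add ih2
  | const_mul c h1 ih =>
    have e := fun x => fderiv_const_mul (h1.contDiff.differentiable (by simp) x) c
    simp only [e]
    exact ih.const_mul c

lemma IsGaussPoly.exists_decay {G : Euc d → ℝ} (h : IsGaussPoly G) (N : ℕ) :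
    ∃ c : ℝ≥0, ∀ x, |G x| * (1 + ‖x‖) ^ N ≤ c := by
  induction h generalizing N with
  | gauss =>
    -- With r = ‖x‖, (1 + r)^N ≤ N! e^{1+r} and -r²/4 + 1 + r = 2 - (r - 2)²/4 ≤ 2.
    refine ⟨⟨N.factorial * Real.exp 2, by positivity⟩, fun x => ?_⟩
    have h1 := Real.pow_div_factorial_le_exp (1 + ‖x‖) (by positivity) N
    rw [div_le_iff₀ (by positivity)] at h1
    change _ ≤ N.factorial * Real.exp 2
    rw [abs_of_pos (Real.exp_pos _)]
    calc _ ≤ Real.exp (-‖x‖ ^ 2 / 4) * (Real.exp (1 + ‖x‖) * N.factorial) := by gcongr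
      _ = N.factorial * Real.exp (-‖x‖ ^ 2 / 4 + (1 + ‖x‖)) := by
        rw [Real.exp_add (-‖x‖ ^ 2 / 4)]; ring
      _ ≤ _ := by gcongr; nlinarith [sq_nonneg (‖x‖ - 2)]
  | @coord_mul i G _ ih =>
    obtain ⟨c, hc⟩ := ih (N + 1)
    refine ⟨c, fun x => le_trans ?_ (hc x)⟩
    have h1 : |x i| ≤ 1 + ‖x‖ := by
      have := PiLp.norm_apply_le x i
      rw [Real.norm_eq_abs] at this
      linarith
    rw [abs_mul, pow_succ]
    calc _ = |x i| * (|G x| * (1 + ‖x‖) ^ N) := by ring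
      _ ≤ (1 + ‖x‖) * (|G x| * (1 + ‖x‖) ^ N) := by gcongr
      _ = _ := by ring
  | add _ _ ih1 ih2 =>
    obtain ⟨c1, h1⟩ := ih1 N
    obtain ⟨c2, h2⟩ := ih2 N
    refine ⟨c1 + c2, fun x => ?_⟩
    calc _ ≤ (|_| + |_|) * (1 + ‖x‖) ^ N := by gcongr; exact abs_add_le _ _
      _ ≤ _ := by rw [add_mul]; exact add_le_add (h1 x) (h2 x)
  | const_mul c _ ih =>
    obtain ⟨c1, h1⟩ := ih N
    refine ⟨‖c‖₊ * c1, fun x => ?_⟩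
    rw [abs_mul, mul_assoc]
    push_cast
    rw [Real.norm_eq_abs]
    gcongr
    exact h1 x

lemma IsGaussPoly.bounded {G : Euc d → ℝ} (h : IsGaussPoly G) : ∃ c : ℝ≥0, ∀ x, ‖G x‖₊ ≤ c := by
  obtain ⟨c, hc⟩ := h.exists_decay 0
  exact ⟨c, fun x => by
    have := hc x
    rw [pow_zero, mul_one] at this
    exact this⟩

lemma IsGaussPoly.integrable {G : Euc d → ℝ} (h : IsGaussPoly G) : Integrable G := by
  obtain ⟨c, hc⟩ := h.exists_decay (d + 1)
  have h1 : Integrable (fun x : Euc d => (1 + ‖x‖) ^ (-((d + 1 : ℕ) : ℝ))) :=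
    integrable_one_add_norm (by simp)
  refine (h1.const_mul c).mono' h.contDiff.continuous.aestronglyMeasurable
    (Eventually.of_forall fun x => ?_)
  rw [Real.rpow_neg (by positivity), Real.rpow_natCast, ← div_eq_mul_inv, le_div_iff₀ (by positivity)]
  exact hc x

/-- A bounded integrable function lies in every L_q with q ≥ 1, because |G|^q ≤ c^{q-1} |G|. -/
lemma IsGaussPoly.lintegral_rpow_lt_top {G : Euc d → ℝ} (h : IsGaussPoly G) {q : ℝ} (hq : 1 ≤ q) :
    ∫⁻ x, ‖G x‖ₑ ^ q < ⊤ := by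
  obtain ⟨c, hc⟩ := h.bounded
  have h1 : ∀ x, ‖G x‖ₑ ^ q ≤ (c : ℝ≥0∞) ^ (q - 1) * ‖G x‖ₑ := fun x => by
    calc ‖G x‖ₑ ^ q = ‖G x‖ₑ ^ (q - 1) * ‖G x‖ₑ ^ (1 : ℝ) := by
          rw [← ENNReal.rpow_add_of_nonneg _ _ (by linarith) zero_le_one, sub_add_cancel]
      _ ≤ _ := by
        rw [ENNReal.rpow_one]
        gcongr
        exact_mod_cast hc x
  refine (lintegral_mono h1).trans_lt ?_
  rw [lintegral_const_mul' _ _ (ENNReal.rpow_ne_top_of_nonneg (by linarith) ENNReal.coe_ne_top)]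
  exact ENNReal.mul_lt_top (ENNReal.rpow_lt_top_of_nonneg (by linarith) ENNReal.coe_ne_top)
    h.integrable.2

end GaussPoly

/-! ### The Bessel kernel as a superposition of heat kernels. -/

section HeatMix
set_option linter.unusedSectionVars false

variable {d : ℕ}

/-- The integrand of `heatMix`. -/
def heatKer (a : ℝ) (G : Euc d → ℝ) (x : Euc d) (r : ℝ) : ℝ :=
  r ^ (a - 1) * Real.exp (-r) * (r ^ (-(d : ℝ) / 2) * G ((√r)⁻¹ • x))

/-- The superposition `∫_0^∞ r^{a-1} e^{-r} r^{-d/2} G(x/√r) dr` of rescaled profiles. -/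
def heatMix (a : ℝ) (G : Euc d → ℝ) (x : Euc d) : ℝ := ∫ r in Ioi (0 : ℝ), heatKer a G x r

lemma measurable_heatKer (a : ℝ) {G : Euc d → ℝ} (hG : Continuous G) :
    Measurable (fun z : Euc d × ℝ => heatKer a G z.1 z.2) := by
  have h1 : Measurable (fun z : Euc d × ℝ => G ((√z.2)⁻¹ • z.1)) := hG.measurable.comp
    ((Real.continuous_sqrt.measurable.comp measurable_snd).inv.smul measurable_fst)
  unfold heatKer
  fun_prop

lemma lintegral_gammaWeight_lt_top {a : ℝ} (ha : 0 < a) :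
    ∫⁻ r in Ioi (0 : ℝ), ENNReal.ofReal (r ^ (a - 1) * Real.exp (-r)) < ⊤ := by
  have h := Real.GammaIntegral_convergent ha
  refine (IntegrableOn.congr_fun (g := fun r => r ^ (a - 1) * Real.exp (-r)) h
    (fun x _ => mul_comm _ _) measurableSet_Ioi).lintegral_lt_top

/-- Tonelli's theorem and the substitution y = √r z, whose Jacobian cancels the factor r^{-d/2}. All
estimates on the superposed kernels reduce to a single profile G integrated against a Gamma weight.
-/
lemma lintegral_heatKer_mul (a : ℝ) {G : Euc d → ℝ} (hG : Continuous G) {h : Euc d → ℝ≥0∞}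
    (hh : AEMeasurable h) (x : Euc d) :
    ∫⁻ y, (∫⁻ r in Ioi (0 : ℝ), ‖heatKer a G y r‖ₑ) * h (x - y) =
      ∫⁻ r in Ioi (0 : ℝ), ENNReal.ofReal (r ^ (a - 1) * Real.exp (-r)) *
        ∫⁻ z, ‖G z‖ₑ * h (x - √r • z) := by
  have hm : AEMeasurable (fun y => h (x - y)) := hh.comp_quasiMeasurePreserving
    (quasiMeasurePreserving_sub_left_of_right_invariant _ x)
  have e1 : ∀ y, (∫⁻ r in Ioi (0 : ℝ), ‖heatKer a G y r‖ₑ) * h (x - y) =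
      ∫⁻ r in Ioi (0 : ℝ), ‖heatKer a G y r‖ₑ * h (x - y) := fun y => by
    rw [lintegral_mul_const]
    exact ((measurable_heatKer a hG).comp measurable_prodMk_left).enorm
  simp_rw [e1]
  rw [lintegral_lintegral_swap]
  swap
  · exact (measurable_heatKer a hG).enorm.aemeasurable.mul hm.comp_fst
  refine setLIntegral_congr_fun measurableSet_Ioi fun r hr => ?_
  have hr : 0 < r := hr
  have hs : 0 < √r := Real.sqrt_pos.2 hr
  have k := lintegral_comp_sub_smul (h := fun w => ‖G ((√r)⁻¹ • (x - w))‖ₑ * h w)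
    ((Continuous.measurable (by fun_prop)).enorm.aemeasurable.mul hh) x hs
  have e2 : ∀ z : Euc d, (√r)⁻¹ • (x - (x - √r • z)) = z := fun z => by
    rw [sub_sub_cancel, smul_smul, inv_mul_cancel₀ hs.ne', one_smul]
  simp only [e2] at k
  rw [k, ← lintegral_sub_left_eq_self _ x]
  simp only [sub_sub_cancel]
  rw [← mul_assoc, ← ENNReal.ofReal_mul (by positivity), ← lintegral_const_mul' _ _ ENNReal.ofReal_ne_top]
  refine lintegral_congr fun y => ?_
  rw [← mul_assoc]
  congr 1
  have e3 : √r ^ (-(d : ℝ)) = r ^ (-(d : ℝ) / 2) := by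
    rw [Real.sqrt_eq_rpow, ← Real.rpow_mul hr.le]
    congr 1; ring
  rw [heatKer, e3, ← mul_assoc, enorm_mul, Real.enorm_eq_ofReal (by positivity)]

lemma enorm_heatMix_le (a : ℝ) (G : Euc d → ℝ) (y : Euc d) :
    ‖heatMix a G y‖ₑ ≤ ∫⁻ r in Ioi (0 : ℝ), ‖heatKer a G y r‖ₑ :=
  enorm_integral_le_lintegral_enorm _

lemma integrable_heatKer {a : ℝ} (ha : 0 < a) {G : Euc d → ℝ} (hG : Continuous G)
    (hGi : Integrable G) : Integrable (fun z : Euc d × ℝ => heatKer a G z.1 z.2)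
      (volume.prod (volume.restrict (Ioi (0 : ℝ)))) := by
  refine ⟨(measurable_heatKer a hG).aestronglyMeasurable, ?_⟩
  rw [hasFiniteIntegral_iff_enorm, lintegral_prod _ (measurable_heatKer a hG).enorm.aemeasurable]
  have h := lintegral_heatKer_mul a hG (h := fun _ => 1) aemeasurable_const 0
  simp only [mul_one] at h
  rw [h, lintegral_mul_const' _ _ hGi.2.ne]
  exact ENNReal.mul_lt_top (lintegral_gammaWeight_lt_top ha) hGi.2

lemma integrable_heatMix {a : ℝ} (ha : 0 < a) {G : Euc d → ℝ} (hG : Continuous G)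
    (hGi : Integrable G) : Integrable (heatMix a G) :=
  (integrable_heatKer ha hG hGi).integral_prod_left

/-- Differentiating G(x/√r) costs r^{-1/2}, which lowers a by 1/2. While a - 1/2 stays positive, the
integrands are jointly integrable, so Fubini's theorem permits integration by parts for each r
separately. -/
lemma hasWeakPartial_heatMix {a : ℝ} (ha : 0 < a - 1 / 2) {G : Euc d → ℝ} (hG : IsGaussPoly G)
    (i : Fin d) : HasWeakPartial i (heatMix a G)
      (heatMix (a - 1 / 2) (fun x => fderiv ℝ G x (stdVec i))) := by
  have hG' := hG.fderiv_apply i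
  have I1 := integrable_heatKer (show 0 < a by linarith) hG.contDiff.continuous hG.integrable
  have I2 := integrable_heatKer ha hG'.contDiff.continuous hG'.integrable
  refine ⟨I1.integral_prod_left.locallyIntegrable, I2.integral_prod_left.locallyIntegrable,
    fun ψ hψ hc => ?_⟩
  have key : ∀ {χ : Euc d → ℝ} {a : ℝ} {G : Euc d → ℝ}, Continuous χ → HasCompactSupport χ →
      Integrable (fun z : Euc d × ℝ => heatKer a G z.1 z.2)
        (volume.prod (volume.restrict (Ioi (0 : ℝ)))) →
      ∫ x, χ x • heatMix a G x = ∫ r in Ioi (0 : ℝ), ∫ x, χ x • heatKer a G x r := by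
    intro χ a G h1 h2 h3
    obtain ⟨c, hc⟩ := h1.bounded_above_of_compact_support h2
    rw [← integral_integral_swap]
    · refine integral_congr_ae (Eventually.of_forall fun x => ?_)
      simp only [heatMix]
      rw [integral_smul]
    · exact h3.bdd_mul (c := c) (h1.comp continuous_fst).aestronglyMeasurable
        (Eventually.of_forall fun z => hc z.1)
  rw [key ((hψ.continuous_fderiv (by simp)).clm_apply continuous_const)
    (hc.fderiv_apply (𝕜 := ℝ) _) I1, key hψ.continuous hc I2, ← integral_neg]
  refine setIntegral_congr_fun measurableSet_Ioi fun r hr => ?_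
  have hr : 0 < r := hr
  have hf : ContDiff ℝ 1 (fun x => heatKer a G x r) := by
    unfold heatKer
    exact contDiff_const.mul (contDiff_const.mul
      ((hG.contDiff.of_le (by exact_mod_cast le_top)).comp (contDiff_id.const_smul _)))
  have k := integral_fderiv_smul_eq (i := i) hf hψ hc
  rw [k]
  congr 1
  refine integral_congr_ae (Eventually.of_forall fun x => ?_)
  simp only
  congr 1
  have h1 : HasFDerivAt (fun x : Euc d => G ((√r)⁻¹ • x))
      ((fderiv ℝ G ((√r)⁻¹ • x)).comp ((√r)⁻¹ • ContinuousLinearMap.id ℝ (Euc d))) x :=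
    (hG.contDiff.differentiable (by simp) _).hasFDerivAt.comp x
      (((√r)⁻¹ • ContinuousLinearMap.id ℝ (Euc d)).hasFDerivAt)
  have h2 := ((h1.const_mul (r ^ (-(d : ℝ) / 2))).const_mul (r ^ (a - 1) * Real.exp (-r))).fderiv
  have e : (fun x => heatKer a G x r) = fun x => r ^ (a - 1) * Real.exp (-r) *
    (r ^ (-(d : ℝ) / 2) * G ((√r)⁻¹ • x)) := rfl
  rw [e, h2]
  have e3 : r ^ (a - 1 / 2 - 1) = r ^ (a - 1) * (√r)⁻¹ := by
    rw [Real.sqrt_eq_rpow, ← Real.rpow_neg hr.le, ← Real.rpow_add hr]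
    congr 1; ring
  simp only [heatKer, e3, _root_.smul_apply, ContinuousLinearMap.comp_apply,
    ContinuousLinearMap.id_apply, smul_eq_mul, map_smul]
  ring

lemma besselKernel_eq (s : ℝ) (x : Euc d) : besselKernel d s x =
    ((Real.Gamma (s / 2))⁻¹ * (4 * Real.pi) ^ (-(d : ℝ) / 2)) *
      heatMix (s / 2) (fun x => Real.exp (-‖x‖ ^ 2 / 4)) x := by
  have key : ∫ r in Ioi (0 : ℝ), r ^ (s / 2 - 1) * Real.exp (-r) *
      ((4 * Real.pi * r) ^ (-(d : ℝ) / 2) * Real.exp (-‖x‖ ^ 2 / (4 * r))) =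
      (4 * Real.pi) ^ (-(d : ℝ) / 2) *
        heatMix (s / 2) (fun x => Real.exp (-‖x‖ ^ 2 / 4)) x := by
    rw [heatMix, ← integral_const_mul]
    refine setIntegral_congr_fun measurableSet_Ioi fun r hr => ?_
    have hr : 0 < r := hr
    simp only [heatKer]
    rw [Real.mul_rpow (by positivity) hr.le, norm_smul, norm_inv, Real.norm_of_nonneg (Real.sqrt_nonneg r),
      mul_pow, inv_pow, Real.sq_sqrt hr.le]
    have : -‖x‖ ^ 2 / (4 * r) = -(r⁻¹ * ‖x‖ ^ 2) / 4 := by field_simp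
    rw [this]
    ring
  rw [besselKernel, key, mul_assoc]

end HeatMix

/-! ### Potentials of L_p functions. -/

section Potential
set_option linter.unusedSectionVars false

variable {d : ℕ} {F : Type*} [NormedAddCommGroup F] [NormedSpace ℝ F]

/-- The convolution of a scalar kernel with a vector valued function. -/
def potential (K : Euc d → ℝ) (g : Euc d → F) (x : Euc d) : F := ∫ y, K (x - y) • g y

lemma potential_eq (K : Euc d → ℝ) (g : Euc d → F) (x : Euc d) :
    potential K g x = ∫ t, K t • g (x - t) := by
  rw [potential, ← integral_sub_left_eq_self _ volume x]
  simp only [sub_sub_cancel]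

lemma aestronglyMeasurable_potential_integrand {K : Euc d → ℝ} {g : Euc d → F}
    (hK : AEStronglyMeasurable K) (hg : AEStronglyMeasurable g) :
    AEStronglyMeasurable (fun z : Euc d × Euc d => K (z.1 - z.2) • g z.2)
      (volume.prod volume) :=
  (hK.comp_quasiMeasurePreserving
    (quasiMeasurePreserving_sub_of_right_invariant volume volume)).smul hg.comp_snd

lemma aestronglyMeasurable_potential {K : Euc d → ℝ} {g : Euc d → F}
    (hK : AEStronglyMeasurable K) (hg : AEStronglyMeasurable g) :
    AEStronglyMeasurable (potential K g) :=
  (aestronglyMeasurable_potential_integrand hK hg).integral_prod_right'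

variable {p : ℝ} [hp : Fact (1 < p)]

lemma one_le_ofReal_of_fact : 1 ≤ ENNReal.ofReal p := by
  rw [← ENNReal.ofReal_one]; exact ENNReal.ofReal_le_ofReal hp.out.le

lemma eLpNorm_potential_le {K : Euc d → ℝ} {g : Euc d → F}
    (hK : Integrable K) (hg : AEStronglyMeasurable g) :
    eLpNorm (potential K g) (ENNReal.ofReal p) volume ≤
      (∫⁻ x, ‖K x‖ₑ) * eLpNorm g (ENNReal.ofReal p) volume := by
  have := eLpNorm_convolution_le (one_le_ofReal_of_fact (p := p)) ENNReal.ofReal_ne_top hK hg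
  simpa only [← potential_eq] using this

lemma lintegral_enorm_rpow_lt_top {g : Euc d → F} (hg : MemLp g (ENNReal.ofReal p) volume) :
    ∫⁻ x, ‖g x‖ₑ ^ p < ⊤ := by
  have hp0 : 0 < p := by linarith [hp.out]
  have h := lintegral_rpow_enorm_lt_top_of_eLpNorm_lt_top (by simpa using hp0)
    ENNReal.ofReal_ne_top hg.2
  rwa [ENNReal.toReal_ofReal hp0.le] at h

/-- Justifies the exchange of integrals: |K| * |g| ∈ L_p by Young's inequality, and the continuous
function χ of compact support lies in the dual exponent space, so Hölder's inequality applies. -/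
lemma integrable_smul_potential_integrand {K : Euc d → ℝ} {g : Euc d → F} {χ : Euc d → ℝ}
    (hK : Integrable K) (hg : MemLp g (ENNReal.ofReal p) volume) (hχ : Continuous χ)
    (hc : HasCompactSupport χ) :
    Integrable (fun z : Euc d × Euc d => χ z.1 • K (z.1 - z.2) • g z.2) (volume.prod volume) := by
  have hm : AEStronglyMeasurable (fun z : Euc d × Euc d => χ z.1 • K (z.1 - z.2) • g z.2)
      (volume.prod volume) := (hχ.aestronglyMeasurable.comp_fst (ν := (volume : Measure (Euc d)))).smul
    (aestronglyMeasurable_potential_integrand hK.1 hg.1)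
  refine ⟨hm, ?_⟩
  rw [hasFiniteIntegral_iff_enorm, lintegral_prod _ hm.enorm]
  simp only [enorm_smul]
  have e1 : ∀ x, ∫⁻ y, ‖χ x‖ₑ * (‖K (x - y)‖ₑ * ‖g y‖ₑ) =
      ‖χ x‖ₑ * ∫⁻ t, ‖K t‖ₑ * ‖g (x - t)‖ₑ := fun x => by
    rw [lintegral_const_mul' _ _ enorm_ne_top, ← lintegral_sub_left_eq_self _ x]
    simp only [sub_sub_cancel]
  simp_rw [e1]
  have hpq : p.HolderConjugate (p.conjExponent) := Real.HolderConjugate.conjExponent hp.out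
  have hp0 : 0 < p := by linarith [hp.out]
  have hAm : AEMeasurable (fun x => ∫⁻ t, ‖K t‖ₑ * ‖g (x - t)‖ₑ) := by
    have h1 : AEMeasurable (fun z : Euc d × Euc d => ‖K z.2‖ₑ * ‖g (z.1 - z.2)‖ₑ)
        (volume.prod volume) :=
      hK.1.enorm.comp_snd.mul (hg.1.enorm.comp_quasiMeasurePreserving
        (quasiMeasurePreserving_sub_of_right_invariant volume volume))
    exact h1.lintegral_prod_right'
  refine (ENNReal.lintegral_mul_le_Lp_mul_Lq volume hpq.symm hχ.aestronglyMeasurable.enorm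
    hAm).trans_lt (ENNReal.mul_lt_top ?_ ?_)
  · refine ENNReal.rpow_lt_top_of_nonneg (by have := hpq.symm.pos; positivity) ?_
    have h2 : MemLp χ (ENNReal.ofReal p.conjExponent) volume := hχ.memLp_of_hasCompactSupport hc
    have h := lintegral_rpow_enorm_lt_top_of_eLpNorm_lt_top (by simpa using hpq.symm.pos)
      ENNReal.ofReal_ne_top h2.2
    rw [ENNReal.toReal_ofReal hpq.symm.nonneg] at h
    exact h.ne
  · refine ENNReal.rpow_lt_top_of_nonneg (by positivity) ?_
    refine ((lintegral_young hp.out.le hK.1.enorm hg.1.enorm hK.2.ne).trans_lt ?_).ne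
    exact ENNReal.mul_lt_top (ENNReal.rpow_lt_top_of_nonneg hp0.le hK.2.ne)
      (lintegral_enorm_rpow_lt_top hg)

/-- Fubini's theorem moves the test function onto the kernel, translated by y. -/
lemma integral_smul_potential {K : Euc d → ℝ} {g : Euc d → F} {χ : Euc d → ℝ}
    (hK : Integrable K) (hg : MemLp g (ENNReal.ofReal p) volume) (hχ : Continuous χ)
    (hc : HasCompactSupport χ) [CompleteSpace F] :
    ∫ x, χ x • potential K g x = ∫ y, (∫ x, χ (x + y) * K x) • g y := by
  simp only [potential]
  calc _ = ∫ x, ∫ y, χ x • K (x - y) • g y := by simp_rw [integral_smul]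
    _ = ∫ y, ∫ x, χ x • K (x - y) • g y :=
      integral_integral_swap (integrable_smul_potential_integrand hK hg hχ hc)
    _ = _ := by
      refine integral_congr_ae (Eventually.of_forall fun y => ?_)
      simp only [smul_smul]
      rw [integral_smul_const, ← integral_add_right_eq_self _ y]
      simp only [add_sub_cancel_right]

/-- After Fubini's theorem the inner integral pairs K with a translate of ψ, which is again a test
function, so the weak derivative of the kernel can be inserted for each y. -/
lemma hasWeakPartial_potential [CompleteSpace F] {i : Fin d} {K K' : Euc d → ℝ} {g : Euc d → F}
    (h : HasWeakPartial i K K') (hK : Integrable K) (hK' : Integrable K')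
    (hg : MemLp g (ENNReal.ofReal p) volume) :
    HasWeakPartial i (potential K g) (potential K' g) := by
  have hl : ∀ {K : Euc d → ℝ}, Integrable K → LocallyIntegrable (potential K g) := fun hK =>
    MemLp.locallyIntegrable (p := ENNReal.ofReal p)
      ⟨aestronglyMeasurable_potential hK.1 hg.1, (eLpNorm_potential_le hK hg.1).trans_lt
        (ENNReal.mul_lt_top hK.2 hg.2)⟩ one_le_ofReal_of_fact
  refine ⟨hl hK, hl hK', fun ψ hψ hc => ?_⟩
  rw [integral_smul_potential hK hg ((hψ.continuous_fderiv (by simp)).clm_apply continuous_const)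
    (hc.fderiv_apply (𝕜 := ℝ) _), integral_smul_potential hK' hg hψ.continuous hc, ← integral_neg]
  refine integral_congr_ae (Eventually.of_forall fun y => ?_)
  have k := h.2.2 (fun x => ψ (x + y)) (hψ.comp (contDiff_id.add contDiff_const))
    (hc.comp_homeomorph (Homeomorph.addRight y))
  simp only [fderiv_comp_add_right, smul_eq_mul] at k
  simp only [k, neg_smul]

/-- Each derivative falls on the kernel and lowers a by 1/2. Since a > m/2, the kernel is still
integrable after m derivatives, and Young's inequality bounds the potential in L_p. -/
lemma exists_sobolevBound_potential [CompleteSpace F] {a : ℝ} (m : ℕ) (ha : (m : ℝ) / 2 < a)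
    {G : Euc d → ℝ} (hG : IsGaussPoly G) :
    ∃ C : ℝ≥0, ∀ (g : Euc d → F) (c : ℝ≥0), AEStronglyMeasurable g →
      eLpNorm g (ENNReal.ofReal p) volume ≤ c →
      SobolevBound p m (potential (heatMix a G) g) (C * c) := by
  have base : ∀ {a : ℝ}, 0 < a → ∀ {G : Euc d → ℝ}, IsGaussPoly G → ∃ C : ℝ≥0,
      ∀ (g : Euc d → F) (c : ℝ≥0), AEStronglyMeasurable g →
      eLpNorm g (ENNReal.ofReal p) volume ≤ c →
      SobolevBound p 0 (potential (heatMix a G) g) (C * c) := by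
    intro a ha G hG
    have hK := integrable_heatMix ha hG.contDiff.continuous hG.integrable
    refine ⟨(∫⁻ x, ‖heatMix a G x‖ₑ).toNNReal, fun g c hg hgc =>
      ⟨aestronglyMeasurable_potential hK.1 hg, (eLpNorm_potential_le hK hg).trans ?_⟩⟩
    push_cast
    rw [ENNReal.coe_toNNReal hK.2.ne]
    gcongr
  induction m generalizing a G with
  | zero => exact base (by simpa using ha) hG
  | succ m ih =>
    push_cast at ha
    have h0 : (0 : ℝ) ≤ m := Nat.cast_nonneg m
    have ha0 : 0 < a := by linarith
    have ha1 : 0 < a - 1 / 2 := by linarith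
    obtain ⟨C0, hC0⟩ := base ha0 hG
    choose C hC using fun i => ih (a := a - 1 / 2) (by linarith) (hG.fderiv_apply i)
    refine ⟨C0 + ∑ i, C i, fun g c hg hgc => ⟨((hC0 g c hg hgc).mono ?_).base, fun i => _,
      fun i => ⟨hasWeakPartial_potential (p := p) (hasWeakPartial_heatMix ha1 hG i)
        (integrable_heatMix ha0 hG.contDiff.continuous hG.integrable)
        (integrable_heatMix ha1 (hG.fderiv_apply i).contDiff.continuous (hG.fderiv_apply i).integrable)
        ⟨hg, hgc.trans_lt ENNReal.coe_lt_top⟩, (hC i g c hg hgc).mono ?_⟩⟩⟩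
    · gcongr; exact le_self_add
    · gcongr
      exact (Finset.single_le_sum (f := C) (fun _ _ => zero_le) (Finset.mem_univ i)).trans
        le_add_self

/-- Hölder's inequality at scale √r costs r^{-d/(2p)}, which the weight r^{a-1} e^{-r} absorbs when
a > d/(2p). With a = s/2 this is the condition s > d/p. The bound is for the absolute integral, so
it also gives convergence at every point. -/
lemma exists_potential_bound {a : ℝ} (ha : (d : ℝ) / (2 * p) < a) {G : Euc d → ℝ}
    (hG : IsGaussPoly G) :
    ∃ C : ℝ≥0, ∀ (g : Euc d → F) (c : ℝ≥0), AEStronglyMeasurable g →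
      eLpNorm g (ENNReal.ofReal p) volume ≤ c →
      ∀ x, ∫⁻ y, ‖heatMix a G (x - y) • g y‖ₑ ≤ (C * c : ℝ≥0) := by
  have hpq : p.HolderConjugate (p.conjExponent) := Real.HolderConjugate.conjExponent hp.out
  set q := p.conjExponent
  have hp0 : 0 < p := by linarith [hp.out]
  have hGc := hG.contDiff.continuous
  set A : ℝ≥0∞ := (∫⁻ z, ‖G z‖ₑ ^ q) ^ (1 / q) with hA
  have hAt : A < ⊤ := ENNReal.rpow_lt_top_of_nonneg (by have := hpq.symm.pos; positivity)
    (hG.lintegral_rpow_lt_top hpq.symm.lt.le).ne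
  set W : ℝ≥0∞ := ∫⁻ r in Ioi (0 : ℝ), ENNReal.ofReal (r ^ (a - d / (2 * p) - 1) * Real.exp (-r))
    with hW
  have hWt : W < ⊤ := lintegral_gammaWeight_lt_top (by linarith)
  refine ⟨(W * A).toNNReal, fun g c hg hgc x => ?_⟩
  have hgc' : (∫⁻ z, ‖g z‖ₑ ^ p) ^ (1 / p) ≤ c := by
    rwa [eLpNorm_eq_lintegral_rpow_enorm_toReal (by simpa using hp0) ENNReal.ofReal_ne_top,
      ENNReal.toReal_ofReal hp0.le] at hgc
  push_cast
  rw [ENNReal.coe_toNNReal (ENNReal.mul_lt_top hWt hAt).ne]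
  simp only [enorm_smul]
  rw [← lintegral_sub_left_eq_self _ x]
  simp only [sub_sub_cancel]
  calc ∫⁻ y, ‖heatMix a G y‖ₑ * ‖g (x - y)‖ₑ
      ≤ ∫⁻ y, (∫⁻ r in Ioi (0 : ℝ), ‖heatKer a G y r‖ₑ) * ‖g (x - y)‖ₑ := by
        gcongr with y
        exact enorm_heatMix_le a G y
    _ = ∫⁻ r in Ioi (0 : ℝ), ENNReal.ofReal (r ^ (a - 1) * Real.exp (-r)) *
        ∫⁻ z, ‖G z‖ₑ * ‖g (x - √r • z)‖ₑ := lintegral_heatKer_mul a hGc hg.enorm x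
    _ ≤ ∫⁻ r in Ioi (0 : ℝ), ENNReal.ofReal (r ^ (a - d / (2 * p) - 1) * Real.exp (-r)) * (A * c) := by
        refine setLIntegral_mono' measurableSet_Ioi fun r hr => ?_
        have hr : 0 < r := hr
        have k := lintegral_mul_comp_sub_smul_le hpq hGc.aestronglyMeasurable.enorm hg.enorm x
          (Real.sqrt_pos.2 hr)
        calc _ ≤ ENNReal.ofReal (r ^ (a - 1) * Real.exp (-r)) *
              (A * (ENNReal.ofReal (√r ^ (-((d : ℝ) / p))) * c)) := by gcongr; exact k.trans (by gcongr)
          _ = (ENNReal.ofReal (r ^ (a - 1) * Real.exp (-r)) *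
              ENNReal.ofReal (√r ^ (-((d : ℝ) / p)))) * (A * c) := by ring
          _ = _ := by
            rw [← ENNReal.ofReal_mul (by positivity)]
            congr 2
            have e : r ^ (a - d / (2 * p) - 1) = r ^ (a - 1) * √r ^ (-((d : ℝ) / p)) := by
              rw [Real.sqrt_eq_rpow, ← Real.rpow_mul hr.le, ← Real.rpow_add hr]
              congr 1
              field_simp
              ring
            rw [e]; ring
    _ = W * A * c := by
        rw [lintegral_mul_const' _ _ (ENNReal.mul_lt_top hAt ENNReal.coe_lt_top).ne, mul_assoc]

lemma enorm_potential_le (K : Euc d → ℝ) (g : Euc d → F) (x : Euc d) :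
    ‖potential K g x‖ₑ ≤ ∫⁻ y, ‖K (x - y) • g y‖ₑ := enorm_integral_le_lintegral_enorm _

/-- Potentials of compactly supported continuous functions are continuous, and by the uniform bound
L_p approximation of g gives uniform approximation of the potential. -/
lemma potential_exists_continuous [CompleteSpace F] {a : ℝ} (ha0 : 0 < a)
    (ha : (d : ℝ) / (2 * p) < a) {G : Euc d → ℝ} (hG : IsGaussPoly G) {g : Euc d → F}
    (hg : MemLp g (ENNReal.ofReal p) volume) :
    ∃ f, Continuous f ∧ potential (heatMix a G) g =ᵐ[volume] f := by
  obtain ⟨C, hC⟩ := exists_potential_bound (F := F) (p := p) ha hG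
  have hK := integrable_heatMix ha0 hG.contDiff.continuous hG.integrable
  refine exists_continuous_ae_eq fun ε hε => ?_
  obtain ⟨δ, hδ, hCδ⟩ : ∃ δ : ℝ≥0, 0 < δ ∧ (C * δ : ℝ) ≤ ε := by
    refine ⟨⟨ε / (C + 1), by positivity⟩, ?_, ?_⟩
    · change 0 < ε / (C + 1); positivity
    · change C * (ε / (C + 1)) ≤ ε
      rw [mul_div_assoc', div_le_iff₀ (by positivity)]
      nlinarith [C.2]
  obtain ⟨f, hfc, hfe, hfcont, hfm⟩ := hg.exists_hasCompactSupport_eLpNorm_sub_le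
    ENNReal.ofReal_ne_top (ε := δ) (by exact_mod_cast hδ.ne')
  refine ⟨potential (heatMix a G) f, ?_, Eventually.of_forall fun x => ?_⟩
  · have h := hfc.continuous_convolution_right (ContinuousLinearMap.lsmul ℝ ℝ)
      hK.locallyIntegrable hfcont (μ := volume)
    have e : potential (heatMix a G) f = heatMix a G ⋆[ContinuousLinearMap.lsmul ℝ ℝ] f := by
      ext x
      rw [potential_eq]; rfl
    rw [e]; exact h
  · have h1 := hC (g - f) δ (hg.1.sub hfm.1) hfe x
    have hi : ∀ {h : Euc d → F}, MemLp h (ENNReal.ofReal p) volume →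
        Integrable (fun y => heatMix a G (x - y) • h y) := fun {h} hh => by
      obtain ⟨c, hc⟩ : ∃ c : ℝ≥0, (c : ℝ≥0∞) = eLpNorm h (ENNReal.ofReal p) volume :=
        ⟨_, ENNReal.coe_toNNReal hh.2.ne⟩
      refine ⟨(hK.1.comp_quasiMeasurePreserving
        (quasiMeasurePreserving_sub_left_of_right_invariant volume x)).smul hh.1,
        (hC h c hh.1 hc.ge x).trans_lt ENNReal.coe_lt_top⟩
    have h2 := (enorm_potential_le (heatMix a G) (g - f) x).trans h1
    have e : potential (heatMix a G) (g - f) x =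
        potential (heatMix a G) g x - potential (heatMix a G) f x := by
      simp only [potential, Pi.sub_apply, smul_sub]
      rw [integral_sub (hi hg) (hi hfm)]
    rw [e] at h2
    have h3 : ‖potential (heatMix a G) g x - potential (heatMix a G) f x‖₊ ≤ C * δ := by
      exact_mod_cast h2
    exact le_trans (by exact_mod_cast h3) hCδ

end Potential

/-! ### Sobolev embedding for integer and fractional order. -/

section Embedding
set_option linter.unusedSectionVars false

variable {d : ℕ} {F : Type*} [NormedAddCommGroup F] [NormedSpace ℝ F]
variable {p : ℝ} [hp : Fact (1 < p)]

lemma IsBesselPotential.ae_eq {s : ℝ} {f g : Euc d → F} (h : IsBesselPotential s f g) :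
    f =ᵐ[volume] ((Real.Gamma (s / 2))⁻¹ * (4 * Real.pi) ^ (-(d : ℝ) / 2)) •
      potential (heatMix (s / 2) (fun x => Real.exp (-‖x‖ ^ 2 / 4))) g := by
  filter_upwards [h.2] with x hx
  rw [hx.2]
  simp only [besselKernel_eq, mul_smul, Pi.smul_apply, potential]
  rw [integral_smul, integral_smul]

lemma exists_sobolevBound_const_smul [CompleteSpace F] (hpd : (d : ℝ) < p) (m : ℕ) (κ : ℝ) :
    ∃ C : ℝ≥0, ∀ (f : Euc d → F) (c : ℝ≥0), SobolevBound p m f c →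
      SobolevBound p m (κ • f) (C * c) := by
  obtain ⟨C, hC⟩ := exists_sobolevBound_bilin (d := d) hpd (ContinuousLinearMap.lsmul ℝ ℝ (E := F)) m
  exact ⟨C * ‖κ‖₊, fun f c h => hC (fun _ => κ) f _ _ (Or.inl ⟨MultiplierBound.const κ, h⟩)⟩

/-- The Bessel norm is an infimum over densities g. Estimates are made with a nearly optimal g, and
the excess δ then tends to zero. -/
lemma le_of_forall_le_mul_add {w : ℝ≥0∞} {D c : ℝ≥0}
    (h : ∀ δ : ℝ≥0, 0 < δ → w ≤ (D * (c + δ) : ℝ≥0)) : w ≤ (D * c : ℝ≥0) := by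
  have hc : Continuous (fun δ : ℝ≥0 => ((D * (c + δ) : ℝ≥0) : ℝ≥0∞)) :=
    ENNReal.continuous_coe.comp (by fun_prop)
  have ht : Tendsto (fun δ : ℝ≥0 => ((D * (c + δ) : ℝ≥0) : ℝ≥0∞)) (𝓝[>] 0)
      (𝓝 ((D * (c + 0) : ℝ≥0) : ℝ≥0∞)) := (hc.tendsto 0).mono_left nhdsWithin_le_nhds
  rw [add_zero] at ht
  exact ge_of_tendsto ht (eventually_nhdsWithin_of_forall fun δ hδ => h δ hδ)

/-- Sobolev embedding for `s > d / p`. -/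
lemma exists_embedding [CompleteSpace F] {s : ℝ} (hpd : (d : ℝ) < p) (hs : (d : ℝ) / p < s)
    (hs0 : 0 < s) :
    ∃ C : ℝ≥0, ∀ (f : Euc d → F) (c : ℝ≥0), sobolevENorm s (ENNReal.ofReal p) f ≤ c →
      SobolevBound p ⌊s⌋₊ f (C * c) ∧ (∀ᵐ x, ‖f x‖₊ ≤ C * c) ∧
        ∃ g, Continuous g ∧ f =ᵐ[volume] g := by
  obtain ⟨CM, hCM1, hCM⟩ := exists_morrey_const d hpd
  -- For integer s the norm already is the weak Sobolev norm, with ⌊s⌋₊ ≥ 1, and Morrey's inequality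
  -- applies. Otherwise ⌊s⌋₊ < s strictly, which leaves room for ⌊s⌋₊ derivatives on the Bessel
  -- kernel.
  by_cases hint : s = (⌊s⌋₊ : ℝ)
  · refine ⟨CM, fun f c h => ?_⟩
    rw [sobolevENorm, if_pos hint] at h
    have h1 := sobolevBound_of_weakSobolevENorm_le h
    obtain ⟨k, hk⟩ : ∃ k, ⌊s⌋₊ = k + 1 := by
      refine Nat.exists_eq_succ_of_ne_zero fun h0 => ?_
      rw [h0] at hint
      simp only [Nat.cast_zero] at hint
      exact hs0.ne' hint
    have h2 := h1
    rw [hk] at h2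
    exact ⟨h1.mono (le_mul_of_one_le_left zero_le hCM1), hCM k f c h2, h2.exists_continuous hpd⟩
  · have hp0 : 0 < p := by linarith [hp.out]
    have hfl : (⌊s⌋₊ : ℝ) < s := lt_of_le_of_ne (Nat.floor_le hs0.le) (Ne.symm hint)
    obtain ⟨C1, hC1⟩ := exists_sobolevBound_potential (F := F) (p := p) (a := s / 2) ⌊s⌋₊
      (by linarith) (IsGaussPoly.gauss (d := d))
    have ha : (d : ℝ) / (2 * p) < s / 2 := by
      rw [mul_comm, ← div_div]
      linarith
    obtain ⟨C2, hC2⟩ := exists_potential_bound (F := F) (p := p) ha (IsGaussPoly.gauss (d := d))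
    set κ : ℝ := (Real.Gamma (s / 2))⁻¹ * (4 * Real.pi) ^ (-(d : ℝ) / 2) with hκ
    obtain ⟨C3, hC3⟩ := exists_sobolevBound_const_smul (F := F) (d := d) (p := p) hpd ⌊s⌋₊ κ
    refine ⟨jetCard d ⌊s⌋₊ * (C3 * C1) + ‖κ‖₊ * C2, fun f c h => ?_⟩
    rw [sobolevENorm, if_neg hint] at h
    have key : ∀ δ : ℝ≥0, 0 < δ → ∃ g : Euc d → F, IsBesselPotential s f g ∧
        eLpNorm g (ENNReal.ofReal p) volume ≤ (c + δ : ℝ≥0) := by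
      intro δ hδ
      have h1 : besselENorm s (ENNReal.ofReal p) f < (c + δ : ℝ≥0) :=
        h.trans_lt (by exact_mod_cast lt_add_of_pos_right c hδ)
      rw [besselENorm, iInf_lt_iff] at h1
      obtain ⟨g, hg⟩ := h1
      exact ⟨g.1, g.2, hg.le⟩
    refine ⟨?_, ?_, ?_⟩
    -- The limit δ → 0 is taken in the Sobolev norm rather than in `SobolevBound`; the passage to
    -- the norm costs the factor `jetCard`.
    · refine (sobolevBound_of_weakSobolevENorm_le (c := jetCard d ⌊s⌋₊ * (C3 * C1) * c) ?_).mono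
        (by gcongr; exact le_self_add)
      refine le_of_forall_le_mul_add fun δ hδ => ?_
      obtain ⟨g, hg, hgc⟩ := key δ hδ
      have h1 := (hC3 _ _ (hC1 g _ hg.1 hgc)).congr_ae hg.ae_eq.symm
      refine h1.weakSobolevENorm_le.trans (le_of_eq ?_)
      congr 1; ring
    · have h2 : eLpNorm f ⊤ volume ≤ (‖κ‖₊ * C2 * c : ℝ≥0) := by
        refine le_of_forall_le_mul_add fun δ hδ => ?_
        obtain ⟨g, hg, hgc⟩ := key δ hδ
        rw [eLpNorm_congr_ae hg.ae_eq, eLpNorm_const_smul]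
        have h3 : eLpNorm (potential (heatMix (s / 2) fun x => Real.exp (-‖x‖ ^ 2 / 4)) g) ⊤
            volume ≤ (C2 * (c + δ) : ℝ≥0) := by
          rw [eLpNorm_exponent_top]
          exact eLpNormEssSup_le_of_ae_enorm_bound (Eventually.of_forall fun x =>
            (enorm_potential_le _ g x).trans (hC2 g _ hg.1 hgc x))
        calc _ ≤ ‖κ‖ₑ * (C2 * (c + δ) : ℝ≥0) := by gcongr
          _ = _ := by rw [enorm_eq_nnnorm, ← ENNReal.coe_mul, mul_assoc]
      rw [eLpNorm_exponent_top] at h2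
      filter_upwards [enorm_ae_le_eLpNormEssSup f volume] with x hx
      have h3 : ‖f x‖₊ ≤ ‖κ‖₊ * C2 * c := by exact_mod_cast hx.trans h2
      exact h3.trans (by gcongr; exact le_add_self)
    -- For continuity any density of finite norm will do.
    · obtain ⟨g, hg, hgc⟩ := key 1 one_pos
      obtain ⟨f', hf', he⟩ := potential_exists_continuous (p := p) (a := s / 2) (by linarith) ha
        IsGaussPoly.gauss (g := g) ⟨hg.1, hgc.trans_lt ENNReal.coe_lt_top⟩
      exact ⟨κ • f', hf'.const_smul κ, hg.ae_eq.trans (he.const_smul κ)⟩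

lemma sobolevENorm_congr_ae [CompleteSpace F] (s : ℝ) (q : ℝ≥0∞) {f g : Euc d → F}
    (h : f =ᵐ[volume] g) : sobolevENorm s q f = sobolevENorm s q g := by
  have key : ∀ {f g : Euc d → F}, f =ᵐ[volume] g → sobolevENorm s q g ≤ sobolevENorm s q f := by
    intro f g h
    unfold sobolevENorm
    split_ifs
    · refine le_iInf fun D => iInf_le_of_le ⟨D.1, fun j α => ⟨(D.2 j α).1.congr h, (D.2 j α).2.1,
        fun ψ hψ hc => ?_⟩⟩ le_rfl
      rw [← (D.2 j α).2.2 ψ hψ hc]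
      exact integral_congr_ae (h.mono fun x hx => by simp only [hx])
    · refine le_iInf fun D => iInf_le_of_le ⟨D.1, D.2.1, ?_⟩ le_rfl
      filter_upwards [D.2.2, h] with x hx hx'
      exact ⟨hx.1, by rw [← hx', hx.2]⟩
  exact le_antisymm (key h.symm) (key h)

end Embedding

/-! ### Abstract local systems: weighted pieces, truncations and gluing. -/

/-- Charts `e i` of `X \ Z` with a partition of unity `ρ`, cut-off functions `θ i` equal to `1` on the
support of `ρ i` and zero outside the closed sets `K i`, and functions `ht i` on the chart domains, which serve as exponents of weights. -/
structure LocalSystem (ι X : Type*) [Fintype ι] [TopologicalSpace X] (Z : Set X) (d : ℕ) where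
  e : ι → OpenPartialHomeomorph X (Euc d)
  notMem : ∀ i, ∀ x ∈ (e i).source, x ∉ Z
  ρ : ι → X → ℝ
  sum_ρ : ∀ x ∉ Z, ∑ i, ρ i x = 1
  θ : ι → Euc d → ℝ
  continuous_θ : ∀ i, Continuous (θ i)
  K : ι → Set (Euc d)
  isClosed_K : ∀ i, IsClosed (K i)
  support_θ : ∀ i, Function.support (θ i) ⊆ K i
  K_subset : ∀ i, K i ⊆ (e i).target
  eq_one : ∀ i, ∀ x ∉ Z, ρ i x ≠ 0 → x ∈ (e i).source ∧ θ i (e i x) = 1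
  closed_image : ∀ i, ∃ A, IsClosed A ∧ A \ Z = (e i).symm '' K i
  ht : ι → Euc d → ℝ
  continuous_ht : ∀ i, Continuous (ht i)

namespace LocalSystem
set_option linter.unusedSectionVars false

section Algebra

variable {ι X : Type*} [Fintype ι] [TopologicalSpace X] {Z : Set X} {d : ℕ}
  (S : LocalSystem ι X Z d)
  {F G H : Type*} [NormedAddCommGroup F] [NormedSpace ℝ F] [NormedAddCommGroup G] [NormedSpace ℝ G]
  [NormedAddCommGroup H] [NormedSpace ℝ H]

open Classical in
/-- The `i`-th member of the partition of unity with the weight `exp (δ ht)`, in coordinates. -/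
def eta (δ : ℝ) (i : ι) (z : Euc d) : ℝ :=
  if z ∈ (S.e i).target then S.ρ i ((S.e i).symm z) * Real.exp (δ * S.ht i z) else 0

/-- The localized and weighted function in coordinates. -/
def piece (δ : ℝ) (i : ι) (u : X → F) (z : Euc d) : F := S.eta δ i z • u ((S.e i).symm z)

/-- The function `θ i u` in coordinates. -/
def trunc (i : ι) (u : X → F) (z : Euc d) : F := S.θ i z • u ((S.e i).symm z)

/-- The change of coordinates. -/
def trans (i j : ι) (z : Euc d) : Euc d := S.e j ((S.e i).symm z)

/-- The domain of the change of coordinates. -/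
def transDom (i j : ι) : Set (Euc d) := ((S.e i).symm.trans (S.e j)).source

open Classical in
/-- The factor with which the `j`-th piece enters the `i`-th truncation. -/
def factor (δ : ℝ) (i j : ι) (z : Euc d) : ℝ :=
  if z ∈ S.transDom i j then
    S.θ i z * (S.θ j (S.trans i j z) * Real.exp (-(δ * S.ht j (S.trans i j z)))) else 0

open Classical in
/-- The function reconstructed from its pieces. -/
def glue (δ : ℝ) (Q : ι → Euc d → F) (x : X) : F :=
  ∑ j, if x ∈ (S.e j).source then
    (S.θ j (S.e j x) * Real.exp (-(δ * S.ht j (S.e j x)))) • Q j (S.e j x) else 0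

variable {S}

lemma mem_transDom {i j : ι} {z : Euc d} :
    z ∈ S.transDom i j ↔ z ∈ (S.e i).target ∧ (S.e i).symm z ∈ (S.e j).source := by
  simp [transDom]

lemma symm_notMem {i : ι} {z : Euc d} (hz : z ∈ (S.e i).target) : (S.e i).symm z ∉ Z :=
  S.notMem i _ ((S.e i).map_target hz)

lemma mem_target_of_θ_ne {i : ι} {z : Euc d} (h : S.θ i z ≠ 0) : z ∈ (S.e i).target :=
  S.K_subset i (S.support_θ i h)

lemma eta_ne {δ : ℝ} {i : ι} {z : Euc d} (h : S.eta δ i z ≠ 0) :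
    z ∈ (S.e i).target ∧ S.θ i z = 1 := by
  rw [eta] at h
  split_ifs at h with hz
  · refine ⟨hz, ?_⟩
    have := (S.eq_one i _ (symm_notMem hz) (left_ne_zero_of_mul h)).2
    rwa [(S.e i).right_inv hz] at this
  · exact absurd rfl h

lemma piece_congr {δ : ℝ} {i : ι} {u v : X → F} (h : ∀ x ∉ Z, u x = v x) :
    S.piece δ i u = S.piece δ i v := by
  ext z
  by_cases hz : z ∈ (S.e i).target
  · rw [piece, piece, h _ (symm_notMem hz)]
  · simp [piece, eta, hz]

lemma trunc_congr {i : ι} {u v : X → F} (h : ∀ x ∉ Z, u x = v x) : S.trunc i u = S.trunc i v := by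
  ext z
  by_cases hz : S.θ i z = 0
  · simp [trunc, hz]
  · rw [trunc, trunc, h _ (symm_notMem (mem_target_of_θ_ne hz))]

/-- Where the weight `eta` is nonzero the cut-off θ equals one, so there u may be replaced by its
truncation inside g; the value of g at 0 plays no role. -/
lemma piece_comp (δ : ℝ) (i : ι) (g : F → G) (u : X → F) (z : Euc d) :
    S.piece δ i (fun x => g (u x)) z = S.eta δ i z • g (S.trunc i u z) := by
  by_cases h : S.eta δ i z = 0
  · simp [piece, h]
  · rw [piece, trunc, (eta_ne h).2, one_smul]

lemma piece_bilin (δ : ℝ) (i : ι) (B : F →L[ℝ] G →L[ℝ] H) (a : X → F) (u : X → G) (z : Euc d) :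
    S.piece δ i (fun x => B (a x) (u x)) z = B (S.piece δ i a z) (S.trunc i u z) := by
  by_cases h : S.eta δ i z = 0
  · simp [piece, h]
  · rw [piece, piece, trunc, (eta_ne h).2, one_smul, map_smul, smul_apply]

lemma piece_bilin_const (δ : ℝ) (i : ι) (B : F →L[ℝ] G →L[ℝ] H) (a : X → F) (v : G) (z : Euc d) :
    S.piece δ i (fun x => B (a x) v) z = B (S.piece δ i a z) v := by
  rw [piece, piece, map_smul, smul_apply]

lemma piece_add (δ : ℝ) (i : ι) (u v : X → F) :
    S.piece δ i (u + v) = S.piece δ i u + S.piece δ i v := by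
  ext z; simp [piece]

lemma piece_sub (δ : ℝ) (i : ι) (u v : X → F) :
    S.piece δ i (u - v) = S.piece δ i u - S.piece δ i v := by
  ext z; simp [piece, smul_sub]

lemma trunc_sub (i : ι) (u v : X → F) : S.trunc i (u - v) = S.trunc i u - S.trunc i v := by
  ext z; simp [trunc, smul_sub]

/-- The exponential weights cancel, θ j = 1 on the support of ρ j, and the functions ρ j add up to
one. -/
lemma glue_piece (δ : ℝ) (u : X → F) {x : X} (hx : x ∉ Z) :
    S.glue δ (fun i => S.piece δ i u) x = u x := by
  rw [glue]
  calc _ = ∑ j, S.ρ j x • u x := by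
        refine Finset.sum_congr rfl fun j _ => ?_
        by_cases h : S.ρ j x = 0
        · split_ifs with hs
          · simp [piece, eta, (S.e j).map_source hs, (S.e j).left_inv hs, h]
          · simp [h]
        · obtain ⟨hs, h1⟩ := S.eq_one j x hx h
          rw [if_pos hs, piece, eta, if_pos ((S.e j).map_source hs), (S.e j).left_inv hs, h1, smul_smul,
            one_mul, mul_left_comm, ← Real.exp_add]
          simp
    _ = u x := by rw [← Finset.sum_smul, S.sum_ρ x hx, one_smul]

lemma trunc_glue (δ : ℝ) (Q : ι → Euc d → F) (i : ι) (z : Euc d) :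
    S.trunc i (S.glue δ Q) z = ∑ j, S.factor δ i j z • Q j (S.trans i j z) := by
  rw [trunc, glue, Finset.smul_sum]
  refine Finset.sum_congr rfl fun j _ => ?_
  by_cases hz : S.θ i z = 0
  · simp [factor, hz]
  · have ht := mem_target_of_θ_ne hz
    by_cases h : (S.e i).symm z ∈ (S.e j).source
    · rw [if_pos h, factor, if_pos (mem_transDom.2 ⟨ht, h⟩), smul_smul, trans]
    · rw [if_neg h, factor, if_neg (fun hc => h (mem_transDom.1 hc).2)]
      simp

/-- This converts what the norm controls, the weighted pieces in their own charts, into the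
unweighted function in chart i: each piece is transported by a transition map and multiplied by a
factor containing e^{-δ ht}. -/
lemma trunc_eq_sum (δ : ℝ) (u : X → F) (i : ι) (z : Euc d) :
    S.trunc i u z = ∑ j, S.factor δ i j z • S.piece δ j u (S.trans i j z) := by
  rw [← trunc_glue, trunc_congr (v := u) (fun x hx => glue_piece δ u hx)]

variable (S) in
/-- The sum of the Sobolev norms of the pieces. -/
def pieceNorm (p s δ : ℝ) (u : X → F) : ℝ≥0∞ :=
  ∑ i, sobolevENorm s (ENNReal.ofReal p) (S.piece δ i u)

variable (S) in
/-- The transition maps are bounded diffeomorphisms on the supports of the factors. -/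
def GoodTransitions (δ : ℝ) : Prop := ∀ i j, ∃ T J c₀,
  IsTransition (S.trans i j) (S.transDom i j) T J c₀ ∧ BoundedSmooth (S.factor δ i j) ∧
    Function.support (S.factor δ i j) ⊆ T

variable (S) in
/-- The weighted members of the partition of unity are in all Sobolev spaces. -/
def GoodWeights (p δ : ℝ) : Prop := ∀ i m, ∃ c, SobolevBound p m (S.eta δ i) c

lemma pieceNorm_congr {p s δ : ℝ} {u v : X → F} (h : ∀ x ∉ Z, u x = v x) :
    S.pieceNorm p s δ u = S.pieceNorm p s δ v := by
  simp only [pieceNorm, piece_congr h]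

lemma sobolevENorm_piece_le {p s δ : ℝ} {u : X → F} {c : ℝ≥0∞} (h : S.pieceNorm p s δ u ≤ c) (i : ι) :
    sobolevENorm s (ENNReal.ofReal p) (S.piece δ i u) ≤ c :=
  (Finset.single_le_sum (f := fun i => sobolevENorm s (ENNReal.ofReal p) (S.piece δ i u))
    (fun _ _ => bot_le) (Finset.mem_univ i)).trans h

end Algebra

section Analysis

variable {ι X : Type*} [Fintype ι] [TopologicalSpace X] {Z : Set X} {d : ℕ}
  {S : LocalSystem ι X Z d}
  {F G H : Type*} [NormedAddCommGroup F] [NormedSpace ℝ F] [NormedAddCommGroup G] [NormedSpace ℝ G]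
  [NormedAddCommGroup H] [NormedSpace ℝ H] [CompleteSpace F] [CompleteSpace G] [CompleteSpace H]
variable {p : ℝ} [hp : Fact (1 < p)] {s δ : ℝ}

lemma pieceNorm_congr_ae {m : ℝ} {u v : X → F}
    (h : ∀ i, S.piece δ i u =ᵐ[volume] S.piece δ i v) :
    S.pieceNorm p m δ u = S.pieceNorm p m δ v := by
  unfold pieceNorm
  exact Finset.sum_congr rfl fun i _ => sobolevENorm_congr_ae _ _ (h i)

/-- The embedding is applied to each piece; the transition maps carry both the Sobolev bound and the
sup bound to chart i, where the pieces are summed. -/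
lemma exists_multiplierBound_trunc (hS : S.GoodTransitions δ) (hpd : (d : ℝ) < p)
    (hs : (d : ℝ) / p < s) (hs0 : 0 < s) :
    ∃ C : ℝ≥0, ∀ (u : X → F) (c : ℝ≥0), S.pieceNorm p s δ u ≤ c →
      ∀ i, MultiplierBound p ⌊s⌋₊ (S.trunc i u) (C * c) := by
  obtain ⟨C, hC⟩ := exists_embedding (F := F) hpd hs hs0
  choose T J c₀ hT hζ hζT using hS
  choose K hK using fun i j => (hT i j).exists_sobolevBound_smul_comp (F := F) (p := p) ⌊s⌋₊
    (hζ i j) (hζT i j)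
  choose M hM using fun i j => (hζ i j).exists_nnnorm_le
  refine ⟨∑ i, ∑ j, (K i j + M i j) * C, fun u c hu i => ?_⟩
  have e : S.trunc i u = ∑ j, fun z => S.factor δ i j z • S.piece δ j u (S.trans i j z) := by
    ext z
    rw [Finset.sum_apply, trunc_eq_sum δ]
  have h0 := fun j => hC _ c (sobolevENorm_piece_le hu j)
  have hle : ∑ j, (K i j + M i j) * (C * c) ≤ (∑ i, ∑ j, (K i j + M i j) * C) * c := by
    simp_rw [← mul_assoc]
    rw [← Finset.sum_mul]
    refine mul_le_mul' ?_ le_rfl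
    exact Finset.single_le_sum (f := fun i => ∑ j, (K i j + M i j) * C) (fun _ _ => zero_le)
      (Finset.mem_univ i)
  have h1 : SobolevBound p ⌊s⌋₊ (S.trunc i u) (∑ j, K i j * (C * c)) := by
    rw [e]
    exact SobolevBound.sum _ fun j _ => hK i j _ _ (h0 j).1
  refine (h1.multiplierBound (c₂ := ∑ j, M i j * (C * c)) (c := ∑ j, (K i j + M i j) * (C * c))
    ?_ ?_ ?_).mono hle
  · have h2 : ∀ j, ∀ᵐ z, ‖S.factor δ i j z • S.piece δ j u (S.trans i j z)‖₊ ≤ M i j * (C * c) := by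
      intro j
      have h3 := (hT i j).ae_comp (h0 j).2.1
      rw [ae_restrict_iff' (hT i j).isClosed.measurableSet] at h3
      filter_upwards [h3] with z hz
      rw [nnnorm_smul]
      by_cases hzT : z ∈ T i j
      · exact mul_le_mul' (hM i j z) (hz hzT)
      · have : S.factor δ i j z = 0 := by_contra fun hne => hzT (hζT i j hne)
        simp [this]
    filter_upwards [ae_all_iff.2 h2] with z hz
    rw [e, Finset.sum_apply]
    exact (nnnorm_sum_le _ _).trans (Finset.sum_le_sum fun j _ => hz j)
  · gcongr; exact le_self_add
  · gcongr; exact le_add_self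

/-- The preceding bound with c = 0, applied to the difference. -/
lemma trunc_ae_eq_of_pieceNorm_sub (hS : S.GoodTransitions δ) (hpd : (d : ℝ) < p)
    (hs : (d : ℝ) / p < s) (hs0 : 0 < s) {u v : X → F} (h : S.pieceNorm p s δ (u - v) = 0) (i : ι) :
    S.trunc i u =ᵐ[volume] S.trunc i v := by
  obtain ⟨C, hC⟩ := exists_multiplierBound_trunc (F := F) hS hpd hs hs0
  filter_upwards [(hC (u - v) 0 (by simp [h]) i).1.2] with z hz
  rw [mul_zero, nonpos_iff_eq_zero, nnnorm_eq_zero, trunc_sub, Pi.sub_apply] at hz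
  exact sub_eq_zero.1 hz

/-- At a point of the j-th chart the j-th summand is continuous as it stands. At any other point off
Z it vanishes nearby, because the image of `K j` is closed relative to the complement of Z; this is
the purpose of the field `closed_image`. -/
lemma continuousOn_glue (δ : ℝ) {Q : ι → Euc d → F} (hQ : ∀ i, Continuous (Q i)) :
    ContinuousOn (S.glue δ Q) Zᶜ := by
  unfold glue
  refine continuousOn_finsetSum _ fun j _ x hx => ?_
  by_cases hs : x ∈ (S.e j).source
  · refine ContinuousAt.continuousWithinAt ?_
    have h1 : ContinuousAt (S.e j) x := (S.e j).continuousAt hs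
    have h2 : ContinuousAt (fun x => (S.θ j (S.e j x) * Real.exp (-(δ * S.ht j (S.e j x)))) •
        Q j (S.e j x)) x :=
      (((S.continuous_θ j).continuousAt.comp h1).mul (Real.continuous_exp.continuousAt.comp
        (((S.continuous_ht j).continuousAt.comp h1).const_mul δ).neg)).smul
        ((hQ j).continuousAt.comp h1)
    refine h2.congr ?_
    filter_upwards [(S.e j).open_source.mem_nhds hs] with y hy
    rw [if_pos hy]
  · obtain ⟨A, hA, hAZ⟩ := S.closed_image j
    have hxA : x ∉ A := fun hxA => by
      have : x ∈ A \ Z := ⟨hxA, hx⟩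
      rw [hAZ] at this
      obtain ⟨z, hz, rfl⟩ := this
      exact hs ((S.e j).map_target (S.K_subset j hz))
    refine (continuousWithinAt_const (b := (0 : F))).congr_of_eventuallyEq ?_ (if_neg hs)
    filter_upwards [mem_nhdsWithin_of_mem_nhds (hA.isOpen_compl.mem_nhds hxA),
      self_mem_nhdsWithin] with y hy hyZ
    split_ifs with hys
    · have : S.θ j (S.e j y) = 0 := by
        by_contra hne
        refine hy ?_
        have : y ∈ A \ Z := by
          rw [hAZ]
          exact ⟨S.e j y, S.support_θ j hne, (S.e j).left_inv hys⟩
        exact this.1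
      rw [this, zero_mul, zero_smul]
    · rfl

/-- Each piece is replaced by its continuous representative and the results are glued. Transition
maps pull null sets back to null sets, so no truncation changes on a set of positive measure. -/
lemma exists_continuousOn_trunc_ae_eq (hS : S.GoodTransitions δ) (hpd : (d : ℝ) < p)
    (hs : (d : ℝ) / p < s) (hs0 : 0 < s) {u : X → F} (hu : S.pieceNorm p s δ u < ⊤) :
    ∃ v : X → F, ContinuousOn v Zᶜ ∧ ∀ i, S.trunc i v =ᵐ[volume] S.trunc i u := by
  obtain ⟨C, hC⟩ := exists_embedding (F := F) hpd hs hs0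
  choose T J c₀ hT hζ hζT using hS
  have h0 := fun j => hC (S.piece δ j u) (S.pieceNorm p s δ u).toNNReal
    (sobolevENorm_piece_le (ENNReal.coe_toNNReal hu.ne).ge j)
  choose Q hQ hQe using fun j => (h0 j).2.2
  refine ⟨S.glue δ Q, continuousOn_glue δ hQ, fun i => ?_⟩
  have h2 : ∀ j, ∀ᵐ z, S.factor δ i j z • Q j (S.trans i j z) =
      S.factor δ i j z • S.piece δ j u (S.trans i j z) := by
    intro j
    have h3 := (hT i j).ae_comp (hQe j)
    rw [ae_restrict_iff' (hT i j).isClosed.measurableSet] at h3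
    filter_upwards [h3] with z hz
    by_cases hzT : z ∈ T i j
    · rw [hz hzT]
    · have : S.factor δ i j z = 0 := by_contra fun hne => hzT (hζT i j hne)
      simp [this]
  filter_upwards [ae_all_iff.2 h2] with z hz
  rw [trunc_glue, trunc_eq_sum δ]
  exact Finset.sum_congr rfl fun j _ => hz j

lemma piece_ae_eq_of_trunc {δ' : ℝ} {u v : X → F} {i : ι}
    (h : S.trunc i u =ᵐ[volume] S.trunc i v) (g : F → G) :
    S.piece δ' i (fun x => g (u x)) =ᵐ[volume] S.piece δ' i (fun x => g (v x)) := by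
  filter_upwards [h] with z hz
  rw [piece_comp, piece_comp, hz]

/-- At each x some ρ i is nonzero, and there the truncation equals u. A failure of the bound at one
point would by continuity persist on an open set, which has positive measure. -/
lemma exists_norm_le_of_continuousOn (hS : S.GoodTransitions δ) (hpd : (d : ℝ) < p)
    (hs : (d : ℝ) / p < s) (hs0 : 0 < s) :
    ∃ C : ℝ≥0, ∀ (u : X → F) (c : ℝ≥0), ContinuousOn u Zᶜ → S.pieceNorm p s δ u ≤ c →
      ∀ x ∉ Z, ‖u x‖₊ ≤ C * c := by
  obtain ⟨C, hC⟩ := exists_multiplierBound_trunc (F := F) hS hpd hs hs0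
  refine ⟨C, fun u c hu huc x hx => ?_⟩
  obtain ⟨i, hi⟩ : ∃ i, S.ρ i x ≠ 0 := by
    by_contra! h0
    have := S.sum_ρ x hx
    simp [h0] at this
  obtain ⟨hxs, hx1⟩ := S.eq_one i x hx hi
  have h1 := (hC u c huc i).1.2
  have hcont : ContinuousOn (S.trunc i u) (S.e i).target := by
    refine (S.continuous_θ i).continuousOn.smul (hu.comp (S.e i).continuousOn_symm
      fun z hz => symm_notMem hz)
  have hle : ∀ z ∈ (S.e i).target, ‖S.trunc i u z‖₊ ≤ C * c := by
    intro z hz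
    by_contra! hlt
    have hopen : {y | ‖S.trunc i u y‖₊ ≤ C * c}ᶜ ∈ 𝓝 z := by
      have := (hcont.continuousAt ((S.e i).open_target.mem_nhds hz)).nnnorm.eventually
        (lt_mem_nhds hlt)
      filter_upwards [this] with y hy using not_le.2 hy
    have := Measure.measure_pos_of_mem_nhds volume hopen
    exact this.ne' h1
  have := hle _ ((S.e i).map_source hxs)
  rwa [trunc, hx1, one_smul, (S.e i).left_inv hxs] at this

end Analysis

section Estimates

variable {ι X : Type*} [Fintype ι] [TopologicalSpace X] {Z : Set X} {d : ℕ}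
  {S : LocalSystem ι X Z d}
  {V : Type} [NormedAddCommGroup V] [NormedSpace ℝ V] [ProperSpace V] [CompleteSpace V]
  {F : Type*} [NormedAddCommGroup F] [NormedSpace ℝ F] [CompleteSpace F]
variable {p : ℝ} [hp : Fact (1 < p)] {s δ δ' : ℝ}

lemma pieceNorm_le_of_sobolevBound {m : ℕ} {u : X → F} {c : ℝ≥0}
    (h : ∀ i, SobolevBound p m (S.piece δ i u) c) :
    S.pieceNorm p m δ u ≤ (Fintype.card ι * (jetCard d m * c) : ℝ≥0) := by
  have h1 : ∀ i ∈ Finset.univ, sobolevENorm (m : ℝ) (ENNReal.ofReal p) (S.piece δ i u) ≤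
      (jetCard d m * c : ℝ≥0) := fun i _ => by
    rw [sobolevENorm_natCast]
    exact (h i).weakSobolevENorm_le
  refine (Finset.sum_le_card_nsmul _ _ _ h1).trans (le_of_eq ?_)
  simp

/-- The decay of the target weight enters here: `eta` lies in W^m_p, so its product with a mere
multiplier, not itself in L_p, does as well. -/
lemma exists_sobolevBound_piece (hW : S.GoodWeights p δ') (hpd : (d : ℝ) < p) (m : ℕ) :
    ∃ C : ℝ≥0, ∀ (u : X → F) (f : ι → Euc d → F) (c : ℝ≥0),
      (∀ i z, S.piece δ' i u z = S.eta δ' i z • f i z) → (∀ i, MultiplierBound p m (f i) c) →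
      S.pieceNorm p m δ' u ≤ (C * c : ℝ≥0) := by
  choose c hc using fun i => hW i m
  obtain ⟨K, hK⟩ := exists_sobolevBound_bilin (d := d) hpd (ContinuousLinearMap.lsmul ℝ ℝ (E := F)) m
  refine ⟨Fintype.card ι * (jetCard d m * (K * ∑ i, c i)), fun u f c' he hf => ?_⟩
  have h1 : ∀ i, SobolevBound p m (S.piece δ' i u) (K * (∑ i, c i) * c') := fun i => by
    have := hK (S.eta δ' i) (f i) (c i) c' (Or.inr ⟨hc i, hf i⟩)
    refine (this.congr_ae (Eventually.of_forall fun z => (he i z).symm)).mono ?_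
    gcongr
    exact Finset.single_le_sum (f := c) (fun _ _ => zero_le) (Finset.mem_univ i)
  refine (pieceNorm_le_of_sobolevBound h1).trans (le_of_eq ?_)
  congr 1
  ring

variable (hS : S.GoodTransitions δ) (hW : S.GoodWeights p δ') (hpd : (d : ℝ) < p)
  (hs : (d : ℝ) / p < s) (hs0 : 0 < s)

include hS hpd hs hs0

lemma multiplierBound_trunc_add_const {w : X → V} (hw : S.pieceNorm p s δ w < ⊤) (v : V) :
    ∃ c, ∀ i, MultiplierBound p ⌊s⌋₊ (fun z => S.trunc i w z + v) c := by
  obtain ⟨C, hC⟩ := exists_multiplierBound_trunc (F := V) hS hpd hs hs0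
  exact ⟨_, fun i => (hC w _ (ENNReal.coe_toNNReal hw.ne).ge i).add (MultiplierBound.const v)⟩

include hW

lemma pieceNorm_comp_lt_top {φ : V → F} (hφ : ContDiff ℝ ⌊s⌋₊ φ) {w : X → V}
    (hw : S.pieceNorm p s δ w < ⊤) (v : V) :
    S.pieceNorm p ⌊s⌋₊ δ' (fun x => φ (w x + v)) < ⊤ := by
  obtain ⟨C, hC⟩ := exists_sobolevBound_piece (F := F) hW hpd ⌊s⌋₊
  obtain ⟨c, hc⟩ := multiplierBound_trunc_add_const hS hpd hs hs0 hw v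
  choose K hK using fun i => exists_multiplierBound_comp hpd _ hφ (hc i)
  refine (hC _ (fun i z => φ (S.trunc i w z + v)) (∑ i, K i)
    (fun i z => piece_comp δ' i (fun ξ => φ (ξ + v)) w z) fun i => (hK i).mono ?_).trans_lt
    ENNReal.coe_lt_top
  exact Finset.single_le_sum (f := K) (fun _ _ => zero_le) (Finset.mem_univ i)

lemma exists_pieceNorm_comp_sub_le {φ : V → F} (hφ : ContDiff ℝ ⌊s⌋₊ φ) {w : X → V}
    (hw : S.pieceNorm p s δ w < ⊤) (v : V) {ε : ℝ≥0} (hε : 0 < ε) :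
    ∃ r : ℝ≥0, 0 < r ∧ ∀ (h : X → V) (y : V), S.pieceNorm p s δ h ≤ r → ‖y‖₊ ≤ r →
      S.pieceNorm p ⌊s⌋₊ δ' (fun x => φ (w x + h x + (v + y)) - φ (w x + v)) ≤ ε := by
  obtain ⟨C, hC⟩ := exists_sobolevBound_piece (F := F) hW hpd ⌊s⌋₊
  obtain ⟨c, hc⟩ := multiplierBound_trunc_add_const hS hpd hs hs0 hw v
  obtain ⟨K, hK⟩ := exists_multiplierBound_trunc (F := V) hS hpd hs hs0
  have hε' : 0 < ε / (C + 1) := div_pos hε (by positivity)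
  choose r hr0 hr using fun i => exists_multiplierBound_comp_sub hpd _ hφ (hc i) hε'
  -- A common radius for the finitely many charts; 1 is inserted so that the minimum exists even if
  -- there are none.
  obtain ⟨r₀, hr₀, hr₀le⟩ : ∃ r₀ : ℝ≥0, 0 < r₀ ∧ ∀ i, r₀ ≤ r i := by
    refine ⟨(insert 1 (Finset.univ.image r)).min' (by simp), ?_, fun i =>
      Finset.min'_le _ _ (by simp)⟩
    rw [Finset.lt_min'_iff]
    simp [hr0]
  -- The truncation of h contributes K r and the constant y contributes r.
  refine ⟨r₀ / (K + 1), div_pos hr₀ (by positivity), fun h y hh hy => ?_⟩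
  have hm : ∀ i, MultiplierBound p ⌊s⌋₊ (fun z => S.trunc i h z + y) (r i) := fun i => by
    refine ((hK h _ hh i).add ((MultiplierBound.const y).mono hy)).mono (le_trans ?_ (hr₀le i))
    rw [← add_one_mul, mul_div_cancel₀ _ (by positivity)]
  refine (hC _ (fun i z => φ (S.trunc i w z + v + (S.trunc i h z + y)) - φ (S.trunc i w z + v)) _
    (fun i z => ?_) fun i => hr i _ (hm i)).trans ?_
  · by_cases h0 : S.eta δ' i z = 0
    · simp [piece, h0]
    · rw [piece, trunc, trunc, (eta_ne h0).2, one_smul, one_smul, add_add_add_comm]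
  · norm_cast
    rw [mul_div_assoc']
    refine div_le_of_le_mul₀ zero_le zero_le ?_
    rw [mul_comm]; gcongr; exact le_self_add

lemma exists_pieceNorm_remainder_le {φ : V → F} (hφ : ContDiff ℝ (⌊s⌋₊ + 1) φ) {w : X → V}
    (hw : S.pieceNorm p s δ w < ⊤) (v : V) {ε : ℝ≥0} (hε : 0 < ε) :
    ∃ r₀ : ℝ≥0, 0 < r₀ ∧ ∀ r ≤ r₀, ∀ (h : X → V) (y : V), S.pieceNorm p s δ h ≤ r → ‖y‖₊ ≤ r →
      S.pieceNorm p ⌊s⌋₊ δ' (fun x => φ (w x + h x + (v + y)) - φ (w x + v) -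
        fderiv ℝ φ (w x + v) (h x + y)) ≤ (ε * r : ℝ≥0) := by
  obtain ⟨C, hC⟩ := exists_sobolevBound_piece (F := F) hW hpd ⌊s⌋₊
  obtain ⟨c, hc⟩ := multiplierBound_trunc_add_const hS hpd hs hs0 hw v
  obtain ⟨K, hK⟩ := exists_multiplierBound_trunc (F := V) hS hpd hs hs0
  -- The factor K + 1 is the multiplier size of h + y relative to r, and C is the cost of
  -- multiplication by the weights.
  have hε' : 0 < ε / (C * (K + 1) + 1) := div_pos hε (by positivity)
  choose r hr0 hr using fun i => exists_multiplierBound_remainder hpd _ hφ (hc i) hε'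
  obtain ⟨r₀, hr₀, hr₀le⟩ : ∃ r₀ : ℝ≥0, 0 < r₀ ∧ ∀ i, r₀ ≤ r i := by
    refine ⟨(insert 1 (Finset.univ.image r)).min' (by simp), ?_, fun i =>
      Finset.min'_le _ _ (by simp)⟩
    rw [Finset.lt_min'_iff]
    simp [hr0]
  refine ⟨r₀ / (K + 1), div_pos hr₀ (by positivity), fun r' hr' h y hh hy => ?_⟩
  have hle : (K + 1) * r' ≤ r₀ := by
    calc (K + 1) * r' ≤ (K + 1) * (r₀ / (K + 1)) := by gcongr
      _ = r₀ := mul_div_cancel₀ _ (by positivity)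
  have hm : ∀ i, MultiplierBound p ⌊s⌋₊ (fun z => S.trunc i h z + y) ((K + 1) * r') := fun i => by
    refine ((hK h _ hh i).add ((MultiplierBound.const y).mono hy)).mono ?_
    rw [add_one_mul]
  refine (hC _ (fun i z => φ (S.trunc i w z + v + (S.trunc i h z + y)) - φ (S.trunc i w z + v) -
    fderiv ℝ φ (S.trunc i w z + v) (S.trunc i h z + y)) _
    (fun i z => ?_) fun i => hr i _ (hle.trans (hr₀le i)) _ (hm i)).trans ?_
  · by_cases h0 : S.eta δ' i z = 0
    · simp [piece, h0]
    · rw [piece, trunc, trunc, (eta_ne h0).2, one_smul, one_smul, add_add_add_comm]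
  · norm_cast
    calc C * (ε / (C * (K + 1) + 1) * ((K + 1) * r')) = ε * r' * (C * (K + 1)) / (C * (K + 1) + 1) := by
          ring
      _ ≤ _ := by
        refine div_le_of_le_mul₀ zero_le zero_le ?_
        gcongr; exact le_self_add

omit hW in
-- A piece of the product is the weighted piece of a, in W^{[s]}_p, times the truncation of h plus
-- y, which is a multiplier. The target weight is carried by a alone, so no decay is needed.
lemma exists_pieceNorm_bilin_le :
    ∃ C : ℝ≥0, ∀ (a : X → V →L[ℝ] F) (h : X → V) (y : V) (c c' : ℝ≥0),
      S.pieceNorm p ⌊s⌋₊ δ' a ≤ c → S.pieceNorm p s δ h ≤ c' → ‖y‖₊ ≤ c' →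
      S.pieceNorm p ⌊s⌋₊ δ' (fun x => a x (h x + y)) ≤ (C * c * c' : ℝ≥0) := by
  obtain ⟨K, hK⟩ := exists_multiplierBound_trunc (F := V) hS hpd hs hs0
  obtain ⟨C, hC⟩ := exists_sobolevBound_bilin (d := d) hpd (evalBilin V F) ⌊s⌋₊
  refine ⟨Fintype.card ι * (jetCard d ⌊s⌋₊ * (C * (K + 1))), fun a h y c c' ha hh hy => ?_⟩
  have h1 : ∀ i, SobolevBound p ⌊s⌋₊ (S.piece δ' i (fun x => a x (h x + y)))
      (C * c * ((K + 1) * c')) := fun i => by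
    have ha' : SobolevBound p ⌊s⌋₊ (S.piece δ' i a) c := by
      refine sobolevBound_of_weakSobolevENorm_le ?_
      rw [← sobolevENorm_natCast]
      exact sobolevENorm_piece_le ha i
    have hm : MultiplierBound p ⌊s⌋₊ (fun z => S.trunc i h z + y) ((K + 1) * c') := by
      refine ((hK h _ hh i).add ((MultiplierBound.const y).mono hy)).mono ?_
      rw [add_one_mul]
    refine (hC _ _ _ _ (Or.inr ⟨ha', hm⟩)).congr_ae (Eventually.of_forall fun z => ?_)
    simp only [map_add]
    rw [← piece_bilin, ← piece_bilin_const, ← Pi.add_apply, ← piece_add]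
    simp only [evalBilin, ContinuousLinearMap.id_apply]
    rfl
  refine (pieceNorm_le_of_sobolevBound h1).trans (le_of_eq ?_)
  congr 1
  ring

end Estimates

end LocalSystem

/-! ### Bump functions, extension by zero and Jacobians of diffeomorphisms. -/

section BumpAndExtension

variable {V W : Type*} [NormedAddCommGroup V] [NormedSpace ℝ V] [NormedAddCommGroup W]
  [NormedSpace ℝ W]

lemma exists_bump [FiniteDimensional ℝ V] {K U : Set V} (hK : IsCompact K) (hU : IsOpen U)
    (hKU : K ⊆ U) : ∃ χ : V → ℝ, ContDiff ℝ ∞ χ ∧ HasCompactSupport χ ∧ tsupport χ ⊆ U ∧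
      ∀ᶠ x in 𝓝ˢ K, χ x = 1 := by
  have : ProperSpace V := FiniteDimensional.proper_real V
  obtain ⟨L, hL, hKL, hLU⟩ := exists_compact_between hK hU hKU
  obtain ⟨f, h1, h0, -⟩ := exists_contMDiffMap_one_nhds_of_subset_interior (n := ⊤) 𝓘(ℝ, V)
    hK.isClosed hKL
  have hs : tsupport f ⊆ L := closure_minimal
    (fun x hx => by_contra fun hxL => hx (h0 x hxL)) hL.isClosed
  exact ⟨f, contMDiff_iff_contDiff.1 f.contMDiff, hL.of_isClosed_subset (isClosed_tsupport _) hs,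
    hs.trans hLU, h1⟩

lemma contDiff_of_support_subset {f : V → W} {U T : Set V} (hU : IsOpen U) (hf : ContDiffOn ℝ ∞ f U)
    (hT : IsClosed T) (hTU : T ⊆ U) (hs : Function.support f ⊆ T) : ContDiff ℝ ∞ f := by
  rw [contDiff_iff_contDiffAt]
  intro z
  by_cases hz : z ∈ U
  · exact hf.contDiffAt (hU.mem_nhds hz)
  · refine (contDiffAt_const (c := (0 : W))).congr_of_eventuallyEq ?_
    filter_upwards [hT.isOpen_compl.mem_nhds fun h => hz (hTU h)] with y hy
    exact by_contra fun h => hy (hs h)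

/-- By the chain rule the derivatives of κ and of its left inverse compose to the identity, whose
determinant is one. -/
lemma det_fderiv_ne_zero [FiniteDimensional ℝ V] {κ κ' : V → V} {U U' : Set V} (hU : IsOpen U)
    (hU' : IsOpen U')
    (hκ : ContDiffOn ℝ ∞ κ U) (hκ' : ContDiffOn ℝ ∞ κ' U') (hm : MapsTo κ U U')
    (hl : LeftInvOn κ' κ U) {z : V} (hz : z ∈ U) : (fderiv ℝ κ z).det ≠ 0 := by
  have h1 := ((hκ.contDiffAt (hU.mem_nhds hz)).differentiableAt (by simp)).hasFDerivAt
  have h2 := ((hκ'.contDiffAt (hU'.mem_nhds (hm hz))).differentiableAt (by simp)).hasFDerivAt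
  have h3 := h2.comp z h1
  have h4 : HasFDerivAt (κ' ∘ κ) (ContinuousLinearMap.id ℝ V) z :=
    (hasFDerivAt_id z).congr_of_eventuallyEq (by
      filter_upwards [hU.mem_nhds hz] with y hy using hl hy)
  have h5 := h3.unique h4
  intro h0
  have h6 : ((fderiv ℝ κ' (κ z)).comp (fderiv ℝ κ z)).det = 0 := by
    change LinearMap.det ((fderiv ℝ κ' (κ z)).toLinearMap ∘ₗ (fderiv ℝ κ z).toLinearMap) = 0
    rw [LinearMap.det_comp]
    change _ * (fderiv ℝ κ z).det = 0
    rw [h0, mul_zero]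
  rw [h5] at h6
  simp [ContinuousLinearMap.det] at h6

end BumpAndExtension

/-! ### Transition maps on compact sets. -/

section Transitions

variable {d : ℕ}

/-- The absolute value of the determinant attains a positive minimum on T. The Jacobian entries are
multiplied by a bump function equal to one near T, which makes them globally bounded with all
derivatives. -/
lemma exists_isTransition_of_isCompact {κ : Euc d → Euc d} {V T : Set (Euc d)} (hV : IsOpen V)
    (hT : IsCompact T) (hTV : T ⊆ V) (hκ : ContDiffOn ℝ ∞ κ V) (hi : InjOn κ V)
    (hd : ∀ z ∈ V, (fderiv ℝ κ z).det ≠ 0) : ∃ J c₀, IsTransition κ V T J c₀ := by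
  obtain ⟨χ, hχ, hχc, hχV, hχ1⟩ := exists_bump hT hV hTV
  have hκ' : ContDiffOn ℝ ∞ (fderiv ℝ κ) V := hκ.fderiv_of_isOpen hV (by simp)
  obtain ⟨c₀, hc₀, hc₀le⟩ : ∃ c₀ : ℝ≥0, 0 < c₀ ∧ ∀ z ∈ T, (c₀ : ℝ) ≤ |(fderiv ℝ κ z).det| := by
    rcases T.eq_empty_or_nonempty with rfl | hne
    · exact ⟨1, one_pos, by simp⟩
    · have hcont : ContinuousOn (fun z => |(fderiv ℝ κ z).det|) T :=
        ((ContinuousLinearMap.continuous_det.comp_continuousOn hκ'.continuousOn).abs).mono hTV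
      obtain ⟨z, hz, hmin⟩ := hT.exists_isMinOn hne hcont
      exact ⟨⟨|(fderiv ℝ κ z).det|, abs_nonneg _⟩, abs_pos.2 (hd z (hTV hz)), fun y hy => hmin hy⟩
  refine ⟨fun i l z => χ z * (fderiv ℝ κ z (stdVec i)) l, c₀, hV, hT.isClosed, hTV, hκ, hi,
    fun i l => ?_, fun z hz i l => ?_, hc₀, hc₀le⟩
  · have hs : Function.support (fun z => χ z * (fderiv ℝ κ z (stdVec i)) l) ⊆ tsupport χ :=
      fun z hz => subset_tsupport _ (left_ne_zero_of_mul hz)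
    refine BoundedSmooth.of_hasCompactSupport (contDiff_of_support_subset hV ?_
      (isClosed_tsupport _) hχV hs) (hχc.of_isClosed_subset (isClosed_tsupport _)
        (closure_minimal hs (isClosed_tsupport _)))
    refine hχ.contDiffOn.mul ?_
    exact (coord_contDiff l).comp_contDiffOn (hκ'.clm_apply contDiffOn_const)
  · rw [hχ1.self_of_nhdsSet z hz, one_mul]

end Transitions

/-! ### Transition maps and cut-off functions on the half cylinder. -/

section Cylinder

variable {n : ℕ}

/-- `ℝ^{n+1} = ℝ × ℝ^n`. -/
def splitCoord (n : ℕ) : Euc (n + 1) ≃L[ℝ] ℝ × Euc n :=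
  (EuclideanSpace.equiv (Fin (n + 1)) ℝ).trans
    ((Fin.consEquivL ℝ (fun _ : Fin (n + 1) => ℝ)).symm.trans
      ((ContinuousLinearEquiv.refl ℝ ℝ).prodCongr (EuclideanSpace.equiv (Fin n) ℝ).symm))

lemma splitCoord_apply (z : Euc (n + 1)) : splitCoord n z = (z 0, crossCoord z) := rfl

lemma splitCoord_symm_zero (t : ℝ) (y : Euc n) : (splitCoord n).symm (t, y) 0 = t := rfl

lemma crossCoord_splitCoord_symm (t : ℝ) (y : Euc n) :
    crossCoord ((splitCoord n).symm (t, y)) = y := rfl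

/-- The projection to the last `n` coordinates. -/
def crossCLM (n : ℕ) : Euc (n + 1) →L[ℝ] Euc n :=
  (ContinuousLinearMap.snd ℝ ℝ (Euc n)).comp (splitCoord n : Euc (n + 1) →L[ℝ] ℝ × Euc n)

/-- The first coordinate. -/
def firstCLM (n : ℕ) : Euc (n + 1) →L[ℝ] ℝ :=
  (ContinuousLinearMap.fst ℝ ℝ (Euc n)).comp (splitCoord n : Euc (n + 1) →L[ℝ] ℝ × Euc n)

lemma crossCLM_apply (z : Euc (n + 1)) : crossCLM n z = crossCoord z := rfl

lemma firstCLM_apply (z : Euc (n + 1)) : firstCLM n z = z 0 := rfl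

lemma norm_le_add_crossCoord (z : Euc (n + 1)) : ‖z‖ ≤ |z 0| + ‖crossCoord z‖ := by
  refine le_of_sq_le_sq ?_ (by positivity)
  have h1 : ‖z‖ ^ 2 = |z 0| ^ 2 + ‖crossCoord z‖ ^ 2 := by
    rw [EuclideanSpace.norm_sq_eq, EuclideanSpace.norm_sq_eq, Fin.sum_univ_succ]
    rfl
  rw [h1]
  nlinarith [abs_nonneg (z 0), norm_nonneg (crossCoord z)]

/-- The map `(t, y) ↦ (t, τ y)`. -/
def cylMap (τ : Euc n → Euc n) (z : Euc (n + 1)) : Euc (n + 1) :=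
  (splitCoord n).symm (z 0, τ (crossCoord z))

lemma hasFDerivAt_cylMap {τ : Euc n → Euc n} {z : Euc (n + 1)} {τ' : Euc n →L[ℝ] Euc n}
    (h : HasFDerivAt τ τ' (crossCoord z)) : HasFDerivAt (cylMap τ)
      (((splitCoord n).symm : ℝ × Euc n →L[ℝ] Euc (n + 1)).comp
        (((ContinuousLinearMap.id ℝ ℝ).prodMap τ').comp
          (splitCoord n : Euc (n + 1) →L[ℝ] ℝ × Euc n))) z := by
  have h1 : HasFDerivAt (fun z : Euc (n + 1) => (z 0, τ (crossCoord z)))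
      ((firstCLM n).prod (τ'.comp (crossCLM n))) z :=
    (firstCLM n).hasFDerivAt.prodMk (HasFDerivAt.comp z (g := τ) (f := crossCLM n) h
      (crossCLM n).hasFDerivAt)
  exact ((splitCoord n).symm : ℝ × Euc n →L[ℝ] Euc (n + 1)).hasFDerivAt.comp z h1

/-- The Jacobian is the block matrix with blocks 1 and J(y), independent of t. Bounds over a compact
part of the cross section thus hold on the whole noncompact cylinder. The condition t₀ > 0 keeps the
closed set inside the open half cylinder. -/
lemma exists_isTransition_cylMap {τ : Euc n → Euc n} {V T : Set (Euc n)}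
    {J : Fin n → Fin n → Euc n → ℝ} {c₀ : ℝ≥0} (h : IsTransition τ V T J c₀) {t₀ : ℝ} (ht₀ : 0 < t₀) :
    ∃ J', IsTransition (cylMap τ) {z | 0 < z 0 ∧ crossCoord z ∈ V}
      {z | t₀ ≤ z 0 ∧ crossCoord z ∈ T} J' c₀ := by
  have hc0 : Continuous fun z : Euc (n + 1) => z 0 := (firstCLM n).continuous
  have hcc : Continuous fun z : Euc (n + 1) => crossCoord z := (crossCLM n).continuous
  refine ⟨fun i l z => Fin.cases (Fin.cases (1 : ℝ) (fun _ => 0) l)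
    (fun i => Fin.cases 0 (fun l => J i l (crossCoord z)) l) i, ?_, ?_, ?_, ?_, ?_, ?_, ?_, h.pos, ?_⟩
  · exact (isOpen_lt continuous_const hc0).inter (h.isOpen.preimage hcc)
  · exact (isClosed_le continuous_const hc0).inter (h.isClosed.preimage hcc)
  · exact fun z hz => ⟨ht₀.trans_le hz.1, h.subset hz.2⟩
  · refine ((splitCoord n).symm : ℝ × Euc n →L[ℝ] Euc (n + 1)).contDiff.comp_contDiffOn ?_
    exact (firstCLM n).contDiff.contDiffOn.prodMk
      (h.contDiffOn.comp (crossCLM n).contDiff.contDiffOn fun z hz => hz.2)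
  · intro z hz w hw he
    have h1 := (splitCoord n).symm.injective he
    simp only [Prod.mk.injEq] at h1
    refine (splitCoord n).injective ?_
    rw [splitCoord_apply, splitCoord_apply, h1.1, h.injOn hz.2 hw.2 h1.2]
  · intro i l
    refine Fin.cases (Fin.cases (BoundedSmooth.const 1) (fun _ => BoundedSmooth.const 0) l)
      (fun i => Fin.cases (BoundedSmooth.const 0)
        (fun l => (h.jacobian_bdd i l).comp_clm (crossCLM n)) l) i
  · intro z hz i l
    rw [(hasFDerivAt_cylMap (h.hasFDerivAt (h.subset hz.2))).fderiv]
    have key : ∀ v : Euc (n + 1), ((((splitCoord n).symm : ℝ × Euc n →L[ℝ] Euc (n + 1)).comp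
        (((ContinuousLinearMap.id ℝ ℝ).prodMap (fderiv ℝ τ (crossCoord z))).comp
          (splitCoord n : Euc (n + 1) →L[ℝ] ℝ × Euc n))) v) =
        (splitCoord n).symm (v 0, fderiv ℝ τ (crossCoord z) (crossCoord v)) := fun v => rfl
    rw [key]
    have e0 : crossCoord (stdVec (0 : Fin (n + 1))) = 0 := by
      ext j; simp [crossCoord, stdVec]
    have es : ∀ i : Fin n, crossCoord (stdVec i.succ) = stdVec i := fun i => by
      ext j; simp [crossCoord, stdVec]
    refine Fin.cases ?_ (fun i => ?_) i
    · rw [e0, map_zero]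
      refine Fin.cases ?_ (fun l => ?_) l
      · simp [splitCoord_symm_zero, stdVec]
      · change (crossCoord ((splitCoord n).symm (_, (0 : Euc n)))) l = 0
        rw [crossCoord_splitCoord_symm]; rfl
    · rw [es]
      refine Fin.cases ?_ (fun l => ?_) l
      · simp [splitCoord_symm_zero, stdVec]
      · change (crossCoord ((splitCoord n).symm (_, fderiv ℝ τ (crossCoord z) (stdVec i)))) l = _
        rw [crossCoord_splitCoord_symm]
        exact h.jacobian_eq _ hz.2 i l
  · intro z hz
    rw [(hasFDerivAt_cylMap (h.hasFDerivAt (h.subset hz.2))).fderiv]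
    refine (h.det_le _ hz.2).trans (le_of_eq ?_)
    congr 1
    have h1 := LinearMap.det_conj (LinearMap.prodMap (LinearMap.id : ℝ →ₗ[ℝ] ℝ)
      (fderiv ℝ τ (crossCoord z) : Euc n →ₗ[ℝ] Euc n)) (splitCoord n).symm.toLinearEquiv
    rw [LinearMap.det_prodMap, LinearMap.det_id, one_mul] at h1
    exact h1.symm

/-- Outside the compact interval [t₀, t₁] the derivatives are explicit: zero on the left and (-δ)^j
e^{-δt} on the right, which is bounded because δ ≥ 0. -/
lemma boundedSmooth_of_eq_exp {f : ℝ → ℝ} (hf : ContDiff ℝ ∞ f) {δ t₀ t₁ : ℝ} (hδ : 0 ≤ δ)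
    (h0 : ∀ t < t₀, f t = 0) (h1 : ∀ t > t₁, f t = Real.exp (-(δ * t))) : BoundedSmooth f := by
  refine ⟨hf, fun j => ?_⟩
  have hc : Continuous (iteratedDeriv j f) := hf.continuous_iteratedDeriv j (by exact_mod_cast le_top)
  obtain ⟨C, hC⟩ := (isCompact_Icc (a := t₀) (b := t₁)).exists_bound_of_continuousOn hc.continuousOn
  refine ⟨max C (max 0 (δ ^ j * Real.exp (-(δ * t₁)))), fun t => ?_⟩
  rw [norm_iteratedFDeriv_eq_norm_iteratedDeriv]
  rcases lt_or_ge t t₀ with ht | ht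
  · have he : f =ᶠ[𝓝 t] fun _ => (0 : ℝ) := by
      filter_upwards [Iio_mem_nhds ht] with s hs using h0 s hs
    rw [he.iteratedDeriv_eq]
    simp
  rcases lt_or_ge t₁ t with ht' | ht'
  · have he : f =ᶠ[𝓝 t] fun s => Real.exp (-δ * s) := by
      filter_upwards [Ioi_mem_nhds ht'] with s hs
      rw [h1 s hs, neg_mul]
    rw [he.iteratedDeriv_eq, iteratedDeriv_exp_const_mul]
    refine le_max_of_le_right (le_max_of_le_right ?_)
    rw [norm_mul, norm_pow, norm_neg, Real.norm_of_nonneg hδ, Real.norm_of_nonneg (Real.exp_pos _).le]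
    gcongr
    nlinarith
  · exact le_max_of_le_left (hC t ⟨ht, ht'⟩)

end Cylinder

/-! ### Sobolev bounds for weight functions. -/

section Weights
set_option linter.unusedSectionVars false

variable {d n : ℕ} {p : ℝ} [hp : Fact (1 < p)]

lemma exists_sobolevBound_of_hasCompactSupport (m : ℕ) {f : Euc d → ℝ} (hf : ContDiff ℝ ∞ f)
    (hc : HasCompactSupport f) : ∃ c, SobolevBound p m f c := by
  have base : ∀ {f : Euc d → ℝ}, ContDiff ℝ ∞ f → HasCompactSupport f →
      ∃ c, SobolevBound p 0 f c := fun {f} hf hc =>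
    ⟨(eLpNorm f (ENNReal.ofReal p) volume).toNNReal, hf.continuous.aestronglyMeasurable,
      (ENNReal.coe_toNNReal (hf.continuous.memLp_of_hasCompactSupport hc).2.ne).ge⟩
  induction m generalizing f with
  | zero => exact base hf hc
  | succ m ih =>
    obtain ⟨c, h⟩ := base hf hc
    choose C hC using fun i : Fin d => ih (f := fun x => fderiv ℝ f x (stdVec i))
      ((hf.fderiv_right (m := ∞) (by simp)).clm_apply contDiff_const) (hc.fderiv_apply (𝕜 := ℝ) _)
    refine ⟨c + ∑ i, C i, (h.mono le_self_add).base, _, fun i =>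
      ⟨HasWeakPartial.of_contDiff i (hf.of_le (by exact_mod_cast le_top)), (hC i).mono ?_⟩⟩
    exact (Finset.single_le_sum (f := C) (fun _ _ => zero_le) (Finset.mem_univ i)).trans le_add_self

lemma integrable_exp_neg_norm {ε : ℝ} (hε : 0 < ε) :
    Integrable (fun z : Euc d => Real.exp (-(ε * ‖z‖))) := by
  have h1 : Integrable (fun x : Euc d => (1 + ‖x‖) ^ (-((d + 1 : ℕ) : ℝ))) :=
    integrable_one_add_norm (by simp)
  refine (h1.const_mul ((d + 1).factorial * Real.exp ε / ε ^ (d + 1))).mono'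
    (Continuous.aestronglyMeasurable (by fun_prop)) (Eventually.of_forall fun x => ?_)
  have h2 := Real.pow_div_factorial_le_exp (ε * (1 + ‖x‖)) (by positivity) (d + 1)
  rw [Real.norm_of_nonneg (Real.exp_pos _).le, Real.rpow_neg (by positivity), Real.rpow_natCast,
    ← div_eq_mul_inv, le_div_iff₀ (by positivity), le_div_iff₀ (by positivity)]
  rw [div_le_iff₀ (by positivity), mul_pow] at h2
  have h3 : Real.exp (ε * (1 + ‖x‖)) = Real.exp ε * Real.exp (ε * ‖x‖) := by
    rw [← Real.exp_add]; ring_nf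
  rw [h3] at h2
  calc Real.exp (-(ε * ‖x‖)) * (1 + ‖x‖) ^ (d + 1) * ε ^ (d + 1)
      = Real.exp (-(ε * ‖x‖)) * (ε ^ (d + 1) * (1 + ‖x‖) ^ (d + 1)) := by ring
    _ ≤ Real.exp (-(ε * ‖x‖)) * (Real.exp ε * Real.exp (ε * ‖x‖) * (d + 1).factorial) := by gcongr
    _ = (Real.exp (-(ε * ‖x‖)) * Real.exp (ε * ‖x‖)) * ((d + 1).factorial * Real.exp ε) := by ring
    _ = _ := by rw [← Real.exp_add]; simp

/-- On the support ‖z‖ ≤ z₀ + R, so the function is dominated by a multiple of e^{-ε‖z‖}, which is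
in L_p. A derivative has the same form, with ζ replaced by ∂_i ζ - ε δ_{i0} ζ, so the induction runs
over all such ζ. -/
lemma exists_sobolevBound_exp_mul {ε R : ℝ} (hε : 0 < ε) (m : ℕ) {ζ : Euc (n + 1) → ℝ}
    (hζ : BoundedSmooth ζ) (hs : Function.support ζ ⊆ {z | 0 ≤ z 0 ∧ ‖crossCoord z‖ ≤ R}) :
    ∃ c, SobolevBound p m (fun z => Real.exp (-(ε * z 0)) * ζ z) c := by
  have hp0 : 0 < p := by linarith [hp.out]
  have hcl : IsClosed {z : Euc (n + 1) | 0 ≤ z 0 ∧ ‖crossCoord z‖ ≤ R} :=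
    (isClosed_le continuous_const (firstCLM n).continuous).inter
      (isClosed_le (crossCLM n).continuous.norm continuous_const)
  have hcd : ContDiff ℝ ∞ (fun z : Euc (n + 1) => Real.exp (-(ε * z 0))) :=
    Real.contDiff_exp.comp (contDiff_const.mul (firstCLM n).contDiff).neg
  have base : ∀ {ζ : Euc (n + 1) → ℝ}, BoundedSmooth ζ →
      Function.support ζ ⊆ {z | 0 ≤ z 0 ∧ ‖crossCoord z‖ ≤ R} →
      ∃ c, SobolevBound p 0 (fun z => Real.exp (-(ε * z 0)) * ζ z) c := by
    intro ζ hζ hs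
    obtain ⟨C, hC⟩ := hζ.exists_nnnorm_le
    have hm : AEStronglyMeasurable (fun z : Euc (n + 1) => Real.exp (-(ε * z 0)) * ζ z) :=
      (hcd.mul hζ.1).continuous.aestronglyMeasurable
    have hle : ∀ z : Euc (n + 1), ‖Real.exp (-(ε * z 0)) * ζ z‖ ≤
        ‖(C * Real.exp (ε * R)) * Real.exp (-(ε * ‖z‖))‖ := fun z => by
      by_cases hz : ζ z = 0
      · rw [hz, mul_zero, norm_zero]
        exact norm_nonneg _
      · have h1 := hs hz
        have h2 := norm_le_add_crossCoord z
        rw [abs_of_nonneg h1.1] at h2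
        rw [norm_mul, Real.norm_of_nonneg (Real.exp_pos _).le, Real.norm_of_nonneg
          (mul_nonneg (mul_nonneg (NNReal.coe_nonneg C) (Real.exp_pos _).le) (Real.exp_pos _).le),
          mul_assoc, ← Real.exp_add, mul_comm]
        refine mul_le_mul (show ‖ζ z‖ ≤ (C : ℝ) from hC z) (Real.exp_le_exp.2 ?_) (Real.exp_pos _).le (NNReal.coe_nonneg C)
        nlinarith [h1.2]
    have hexp : MemLp (fun z : Euc (n + 1) => Real.exp (-(ε * ‖z‖))) (ENNReal.ofReal p) volume := by
      rw [← integrable_norm_rpow_iff (Continuous.aestronglyMeasurable (by fun_prop))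
        (by simpa using hp0) ENNReal.ofReal_ne_top, ENNReal.toReal_ofReal hp0.le]
      refine (integrable_exp_neg_norm (d := n + 1) (mul_pos hε hp0)).congr
        (Eventually.of_forall fun z => ?_)
      simp only
      rw [Real.norm_of_nonneg (Real.exp_pos _).le, ← Real.exp_mul]
      congr 1; ring
    have hmem := (hexp.const_mul (C * Real.exp (ε * R))).of_le hm (Eventually.of_forall hle)
    exact ⟨(eLpNorm _ (ENNReal.ofReal p) volume).toNNReal, hm, (ENNReal.coe_toNNReal hmem.2.ne).ge⟩
  induction m generalizing ζ with
  | zero => exact base hζ hs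
  | succ m ih =>
    obtain ⟨c, h⟩ := base hζ hs
    have hD : ∀ i : Fin (n + 1), BoundedSmooth (fun z => fderiv ℝ ζ z (stdVec i) +
        (-(ε * stdVec i 0)) * ζ z) := fun i => (hζ.fderiv_apply _).add ((BoundedSmooth.const _).mul hζ)
    have hDs : ∀ i : Fin (n + 1), Function.support (fun z => fderiv ℝ ζ z (stdVec i) +
        (-(ε * stdVec i 0)) * ζ z) ⊆ {z | 0 ≤ z 0 ∧ ‖crossCoord z‖ ≤ R} := fun i z hz => by
      by_contra hzn
      have h1 : z ∉ tsupport ζ := fun h => hzn (closure_minimal hs hcl h)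
      have h2 : fderiv ℝ ζ z = 0 := by_contra fun h => h1 (support_fderiv_subset ℝ h)
      exact hz (by simp [h2, image_eq_zero_of_notMem_tsupport h1])
    choose C hC using fun i => ih (hD i) (hDs i)
    refine ⟨c + ∑ i, C i, (h.mono le_self_add).base, _, fun i =>
      ⟨HasWeakPartial.of_contDiff i ((hcd.mul hζ.1).of_le (by exact_mod_cast le_top)), ?_⟩⟩
    refine ((hC i).mono ((Finset.single_le_sum (f := C) (fun _ _ => zero_le)
      (Finset.mem_univ i)).trans le_add_self)).congr_ae (Eventually.of_forall fun z => ?_)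
    have h1 : HasFDerivAt (fun z : Euc (n + 1) => Real.exp (-(ε * z 0)))
        (Real.exp (-(ε * z 0)) • -(ε • firstCLM n)) z :=
      (((firstCLM n).hasFDerivAt.const_mul ε).neg).exp
    have h2 := (h1.mul (hζ.1.differentiable (by simp) z).hasFDerivAt).fderiv
    change _ = fderiv ℝ ((fun z : Euc (n + 1) => Real.exp (-(ε * z 0))) * ζ) z (stdVec i)
    rw [h2]
    simp only [_root_.add_apply, _root_.smul_apply, _root_.neg_apply, smul_eq_mul, firstCLM_apply]
    ring

end Weights

/-! ### Interior charts and cylinder charts of a conic manifold. -/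

section ConicCharts
set_option linter.unusedSectionVars false

variable {n : ℕ} {Mt B : Type*}
  [TopologicalSpace Mt] [ChartedSpace (EuclideanHalfSpace (n + 1)) Mt]
  [IsManifold (𝓡∂ (n + 1)) ∞ Mt]
  [TopologicalSpace B] [ChartedSpace (Euc n) B] [IsManifold (𝓡 n) ∞ B]

lemma isClosed_manifold_boundary : IsClosed ((𝓡∂ (n + 1)).boundary Mt) := by
  have : IsManifold (𝓡∂ (n + 1)) 1 Mt := IsManifold.of_le (n := ∞) (by simp)
  exact ModelWithCorners.isClosed_boundary (n := 1) (by simp)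

/-- A chart of a manifold with boundary, restricted to interior points. -/
def interiorChart (c : OpenPartialHomeomorph Mt (EuclideanHalfSpace (n + 1))) :
    OpenPartialHomeomorph Mt (Euc (n + 1)) where
  toFun := c.extend (𝓡∂ (n + 1))
  invFun := (c.extend (𝓡∂ (n + 1))).symm
  source := c.source ∩ c ⁻¹' ((𝓡∂ (n + 1)) ⁻¹' interior (range (𝓡∂ (n + 1))))
  target := (c.extend (𝓡∂ (n + 1))).target ∩ interior (range (𝓡∂ (n + 1)))
  map_source' x hx := ⟨(c.extend (𝓡∂ (n + 1))).map_source (by rw [c.extend_source]; exact hx.1), hx.2⟩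
  map_target' z hz := by
    have h := (c.extend (𝓡∂ (n + 1))).map_target hz.1
    rw [c.extend_source] at h
    refine ⟨h, ?_⟩
    have h2 := (c.extend (𝓡∂ (n + 1))).right_inv hz.1
    change c.extend (𝓡∂ (n + 1)) ((c.extend (𝓡∂ (n + 1))).symm z) ∈ interior (range (𝓡∂ (n + 1)))
    rw [h2]
    exact hz.2
  left_inv' x hx := (c.extend (𝓡∂ (n + 1))).left_inv (by rw [c.extend_source]; exact hx.1)
  right_inv' z hz := (c.extend (𝓡∂ (n + 1))).right_inv hz.1
  open_source := c.isOpen_inter_preimage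
    (isOpen_interior.preimage (𝓡∂ (n + 1)).continuous)
  open_target := by
    have e : (c.extend (𝓡∂ (n + 1))).target ∩ interior (range (𝓡∂ (n + 1))) =
        (𝓡∂ (n + 1)).symm ⁻¹' c.target ∩ interior (range (𝓡∂ (n + 1))) := by
      rw [c.extend_target]
      ext z
      constructor
      · exact fun h => ⟨h.1.1, h.2⟩
      · exact fun h => ⟨⟨h.1, interior_subset h.2⟩, h.2⟩
    rw [e]
    exact (c.open_target.preimage (𝓡∂ (n + 1)).continuous_symm).inter isOpen_interior
  continuousOn_toFun := (c.continuousOn_extend (I := 𝓡∂ (n + 1))).mono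
    (by rw [c.extend_source]; exact inter_subset_left)
  continuousOn_invFun := (c.continuousOn_extend_symm (I := 𝓡∂ (n + 1))).mono inter_subset_left

/-- A chart of the maximal atlas is a local diffeomorphism into the half space, and these map
interior points to interior points and boundary points to boundary points. -/
lemma interiorChart_source {c : OpenPartialHomeomorph Mt (EuclideanHalfSpace (n + 1))}
    (hc : c ∈ IsManifold.maximalAtlas (𝓡∂ (n + 1)) ∞ Mt) :
    (interiorChart c).source = c.source ∩ ((𝓡∂ (n + 1)).boundary Mt)ᶜ := by
  ext x
  refine and_congr_right fun hx => ?_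
  let P : PartialDiffeomorph (𝓡∂ (n + 1)) (𝓡∂ (n + 1)) Mt (EuclideanHalfSpace (n + 1)) ∞ :=
    { c.toPartialEquiv with
      open_source := c.open_source
      open_target := c.open_target
      contMDiffOn_toFun := contMDiffOn_of_mem_maximalAtlas hc
      contMDiffOn_invFun := contMDiffOn_symm_of_mem_maximalAtlas hc }
  have h : IsLocalDiffeomorphAt (𝓡∂ (n + 1)) (𝓡∂ (n + 1)) ∞ c x := ⟨P, hx, fun _ _ => rfl⟩
  have h1 := h.isInteriorPoint_iff (by simp)
  rw [ModelWithCorners.compl_boundary]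
  change (𝓡∂ (n + 1)) (c x) ∈ interior (range (𝓡∂ (n + 1))) ↔ (𝓡∂ (n + 1)).IsInteriorPoint x
  rw [h1]
  simp only [ModelWithCorners.IsInteriorPoint, extChartAt, OpenPartialHomeomorph.extend_coe,
    chartAt_self_eq, OpenPartialHomeomorph.refl_apply, Function.comp_apply]
  exact Iff.rfl

lemma contMDiffOn_interiorChart {c : OpenPartialHomeomorph Mt (EuclideanHalfSpace (n + 1))}
    (hc : c ∈ IsManifold.maximalAtlas (𝓡∂ (n + 1)) ∞ Mt) :
    ContMDiffOn (𝓡∂ (n + 1)) 𝓘(ℝ, Euc (n + 1)) ∞ (interiorChart c) (interiorChart c).source :=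
  (OpenPartialHomeomorph.contMDiffOn_extend hc).mono inter_subset_left

lemma contMDiffOn_interiorChart_symm {c : OpenPartialHomeomorph Mt (EuclideanHalfSpace (n + 1))}
    (hc : c ∈ IsManifold.maximalAtlas (𝓡∂ (n + 1)) ∞ Mt) :
    ContMDiffOn 𝓘(ℝ, Euc (n + 1)) (𝓡∂ (n + 1)) ∞ (interiorChart c).symm (interiorChart c).target := by
  refine (contMDiffOn_extend_symm hc).mono fun z hz => ?_
  have h1 := hz.1
  rw [c.extend_target, mem_inter_iff] at h1
  exact ⟨(𝓡∂ (n + 1)).symm z, h1.1, (𝓡∂ (n + 1)).right_inv h1.2⟩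

namespace ConicManifold

variable (C : ConicManifold n Mt B)

lemma mem_source {x : ℝ × B} : x ∈ C.collar.source ↔ x.1 ∈ Icc (0 : ℝ) 1 := by
  rw [C.source_eq]; simp

lemma mem_boundary_iff {x : ℝ × B} (hx : x.1 ∈ Icc (0 : ℝ) 1) :
    C.collar x ∈ (𝓡∂ (n + 1)).boundary Mt ↔ x.1 = 0 := by
  rw [← C.image_zero]
  constructor
  · rintro ⟨y, hy, he⟩
    have hy1 : y.1 = 0 := hy.1
    have : y = x := C.collar.injOn (C.mem_source.2 (by rw [hy1]; simp)) (C.mem_source.2 hx) he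
    rw [← this, hy1]
  · exact fun h => ⟨x, ⟨h, mem_univ _⟩, rfl⟩

lemma continuousOn_collar : ContinuousOn C.collar C.collar.source :=
  C.contMDiffOn_collar.continuousOn

lemma continuousOn_collar_symm : ContinuousOn C.collar.symm C.collar.target :=
  C.contMDiffOn_collar_symm.continuousOn

include C in
-- The collar at x = 0 is a continuous injection of B into the Hausdorff space M̃.
lemma t2Space_cross [T2Space Mt] : T2Space B := by
  have hc : Continuous fun y : B => C.collar (0, y) :=
    C.continuousOn_collar.comp_continuous (by fun_prop) fun y => C.mem_source.2 (by simp)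
  refine T2Space.of_injective_continuous (f := fun y : B => C.collar (0, y)) (fun y y' h => ?_) hc
  have := C.collar.injOn (C.mem_source.2 (by simp)) (C.mem_source.2 (by simp)) h
  exact (Prod.mk.inj this).2

include C in
-- B is the continuous image of the closed, hence compact, boundary under the second component of
-- the inverse collar.
lemma compactSpace_cross [CompactSpace Mt] : CompactSpace B := by
  have hsub : (𝓡∂ (n + 1)).boundary Mt ⊆ C.collar.target := by
    rw [← C.image_zero]
    rintro _ ⟨x, hx, rfl⟩
    exact C.collar.map_source (C.mem_source.2 (by rw [show x.1 = 0 from hx.1]; simp))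
  have hK : IsCompact ((fun x => (C.collar.symm x).2) '' (𝓡∂ (n + 1)).boundary Mt) :=
    (isClosed_manifold_boundary (n := n) (Mt := Mt)).isCompact.image_of_continuousOn
      (continuous_snd.comp_continuousOn (C.continuousOn_collar_symm.mono hsub))
  refine ⟨hK.of_isClosed_subset isClosed_univ fun y _ => ?_⟩
  refine ⟨C.collar (0, y), (C.mem_boundary_iff (x := (0, y)) (by simp)).2 rfl, ?_⟩
  simp only
  rw [C.collar.left_inv (C.mem_source.2 (by simp))]

lemma isCompact_image {a b : ℝ} (ha : 0 ≤ a) (hb : b ≤ 1) {K : Set B} (hK : IsCompact K) :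
    IsCompact (C.collar '' (Icc a b ×ˢ K)) :=
  (isCompact_Icc.prod hK).image_of_continuousOn (C.continuousOn_collar.mono fun _ hx =>
    C.mem_source.2 ⟨ha.trans hx.1.1, hx.1.2.trans hb⟩)

/-- The collar without its outer boundary. -/
def openCollar : Set Mt := C.collar '' (Ico 0 1 ×ˢ univ)

lemma openCollar_subset : C.openCollar ⊆ C.collar.target := by
  rintro _ ⟨x, hx, rfl⟩
  exact C.collar.map_source (C.mem_source.2 ⟨hx.1.1, hx.1.2.le⟩)

lemma collar_mem_openCollar {x : ℝ × B} (h0 : 0 ≤ x.1) (h1 : x.1 < 1) :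
    C.collar x ∈ C.openCollar := ⟨x, ⟨⟨h0, h1⟩, mem_univ _⟩, rfl⟩

lemma symm_collar {x : ℝ × B} (h0 : 0 ≤ x.1) (h1 : x.1 ≤ 1) : C.collar.symm (C.collar x) = x :=
  C.collar.left_inv (C.mem_source.2 ⟨h0, h1⟩)

lemma exp_neg_mem {t : ℝ} (ht : 0 < t) : Real.exp (-t) ∈ Ioo (0 : ℝ) 1 :=
  ⟨Real.exp_pos _, by rw [Real.exp_lt_one_iff]; linarith⟩

/-- The chart `(-log x, y)` of the collar. -/
def cylChart (c : OpenPartialHomeomorph B (Euc n)) : OpenPartialHomeomorph Mt (Euc (n + 1)) where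
  toFun x := (splitCoord n).symm (-Real.log (C.collar.symm x).1, c (C.collar.symm x).2)
  invFun z := C.collar (Real.exp (-z 0), c.symm (crossCoord z))
  source := C.collar '' (Ioo 0 1 ×ˢ c.source)
  target := {z | 0 < z 0 ∧ crossCoord z ∈ c.target}
  map_source' := by
    rintro _ ⟨x, hx, rfl⟩
    rw [C.symm_collar hx.1.1.le hx.1.2.le]
    exact ⟨by rw [splitCoord_symm_zero]; exact neg_pos.2 (Real.log_neg hx.1.1 hx.1.2),
      by rw [crossCoord_splitCoord_symm]; exact c.map_source hx.2⟩
  map_target' z hz := ⟨_, ⟨exp_neg_mem hz.1, c.map_target hz.2⟩, rfl⟩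
  left_inv' := by
    rintro _ ⟨x, hx, rfl⟩
    rw [C.symm_collar hx.1.1.le hx.1.2.le, splitCoord_symm_zero, crossCoord_splitCoord_symm,
      c.left_inv hx.2, neg_neg, Real.exp_log hx.1.1]
  right_inv' z hz := by
    have h := exp_neg_mem hz.1
    rw [C.symm_collar h.1.le h.2.le]
    simp only
    rw [c.right_inv hz.2, Real.log_exp, neg_neg, ← splitCoord_apply,
      ContinuousLinearEquiv.symm_apply_apply]
  open_source := by
    have e : C.collar '' (Ioo 0 1 ×ˢ c.source) =
        C.openCollar ∩ C.collar.symm ⁻¹' (Ioo 0 1 ×ˢ c.source) := by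
      ext x
      constructor
      · rintro ⟨y, hy, rfl⟩
        refine ⟨C.collar_mem_openCollar hy.1.1.le hy.1.2, ?_⟩
        rw [mem_preimage, C.symm_collar hy.1.1.le hy.1.2.le]
        exact hy
      · rintro ⟨h1, h2⟩
        exact ⟨_, h2, C.collar.right_inv (C.openCollar_subset h1)⟩
    rw [e]
    exact (C.continuousOn_collar_symm.mono C.openCollar_subset).isOpen_inter_preimage
      C.isOpen_image (isOpen_Ioo.prod c.open_source)
  open_target := (isOpen_lt continuous_const (firstCLM n).continuous).inter
    (c.open_target.preimage (crossCLM n).continuous)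
  continuousOn_toFun := by
    have hsub : C.collar '' (Ioo 0 1 ×ˢ c.source) ⊆ C.collar.target := by
      rintro _ ⟨x, hx, rfl⟩
      exact C.collar.map_source (C.mem_source.2 ⟨hx.1.1.le, hx.1.2.le⟩)
    have h1 := C.continuousOn_collar_symm.mono hsub
    have hm : ∀ x ∈ C.collar '' (Ioo 0 1 ×ˢ c.source), C.collar.symm x ∈ Ioo (0 : ℝ) 1 ×ˢ c.source := by
      rintro _ ⟨x, hx, rfl⟩
      rw [C.symm_collar hx.1.1.le hx.1.2.le]
      exact hx
    refine (splitCoord n).symm.continuous.comp_continuousOn (ContinuousOn.prodMk ?_ ?_)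
    · exact ((continuous_fst.comp_continuousOn h1).log fun x hx => (hm x hx).1.1.ne').neg
    · exact c.continuousOn.comp (continuous_snd.comp_continuousOn h1) fun x hx => (hm x hx).2
  continuousOn_invFun := by
    refine C.continuousOn_collar.comp (ContinuousOn.prodMk ?_ ?_) fun z hz =>
      C.mem_source.2 ⟨(exp_neg_mem hz.1).1.le, (exp_neg_mem hz.1).2.le⟩
    · exact (Real.continuous_exp.comp (firstCLM n).continuous.neg).continuousOn
    · exact c.continuousOn_symm.comp (crossCLM n).continuous.continuousOn fun z hz => hz.2

lemma contMDiffOn_cylChart {c : OpenPartialHomeomorph B (Euc n)}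
    (hc : c ∈ IsManifold.maximalAtlas (𝓡 n) ∞ B) :
    ContMDiffOn (𝓡∂ (n + 1)) 𝓘(ℝ, Euc (n + 1)) ∞ (C.cylChart c) (C.cylChart c).source := by
  have hsub : (C.cylChart c).source ⊆ C.collar.target := by
    rintro _ ⟨x, hx, rfl⟩
    exact C.collar.map_source (C.mem_source.2 ⟨hx.1.1.le, hx.1.2.le⟩)
  have h1 := C.contMDiffOn_collar_symm.mono hsub
  have hm : ∀ x ∈ (C.cylChart c).source, C.collar.symm x ∈ Ioo (0 : ℝ) 1 ×ˢ c.source := by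
    rintro _ ⟨x, hx, rfl⟩
    rw [C.symm_collar hx.1.1.le hx.1.2.le]
    exact hx
  have h2 : ContMDiffOn (𝓡∂ (n + 1)) 𝓘(ℝ, ℝ) ∞ (fun x => -Real.log (C.collar.symm x).1)
      (C.cylChart c).source := by
    have hl : ContDiffOn ℝ ∞ (fun r : ℝ => -Real.log r) (Ioi 0) :=
      (contDiffOn_id.log fun x hx => (ne_of_gt hx)).neg
    exact hl.contMDiffOn.comp (contMDiff_fst.comp_contMDiffOn h1) fun x hx => (hm x hx).1.1
  have h3 : ContMDiffOn (𝓡∂ (n + 1)) 𝓘(ℝ, Euc n) ∞ (fun x => c (C.collar.symm x).2)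
      (C.cylChart c).source :=
    (contMDiffOn_of_mem_maximalAtlas hc).comp (contMDiff_snd.comp_contMDiffOn h1)
      fun x hx => (hm x hx).2
  exact (splitCoord n).symm.contDiff.contMDiff.comp_contMDiffOn (h2.prodMk_space h3)

lemma contMDiffOn_cylChart_symm {c : OpenPartialHomeomorph B (Euc n)}
    (hc : c ∈ IsManifold.maximalAtlas (𝓡 n) ∞ B) :
    ContMDiffOn 𝓘(ℝ, Euc (n + 1)) (𝓡∂ (n + 1)) ∞ (C.cylChart c).symm (C.cylChart c).target := by
  have h1 : ContMDiffOn 𝓘(ℝ, Euc (n + 1)) 𝓘(ℝ, ℝ) ∞ (fun z : Euc (n + 1) => Real.exp (-z 0))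
      (C.cylChart c).target :=
    (Real.contDiff_exp.comp (firstCLM n).contDiff.neg).contMDiff.contMDiffOn
  have h2 : ContMDiffOn 𝓘(ℝ, Euc (n + 1)) (𝓡 n) ∞ (fun z : Euc (n + 1) => c.symm (crossCoord z))
      (C.cylChart c).target :=
    (contMDiffOn_symm_of_mem_maximalAtlas hc).comp (crossCLM n).contDiff.contMDiff.contMDiffOn
      fun z hz => hz.2
  exact C.contMDiffOn_collar.comp (h1.prodMk h2) fun z hz =>
    C.mem_source.2 ⟨(exp_neg_mem hz.1).1.le, (exp_neg_mem hz.1).2.le⟩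

lemma cylChart_source_notMem (c : OpenPartialHomeomorph B (Euc n)) :
    ∀ x ∈ (C.cylChart c).source, x ∉ (𝓡∂ (n + 1)).boundary Mt := by
  rintro _ ⟨x, hx, rfl⟩ h
  exact hx.1.1.ne' ((C.mem_boundary_iff ⟨hx.1.1.le, hx.1.2.le⟩).1 h)

/-- Inside the open collar this is smoothness of `cut` on (0, 1). Elsewhere the function vanishes
nearby, since it is supported in the image of [0, b] × B, a compact and therefore closed set. -/
lemma contMDiffOn_cutoff [CompactSpace Mt] [T2Space Mt] {cut : ℝ → ℝ} (hcut : IsCutoff cut) :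
    ContMDiffOn (𝓡∂ (n + 1)) 𝓘(ℝ, ℝ) ∞ (C.cutoff cut) ((𝓡∂ (n + 1)).boundary Mt)ᶜ := by
  have : CompactSpace B := C.compactSpace_cross
  intro x hx
  refine ContMDiffAt.contMDiffWithinAt ?_
  by_cases hxW : x ∈ C.openCollar
  · have h1 : ContMDiffAt (𝓡∂ (n + 1)) (𝓘(ℝ, ℝ).prod (𝓡 n)) ∞ C.collar.symm x :=
      (C.contMDiffOn_collar_symm.mono C.openCollar_subset).contMDiffAt (C.isOpen_image.mem_nhds hxW)
    have h3 : (C.collar.symm x).1 ∈ Ioo (0 : ℝ) 1 := by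
      obtain ⟨y, hy, rfl⟩ := hxW
      rw [C.symm_collar hy.1.1 hy.1.2.le]
      exact ⟨lt_of_le_of_ne hy.1.1 fun h => hx ((C.mem_boundary_iff ⟨hy.1.1, hy.1.2.le⟩).2 h.symm),
        hy.1.2⟩
    have h4 : ContDiffAt ℝ ∞ cut (C.collar.symm x).1 :=
      (hcut.contDiffOn.mono Ioo_subset_Ico_self).contDiffAt (isOpen_Ioo.mem_nhds h3)
    have h5 : ContMDiffAt (𝓡∂ (n + 1)) 𝓘(ℝ, ℝ) ∞ (fun x => cut (C.collar.symm x).1) x :=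
      h4.contMDiffAt.comp x (contMDiff_fst.contMDiffAt.comp x h1)
    refine h5.congr_of_eventuallyEq ?_
    filter_upwards [C.isOpen_image.mem_nhds hxW] with y hy
    rw [cutoff, if_pos hy]
  · obtain ⟨b, hb, hb0⟩ := hcut.eq_zero
    have hK := (C.isCompact_image le_rfl hb.2.le (isCompact_univ (X := B))).isClosed
    refine (contMDiffAt_const (c := (0 : ℝ))).congr_of_eventuallyEq ?_
    have hxK : x ∉ C.collar '' (Icc 0 b ×ˢ univ) := by
      rintro ⟨y, hy, rfl⟩
      exact hxW (C.collar_mem_openCollar hy.1.1 (hy.1.2.trans_lt hb.2))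
    filter_upwards [hK.isOpen_compl.mem_nhds hxK] with y hy
    rw [cutoff]
    split_ifs with hyW
    · obtain ⟨w, hw, rfl⟩ := hyW
      rw [C.symm_collar hw.1.1 hw.1.2.le]
      refine hb0 _ ⟨?_, hw.1.2⟩
      by_contra! hlt
      exact hy ⟨w, ⟨⟨hw.1.1, hlt.le⟩, mem_univ _⟩, rfl⟩
    · rfl

end ConicManifold

end ConicCharts

lemma IsTransition.congr {d : ℕ} {κ κ' : Euc d → Euc d} {V T : Set (Euc d)}
    {J : Fin d → Fin d → Euc d → ℝ} {c₀ : ℝ≥0} (h : IsTransition κ V T J c₀) (he : EqOn κ' κ V) :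
    IsTransition κ' V T J c₀ := by
  have hd : ∀ z ∈ T, fderiv ℝ κ' z = fderiv ℝ κ z := fun z hz =>
    Filter.EventuallyEq.fderiv_eq (he.eventuallyEq_of_mem (h.isOpen.mem_nhds (h.subset hz)))
  exact ⟨h.isOpen, h.isClosed, h.subset, h.contDiffOn.congr he, h.injOn.congr he.symm,
    h.jacobian_bdd, fun z hz => by rw [hd z hz]; exact h.jacobian_eq z hz, h.pos,
    fun z hz => by rw [hd z hz]; exact h.det_le z hz⟩

/-! ### Transitions in which one of the two charts has a compact cut-off. -/

namespace LocalSystem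

variable {ι X : Type*} [Fintype ι] [TopologicalSpace X] {Z : Set X} {d : ℕ}
  {S : LocalSystem ι X Z d}

lemma trans_mapsTo (i j : ι) : MapsTo (S.trans i j) (S.transDom i j) (S.transDom j i) := by
  intro z hz
  rw [mem_transDom] at hz ⊢
  refine ⟨(S.e j).map_source hz.2, ?_⟩
  rw [trans, (S.e j).left_inv hz.2]
  exact (S.e i).map_target hz.1

lemma trans_leftInvOn (i j : ι) : LeftInvOn (S.trans j i) (S.trans i j) (S.transDom i j) := by
  intro z hz
  rw [mem_transDom] at hz
  rw [trans, trans, (S.e j).left_inv hz.2, (S.e i).right_inv hz.1]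

lemma symm_mem_of_mem {A : Set X} {i j : ι} (hA : A \ Z = (S.e j).symm '' S.K j) {z : Euc d}
    (hz : z ∈ S.K i) (hzA : (S.e i).symm z ∈ A) :
    z ∈ S.transDom i j ∧ S.trans i j z ∈ S.K j := by
  have h1 : (S.e i).symm z ∈ A \ Z := ⟨hzA, symm_notMem (S.K_subset i hz)⟩
  rw [hA] at h1
  obtain ⟨w, hw, he⟩ := h1
  have h2 := S.K_subset j hw
  refine ⟨mem_transDom.2 ⟨S.K_subset i hz, he ▸ (S.e j).map_target h2⟩, ?_⟩
  rw [trans, ← he, (S.e j).right_inv h2]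
  exact hw

lemma support_factor_subset {A : Set X} (δ : ℝ) {i j : ι} (hA : A \ Z = (S.e j).symm '' S.K j) :
    Function.support (S.factor δ i j) ⊆ S.K i ∩ (S.e i).symm ⁻¹' A := by
  intro z hz
  rw [Function.mem_support, factor] at hz
  split_ifs at hz with hV
  · refine ⟨S.support_θ i (left_ne_zero_of_mul hz), ?_⟩
    have h1 := S.support_θ j (left_ne_zero_of_mul (right_ne_zero_of_mul hz))
    have h2 : (S.e i).symm z ∈ A \ Z := by
      rw [hA]
      exact ⟨_, h1, by rw [trans, (S.e j).left_inv (mem_transDom.1 hV).2]⟩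
    exact h2.1
  · exact absurd rfl hz

/-- The factor is supported in the part of `K i` that the change of coordinates maps into `K j`.
This set is compact if `K i` is; if instead `K j` is compact, it is contained in the image of a
compact part of `K j` under the inverse change of coordinates. -/
lemma exists_transition_of_isCompact (hsm : ∀ i j, ContDiffOn ℝ ∞ (S.trans i j) (S.transDom i j))
    (hθ : ∀ i, ContDiff ℝ ∞ (S.θ i)) (hht : ∀ i, ContDiff ℝ ∞ (S.ht i)) (δ : ℝ) (i j : ι)
    (hK : IsCompact (S.K i) ∨ IsCompact (S.K j)) : ∃ T J c₀,
    IsTransition (S.trans i j) (S.transDom i j) T J c₀ ∧ BoundedSmooth (S.factor δ i j) ∧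
      Function.support (S.factor δ i j) ⊆ T := by
  have hopen : ∀ i j, IsOpen (S.transDom i j) := fun i j => ((S.e i).symm.trans (S.e j)).open_source
  have hcl : ∀ {A : Set X} (i), IsClosed A → IsClosed (S.K i ∩ (S.e i).symm ⁻¹' A) := fun i hA =>
    ((S.e i).continuousOn_symm.mono (S.K_subset i)).preimage_isClosed_of_isClosed (S.isClosed_K i) hA
  obtain ⟨A, hA, hAZ⟩ := S.closed_image j
  obtain ⟨A', hA', hAZ'⟩ := S.closed_image i
  have hTV : S.K i ∩ (S.e i).symm ⁻¹' A ⊆ S.transDom i j := fun z hz =>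
    (symm_mem_of_mem hAZ hz.1 hz.2).1
  have hT : IsCompact (S.K i ∩ (S.e i).symm ⁻¹' A) := by
    rcases hK with hK | hK
    · exact hK.of_isClosed_subset (hcl i hA) inter_subset_left
    · have h1 : IsCompact (S.K j ∩ (S.e j).symm ⁻¹' A') :=
        hK.of_isClosed_subset (hcl j hA') inter_subset_left
      have h2 := h1.image_of_continuousOn ((hsm j i).continuousOn.mono fun z hz =>
        (symm_mem_of_mem hAZ' hz.1 hz.2).1)
      refine h2.of_isClosed_subset (hcl i hA) fun z hz => ?_
      obtain ⟨h3, h4⟩ := symm_mem_of_mem hAZ hz.1 hz.2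
      refine ⟨S.trans i j z, ⟨h4, ?_⟩, trans_leftInvOn i j h3⟩
      rw [mem_preimage, trans, (S.e j).left_inv (mem_transDom.1 h3).2]
      have : (S.e i).symm z ∈ A' \ Z := by rw [hAZ']; exact ⟨z, hz.1, rfl⟩
      exact this.1
  obtain ⟨J, c₀, h⟩ := exists_isTransition_of_isCompact (hopen i j) hT hTV (hsm i j)
    (trans_leftInvOn i j).injOn fun z hz => det_fderiv_ne_zero (hopen i j) (hopen j i) (hsm i j)
      (hsm j i) (trans_mapsTo i j) (trans_leftInvOn i j) hz
  have hs := support_factor_subset δ (i := i) hAZ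
  refine ⟨_, J, c₀, h, BoundedSmooth.of_hasCompactSupport
    (contDiff_of_support_subset (hopen i j) ?_ (hcl i hA) hTV hs)
    (hT.of_isClosed_subset (isClosed_tsupport _) (closure_minimal hs hT.isClosed)), hs⟩
  have h1 : ContDiffOn ℝ ∞ (fun z => S.θ i z * (S.θ j (S.trans i j z) *
      Real.exp (-(δ * S.ht j (S.trans i j z))))) (S.transDom i j) :=
    (hθ i).contDiffOn.mul (((hθ j).comp_contDiffOn (hsm i j)).mul
      (Real.contDiff_exp.comp_contDiffOn (contDiffOn_const.mul
        ((hht j).comp_contDiffOn (hsm i j))).neg))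
  refine h1.congr fun z hz => ?_
  rw [factor, if_pos hz]

end LocalSystem

/-! ### The local system of a conic manifold. -/

section ConicSystem
set_option linter.unusedSectionVars false

variable {n : ℕ} {Mt B : Type*}
  [TopologicalSpace Mt] [ChartedSpace (EuclideanHalfSpace (n + 1)) Mt]
  [IsManifold (𝓡∂ (n + 1)) ∞ Mt]
  [TopologicalSpace B] [ChartedSpace (Euc n) B] [IsManifold (𝓡 n) ∞ B]
  {C : ConicManifold n Mt B} {cut : ℝ → ℝ}

/-- Cut-off functions which are equal to one on the supports of the members of the partitions of
unity, in the coordinates of the atlas. -/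
structure CutoffData (loc : ConicAtlas C cut) where
  t₀ : ℝ
  t₀_pos : 0 < t₀
  a : ℝ → ℝ
  contDiff_a : ContDiff ℝ ∞ a
  a_eq_zero : ∀ t < t₀, a t = 0
  a_eq_one : ∀ t, 0 < t → cut (Real.exp (-t)) ≠ 0 → a t = 1
  a_large : ∃ t₁, ∀ t > t₁, a t = 1
  b : Fin loc.cardB → Euc n → ℝ
  contDiff_b : ∀ i, ContDiff ℝ ∞ (b i)
  hasCompactSupport_b : ∀ i, HasCompactSupport (b i)
  tsupport_b : ∀ i, tsupport (b i) ⊆ (loc.chartB i).target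
  b_eq_one : ∀ i y, loc.partB i y ≠ 0 → b i (loc.chartB i y) = 1
  c : Fin loc.cardM → Euc (n + 1) → ℝ
  contDiff_c : ∀ i, ContDiff ℝ ∞ (c i)
  hasCompactSupport_c : ∀ i, HasCompactSupport (c i)
  tsupport_c : ∀ i, tsupport (c i) ⊆ (interiorChart (loc.chartM i)).target
  c_eq_one : ∀ i x, loc.partM i x ≠ 0 → c i (interiorChart (loc.chartM i) x) = 1

variable {loc : ConicAtlas C cut}

lemma mem_chartB_source {i : Fin loc.cardB} {y : B} (h : loc.partB i y ≠ 0) :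
    y ∈ (loc.chartB i).source := loc.partB_tsupport i (subset_tsupport _ h)

lemma mem_chartM_source {i : Fin loc.cardM} {x : Mt} (h : loc.partM i x ≠ 0) :
    x ∈ (interiorChart (loc.chartM i)).source := by
  rw [interiorChart_source (loc.chartM_mem i)]
  exact loc.partM_tsupport i (subset_tsupport _ h)

variable [CompactSpace Mt] [T2Space Mt]

lemma exists_cutoffData (hcut : IsCutoff cut) (loc : ConicAtlas C cut) : Nonempty (CutoffData loc) := by
  have : CompactSpace B := C.compactSpace_cross
  obtain ⟨b, hb, hb0⟩ := hcut.eq_zero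
  have hlog : Real.log b < 0 := Real.log_neg hb.1 hb.2
  have hB : ∀ i, ∃ χ : Euc n → ℝ, ContDiff ℝ ∞ χ ∧ HasCompactSupport χ ∧
      tsupport χ ⊆ (loc.chartB i).target ∧ ∀ y, loc.partB i y ≠ 0 → χ (loc.chartB i y) = 1 := by
    intro i
    obtain ⟨χ, h1, h2, h3, h4⟩ := exists_bump
      ((isClosed_tsupport (loc.partB i)).isCompact.image_of_continuousOn
        ((loc.chartB i).continuousOn.mono (loc.partB_tsupport i))) (loc.chartB i).open_target
      (by
        rintro _ ⟨y, hy, rfl⟩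
        exact (loc.chartB i).map_source (loc.partB_tsupport i hy))
    exact ⟨χ, h1, h2, h3, fun y hy => h4.self_of_nhdsSet _ ⟨y, subset_tsupport _ hy, rfl⟩⟩
  have hM : ∀ i, ∃ χ : Euc (n + 1) → ℝ, ContDiff ℝ ∞ χ ∧ HasCompactSupport χ ∧
      tsupport χ ⊆ (interiorChart (loc.chartM i)).target ∧
      ∀ x, loc.partM i x ≠ 0 → χ (interiorChart (loc.chartM i) x) = 1 := by
    intro i
    have hs : tsupport (loc.partM i) ⊆ (interiorChart (loc.chartM i)).source := by
      rw [interiorChart_source (loc.chartM_mem i)]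
      exact loc.partM_tsupport i
    obtain ⟨χ, h1, h2, h3, h4⟩ := exists_bump
      ((isClosed_tsupport (loc.partM i)).isCompact.image_of_continuousOn
        ((interiorChart (loc.chartM i)).continuousOn.mono hs))
      (interiorChart (loc.chartM i)).open_target
      (by
        rintro _ ⟨y, hy, rfl⟩
        exact (interiorChart (loc.chartM i)).map_source (hs hy))
    exact ⟨χ, h1, h2, h3, fun y hy => h4.self_of_nhdsSet _ ⟨y, subset_tsupport _ hy, rfl⟩⟩
  choose χB hB1 hB2 hB3 hB4 using hB
  choose χM hM1 hM2 hM3 hM4 using hM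
  -- With T = -log b > 0 the function `a` rises from 0 at T/2 to 1 at T, and cut(e^{-t}) ≠ 0 forces
  -- e^{-t} < b, that is t > T.
  refine ⟨⟨-Real.log b / 2, by linarith, fun t => Real.smoothTransition
    ((t + Real.log b / 2) / (-Real.log b / 2)), ?_, fun t ht => ?_, fun t ht hne => ?_,
    ⟨-Real.log b, fun t ht => ?_⟩, χB, hB1, hB2, hB3, hB4, χM, hM1, hM2, hM3, hM4⟩⟩
  · exact Real.smoothTransition.contDiff.comp ((contDiff_id.add contDiff_const).div_const _)
  · exact Real.smoothTransition.zero_of_nonpos (div_nonpos_of_nonpos_of_nonneg (by linarith)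
      (by linarith))
  · refine Real.smoothTransition.one_of_one_le ?_
    rw [one_le_div (by linarith)]
    have h1 : Real.exp (-t) < b := by
      by_contra! hle
      exact hne (hb0 _ ⟨hle, by rw [Real.exp_lt_one_iff]; linarith⟩)
    have := (Real.lt_log_iff_exp_lt hb.1).2 h1
    linarith
  · refine Real.smoothTransition.one_of_one_le ?_
    rw [one_le_div (by linarith)]
    linarith

namespace CutoffData

open Classical in
/-- The local system of a conic manifold with an atlas. -/
def localSystem (D : CutoffData loc) :
    LocalSystem (Fin loc.cardB ⊕ Fin loc.cardM) Mt ((𝓡∂ (n + 1)).boundary Mt) (n + 1) where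
  e := Sum.elim (fun i => C.cylChart (loc.chartB i)) (fun i => interiorChart (loc.chartM i))
  notMem := by
    rintro (i | i) x hx
    · exact C.cylChart_source_notMem _ x hx
    · have h : x ∈ (interiorChart (loc.chartM i)).source := hx
      rw [interiorChart_source (loc.chartM_mem i)] at h
      exact h.2
  -- The cylinder members carry the factor `cut` and sum to `cut`; the core members carry 1 - `cut`
  -- and sum to 1 - `cut`, also where `cut` = 1 and their partition of unity need not sum to one.
  ρ := Sum.elim (fun i x => if x ∈ C.openCollar then
      loc.partB i (C.collar.symm x).2 * cut (C.collar.symm x).1 else 0)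
    (fun i x => loc.partM i x * (1 - C.cutoff cut x))
  sum_ρ x _ := by
    rw [Fintype.sum_sum_type]
    simp only [Sum.elim_inl, Sum.elim_inr]
    have h1 : ∑ i, (if x ∈ C.openCollar then
        loc.partB i (C.collar.symm x).2 * cut (C.collar.symm x).1 else 0) = C.cutoff cut x := by
      rw [ConicManifold.cutoff]
      by_cases hx : x ∈ C.openCollar
      · simp only [if_pos hx]
        rw [if_pos (show x ∈ C.collar '' (Ico 0 1 ×ˢ univ) from hx), ← Finset.sum_mul,
          loc.partB_sum, one_mul]
      · simp only [if_neg hx]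
        rw [if_neg (show x ∉ C.collar '' (Ico 0 1 ×ˢ univ) from hx), Finset.sum_const_zero]
    rw [h1, ← Finset.sum_mul]
    by_cases h : C.cutoff cut x = 1
    · simp [h]
    · rw [loc.partM_sum x h]; ring
  θ := Sum.elim (fun i z => D.a (z 0) * D.b i (crossCoord z)) D.c
  continuous_θ := by
    rintro (i | i)
    · exact (D.contDiff_a.continuous.comp (firstCLM n).continuous).mul
        ((D.contDiff_b i).continuous.comp (crossCLM n).continuous)
    · exact (D.contDiff_c i).continuous
  K := Sum.elim (fun i => {z | D.t₀ ≤ z 0 ∧ crossCoord z ∈ tsupport (D.b i)})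
    (fun i => tsupport (D.c i))
  isClosed_K := by
    rintro (i | i)
    · exact (isClosed_le continuous_const (firstCLM n).continuous).inter
        ((isClosed_tsupport _).preimage (crossCLM n).continuous)
    · exact isClosed_tsupport _
  support_θ := by
    rintro (i | i) z hz
    · refine ⟨?_, subset_tsupport _ (right_ne_zero_of_mul hz)⟩
      by_contra! hlt
      exact left_ne_zero_of_mul hz (D.a_eq_zero _ hlt)
    · exact subset_tsupport _ hz
  K_subset := by
    rintro (i | i) z hz
    · exact ⟨D.t₀_pos.trans_le hz.1, D.tsupport_b i hz.2⟩
    · exact D.tsupport_c i hz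
  eq_one := by
    rintro (i | i) x hx h
    · simp only [Sum.elim_inl] at h ⊢
      split_ifs at h with hxW
      · obtain ⟨w, hw, rfl⟩ := hxW
        rw [C.symm_collar hw.1.1 hw.1.2.le] at h
        have hw0 : 0 < w.1 := lt_of_le_of_ne hw.1.1 fun h0 =>
          hx ((C.mem_boundary_iff ⟨hw.1.1, hw.1.2.le⟩).2 h0.symm)
        have hs : w.2 ∈ (loc.chartB i).source := mem_chartB_source (left_ne_zero_of_mul h)
        refine ⟨⟨w, ⟨⟨hw0, hw.1.2⟩, hs⟩, rfl⟩, ?_⟩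
        have he : C.cylChart (loc.chartB i) (C.collar w) =
            (splitCoord n).symm (-Real.log w.1, loc.chartB i w.2) := by
          change (splitCoord n).symm (-Real.log (C.collar.symm (C.collar w)).1,
            loc.chartB i (C.collar.symm (C.collar w)).2) = _
          rw [C.symm_collar hw.1.1 hw.1.2.le]
        rw [he, splitCoord_symm_zero, crossCoord_splitCoord_symm,
          D.b_eq_one i _ (left_ne_zero_of_mul h), D.a_eq_one, one_mul]
        · exact neg_pos.2 (Real.log_neg hw0 hw.1.2)
        · rw [neg_neg, Real.exp_log hw0]
          exact right_ne_zero_of_mul h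
      · exact absurd rfl h
    · exact ⟨mem_chartM_source (left_ne_zero_of_mul h), D.c_eq_one i x (left_ne_zero_of_mul h)⟩
  closed_image := by
    have hM : ∀ K : Set (Euc (n + 1)), IsCompact K → ∀ e : OpenPartialHomeomorph Mt (Euc (n + 1)),
        (∀ x ∈ e.source, x ∉ (𝓡∂ (n + 1)).boundary Mt) → K ⊆ e.target →
        ∃ A, IsClosed A ∧ A \ (𝓡∂ (n + 1)).boundary Mt = e.symm '' K := by
      intro K hK e he hKe
      refine ⟨e.symm '' K, (hK.image_of_continuousOn (e.continuousOn_symm.mono hKe)).isClosed,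
        sdiff_eq_left.2 (disjoint_left.2 ?_)⟩
      rintro _ ⟨z, hz, rfl⟩
      exact he _ (e.map_target (hKe hz))
    rintro (i | i)
    -- The image of the cylinder set {t ≥ t₀} accumulates at the boundary x = 0. Adding the boundary
    -- points makes it the image of a compact set, and removing them again recovers it.
    · have hexp := ConicManifold.exp_neg_mem D.t₀_pos
      refine ⟨C.collar '' (Icc 0 (Real.exp (-D.t₀)) ×ˢ ((loc.chartB i).symm '' tsupport (D.b i))),
        (C.isCompact_image le_rfl hexp.2.le ((D.hasCompactSupport_b i).image_of_continuousOn
          ((loc.chartB i).continuousOn_symm.mono (D.tsupport_b i)))).isClosed, ?_⟩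
      ext x
      constructor
      · rintro ⟨⟨⟨r, y⟩, ⟨hr, w, hw, hwy⟩, rfl⟩, hx⟩
        simp only at hr hwy
        have hr0 : 0 < r := lt_of_le_of_ne hr.1 fun h0 =>
          hx ((C.mem_boundary_iff (x := (r, y)) ⟨hr.1, hr.2.trans hexp.2.le⟩).2 h0.symm)
        refine ⟨(splitCoord n).symm (-Real.log r, w), ⟨?_, ?_⟩, ?_⟩
        · rw [splitCoord_symm_zero, le_neg, Real.log_le_iff_le_exp hr0]
          exact hr.2
        · rw [crossCoord_splitCoord_symm]; exact hw
        · change C.collar (Real.exp (-(splitCoord n).symm (-Real.log r, w) 0),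
            (loc.chartB i).symm (crossCoord ((splitCoord n).symm (-Real.log r, w)))) = _
          rw [splitCoord_symm_zero, crossCoord_splitCoord_symm, neg_neg, Real.exp_log hr0, hwy]
      · rintro ⟨z, hz, rfl⟩
        refine ⟨⟨_, ⟨⟨(Real.exp_pos _).le, ?_⟩, _, hz.2, rfl⟩, rfl⟩, ?_⟩
        · exact Real.exp_le_exp.2 (neg_le_neg hz.1)
        · exact C.cylChart_source_notMem (loc.chartB i) _
            ((C.cylChart (loc.chartB i)).map_target ⟨D.t₀_pos.trans_le hz.1, D.tsupport_b i hz.2⟩)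
    · refine hM _ (D.hasCompactSupport_c i) _ (fun x hx => ?_) (D.tsupport_c i)
      have h : x ∈ (interiorChart (loc.chartM i)).source := hx
      rw [interiorChart_source (loc.chartM_mem i)] at h
      exact h.2
  ht := Sum.elim (fun _ z => z 0) (fun _ _ => 0)
  continuous_ht := by
    rintro (i | i)
    · exact (firstCLM n).continuous
    · exact continuous_const

end CutoffData

end ConicSystem

/-! ### Transitions and weights of the conic local system. -/

section ConicSystem
set_option linter.unusedSectionVars false

variable {n : ℕ} {Mt B : Type*}
  [TopologicalSpace Mt] [ChartedSpace (EuclideanHalfSpace (n + 1)) Mt]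
  [IsManifold (𝓡∂ (n + 1)) ∞ Mt]
  [TopologicalSpace B] [ChartedSpace (Euc n) B] [IsManifold (𝓡 n) ∞ B]
  {C : ConicManifold n Mt B} {cut : ℝ → ℝ}
  {loc : ConicAtlas C cut} [CompactSpace Mt] [T2Space Mt]

namespace CutoffData

variable (D : CutoffData loc)

lemma contMDiffOn_e (i : Fin loc.cardB ⊕ Fin loc.cardM) :
    ContMDiffOn (𝓡∂ (n + 1)) 𝓘(ℝ, Euc (n + 1)) ∞ (D.localSystem.e i) (D.localSystem.e i).source := by
  rcases i with i | i
  · exact C.contMDiffOn_cylChart (loc.chartB_mem i)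
  · exact contMDiffOn_interiorChart (loc.chartM_mem i)

lemma contMDiffOn_e_symm (i : Fin loc.cardB ⊕ Fin loc.cardM) :
    ContMDiffOn 𝓘(ℝ, Euc (n + 1)) (𝓡∂ (n + 1)) ∞ (D.localSystem.e i).symm
      (D.localSystem.e i).target := by
  rcases i with i | i
  · exact C.contMDiffOn_cylChart_symm (loc.chartB_mem i)
  · exact contMDiffOn_interiorChart_symm (loc.chartM_mem i)

lemma contDiffOn_trans (i j : Fin loc.cardB ⊕ Fin loc.cardM) :
    ContDiffOn ℝ ∞ (D.localSystem.trans i j) (D.localSystem.transDom i j) := by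
  rw [← contMDiffOn_iff_contDiffOn]
  exact (D.contMDiffOn_e j).comp ((D.contMDiffOn_e_symm i).mono fun z hz =>
    (LocalSystem.mem_transDom.1 hz).1) fun z hz => (LocalSystem.mem_transDom.1 hz).2

/-- The transition maps of the cross section. -/
def crossTrans (loc : ConicAtlas C cut) (i j : Fin loc.cardB) (y : Euc n) : Euc n :=
  loc.chartB j ((loc.chartB i).symm y)

/-- The domains of the transition maps of the cross section. -/
def crossDom (loc : ConicAtlas C cut) (i j : Fin loc.cardB) : Set (Euc n) :=
  ((loc.chartB i).symm.trans (loc.chartB j)).source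

omit [CompactSpace Mt] [T2Space Mt] in
lemma mem_crossDom {i j : Fin loc.cardB} {y : Euc n} : y ∈ crossDom loc i j ↔
    y ∈ (loc.chartB i).target ∧ (loc.chartB i).symm y ∈ (loc.chartB j).source := by
  simp [crossDom]

omit [CompactSpace Mt] [T2Space Mt] in
lemma contDiffOn_crossTrans (i j : Fin loc.cardB) :
    ContDiffOn ℝ ∞ (crossTrans loc i j) (crossDom loc i j) := by
  rw [← contMDiffOn_iff_contDiffOn]
  exact (contMDiffOn_of_mem_maximalAtlas (loc.chartB_mem j)).comp
    ((contMDiffOn_symm_of_mem_maximalAtlas (loc.chartB_mem i)).mono fun y hy =>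
      (mem_crossDom.1 hy).1) fun y hy => (mem_crossDom.1 hy).2

omit [CompactSpace Mt] [T2Space Mt] in
lemma crossTrans_mapsTo (i j : Fin loc.cardB) :
    MapsTo (crossTrans loc i j) (crossDom loc i j) (crossDom loc j i) := by
  intro y hy
  rw [mem_crossDom] at hy ⊢
  refine ⟨(loc.chartB j).map_source hy.2, ?_⟩
  rw [crossTrans, (loc.chartB j).left_inv hy.2]
  exact (loc.chartB i).map_target hy.1

omit [CompactSpace Mt] [T2Space Mt] in
lemma crossTrans_leftInvOn (i j : Fin loc.cardB) :
    LeftInvOn (crossTrans loc j i) (crossTrans loc i j) (crossDom loc i j) := by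
  intro y hy
  rw [mem_crossDom] at hy
  rw [crossTrans, crossTrans, (loc.chartB j).left_inv hy.2, (loc.chartB i).right_inv hy.1]

lemma mem_transDom_inl {i j : Fin loc.cardB} {z : Euc (n + 1)} :
    z ∈ D.localSystem.transDom (Sum.inl i) (Sum.inl j) ↔ 0 < z 0 ∧ crossCoord z ∈ crossDom loc i j := by
  rw [LocalSystem.mem_transDom, mem_crossDom, ← and_assoc]
  change (0 < z 0 ∧ crossCoord z ∈ (loc.chartB i).target) ∧
    C.collar (Real.exp (-z 0), (loc.chartB i).symm (crossCoord z)) ∈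
      C.collar '' (Ioo 0 1 ×ˢ (loc.chartB j).source) ↔ _
  refine and_congr_right fun hz => ?_
  have h := ConicManifold.exp_neg_mem hz.1
  constructor
  · rintro ⟨w, hw, he⟩
    have := C.collar.injOn (C.mem_source.2 ⟨hw.1.1.le, hw.1.2.le⟩) (C.mem_source.2 ⟨h.1.le, h.2.le⟩) he
    rw [this] at hw
    exact hw.2
  · exact fun h' => ⟨_, ⟨h, h'⟩, rfl⟩

lemma trans_inl {i j : Fin loc.cardB} {z : Euc (n + 1)} (hz : 0 < z 0) :
    D.localSystem.trans (Sum.inl i) (Sum.inl j) z = cylMap (crossTrans loc i j) z := by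
  have h := ConicManifold.exp_neg_mem hz
  change (splitCoord n).symm (-Real.log (C.collar.symm (C.collar (Real.exp (-z 0), _))).1,
    loc.chartB j (C.collar.symm (C.collar (Real.exp (-z 0),
      (loc.chartB i).symm (crossCoord z)))).2) = _
  rw [C.symm_collar h.1.le h.2.le, Real.log_exp, neg_neg]
  rfl

/-- Between two cylinder charts no cut-off is compact in t, but the transition map is (t, y) ↦ (t,
τ(y)), so compactness in the cross section suffices. The factor splits into α(t) β(y), and α is
bounded with all derivatives because e^{-δt} is for δ ≥ 0. With δ = γ - (n+1)/2 this is where γ ≥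
(n+1)/2 enters. -/
lemma exists_transition_inl {δ : ℝ} (hδ : 0 ≤ δ) (i j : Fin loc.cardB) : ∃ T J c₀,
    IsTransition (D.localSystem.trans (Sum.inl i) (Sum.inl j))
      (D.localSystem.transDom (Sum.inl i) (Sum.inl j)) T J c₀ ∧
    BoundedSmooth (D.localSystem.factor δ (Sum.inl i) (Sum.inl j)) ∧
    Function.support (D.localSystem.factor δ (Sum.inl i) (Sum.inl j)) ⊆ T := by
  classical
  have : T2Space B := C.t2Space_cross
  have hopen : ∀ i j, IsOpen (crossDom loc i j) := fun i j =>
    ((loc.chartB i).symm.trans (loc.chartB j)).open_source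
  set T : Set (Euc n) := tsupport (D.b i) ∩
    (loc.chartB i).symm ⁻¹' ((loc.chartB j).symm '' tsupport (D.b j)) with hTdef
  have hTc : IsClosed T := ((loc.chartB i).continuousOn_symm.mono
    (D.tsupport_b i)).preimage_isClosed_of_isClosed (isClosed_tsupport _)
      ((D.hasCompactSupport_b j).image_of_continuousOn
        ((loc.chartB j).continuousOn_symm.mono (D.tsupport_b j))).isClosed
  have hT : IsCompact T := (D.hasCompactSupport_b i).of_isClosed_subset hTc inter_subset_left
  have hTV : T ⊆ crossDom loc i j := by
    rintro y ⟨h1, w, hw, he⟩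
    refine mem_crossDom.2 ⟨D.tsupport_b i h1, ?_⟩
    rw [← he]
    exact (loc.chartB j).map_target (D.tsupport_b j hw)
  obtain ⟨J, c₀, h⟩ := exists_isTransition_of_isCompact (hopen i j) hT hTV (contDiffOn_crossTrans i j)
    (crossTrans_leftInvOn i j).injOn fun y hy => det_fderiv_ne_zero (hopen i j) (hopen j i)
      (contDiffOn_crossTrans i j) (contDiffOn_crossTrans j i) (crossTrans_mapsTo i j)
      (crossTrans_leftInvOn i j) hy
  obtain ⟨J', h'⟩ := exists_isTransition_cylMap h D.t₀_pos
  have hdom : {z : Euc (n + 1) | 0 < z 0 ∧ crossCoord z ∈ crossDom loc i j} =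
      D.localSystem.transDom (Sum.inl i) (Sum.inl j) := by
    ext z
    exact D.mem_transDom_inl.symm
  have h'' := h'.congr (κ' := D.localSystem.trans (Sum.inl i) (Sum.inl j))
    fun z hz => D.trans_inl hz.1
  rw [hdom] at h''
  set α : ℝ → ℝ := fun t => D.a t * (D.a t * Real.exp (-(δ * t))) with hα
  set β : Euc n → ℝ := fun y => if y ∈ crossDom loc i j then D.b i y * D.b j (crossTrans loc i j y)
    else 0 with hβ
  have hαs : BoundedSmooth α := by
    obtain ⟨t₁, ht₁⟩ := D.a_large
    refine boundedSmooth_of_eq_exp (t₀ := D.t₀) (t₁ := t₁) ?_ hδ (fun t ht => ?_) fun t ht => ?_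
    · exact D.contDiff_a.mul (D.contDiff_a.mul (Real.contDiff_exp.comp (contDiff_const.mul contDiff_id).neg))
    · simp [hα, D.a_eq_zero t ht]
    · simp [hα, ht₁ t ht]
  have hβsupp : Function.support β ⊆ T := by
    intro y hy
    rw [Function.mem_support, hβ] at hy
    simp only at hy
    split_ifs at hy with hV
    · refine ⟨subset_tsupport _ (left_ne_zero_of_mul hy), _,
        subset_tsupport _ (right_ne_zero_of_mul hy), ?_⟩
      rw [crossTrans, (loc.chartB j).left_inv (mem_crossDom.1 hV).2]
    · exact absurd rfl hy
  have hβs : BoundedSmooth β := by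
    refine BoundedSmooth.of_hasCompactSupport (contDiff_of_support_subset (hopen i j) ?_ hTc hTV hβsupp)
      (hT.of_isClosed_subset (isClosed_tsupport _) (closure_minimal hβsupp hTc))
    have h1 : ContDiffOn ℝ ∞ (fun y => D.b i y * D.b j (crossTrans loc i j y)) (crossDom loc i j) :=
      (D.contDiff_b i).contDiffOn.mul ((D.contDiff_b j).comp_contDiffOn (contDiffOn_crossTrans i j))
    refine h1.congr fun y hy => ?_
    simp only [hβ, if_pos hy]
  have hfac : D.localSystem.factor δ (Sum.inl i) (Sum.inl j) =
      fun z => α (firstCLM n z) * β (crossCLM n z) := by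
    ext z
    rw [LocalSystem.factor, firstCLM_apply, crossCLM_apply]
    by_cases h0 : 0 < z 0
    · by_cases h1 : crossCoord z ∈ crossDom loc i j
      · rw [if_pos (D.mem_transDom_inl.2 ⟨h0, h1⟩), D.trans_inl h0]
        simp only [hβ, if_pos h1, hα]
        change D.a (z 0) * D.b i (crossCoord z) * (D.a (z 0) * D.b j (crossTrans loc i j (crossCoord z)) *
          Real.exp (-(δ * z 0))) = _
        ring
      · rw [if_neg (fun h => h1 (D.mem_transDom_inl.1 h).2)]
        simp only [hβ, if_neg h1, mul_zero]
    · rw [if_neg (fun h => h0 (D.mem_transDom_inl.1 h).1)]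
      simp only [hα]
      rw [D.a_eq_zero _ (lt_of_le_of_lt (not_lt.1 h0) D.t₀_pos)]
      simp
  refine ⟨_, J', c₀, h'', ?_, ?_⟩
  · rw [hfac]
    exact (hαs.comp_clm (firstCLM n)).mul (hβs.comp_clm (crossCLM n))
  · rw [hfac]
    intro z hz
    refine ⟨?_, hβsupp (right_ne_zero_of_mul hz)⟩
    by_contra! hlt
    refine left_ne_zero_of_mul hz ?_
    simp [hα, firstCLM_apply, D.a_eq_zero _ hlt]

lemma goodTransitions {δ : ℝ} (hδ : 0 ≤ δ) : D.localSystem.GoodTransitions δ := by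
  have hθ : ∀ i, ContDiff ℝ ∞ (D.localSystem.θ i) := by
    rintro (i | i)
    · exact (D.contDiff_a.comp (firstCLM n).contDiff).mul ((D.contDiff_b i).comp (crossCLM n).contDiff)
    · exact D.contDiff_c i
  have hht : ∀ i, ContDiff ℝ ∞ (D.localSystem.ht i) := by
    rintro (i | i)
    · exact (firstCLM n).contDiff
    · exact contDiff_const
  rintro (i | i) (j | j)
  · exact D.exists_transition_inl hδ i j
  · exact LocalSystem.exists_transition_of_isCompact D.contDiffOn_trans hθ hht δ _ _
      (Or.inr (D.hasCompactSupport_c j))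
  · exact LocalSystem.exists_transition_of_isCompact D.contDiffOn_trans hθ hht δ _ _
      (Or.inl (D.hasCompactSupport_c i))
  · exact LocalSystem.exists_transition_of_isCompact D.contDiffOn_trans hθ hht δ _ _
      (Or.inl (D.hasCompactSupport_c i))

lemma rho_inl {i : Fin loc.cardB} {z : Euc (n + 1)} (hz : 0 < z 0) :
    D.localSystem.ρ (Sum.inl i) ((D.localSystem.e (Sum.inl i)).symm z) =
      loc.partB i ((loc.chartB i).symm (crossCoord z)) * cut (Real.exp (-z 0)) := by
  have h := ConicManifold.exp_neg_mem hz
  have e : (D.localSystem.e (Sum.inl i)).symm z =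
    C.collar (Real.exp (-z 0), (loc.chartB i).symm (crossCoord z)) := rfl
  rw [e]
  refine (if_pos (C.collar_mem_openCollar h.1.le h.2)).trans ?_
  rw [C.symm_collar h.1.le h.2.le]

end CutoffData

/-- In the coordinate t the function is 0 for t < -log b and 1 for t > -log a, which is the case δ =
0 of `boundedSmooth_of_eq_exp`. -/
lemma IsCutoff.boundedSmooth_exp (hcut : IsCutoff cut) :
    BoundedSmooth fun t : ℝ => if 0 < t then cut (Real.exp (-t)) else 0 := by
  obtain ⟨a, ha, ha1⟩ := hcut.eq_one
  obtain ⟨b, hb, hb0⟩ := hcut.eq_zero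
  have hlog : Real.log b < 0 := Real.log_neg hb.1 hb.2
  have hloga : Real.log a < 0 := Real.log_neg ha.1 ha.2
  have hzero : ∀ t < -Real.log b, (if 0 < t then cut (Real.exp (-t)) else 0) = 0 := by
    intro t ht
    split_ifs with h0
    · refine hb0 _ ⟨?_, (ConicManifold.exp_neg_mem h0).2⟩
      rw [← Real.log_le_iff_le_exp hb.1]
      linarith
    · rfl
  refine boundedSmooth_of_eq_exp (δ := 0) (t₀ := -Real.log b) (t₁ := -Real.log a) ?_ le_rfl hzero ?_
  · rw [contDiff_iff_contDiffAt]
    intro t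
    by_cases ht : 0 < t
    · have h1 : ContDiffAt ℝ ∞ cut (Real.exp (-t)) :=
        (hcut.contDiffOn.mono Ioo_subset_Ico_self).contDiffAt
          (isOpen_Ioo.mem_nhds (ConicManifold.exp_neg_mem ht))
      have h2 : ContDiffAt ℝ ∞ (fun t : ℝ => cut (Real.exp (-t))) t :=
        h1.comp t (Real.contDiff_exp.comp contDiff_neg).contDiffAt
      refine h2.congr_of_eventuallyEq ?_
      filter_upwards [isOpen_Ioi.mem_nhds ht] with r hr
      exact if_pos hr
    · refine (contDiffAt_const (c := (0 : ℝ))).congr_of_eventuallyEq ?_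
      filter_upwards [isOpen_Iio.mem_nhds (show t < -Real.log b by linarith)] with r hr
      exact hzero r hr
  · intro t ht
    have h0 : 0 < t := by linarith
    rw [if_pos h0, zero_mul, neg_zero, Real.exp_zero]
    refine ha1 _ ⟨(Real.exp_pos _).le, ?_⟩
    rw [← Real.le_log_iff_exp_le ha.1]
    linarith

namespace CutoffData

variable (D : CutoffData loc) {p : ℝ} [hp : Fact (1 < p)]

/-- For δ < 0 the weight is a decaying exponential in t times a bounded smooth function supported in
t ≥ 0 and bounded in y. With δ = ϑ - (n+1)/2 this is where ϑ < (n+1)/2 enters. -/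
lemma exists_sobolevBound_eta_inl (hcut : IsCutoff cut) {δ : ℝ} (hδ : δ < 0) (i : Fin loc.cardB)
    (m : ℕ) : ∃ c, SobolevBound p m (D.localSystem.eta δ (Sum.inl i)) c := by
  classical
  have : CompactSpace B := C.compactSpace_cross
  set β : Euc n → ℝ := fun y => if y ∈ (loc.chartB i).target then
    loc.partB i ((loc.chartB i).symm y) else 0 with hβ
  have hsub := loc.partB_tsupport i
  have hT : IsCompact (loc.chartB i '' tsupport (loc.partB i)) :=
    (isClosed_tsupport (loc.partB i)).isCompact.image_of_continuousOn
      ((loc.chartB i).continuousOn.mono hsub)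
  have hTV : loc.chartB i '' tsupport (loc.partB i) ⊆ (loc.chartB i).target := by
    rintro _ ⟨y, hy, rfl⟩
    exact (loc.chartB i).map_source (hsub hy)
  have hs : Function.support β ⊆ loc.chartB i '' tsupport (loc.partB i) := by
    intro y hy
    rw [Function.mem_support, hβ] at hy
    simp only at hy
    split_ifs at hy with hV
    · exact ⟨_, subset_tsupport _ hy, (loc.chartB i).right_inv hV⟩
    · exact absurd rfl hy
  have hβs : BoundedSmooth β := by
    refine BoundedSmooth.of_hasCompactSupport (contDiff_of_support_subset (loc.chartB i).open_target ?_
      hT.isClosed hTV hs) (hT.of_isClosed_subset (isClosed_tsupport _) (closure_minimal hs hT.isClosed))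
    have h1 : ContDiffOn ℝ ∞ (fun y => loc.partB i ((loc.chartB i).symm y)) (loc.chartB i).target := by
      rw [← contMDiffOn_iff_contDiffOn]
      exact (loc.partB_smooth i).comp_contMDiffOn
        (contMDiffOn_symm_of_mem_maximalAtlas (loc.chartB_mem i))
    refine h1.congr fun y hy => ?_
    simp only [hβ, if_pos hy]
  obtain ⟨R, hR⟩ := hT.isBounded.exists_norm_le
  obtain ⟨c, hc⟩ := exists_sobolevBound_exp_mul (p := p) (neg_pos.2 hδ) m (R := R)
    ((hcut.boundedSmooth_exp.comp_clm (firstCLM n)).mul (hβs.comp_clm (crossCLM n))) (by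
      intro z hz
      refine ⟨?_, hR _ (hs (right_ne_zero_of_mul hz))⟩
      by_contra! hlt
      refine left_ne_zero_of_mul hz ?_
      rw [firstCLM_apply, if_neg (by linarith)])
  refine ⟨c, ?_⟩
  convert hc using 1
  ext z
  rw [LocalSystem.eta, firstCLM_apply, crossCLM_apply]
  by_cases h0 : 0 < z 0
  · by_cases h1 : crossCoord z ∈ (loc.chartB i).target
    · have hm : z ∈ (D.localSystem.e (Sum.inl i)).target := ⟨h0, h1⟩
      rw [if_pos hm, D.rho_inl h0, if_pos h0]
      simp only [hβ, if_pos h1]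
      rw [neg_mul, neg_neg]
      change _ * Real.exp (δ * z 0) = _
      ring
    · have hm : z ∉ (D.localSystem.e (Sum.inl i)).target := fun h => h1 h.2
      rw [if_neg hm]
      simp only [hβ, if_neg h1, mul_zero]
  · have hm : z ∉ (D.localSystem.e (Sum.inl i)).target := fun h => h0 h.1
    rw [if_neg hm, if_neg h0]
    simp

lemma exists_sobolevBound_eta_inr (hcut : IsCutoff cut) (δ : ℝ) (i : Fin loc.cardM) (m : ℕ) :
    ∃ c, SobolevBound p m (D.localSystem.eta δ (Sum.inr i)) c := by
  have hs : Function.support (D.localSystem.eta δ (Sum.inr i)) ⊆ tsupport (D.c i) := fun z hz =>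
    subset_tsupport _ (by
      have h : D.c i z = 1 := (LocalSystem.eta_ne hz).2
      rw [Function.mem_support, h]
      exact one_ne_zero)
  have hT : IsCompact (tsupport (D.c i)) := D.hasCompactSupport_c i
  refine exists_sobolevBound_of_hasCompactSupport m (contDiff_of_support_subset
    (interiorChart (loc.chartM i)).open_target ?_ hT.isClosed (D.tsupport_c i) hs)
    (hT.of_isClosed_subset (isClosed_tsupport _) (closure_minimal hs hT.isClosed))
  have hsymm := contMDiffOn_interiorChart_symm (loc.chartM_mem i)
  have h1 : ContDiffOn ℝ ∞ (fun z => loc.partM i ((interiorChart (loc.chartM i)).symm z))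
      (interiorChart (loc.chartM i)).target := by
    rw [← contMDiffOn_iff_contDiffOn]
    exact (loc.partM_smooth i).comp_contMDiffOn hsymm
  have h2 : ContDiffOn ℝ ∞ (fun z => C.cutoff cut ((interiorChart (loc.chartM i)).symm z))
      (interiorChart (loc.chartM i)).target := by
    rw [← contMDiffOn_iff_contDiffOn]
    refine (C.contMDiffOn_cutoff hcut).comp hsymm fun z hz => ?_
    have h3 := (interiorChart (loc.chartM i)).map_target hz
    rw [interiorChart_source (loc.chartM_mem i)] at h3
    exact h3.2
  refine (h1.mul (contDiffOn_const.sub h2) (f := fun z => loc.partM i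
    ((interiorChart (loc.chartM i)).symm z))
    (g := fun z => 1 - C.cutoff cut ((interiorChart (loc.chartM i)).symm z))).congr fun z hz => ?_
  rw [LocalSystem.eta, if_pos (show z ∈ (D.localSystem.e (Sum.inr i)).target from hz)]
  change _ * Real.exp (δ * 0) = _
  rw [mul_zero, Real.exp_zero, mul_one]
  rfl

lemma goodWeights (hcut : IsCutoff cut) {δ : ℝ} (hδ : δ < 0) : D.localSystem.GoodWeights p δ := by
  rintro (i | i) m
  · exact D.exists_sobolevBound_eta_inl hcut hδ i m
  · exact D.exists_sobolevBound_eta_inr hcut δ i m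

omit hp in
lemma mellinENorm_eq {F : Type*} [NormedAddCommGroup F] [NormedSpace ℝ F] (p s γ : ℝ)
    (u : RegularPart n Mt → F) : loc.mellinENorm p s γ u =
      D.localSystem.pieceNorm p s (γ - (n + 1) / 2) (Function.extend Subtype.val u 0) := by
  have h1 : ∀ i, loc.cylinderPiece γ i u =
      D.localSystem.piece (γ - (n + 1) / 2) (Sum.inl i) (Function.extend Subtype.val u 0) := by
    intro i
    ext z
    rw [ConicAtlas.cylinderPiece, LocalSystem.piece, LocalSystem.eta]
    by_cases h : 0 < z 0 ∧ crossCoord z ∈ (loc.chartB i).target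
    · rw [if_pos h, if_pos (show z ∈ (D.localSystem.e (Sum.inl i)).target from h), D.rho_inl h.1]
      change _ = (_ * _ * Real.exp ((γ - (n + 1) / 2) * z 0)) • _
      rw [mul_right_comm]
      rfl
    · rw [if_neg h, if_neg (show z ∉ (D.localSystem.e (Sum.inl i)).target from h), zero_smul]
  have h2 : ∀ i, loc.corePiece i u =
      D.localSystem.piece (γ - (n + 1) / 2) (Sum.inr i) (Function.extend Subtype.val u 0) := by
    intro i
    ext z
    rw [ConicAtlas.corePiece, LocalSystem.piece, LocalSystem.eta]
    by_cases h : z ∈ ((loc.chartM i).extend (𝓡∂ (n + 1))).target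
    · rw [if_pos h]
      by_cases h' : z ∈ interior (range (𝓡∂ (n + 1)))
      · rw [if_pos (show z ∈ (D.localSystem.e (Sum.inr i)).target from ⟨h, h'⟩)]
        change _ = (_ * Real.exp ((γ - (n + 1) / 2) * 0)) • _
        rw [mul_zero, Real.exp_zero, mul_one]
        rfl
      -- A point on the edge of the half space corresponds to a boundary point of M̃, where the
      -- extension of u is zero; otherwise the interior chart would map it into the interior.
      · rw [if_neg (show z ∉ (D.localSystem.e (Sum.inr i)).target from fun hh => h' hh.2), zero_smul,
          Function.extend_apply', Pi.zero_apply, smul_zero]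
        rintro ⟨x, hx⟩
        have h3 : ((loc.chartM i).extend (𝓡∂ (n + 1))).symm z ∈
            (interiorChart (loc.chartM i)).source := by
          rw [interiorChart_source (loc.chartM_mem i), ← (loc.chartM i).extend_source (I := 𝓡∂ (n + 1))]
          exact ⟨((loc.chartM i).extend (𝓡∂ (n + 1))).map_target h, hx ▸ x.2⟩
        have h4 := (interiorChart (loc.chartM i)).map_source h3
        have h5 : interiorChart (loc.chartM i) (((loc.chartM i).extend (𝓡∂ (n + 1))).symm z) = z :=
          ((loc.chartM i).extend (𝓡∂ (n + 1))).right_inv h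
        rw [h5] at h4
        exact h' h4.2
    · rw [if_neg h, if_neg (show z ∉ (D.localSystem.e (Sum.inr i)).target from fun hh => h hh.1),
        zero_smul]
  rw [ConicAtlas.mellinENorm, LocalSystem.pieceNorm, Fintype.sum_sum_type]
  simp only [h1, h2]

end CutoffData

end ConicSystem

/-! ### Representatives of classes and estimates in Mellin Sobolev spaces. -/

section MellinEstimates
set_option linter.unusedSectionVars false

variable {n : ℕ} {Mt B : Type*}
  [TopologicalSpace Mt] [ChartedSpace (EuclideanHalfSpace (n + 1)) Mt]
  [IsManifold (𝓡∂ (n + 1)) ∞ Mt]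
  [TopologicalSpace B] [ChartedSpace (Euc n) B] [IsManifold (𝓡 n) ∞ B]
  {C : ConicManifold n Mt B} {cut : ℝ → ℝ} {loc : ConicAtlas C cut}

section Represents

variable {F : Type*} [NormedAddCommGroup F] [NormedSpace ℝ F]
  {p s γ : ℝ} [hp : Fact (1 < p)] {q q' : MellinSobolev loc p s γ F} {u v : RegularPart n Mt → F}

namespace MellinSobolev

lemma exists_represents (q : MellinSobolev loc p s γ F) : ∃ u, q.Represents u := by
  obtain ⟨u, hu⟩ := SeparationQuotient.surjective_mk (X := MellinFun loc p s γ F) q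
  exact ⟨u.1, u.2, hu.symm⟩

lemma exists_represents_of_lt_top (h : loc.mellinENorm p s γ u < ⊤) :
    ∃ q : MellinSobolev loc p s γ F, q.Represents u := ⟨_, h, rfl⟩

lemma Represents.lt_top (h : q.Represents u) : loc.mellinENorm p s γ u < ⊤ := h.1

lemma Represents.mellinENorm_eq (h : q.Represents u) : loc.mellinENorm p s γ u = ‖q‖₊ := by
  obtain ⟨hu, rfl⟩ := h
  have h1 : ‖(SeparationQuotient.mk (show MellinFun loc p s γ F from ⟨u, hu⟩) :
      MellinSobolev loc p s γ F)‖ = (loc.mellinENorm p s γ u).toReal :=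
    SeparationQuotient.norm_mk (E := MellinFun loc p s γ F) _
  rw [← ENNReal.ofReal_toReal (show loc.mellinENorm p s γ u ≠ ⊤ from LT.lt.ne hu), ← h1,
    ENNReal.ofReal, Real.toNNReal_of_nonneg (norm_nonneg _)]
  rfl

lemma Represents.add (h : q.Represents u) (h' : q'.Represents v) : (q + q').Represents (u + v) := by
  obtain ⟨hu, rfl⟩ := h
  obtain ⟨hv, rfl⟩ := h'
  exact ⟨add_mem hu hv, rfl⟩

lemma Represents.smul (c : ℝ) (h : q.Represents u) : (c • q).Represents (c • u) := by
  obtain ⟨hu, rfl⟩ := h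
  exact ⟨Submodule.smul_mem _ c hu, rfl⟩

lemma Represents.sub (h : q.Represents u) (h' : q'.Represents v) : (q - q').Represents (u - v) := by
  rw [sub_eq_add_neg, sub_eq_add_neg, ← neg_one_smul ℝ q', ← neg_one_smul ℝ v]
  exact h.add (h'.smul _)

lemma Represents.unique (h : q.Represents u) (h' : q'.Represents u) : q = q' := by
  obtain ⟨hu, rfl⟩ := h
  obtain ⟨hv, rfl⟩ := h'
  rfl

lemma Represents.mellinENorm_sub (h : q.Represents u) (h' : q.Represents v) :
    loc.mellinENorm p s γ (u - v) = 0 := by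
  rw [(h.sub h').mellinENorm_eq, sub_self, nnnorm_zero, ENNReal.coe_zero]

lemma Represents.congr (h : q.Represents u) (h' : loc.mellinENorm p s γ (v - u) = 0) :
    q.Represents v := by
  obtain ⟨q₁, h₁⟩ := exists_represents_of_lt_top (loc := loc) (u := v - u) (h'.trans_lt ENNReal.zero_lt_top)
  have h2 := h₁.mellinENorm_eq
  rw [h', eq_comm, ENNReal.coe_eq_zero, nnnorm_eq_zero] at h2
  have := h.add h₁
  rwa [h2, add_zero, add_sub_cancel] at this

end MellinSobolev

end Represents

variable [CompactSpace Mt] [T2Space Mt]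
  {V F : Type*} [NormedAddCommGroup V] [NormedSpace ℝ V] [NormedAddCommGroup F] [NormedSpace ℝ F]
  {p s γ ϑ : ℝ}

/-- The pieces do not see the values on the boundary, so any extension of u to M̃ may be used, for
instance one obtained by substitution that does not vanish there. -/
lemma mellinENorm_eq_of_eq (D : CutoffData loc) {u : RegularPart n Mt → F} {v : Mt → F}
    (h : ∀ z : RegularPart n Mt, v z = u z) :
    loc.mellinENorm p s γ u = D.localSystem.pieceNorm p s (γ - (n + 1) / 2) v := by
  rw [D.mellinENorm_eq]
  refine LocalSystem.pieceNorm_congr fun x hx => ?_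
  rw [h ⟨x, hx⟩]
  exact Subtype.val_injective.extend_apply u 0 ⟨x, hx⟩

lemma extend_val (u : RegularPart n Mt → F) (z : RegularPart n Mt) :
    Function.extend Subtype.val u (0 : Mt → F) z = u z :=
  Subtype.val_injective.extend_apply u 0 z

variable [hp : Fact (1 < p)] [CompleteSpace F]
  (hcut : IsCutoff cut) (loc)
  (hpd : (n : ℝ) + 1 < p) (hs : ((n : ℝ) + 1) / p < s) (hγ : ((n : ℝ) + 1) / 2 ≤ γ)

include hcut hpd hs hγ

/-- Norm zero in the source space makes all truncations agree almost everywhere, and then so do the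
pieces of the composition with any g and for any weight. Substitution is therefore well defined on
classes. -/
lemma mellin_comp_sub_eq_zero {G : Type*} [NormedAddCommGroup G] [NormedSpace ℝ G] [CompleteSpace G]
    {w w' : RegularPart n Mt → F}
    (h : loc.mellinENorm p s γ (w - w') = 0) (g : F → G) {r : ℝ} :
    loc.mellinENorm p r ϑ ((fun z => g (w z)) - fun z => g (w' z)) = 0 := by
  obtain ⟨D⟩ := exists_cutoffData hcut loc
  have hpd' : ((n + 1 : ℕ) : ℝ) < p := by push_cast; exact hpd
  have hs' : ((n + 1 : ℕ) : ℝ) / p < s := by push_cast; exact hs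
  have hs0 : 0 < s := lt_of_le_of_lt (div_nonneg (by positivity) (by linarith [hp.out])) hs
  have hS := D.goodTransitions (sub_nonneg.2 hγ)
  rw [mellinENorm_eq_of_eq D (v := Function.extend Subtype.val w 0 - Function.extend Subtype.val w' 0)
    (fun z => by simp only [Pi.sub_apply, extend_val])] at h
  rw [mellinENorm_eq_of_eq D (v := (fun x => g (Function.extend Subtype.val w 0 x)) -
    fun x => g (Function.extend Subtype.val w' 0 x)) (fun z => by simp only [Pi.sub_apply, extend_val])]
  have hz : D.localSystem.pieceNorm p r (ϑ - (n + 1) / 2) (0 : Mt → G) = 0 := by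
    rw [← mellinENorm_eq_of_eq D (u := (0 : RegularPart n Mt → G)) (fun z => rfl), loc.mellinENorm_zero]
  rw [← hz]
  refine LocalSystem.pieceNorm_congr_ae fun i => ?_
  have ht := LocalSystem.trunc_ae_eq_of_pieceNorm_sub hS hpd' hs' hs0 h i
  filter_upwards [LocalSystem.piece_ae_eq_of_trunc (δ' := ϑ - (n + 1) / 2) ht g] with z hz
  rw [LocalSystem.piece_sub, Pi.sub_apply, hz, sub_self]
  simp [LocalSystem.piece]

lemma exists_continuous_mellinENorm_sub {w : RegularPart n Mt → F}
    (hw : loc.mellinENorm p s γ w < ⊤) :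
    ∃ w', Continuous w' ∧ loc.mellinENorm p s γ (w' - w) = 0 := by
  obtain ⟨D⟩ := exists_cutoffData hcut loc
  have hpd' : ((n + 1 : ℕ) : ℝ) < p := by push_cast; exact hpd
  have hs' : ((n + 1 : ℕ) : ℝ) / p < s := by push_cast; exact hs
  have hs0 : 0 < s := lt_of_le_of_lt (div_nonneg (by positivity) (by linarith [hp.out])) hs
  have hS := D.goodTransitions (sub_nonneg.2 hγ)
  rw [D.mellinENorm_eq] at hw
  obtain ⟨v, hv, hvt⟩ := LocalSystem.exists_continuousOn_trunc_ae_eq hS hpd' hs' hs0 hw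
  refine ⟨fun z => v z, hv.comp_continuous continuous_subtype_val fun z => z.2, ?_⟩
  rw [mellinENorm_eq_of_eq D (v := v - Function.extend Subtype.val w 0)
    (fun z => by simp only [Pi.sub_apply, extend_val])]
  have hz : D.localSystem.pieceNorm p s (γ - (n + 1) / 2) (0 : Mt → F) = 0 := by
    rw [← mellinENorm_eq_of_eq D (u := (0 : RegularPart n Mt → F)) (fun z => rfl), loc.mellinENorm_zero]
  rw [← hz]
  refine LocalSystem.pieceNorm_congr_ae fun i => ?_
  filter_upwards [LocalSystem.piece_ae_eq_of_trunc (δ' := γ - (n + 1) / 2) (hvt i) id] with z hz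
  rw [LocalSystem.piece_sub, Pi.sub_apply]
  refine (sub_eq_zero.2 hz).trans ?_
  simp [LocalSystem.piece]

lemma exists_norm_le_mellinENorm : ∃ K : ℝ≥0, ∀ (w : RegularPart n Mt → F) (c : ℝ≥0),
    Continuous w → loc.mellinENorm p s γ w ≤ c → ∀ z, ‖w z‖₊ ≤ K * c := by
  obtain ⟨D⟩ := exists_cutoffData hcut loc
  have hpd' : ((n + 1 : ℕ) : ℝ) < p := by push_cast; exact hpd
  have hs' : ((n + 1 : ℕ) : ℝ) / p < s := by push_cast; exact hs
  have hs0 : 0 < s := lt_of_le_of_lt (div_nonneg (by positivity) (by linarith [hp.out])) hs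
  have hS := D.goodTransitions (sub_nonneg.2 hγ)
  obtain ⟨K, hK⟩ := LocalSystem.exists_norm_le_of_continuousOn (F := F) hS hpd' hs' hs0
  refine ⟨K, fun w c hw hc z => ?_⟩
  have h := hK (Function.extend Subtype.val w 0) c ?_ (by rwa [← D.mellinENorm_eq]) z z.2
  · rwa [extend_val] at h
  · rw [continuousOn_iff_continuous_domRestrict]
    refine hw.congr fun z => ?_
    exact (extend_val w z).symm

variable {V' : Type} [NormedAddCommGroup V'] [NormedSpace ℝ V'] [CompleteSpace V'] [ProperSpace V']

lemma exists_mellinENorm_bilin_le : ∃ K : ℝ≥0, ∀ (a : RegularPart n Mt → V' →L[ℝ] F)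
    (h : RegularPart n Mt → V') (y : V') (c c' : ℝ≥0), loc.mellinENorm p ⌊s⌋₊ ϑ a ≤ c →
    loc.mellinENorm p s γ h ≤ c' → ‖y‖₊ ≤ c' →
    loc.mellinENorm p ⌊s⌋₊ ϑ (fun z => a z (h z + y)) ≤ (K * c * c' : ℝ≥0) := by
  obtain ⟨D⟩ := exists_cutoffData hcut loc
  have hpd' : ((n + 1 : ℕ) : ℝ) < p := by push_cast; exact hpd
  have hs' : ((n + 1 : ℕ) : ℝ) / p < s := by push_cast; exact hs
  have hs0 : 0 < s := lt_of_le_of_lt (div_nonneg (by positivity) (by linarith [hp.out])) hs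
  have hS := D.goodTransitions (sub_nonneg.2 hγ)
  obtain ⟨K, hK⟩ := LocalSystem.exists_pieceNorm_bilin_le (V := V') (F := F) (δ' := ϑ - (n + 1) / 2)
    hS hpd' hs' hs0
  refine ⟨K, fun a h y c c' ha hh hy => ?_⟩
  rw [D.mellinENorm_eq] at ha hh
  rw [mellinENorm_eq_of_eq D (v := fun x => Function.extend Subtype.val a 0 x
    (Function.extend Subtype.val h 0 x + y)) (fun z => by simp only [extend_val])]
  exact hK _ _ y c c' ha hh hy

variable (hϑ : ϑ < ((n : ℝ) + 1) / 2)
include hϑ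

lemma mellinENorm_comp_lt_top {φ : V' → F} (hφ : ContDiff ℝ ⌊s⌋₊ φ) {w : RegularPart n Mt → V'}
    (hw : loc.mellinENorm p s γ w < ⊤) (v : V') :
    loc.mellinENorm p ⌊s⌋₊ ϑ (fun z => φ (w z + v)) < ⊤ := by
  obtain ⟨D⟩ := exists_cutoffData hcut loc
  have hpd' : ((n + 1 : ℕ) : ℝ) < p := by push_cast; exact hpd
  have hs' : ((n + 1 : ℕ) : ℝ) / p < s := by push_cast; exact hs
  have hs0 : 0 < s := lt_of_le_of_lt (div_nonneg (by positivity) (by linarith [hp.out])) hs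
  have hS := D.goodTransitions (sub_nonneg.2 hγ)
  have hW := D.goodWeights (p := p) hcut (sub_neg.2 hϑ)
  rw [D.mellinENorm_eq] at hw
  rw [mellinENorm_eq_of_eq D (v := fun x => φ (Function.extend Subtype.val w 0 x + v))
    (fun z => by simp only [extend_val])]
  exact LocalSystem.pieceNorm_comp_lt_top hS hW hpd' hs' hs0 hφ hw v

lemma exists_mellinENorm_comp_sub_le {φ : V' → F} (hφ : ContDiff ℝ ⌊s⌋₊ φ)
    {w : RegularPart n Mt → V'} (hw : loc.mellinENorm p s γ w < ⊤) (v : V') {ε : ℝ≥0} (hε : 0 < ε) :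
    ∃ r : ℝ≥0, 0 < r ∧ ∀ (h : RegularPart n Mt → V') (y : V'), loc.mellinENorm p s γ h ≤ r →
      ‖y‖₊ ≤ r → loc.mellinENorm p ⌊s⌋₊ ϑ
        ((fun z => φ ((w + h) z + (v + y))) - fun z => φ (w z + v)) ≤ ε := by
  obtain ⟨D⟩ := exists_cutoffData hcut loc
  have hpd' : ((n + 1 : ℕ) : ℝ) < p := by push_cast; exact hpd
  have hs' : ((n + 1 : ℕ) : ℝ) / p < s := by push_cast; exact hs
  have hs0 : 0 < s := lt_of_le_of_lt (div_nonneg (by positivity) (by linarith [hp.out])) hs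
  have hS := D.goodTransitions (sub_nonneg.2 hγ)
  have hW := D.goodWeights (p := p) hcut (sub_neg.2 hϑ)
  rw [D.mellinENorm_eq] at hw
  obtain ⟨r, hr, h⟩ := LocalSystem.exists_pieceNorm_comp_sub_le hS hW hpd' hs' hs0 hφ hw v hε
  refine ⟨r, hr, fun u y hu hy => ?_⟩
  rw [D.mellinENorm_eq] at hu
  rw [mellinENorm_eq_of_eq D (v := fun x => φ (Function.extend Subtype.val w 0 x +
    Function.extend Subtype.val u 0 x + (v + y)) - φ (Function.extend Subtype.val w 0 x + v))
    (fun z => by simp only [extend_val, Pi.sub_apply, Pi.add_apply])]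
  exact h _ y hu hy

lemma exists_mellinENorm_remainder_le {φ : V' → F} (hφ : ContDiff ℝ (⌊s⌋₊ + 1) φ)
    {w : RegularPart n Mt → V'} (hw : loc.mellinENorm p s γ w < ⊤) (v : V') {ε : ℝ≥0} (hε : 0 < ε) :
    ∃ r₀ : ℝ≥0, 0 < r₀ ∧ ∀ r ≤ r₀, ∀ (h : RegularPart n Mt → V') (y : V'),
      loc.mellinENorm p s γ h ≤ r → ‖y‖₊ ≤ r → loc.mellinENorm p ⌊s⌋₊ ϑ
        ((fun z => φ ((w + h) z + (v + y))) - (fun z => φ (w z + v)) -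
          fun z => fderiv ℝ φ (w z + v) (h z + y)) ≤ (ε * r : ℝ≥0) := by
  obtain ⟨D⟩ := exists_cutoffData hcut loc
  have hpd' : ((n + 1 : ℕ) : ℝ) < p := by push_cast; exact hpd
  have hs' : ((n + 1 : ℕ) : ℝ) / p < s := by push_cast; exact hs
  have hs0 : 0 < s := lt_of_le_of_lt (div_nonneg (by positivity) (by linarith [hp.out])) hs
  have hS := D.goodTransitions (sub_nonneg.2 hγ)
  have hW := D.goodWeights (p := p) hcut (sub_neg.2 hϑ)
  rw [D.mellinENorm_eq] at hw
  obtain ⟨r, hr, h⟩ := LocalSystem.exists_pieceNorm_remainder_le hS hW hpd' hs' hs0 hφ hw v hε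
  refine ⟨r, hr, fun r' hr' u y hu hy => ?_⟩
  rw [D.mellinENorm_eq] at hu
  rw [mellinENorm_eq_of_eq D (v := fun x => φ (Function.extend Subtype.val w 0 x +
    Function.extend Subtype.val u 0 x + (v + y)) - φ (Function.extend Subtype.val w 0 x + v) -
    fderiv ℝ φ (Function.extend Subtype.val w 0 x + v) (Function.extend Subtype.val u 0 x + y))
    (fun z => by simp only [extend_val, Pi.sub_apply, Pi.add_apply])]
  exact h r' hr' _ y hu hy

end MellinEstimates

/-! ### The substitution operator and its derivatives. -/

section Substitution
set_option linter.unusedSectionVars false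

universe u

variable {n : ℕ} {Mt B : Type*}
  [TopologicalSpace Mt] [ChartedSpace (EuclideanHalfSpace (n + 1)) Mt]
  [IsManifold (𝓡∂ (n + 1)) ∞ Mt]
  [TopologicalSpace B] [ChartedSpace (Euc n) B] [IsManifold (𝓡 n) ∞ B]
  {C : ConicManifold n Mt B} {cut : ℝ → ℝ} {loc : ConicAtlas C cut}
  [CompactSpace Mt] [T2Space Mt]
  {V : Type} [NormedAddCommGroup V] [NormedSpace ℝ V] [CompleteSpace V] [ProperSpace V]
  {F : Type u} [NormedAddCommGroup F] [NormedSpace ℝ F] [CompleteSpace F]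
  {p s γ ϑ : ℝ} [hp : Fact (1 < p)]

open Classical in
/-- The substitution operator `(w, c) ↦ φ ∘ (w + c)`, with value zero where the result has infinite
norm. -/
def substitution (r : ℝ) (ϑ : ℝ) (φ : V → F) (U : MellinSobolev loc p s γ V × V) :
    MellinSobolev loc p r ϑ F :=
  if h : loc.mellinENorm p r ϑ (fun z => φ (U.1.exists_represents.choose z + U.2)) < ⊤ then
    (MellinSobolev.exists_represents_of_lt_top h).choose else 0

open Classical in
/-- The product `(a, (w, c)) ↦ a (w + c)`, with value zero where the result has infinite norm. -/
def mellinProd (r : ℝ) (ϑ : ℝ) (a : MellinSobolev loc p r ϑ (V →L[ℝ] F))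
    (U : MellinSobolev loc p s γ V × V) : MellinSobolev loc p r ϑ F :=
  if h : loc.mellinENorm p r ϑ
      (fun z => a.exists_represents.choose z (U.1.exists_represents.choose z + U.2)) < ⊤ then
    (MellinSobolev.exists_represents_of_lt_top h).choose else 0

variable (hcut : IsCutoff cut)
  (hpd : (n : ℝ) + 1 < p) (hs : ((n : ℝ) + 1) / p < s) (hγ : ((n : ℝ) + 1) / 2 ≤ γ)
include hcut hpd hs hγ

open MellinSobolev

lemma Represents.comp {q : MellinSobolev loc p s γ V} {w w' : RegularPart n Mt → V} {r : ℝ}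
    {Q : MellinSobolev loc p r ϑ F} {g : V → F}
    (hw : q.Represents w) (hw' : q.Represents w') (h : Q.Represents (fun z => g (w z))) :
    Q.Represents (fun z => g (w' z)) :=
  h.congr (mellin_comp_sub_eq_zero loc hcut hpd hs hγ (hw'.mellinENorm_sub hw) g)

/-- The operator is defined through a chosen representative of the class; passing from w to the
chosen one and on to w' shows that the choice is immaterial. -/
lemma substitution_represents_of {r : ℝ} {U : MellinSobolev loc p s γ V × V}
    {w w' : RegularPart n Mt → V} {φ : V → F} (hw : U.1.Represents w) (hw' : U.1.Represents w')
    (h : loc.mellinENorm p r ϑ (fun z => φ (w z + U.2)) < ⊤) :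
    (substitution r ϑ φ U).Represents (fun z => φ (w' z + U.2)) := by
  obtain ⟨Q, hQ⟩ := exists_represents_of_lt_top h
  have h0 := U.1.exists_represents.choose_spec
  have h1 := Represents.comp hcut hpd hs hγ (g := fun ξ => φ (ξ + U.2)) hw h0 hQ
  rw [substitution, dif_pos h1.lt_top]
  exact Represents.comp hcut hpd hs hγ (g := fun ξ => φ (ξ + U.2)) h0 hw'
    (exists_represents_of_lt_top h1.lt_top).choose_spec

lemma exists_mellinProd_bound : ∃ K : ℝ≥0, ∀ (a : MellinSobolev loc p ⌊s⌋₊ ϑ (V →L[ℝ] F))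
    (U : MellinSobolev loc p s γ V × V) (α : RegularPart n Mt → V →L[ℝ] F)
    (w : RegularPart n Mt → V), a.Represents α → U.1.Represents w →
    (mellinProd ⌊s⌋₊ ϑ a U).Represents (fun z => α z (w z + U.2)) ∧
      ‖mellinProd ⌊s⌋₊ ϑ a U‖₊ ≤ K * ‖a‖₊ * ‖U‖₊ := by
  obtain ⟨K, hK⟩ := exists_mellinENorm_bilin_le (ϑ := ϑ) (F := F) (V' := V) loc hcut hpd hs hγ
  refine ⟨K, fun a U α w hα hw => ?_⟩
  have hle : ∀ {α : RegularPart n Mt → V →L[ℝ] F} {w : RegularPart n Mt → V}, a.Represents α →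
      U.1.Represents w → loc.mellinENorm p ⌊s⌋₊ ϑ (fun z => α z (w z + U.2)) ≤
        (K * ‖a‖₊ * ‖U‖₊ : ℝ≥0) := fun hα hw =>
    hK _ _ _ _ _ hα.mellinENorm_eq.le (hw.mellinENorm_eq.le.trans
      (ENNReal.coe_le_coe.2 (norm_fst_le U))) (norm_snd_le U)
  have ha0 := a.exists_represents.choose_spec
  have hU0 := U.1.exists_represents.choose_spec
  have h1 : (mellinProd ⌊s⌋₊ ϑ a U).Represents
      (fun z => a.exists_represents.choose z (U.1.exists_represents.choose z + U.2)) := by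
    have hlt := (hle ha0 hU0).trans_lt ENNReal.coe_lt_top
    rw [mellinProd, dif_pos hlt]
    exact (exists_represents_of_lt_top hlt).choose_spec
  constructor
  · refine h1.congr ?_
    -- Independence of representatives: changing a and w one at a time leaves two products, each
    -- with a factor of norm zero.
    have e : ((fun z => α z (w z + U.2)) -
        fun z => a.exists_represents.choose z (U.1.exists_represents.choose z + U.2)) =
        (fun z => (α - a.exists_represents.choose) z (w z + U.2)) +
        fun z => a.exists_represents.choose z ((w - U.1.exists_represents.choose) z + 0) := by
      ext z
      simp only [Pi.sub_apply, Pi.add_apply, sub_apply, map_add, map_sub, map_zero]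
      abel
    rw [e]
    refine le_antisymm ((loc.mellinENorm_add_le hp.out _ _ _ _).trans ?_) bot_le
    have h2 := hK (α - a.exists_represents.choose) w U.2 0 ‖U‖₊ (hα.mellinENorm_sub ha0).le
      (hw.mellinENorm_eq.le.trans (ENNReal.coe_le_coe.2 (norm_fst_le U))) (norm_snd_le U)
    have h3 := hK a.exists_represents.choose (w - U.1.exists_represents.choose) 0 ‖a‖₊ 0
      ha0.mellinENorm_eq.le (hw.mellinENorm_sub hU0).le (by simp)
    rw [mul_zero, zero_mul, ENNReal.coe_zero] at h2
    rw [mul_zero, ENNReal.coe_zero] at h3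
    exact (add_le_add h2 h3).trans (by simp)
  · have h2 := hle ha0 hU0
    rw [h1.mellinENorm_eq] at h2
    exact ENNReal.coe_le_coe.1 h2

/-- The product as a bounded bilinear map. -/
lemma exists_mellinProdL : ∃ M : MellinSobolev loc p ⌊s⌋₊ ϑ (V →L[ℝ] F) →L[ℝ]
    (MellinSobolev loc p s γ V × V) →L[ℝ] MellinSobolev loc p ⌊s⌋₊ ϑ F,
    ∀ a U α w, a.Represents α → U.1.Represents w →
      (M a U).Represents (fun z => α z (w z + U.2)) := by
  obtain ⟨K, hK⟩ := exists_mellinProd_bound (ϑ := ϑ) (F := F) (V := V) (loc := loc) hcut hpd hs hγ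
  refine ⟨LinearMap.mkContinuous₂ (LinearMap.mk₂ ℝ (mellinProd ⌊s⌋₊ ϑ) ?_ ?_ ?_ ?_) K ?_, ?_⟩
  · intro a a' U
    obtain ⟨α, hα⟩ := a.exists_represents
    obtain ⟨α', hα'⟩ := a'.exists_represents
    obtain ⟨w, hw⟩ := U.1.exists_represents
    exact (hK _ _ _ _ (hα.add hα') hw).1.unique ((hK _ _ _ _ hα hw).1.add (hK _ _ _ _ hα' hw).1)
  · intro c a U
    obtain ⟨α, hα⟩ := a.exists_represents
    obtain ⟨w, hw⟩ := U.1.exists_represents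
    exact (hK _ _ _ _ (hα.smul c) hw).1.unique ((hK _ _ _ _ hα hw).1.smul c)
  · intro a U U'
    obtain ⟨α, hα⟩ := a.exists_represents
    obtain ⟨w, hw⟩ := U.1.exists_represents
    obtain ⟨w', hw'⟩ := U'.1.exists_represents
    have h1 := (hK a (U + U') _ _ hα (hw.add hw')).1
    have h2 := (hK _ _ _ _ hα hw).1.add (hK _ _ _ _ hα hw').1
    refine h1.unique ?_
    convert h2 using 1
    ext z
    simp only [Pi.add_apply, Prod.snd_add, map_add]
    abel
  · intro c a U
    obtain ⟨α, hα⟩ := a.exists_represents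
    obtain ⟨w, hw⟩ := U.1.exists_represents
    have h1 := (hK a (c • U) _ _ hα (hw.smul c)).1
    have h2 := (hK _ _ _ _ hα hw).1.smul c
    refine h1.unique ?_
    convert h2 using 1
    ext z
    simp only [Pi.smul_apply, Prod.smul_snd, map_add, map_smul, smul_add]
  · intro a U
    obtain ⟨α, hα⟩ := a.exists_represents
    obtain ⟨w, hw⟩ := U.1.exists_represents
    exact_mod_cast (hK _ _ _ _ hα hw).2
  · intro a U α w hα hw
    exact (hK _ _ _ _ hα hw).1

variable (hϑ : ϑ < ((n : ℝ) + 1) / 2)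
include hϑ

lemma substitution_represents {φ : V → F} (hφ : ContDiff ℝ ⌊s⌋₊ φ)
    {U : MellinSobolev loc p s γ V × V} {w : RegularPart n Mt → V} (hw : U.1.Represents w) :
    (substitution ⌊s⌋₊ ϑ φ U).Represents (fun z => φ (w z + U.2)) :=
  substitution_represents_of hcut hpd hs hγ hw hw
    (mellinENorm_comp_lt_top loc hcut hpd hs hγ hϑ hφ hw.lt_top _)

lemma continuous_substitution {φ : V → F} (hφ : ContDiff ℝ ⌊s⌋₊ φ) :
    Continuous (substitution (loc := loc) (p := p) (s := s) (γ := γ) ⌊s⌋₊ ϑ φ) := by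
  rw [Metric.continuous_iff']
  intro U ε hε
  lift ε to ℝ≥0 using hε.le
  obtain ⟨w, hw⟩ := U.1.exists_represents
  obtain ⟨r, hr, h⟩ := exists_mellinENorm_comp_sub_le loc hcut hpd hs hγ hϑ hφ hw.lt_top U.2
    (half_pos (NNReal.coe_pos.1 hε))
  filter_upwards [Metric.ball_mem_nhds U (show (0 : ℝ) < r from hr)] with U' hU'
  obtain ⟨w', hw'⟩ := U'.1.exists_represents
  have hlt : ‖U' - U‖ < r := by rwa [← dist_eq_norm]
  have h1 := h (w' - w) (U'.2 - U.2)
    ((hw'.sub hw).mellinENorm_eq.le.trans (ENNReal.coe_le_coe.2 ((norm_fst_le (U' - U)).trans hlt.le)))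
    ((norm_snd_le (U' - U)).trans hlt.le)
  rw [add_sub_cancel, add_sub_cancel] at h1
  rw [((substitution_represents hcut hpd hs hγ hϑ hφ hw').sub
    (substitution_represents hcut hpd hs hγ hϑ hφ hw)).mellinENorm_eq, ENNReal.coe_le_coe] at h1
  rw [dist_eq_norm]
  exact lt_of_le_of_lt (NNReal.coe_le_coe.2 h1) (NNReal.coe_lt_coe.2 (half_lt_self (NNReal.coe_pos.1 hε)))

/-- The remainder estimate with increment size exactly ‖H‖ bounds the norm of the Taylor remainder
by ε ‖H‖ for all small H. -/
lemma hasFDerivAt_substitution {φ : V → F} (hφ : ContDiff ℝ (⌊s⌋₊ + 1) φ)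
    {M : MellinSobolev loc p ⌊s⌋₊ ϑ (V →L[ℝ] F) →L[ℝ]
      (MellinSobolev loc p s γ V × V) →L[ℝ] MellinSobolev loc p ⌊s⌋₊ ϑ F}
    (hM : ∀ a U α w, a.Represents α → U.1.Represents w →
      (M a U).Represents (fun z => α z (w z + U.2))) (U : MellinSobolev loc p s γ V × V) :
    HasFDerivAt (substitution ⌊s⌋₊ ϑ φ) (M (substitution ⌊s⌋₊ ϑ (fderiv ℝ φ) U)) U := by
  have hφ0 : ContDiff ℝ ⌊s⌋₊ φ := hφ.of_le (by exact_mod_cast Nat.le_succ _)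
  have hφ' : ContDiff ℝ ⌊s⌋₊ (fderiv ℝ φ) := hφ.fderiv_right le_rfl
  rw [hasFDerivAt_iff_isLittleO_nhds_zero, Asymptotics.isLittleO_iff]
  intro ε hε
  lift ε to ℝ≥0 using hε.le
  obtain ⟨w, hw⟩ := U.1.exists_represents
  obtain ⟨r, hr, h⟩ := exists_mellinENorm_remainder_le loc hcut hpd hs hγ hϑ hφ hw.lt_top U.2
    (NNReal.coe_pos.1 hε)
  filter_upwards [Metric.ball_mem_nhds 0 (show (0 : ℝ) < r from hr)] with H hH
  obtain ⟨u, hu⟩ := H.1.exists_represents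
  have hlt : ‖H‖ < r := by rwa [mem_ball_zero_iff] at hH
  have h1 := h ‖H‖₊ hlt.le u H.2
    (hu.mellinENorm_eq.le.trans (ENNReal.coe_le_coe.2 (norm_fst_le H))) (norm_snd_le H)
  have hadd : (U + H).1.Represents (w + u) := hw.add hu
  have h2 := (((substitution_represents hcut hpd hs hγ hϑ hφ0 hadd).sub
    (substitution_represents hcut hpd hs hγ hϑ hφ0 hw)).sub
    (hM _ H _ _ (substitution_represents hcut hpd hs hγ hϑ hφ' hw) hu)).mellinENorm_eq
  exact_mod_cast ENNReal.coe_le_coe.1 (h2.symm.le.trans h1)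

/-- The derivative is M composed with the substitution operator of φ', which has one derivative less
and takes values in V →L[ℝ] F. Hence the induction on k is over all target spaces; V lies in `Type`,
so these stay in the universe of F. -/
lemma contDiff_substitution (k : ℕ) : ∀ {F : Type u} [NormedAddCommGroup F] [NormedSpace ℝ F]
    [CompleteSpace F] {φ : V → F}, ContDiff ℝ (⌊s⌋₊ + k) φ →
    ContDiff ℝ k (substitution (loc := loc) (p := p) (s := s) (γ := γ) ⌊s⌋₊ ϑ φ) := by
  induction k with
  | zero =>
    intro F _ _ _ φ hφ
    exact contDiff_zero.2 (continuous_substitution hcut hpd hs hγ hϑ (by simpa using hφ))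
  | succ k ih =>
    intro F _ _ _ φ hφ
    obtain ⟨M, hM⟩ := exists_mellinProdL (ϑ := ϑ) (F := F) (V := V) (loc := loc) hcut hpd hs hγ
    push_cast at hφ ⊢
    rw [contDiff_succ_iff_hasFDerivAt]
    refine ⟨_, M.contDiff.comp (ih (hφ.fderiv_right ?_)),
      hasFDerivAt_substitution hcut hpd hs hγ hϑ (hφ.of_le ?_) hM⟩
    · rw [add_assoc]
    · exact_mod_cast Nat.add_le_add_left (Nat.le_add_left 1 k) _

end Substitution

/-! ### Localization to the open set O. -/

lemma isCkLip_of_contDiffOn {G H : Type*} [NormedAddCommGroup G] [NormedSpace ℝ G]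
    [NormedAddCommGroup H] [NormedSpace ℝ H] {k : ℕ} {f : G → H} {X : Set G} (hX : IsOpen X)
    (hf : ContDiffOn ℝ (k + 1) f X) : IsCkLip k f X := by
  refine ⟨hf.of_le (by exact_mod_cast Nat.le_succ k), fun x hx => ?_⟩
  -- The k-th derivative of a C^{k+1} map is C^1, hence locally Lipschitz.
  have h1 : ContDiffAt ℝ 1 (iteratedFDerivWithin ℝ k f X) x := by
    refine ((hf.contDiffAt (hX.mem_nhds hx)).iteratedFDeriv_right (m := 1) (i := k)
      (by rw [add_comm])).congr_of_eventuallyEq ?_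
    filter_upwards [hX.mem_nhds hx] with y hy
    exact iteratedFDerivWithin_of_isOpen k hX hy
  obtain ⟨K, t, ht, hK⟩ := h1.exists_lipschitzOnWith
  exact ⟨K, t, mem_nhdsWithin_of_mem_nhds ht, hK⟩

/-- A function which is smooth on a neighbourhood of a compact set can be changed away from the
compact set to become smooth everywhere. -/
lemma exists_contDiff_eq_near {V F : Type*} [NormedAddCommGroup V] [NormedSpace ℝ V]
    [FiniteDimensional ℝ V] [NormedAddCommGroup F] [NormedSpace ℝ F] {K O : Set V} (hK : IsCompact K)
    (hO : IsOpen O) (hKO : K ⊆ O) {m : ℕ} {φ : V → F} (hφ : ContDiffOn ℝ m φ O) :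
    ∃ ψ : V → F, ContDiff ℝ m ψ ∧ ∃ r > 0, ∀ ξ ∈ Metric.thickening r K, ψ ξ = φ ξ := by
  obtain ⟨χ, hχ, -, hχO, hχ1⟩ := exists_bump hK hO hKO
  obtain ⟨W, hW, hKW, hW1⟩ := mem_nhdsSet_iff_exists.1 hχ1
  obtain ⟨r, hr, hrW⟩ := hK.exists_thickening_subset_open hW hKW
  refine ⟨fun ξ => χ ξ • φ ξ, contDiff_iff_contDiffAt.2 fun ξ => ?_, r, hr, fun ξ hξ => ?_⟩
  · by_cases h : ξ ∈ O
    · exact (hχ.contDiffAt.of_le (by exact_mod_cast le_top)).smul (hφ.contDiffAt (hO.mem_nhds h))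
    · refine (contDiffAt_const (c := (0 : F))).congr_of_eventuallyEq ?_
      have hξ : ξ ∈ (tsupport χ)ᶜ := fun h' => h (hχO h')
      filter_upwards [(isClosed_tsupport χ).isOpen_compl.mem_nhds hξ] with y hy
      rw [image_eq_zero_of_notMem_tsupport hy, zero_smul]
  · have h1 : χ ξ = 1 := hW1 (hrW hξ)
    simp only [h1, one_smul]

section Localization
set_option linter.unusedSectionVars false

variable {n : ℕ} {Mt B : Type*}
  [TopologicalSpace Mt] [ChartedSpace (EuclideanHalfSpace (n + 1)) Mt]
  [IsManifold (𝓡∂ (n + 1)) ∞ Mt]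
  [TopologicalSpace B] [ChartedSpace (Euc n) B] [IsManifold (𝓡 n) ∞ B]
  {C : ConicManifold n Mt B} {cut : ℝ → ℝ} {loc : ConicAtlas C cut}
  [CompactSpace Mt] [T2Space Mt]
  {E : Type*} [NormedAddCommGroup E] [NormedSpace ℝ E] [CompleteSpace E]
  {L : ℕ} {p s γ ϑ : ℝ} [hp : Fact (1 < p)]
  (hcut : IsCutoff cut)
  (hpd : (n : ℝ) + 1 < p) (hs : ((n : ℝ) + 1) / p < s) (hγ : ((n : ℝ) + 1) / 2 ≤ γ)
include hcut hpd hs hγ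

open MellinSobolev

lemma exists_continuous_represents (q : MellinSobolev loc p s γ E) :
    ∃ w, q.Represents w ∧ Continuous w := by
  obtain ⟨u, hu⟩ := q.exists_represents
  obtain ⟨w, hw, h0⟩ := exists_continuous_mellinENorm_sub loc hcut hpd hs hγ hu.lt_top
  exact ⟨w, hu.congr h0, hw⟩

lemma exists_norm_le_of_represents : ∃ K : ℝ≥0, ∀ (q : MellinSobolev loc p s γ E)
    (w : RegularPart n Mt → E), q.Represents w → Continuous w → ∀ z, ‖w z‖ ≤ K * ‖q‖ := by
  obtain ⟨K, hK⟩ := exists_norm_le_mellinENorm (F := E) loc hcut hpd hs hγ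
  exact ⟨K, fun q w hw hc z => hK w ‖q‖₊ hc hw.mellinENorm_eq.le z⟩

/-- A neighbourhood of the closure of the range of w₀ + c₀ lies in O, so φ can be replaced by a
globally C^m function equal to φ near this compact set. By the sup bound, all U near U₀ have their
range in the region of agreement. -/
lemma exists_substitution_eq {O : Set (Euc L)} (hO : IsOpen O) {m : ℕ} {φ : Euc L → E}
    (hφ : ContDiffOn ℝ m φ O) {X : Set (MellinSobolev loc p s γ (Euc L) × Euc L)} (hX : IsOpen X)
    (hXO : mellinRng X ⊆ O) {U₀ : MellinSobolev loc p s γ (Euc L) × Euc L} (hU₀ : U₀ ∈ X) :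
    ∃ ψ : Euc L → E, ContDiff ℝ m ψ ∧ ∀ᶠ U in 𝓝 U₀, ∃ w, U.1.Represents w ∧
      (fun z => ψ (w z + U.2)) = fun z => φ (w z + U.2) := by
  obtain ⟨r, hr, hrX⟩ := Metric.isOpen_iff.1 hX U₀ hU₀
  obtain ⟨w₀, hw₀, hc₀⟩ := exists_continuous_represents hcut hpd hs hγ U₀.1
  obtain ⟨K, hK⟩ := exists_norm_le_of_represents (loc := loc) (E := Euc L) hcut hpd hs hγ
  set R : Set (Euc L) := range fun z => w₀ z + U₀.2 with hR
  have hRO : Metric.thickening r R ⊆ O := by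
    intro ξ hξ
    obtain ⟨_, ⟨z, rfl⟩, hz⟩ := Metric.mem_thickening_iff.1 hξ
    -- Only the constant is changed, to ξ - w₀(z), so that ξ becomes a value of a function in X. The
    -- change is smaller than r, the radius of a ball around U₀ inside X.
    refine hXO ⟨(U₀.1, ξ - w₀ z), hrX ?_, w₀, hw₀, hc₀, z, by simp⟩
    rw [Metric.mem_ball, Prod.dist_eq, dist_self, max_eq_right dist_nonneg, dist_eq_norm]
    rw [dist_eq_norm] at hz
    rwa [sub_sub]
  have hRb : Bornology.IsBounded R := by
    refine isBounded_iff_forall_norm_le.2 ⟨K * ‖U₀.1‖ + ‖U₀.2‖, ?_⟩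
    rintro _ ⟨z, rfl⟩
    exact (norm_add_le _ _).trans (add_le_add_left (hK _ _ hw₀ hc₀ z) _)
  obtain ⟨ψ, hψ, δ, hδ, hψφ⟩ := exists_contDiff_eq_near hRb.isCompact_closure hO
    ((Metric.closure_subset_thickening hr R).trans hRO) hφ
  refine ⟨ψ, hψ, ?_⟩
  -- The sup norm of w - w₀ costs the factor K and the constant part the factor 1.
  filter_upwards [Metric.ball_mem_nhds U₀ (show 0 < δ / (K + 1) by positivity)] with U hU
  obtain ⟨w, hw, hc⟩ := exists_continuous_represents hcut hpd hs hγ U.1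
  refine ⟨w, hw, funext fun z => hψφ _ (Metric.mem_thickening_iff.2
    ⟨_, subset_closure ⟨z, rfl⟩, ?_⟩)⟩
  rw [Metric.mem_ball, dist_eq_norm, lt_div_iff₀ (by positivity)] at hU
  have h1 := hK _ _ (hw.sub hw₀) (hc.sub hc₀) z
  rw [dist_eq_norm, add_sub_add_comm]
  calc ‖w z - w₀ z + (U.2 - U₀.2)‖ ≤ K * ‖U - U₀‖ + ‖U - U₀‖ :=
        (norm_add_le _ _).trans (add_le_add (h1.trans (mul_le_mul_of_nonneg_left
          (norm_fst_le (U - U₀)) K.2)) (norm_snd_le (U - U₀)))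
    _ = ‖U - U₀‖ * (K + 1) := by ring
    _ < δ := hU

end Localization

end

/-! ### The theorem. -/

theorem mainTheorem5 {n : ℕ} {Mt B : Type*}
    [TopologicalSpace Mt] [ChartedSpace (EuclideanHalfSpace (n + 1)) Mt]
    [IsManifold (𝓡∂ (n + 1)) ∞ Mt] [CompactSpace Mt] [T2Space Mt]
    [TopologicalSpace B] [ChartedSpace (Euc n) B] [IsManifold (𝓡 n) ∞ B]
    (C : ConicManifold n Mt B) (cut : ℝ → ℝ) (hcut : IsCutoff cut) (loc : ConicAtlas C cut)
    {E : Type*} [NormedAddCommGroup E] [NormedSpace ℝ E] [CompleteSpace E]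
    (L k ν : ℕ) (p s γ ϑ : ℝ) [Fact (1 < p)]
    (hp : (n : ℝ) + 1 < p) (hs : ((n : ℝ) + 1) / p < s) (hγ : ((n : ℝ) + 1) / 2 ≤ γ)
    (hν : ⌊s⌋₊ ≤ ν) (hϑ : ϑ < ((n : ℝ) + 1) / 2)
    (O : Set (Euc L)) (hO : IsOpen O) (φ : Euc L → E) (hφ : IsBC (ν + k + 1) O φ)
    (X : Set (MellinSobolev loc p s γ (Euc L) × Euc L)) (hX : IsOpen X)
    (hXO : mellinRng X ⊆ O) :
    ∃ Φ : MellinSobolev loc p s γ (Euc L) × Euc L → MellinSobolev loc p (⌊s⌋₊ : ℝ) ϑ E,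
      (∀ U ∈ X, ∀ w : RegularPart n Mt → Euc L, U.1.Represents w →
        (Φ U).Represents (fun z => φ (w z + U.2))) ∧
      IsCkLip k Φ X := by
  -- Of the ν + k + 1 derivatives, [s] ≤ ν serve for the target space and k + 1 for the
  -- differentiability of Φ.
  have hφ' : ContDiffOn ℝ (⌊s⌋₊ + (k + 1) : ℕ) φ O :=
    hφ.1.of_le (by exact_mod_cast (by omega : ⌊s⌋₊ + (k + 1) ≤ ν + k + 1))
  -- Near each point of X the operator coincides with the substitution operator of a globally smooth
  -- ψ; the statement about representatives is included for all nearby U', with every choice of w.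
  have key : ∀ U ∈ X, ∃ ψ : Euc L → E, ContDiff ℝ (⌊s⌋₊ + (k + 1) : ℕ) ψ ∧ ∀ᶠ U' in 𝓝 U,
      substitution (⌊s⌋₊ : ℝ) ϑ φ U' = substitution (⌊s⌋₊ : ℝ) ϑ ψ U' ∧
      ∀ w, U'.1.Represents w →
        (substitution (⌊s⌋₊ : ℝ) ϑ φ U').Represents (fun z => φ (w z + U'.2)) := by
    intro U hU
    obtain ⟨ψ, hψ, hev⟩ := exists_substitution_eq hcut hp hs hγ hO hφ' hX hXO hU
    refine ⟨ψ, hψ, hev.mono fun U' ⟨w, hw, he⟩ => ?_⟩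
    have h1 := substitution_represents hcut hp hs hγ hϑ
      (hψ.of_le (by exact_mod_cast Nat.le_add_right _ _)) hw
    rw [he] at h1
    have h2 : ∀ w', U'.1.Represents w' →
        (substitution (⌊s⌋₊ : ℝ) ϑ φ U').Represents (fun z => φ (w' z + U'.2)) := fun w' hw' =>
      substitution_represents_of hcut hp hs hγ hw hw' h1.lt_top
    exact ⟨(h2 w hw).unique h1, h2⟩
  -- It suffices that Φ is C^{k+1} on X, and this is a local property.
  refine ⟨substitution (⌊s⌋₊ : ℝ) ϑ φ, fun U hU w hw => ?_, isCkLip_of_contDiffOn hX fun U hU => ?_⟩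
  · obtain ⟨ψ, -, hev⟩ := key U hU
    exact hev.self_of_nhds.2 w hw
  · obtain ⟨ψ, hψ, hev⟩ := key U hU
    have h1 := contDiff_substitution (loc := loc) hcut hp hs hγ hϑ (k + 1) (φ := ψ)
      (by exact_mod_cast hψ)
    push_cast at h1
    exact (h1.contDiffAt.congr_of_eventuallyEq (hev.mono fun _ h => h.1)).contDiffWithinAt
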